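/- **Setting.** Fix integers $0\le f<n$ and the set of locations $\Pi=\{1,\dots,n\}$. *I/O automata* are as usual: disjoint sets of input, output and internal actions; a nonempty set of start states; a transition relation in which every input is enabled in every state; and a partition of the locally controlled (output and internal) actions into tasks. A finite execution is *fair* if no task is enabled in its last state; an infinite one is fair if every task has infinitely many events in it or is infinitely often not enabled. An automaton is *task deterministic* if in each state at most one action of each task is enabled and each action leads to at most one next state; it is *deterministic* if moreover it has exactly one task and exactly one start state. A *crash problem* $P$ consists of inputs and outputs, each with a location, among the inputs an action $\mathrm{crash}_i$ for each $i\in\Pi$, and a set $T_P$ of finite or infinite sequences over these actions. A location is *faulty* in $t$ if $\mathrm{crash}_i$ occurs in $t$, otherwise *live*. **Failure detectors.** Let $D$ be a crash problem with no inputs but the crashes. A sequence is *valid* if no output at $i$ follows a $\mathrm{crash}_i$, and each live location has infinitely many outputs. $D$ is an *AFD* if some I/O automaton with inputs and outputs those of $D$ has all its fair traces in $T_D$; all $t\in T_D$ are valid; and $T_D$ is closed under (i) *sampling*: passing to a subsequence that keeps all outputs at live locations and, for each faulty $i$, keeps the first $\mathrm{crash}_i$ and a prefix of the outputs at $i$;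 (ii) *constrained reordering*: passing to a valid permutation that preserves the order of any two outputs at the same location and of any crash and a later output; (iii) *crash extension*: if $t'$ is a finite prefix of some $t\in T_D$ followed by (finitely or infinitely many) crash events, then $t'$ is a prefix of an element of $T_D$ if it is finite, and $t'\in T_D$ if all locations are faulty in $t'$; (iv) *extra crashes*: if $t\in T_D$, and $t,t'$ become equal when each $\mathrm{crash}_i$ that follows another $\mathrm{crash}_i$ is removed, then $t'\in T_D$. It is *strong-sampling* if moreover every valid subsequence of an element of $T_D$ is in $T_D$. $\Omega_f$ has the outputs $FD_\Omega(j)_i$ ($i,j\in\Pi$, at location $i$); $T_{\Omega_f}$ is the set of all valid $t$ such that, if at most $f$ locations are faulty and some location is live in $t$, then there is a live location $l$ such that every output in some suffix of $t$ is of the form $FD_\Omega(l)_i$ with $i$ live. **Systems.** A *distributed algorithm* consists of a deterministic I/O automaton at each location whose locally controlled actions are permanently disabled by its crash. For solving $P$ using $D$, the inputs of the automaton at $i$ are $\mathrm{crash}_i$, the outputs of $D$ at $i$, the inputs of $P$ at $i$ and $\mathrm{receive}(m,j)_i$ for $j\ne i$; its outputs are those of $P$ at $i$ and $\mathrm{send}(m,j)_i$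 for $j\neq i$. Channels are reliable FIFO queues, one for each ordered pair of distinct locations. The crash automaton may produce any sequence of crashes. An *environment* for $P$ consists of a task-deterministic automaton with a unique start state at each $i$, whose inputs are $\mathrm{crash}_i$ and the outputs of $P$ at $i$, whose outputs are the non-crash inputs of $P$ at $i$, and whose locally controlled actions are permanently disabled by $\mathrm{crash}_i$. An algorithm *solves $P$ using $D$ in the environment $\mathcal E$* if in every fair execution of the composition of algorithm, channels, crash automaton and $\mathcal E$ in which the events of $D$ form an element of $T_D$, the events of $P$ form an element of $T_P$. $D$ is *sufficient* for $P$ in $\mathcal E$ if such an algorithm exists. An AFD $D$ is *stronger than* an AFD $D'$ if some algorithm solves $D'$ using $D$ (in every environment for $D'$; such environments have no outputs). **Consensus.** *$f$-crash-tolerant binary consensus* has inputs $\mathrm{crash}_i$, $\mathrm{propose}(v)_i$ and outputs $\mathrm{decide}(v)_i$ ($v\in\{0,1\}$). A sequence $t$ belongs to its set of traces iff, whenever $t$ is environment well-formed (at most one proposal at each location, none after a crash there, exactly one at each live location) and has at most $f$ faulty locations, then $t$ satisfies crash validity (no location decides after crashing), agreement (all decisions are equal), validity (each decided value is proposed somewhere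 in $t$) and termination (each location decides at most once, each live one exactly once). The environment $\mathcal E_C$ has at each $i$ the two tasks $Env_{i,0},Env_{i,1}$ with actions $\mathrm{propose}(0)_i$, $\mathrm{propose}(1)_i$, both enabled until one of these or $\mathrm{crash}_i$ occurs. **Trees.** Let $D$ be a strong-sampling AFD, let $A$ be an algorithm that solves $f$-crash-tolerant binary consensus using $D$ in $\mathcal E_C$, and let $\mathcal S$ be the composition of $A$, the channels and $\mathcal E_C$. Let $G=(V,Z)$ be a directed graph whose vertices are triples (location $i$, index $k\geq1$, output $d$ of $D$ at $i$). The tree $\mathcal R^G$ has height $|V|$ (it is infinite if $V$ is). Each node has a vertex tag (a vertex of $G$ or the null vertex $\bot$) and a configuration tag (a state of $\mathcal S$); at the root these are $\bot$ and the initial state. A vertex $u\in V$ is a *successor* of a vertex tag $v$ if $(v,u)\in Z$ or $v=\bot$. An internal node with tags $v,c$ has exactly one edge for each label $Proc_i,Env_{i,b},Chan_{i,j}$ $(i\ne j)$; these leave the vertex tag unchanged. It has an $FD_i$-edge with new vertex tag $u$ for every successor $u$ of $v$ at location $i$, or, if there is none, one $FD_i$-edge with unchanged vertex tag. The action tag of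 an $FD_i$-edge is the output in $u$ if the vertex tag changes to $u$, and $\bot$ otherwise; that of a $Chan_{i,j}$-edge is the receipt at $j$ that is enabled in $c$, and $\bot$ if there is none; that of a $Proc_i$- or $Env_{i,b}$-edge is the action of this task enabled in $c$, if there is one and $v$ has a successor at $i$, and $\bot$ otherwise. The configuration tag of the child results from the action (it is unchanged for $\bot$). A node is *non-$\bot$* if no action tag on the path to it is $\bot$. A node is *bivalent* if for each $b\in\{0,1\}$ some descendant (possibly itself) has a $\mathrm{decide}(b)$ event on the path to it; it is *$b$-valent* if this holds for $b$ and not for $1-b$. Denote by $N^l$ the lower endpoint of an $l$-edge of a node $N$. * A *fork* is a bivalent node $N$ with two $l$-edges, the first of which leads to a $b$-valent and the second to a $(1-b)$-valent node, for some $b$ (so $l$ is some $FD_i$). Its *critical location* is the location of $l$. * A *hook* consists of a bivalent node $N$, labels $l\ne r$, an $l$-edge from $N$ to $N^l$, an $r$-edge with action tag $\ne\bot$ from $N$ to $N^r$, and an $l$-edge from $N^r$ to $N^{rl}$, such that, for some $b$, $N^l$ is $b$-valent and $N^{rl}$ is $(1-b)$-valent and, if $l$ is some $FD_i$, both $l$-edges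 carry the same vertex tag. Its *critical location* is the location of the action of the $r$-edge. A *non-$\bot$ decision gadget* is a fork or hook whose node $N$ is non-$\bot$. **Order.** Number the labels consecutively from $1$ in the order $Proc_1,\dots,Proc_n$, $Env_{1,0},Env_{1,1},\dots,Env_{n,0},Env_{n,1}$, $Chan_{1,2},\dots,Chan_{n,n-1}$ (lexicographically), $FD_1,\dots,FD_n$. The number of a vertex $(i,k,d)$ is $kn+i$, that of $\bot$ is $0$. Order edges by the number of their new vertex tag, then by the number of their label; order nodes by depth plus index of the vertex tag ($0$ for $\bot$), then by the lexicographic order of the sequences of edges that lead to them from the root. The *rank* of a node is the number of nodes of $\mathcal R^G$ before it. The *metric* of a decision gadget is $\langle \mathrm{rank}(N),\langle\mathrm{rank}(N_1),\mathrm{rank}(N_2)\rangle\rangle$, where $N_1,N_2$ are its two univalent nodes in the order above and $\langle a,b\rangle=\frac12(a+b)(a+b+1)+b$. The *first* non-$\bot$ decision gadget of $\mathcal R^G$ is the one of strictly smallest metric, if it exists. **The algorithm $A^\Omega$** (built from $A$; its messages are graphs). The automaton at $i$ has the variables $G$ (a graph, initially empty), $k$ (initially $0$), $sendq$ (a queue,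 initially empty), $fdout\in\Pi$ (initially $i$), $faulty$ (initially false). $\mathrm{crash}_i$ sets $faulty$ to true; while $faulty$ is true, all other inputs have no effect and no output is enabled. On an output $d$ of $D$ at $i$: increase $k$ by one; add to $G$ the vertex $(i,k,d)$ with edges to it from all other vertices of $G$; append $(G,j)$ to $sendq$ for each $j\ne i$, in increasing order; if $\mathcal R^G$ has a first non-$\bot$ decision gadget, set $fdout$ to its critical location; append $(fdout,i)$ to $sendq$. On receipt of a graph $H$: replace $G$ by $G\cup H$. If the head of $sendq$ is $(H,j)$ with $H$ a graph, then sending $H$ to $j$ is enabled; if it is $(j,i)$ with $j\in\Pi$, then the output $FD_\Omega(j)_i$ is enabled; either action deletes the head. All locally controlled actions form one task. **Theorem.** Let $0\le f<n$, let $D$ be a strong-sampling AFD, and let $A$ solve $f$-crash-tolerant binary consensus using $D$ in $\mathcal E_C$. 1. $A^\Omega$ solves $\Omega_f$ using $D$, in every environment for $\Omega_f$. Moreover, in every fair execution of $A^\Omega$ with channels, crash automaton and such an environment in which the events of $D$ form an element of $T_D$ and at most $f$ locations crash, the graphs $G$ at all live locations converge to one and the same graph $G^\infty$ (the union of the successive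 graphs at any live location); $\mathcal R^{G^\infty}$ has a first non-$\bot$ decision gadget $Y$; the critical location of $Y$ is live; and at each live location, $Y$ is from some point on the first non-$\bot$ decision gadget of the tree of the local graph, from some point on all outputs are the critical location of $Y$, and there are infinitely many such outputs. 2. $\Omega_f$ is a strong-sampling AFD. 3. Every strong-sampling AFD that is sufficient for $f$-crash-tolerant binary consensus in $\mathcal E_C$ is stronger than $\Omega_f$. 4. Hence, if $\Omega_f$ is sufficient for $f$-crash-tolerant binary consensus in $\mathcal E_C$, then it is a weakest strong-sampling AFD with this property: it is a strong-sampling AFD, it is sufficient, and every strong-sampling AFD that is sufficient is stronger than it. -/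

import Mathlib

namespace Afd

/-! ### Finite or infinite sequences -/

section Sequences

variable {α β : Type}

/-- `t` is a finite sequence with exactly `L` entries. -/
def HasLength (t : Stream'.Seq α) (L : ℕ) : Prop := ∀ k, (t.get? k).isSome = true ↔ k < L

/-- `t'` is a prefix of `t`. -/
def IsPrefix (t' t : Stream'.Seq α) : Prop := ∀ k a, t'.get? k = some a → t.get? k = some a

/-- `φ` embeds `t'` into `t` as a subsequence. -/
def IsEmbedding (φ : ℕ → ℕ) (t' t : Stream'.Seq α) : Prop :=
  StrictMono φ ∧ ∀ k a, t'.get? k = some a → t.get? (φ k) = some a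

/-- The entry at position `k` of `t` is retained by `f`. -/
def Retained (f : ℕ → α → Option β) (t : Stream'.Seq α) (k : ℕ) : Prop :=
  ((t.get? k).bind (f k)).isSome = true

open Classical in
/-- The `m`-th entry of the sequence obtained by applying `f` to all positions and entries of `t`
and dropping those that are mapped to `none`. -/
noncomputable def selectAt (f : ℕ → α → Option β) (t : Stream'.Seq α) (m : ℕ) : Option β :=
  if ∀ h : (Set.ofPred (Retained f t)).Finite, m < h.toFinset.card then
    (t.get? (Nat.nth (Retained f t) m)).bind (f (Nat.nth (Retained f t) m))
  else none

theorem selectAt_isSome (f : ℕ → α → Option β) (t : Stream'.Seq α) (m : ℕ) :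
    (selectAt f t m).isSome = true ↔
      ∀ h : (Set.ofPred (Retained f t)).Finite, m < h.toFinset.card := by
  unfold selectAt
  split_ifs with h
  · exact iff_of_true (Nat.nth_mem m h) h
  · simpa using h

/-- Apply `f` to all positions and entries of `t` and drop those that are mapped to `none`. -/
noncomputable def select (f : ℕ → α → Option β) (t : Stream'.Seq α) : Stream'.Seq β :=
  ⟨fun m => selectAt f t m, by
    intro m hm
    by_contra hne
    have h1 : (selectAt f t (m + 1)).isSome = true := Option.isSome_iff_ne_none.2 hne
    rw [selectAt_isSome] at h1
    have h0 : (selectAt f t m).isSome = true :=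
      (selectAt_isSome f t m).2 fun h => (Nat.lt_succ_self m).trans (h1 h)
    exact (Option.isSome_iff_ne_none.1 h0) hm⟩

/-- The projection of `t` to the entries on which `f` is defined. -/
noncomputable def proj (f : α → Option β) (t : Stream'.Seq α) : Stream'.Seq β :=
  select (fun _ => f) t

end Sequences

/-! ### I/O automata -/

/-- An I/O automaton over the action type `α`; the tasks are indexed by `Task`. -/
structure Automaton (α : Type) where
  input : Set α
  output : Set α
  internal : Set α
  State : Type
  start : Set State
  trans : State → α → State → Prop
  Task : Type
  task : Task → Set α

namespace Automaton

variable {α β : Type}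

def acts (A : Automaton α) : Set α := A.input ∪ A.output ∪ A.internal

def locallyControlled (A : Automaton α) : Set α := A.output ∪ A.internal

/-- The action `a` is enabled in the state `s`. -/
def Enabled (A : Automaton α) (s : A.State) (a : α) : Prop := ∃ s', A.trans s a s'

/-- Some action of the task `c` is enabled in the state `s`. -/
def TaskEnabled (A : Automaton α) (s : A.State) (c : A.Task) : Prop :=
  ∃ a ∈ A.task c, A.Enabled s a

/-- The requirements in the definition of an I/O automaton. -/
structure WellFormed (A : Automaton α) : Prop where
  input_output : Disjoint A.input A.output
  input_internal : Disjoint A.input A.internal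
  output_internal : Disjoint A.output A.internal
  start_nonempty : A.start.Nonempty
  trans_acts : ∀ s a s', A.trans s a s' → a ∈ A.acts
  input_enabled : ∀ s, ∀ a ∈ A.input, A.Enabled s a
  task_local : ∀ c, A.task c ⊆ A.locallyControlled
  task_unique : ∀ a ∈ A.locallyControlled, ∃! c, a ∈ A.task c

structure TaskDeterministic (A : Automaton α) : Prop where
  task_enabled : ∀ c s, ∀ a ∈ A.task c, ∀ b ∈ A.task c, A.Enabled s a → A.Enabled s b → a = b
  trans_unique : ∀ s a s₁ s₂, A.trans s a s₁ → A.trans s a s₂ → s₁ = s₂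

structure Deterministic (A : Automaton α) : Prop where
  taskDeterministic : A.TaskDeterministic
  one_task : ∃! _c : A.Task, True
  one_start : ∃! s, s ∈ A.start

/-- The same automaton with its actions renamed along `g` (used only for injective `g`). -/
def rename (g : α → β) (A : Automaton α) : Automaton β where
  input := g '' A.input
  output := g '' A.output
  internal := g '' A.internal
  State := A.State
  start := A.start
  trans s b s' := ∃ a, g a = b ∧ A.trans s a s'
  Task := A.Task
  task c := g '' A.task c

/-- Parallel composition: the components that have an action `a` take an `a`-step together, the
others do not move. -/
def compose {ι : Type} (A : ι → Automaton α) : Automaton α where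
  input := (⋃ i, (A i).input) \ ⋃ i, (A i).output
  output := ⋃ i, (A i).output
  internal := ⋃ i, (A i).internal
  State := ∀ i, (A i).State
  start := {s | ∀ i, s i ∈ (A i).start}
  trans s a s' := (∃ i, a ∈ (A i).acts) ∧
    ∀ i, (a ∈ (A i).acts ∧ (A i).trans (s i) a (s' i)) ∨ (a ∉ (A i).acts ∧ s' i = s i)
  Task := Σ i, (A i).Task
  task c := (A c.1).task c.2

/-- An execution: the sequence of its events, and its states (`state k` is the state after the
first `k` events; if there are only `L` events, the values `state k` with `k > L` have no
meaning). -/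
structure Execution (A : Automaton α) where
  events : Stream'.Seq α
  state : ℕ → A.State
  state_zero : state 0 ∈ A.start
  step : ∀ k a, events.get? k = some a → A.trans (state k) a (state (k + 1))

/-- Fair executions: if the execution is finite, no task is enabled in its last state; if it is
infinite, each task has infinitely many events or is infinitely often not enabled. -/
def Execution.Fair {A : Automaton α} (x : A.Execution) : Prop :=
  ∀ c : A.Task,
    (∀ L, HasLength x.events L → ¬ A.TaskEnabled (x.state L) c) ∧
    ((∀ k, (x.events.get? k).isSome = true) →
      (∀ m, ∃ k ≥ m, ∃ a ∈ A.task c, x.events.get? k = some a) ∨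
      (∀ m, ∃ k ≥ m, ¬ A.TaskEnabled (x.state k) c))

/-- The action `c` permanently disables all locally controlled actions, in every execution. -/
def DisabledBy (A : Automaton α) (c : α) : Prop :=
  ∀ (x : A.Execution) (k l : ℕ), x.events.get? k = some c → k ≤ l →
    (x.events.get? l).isSome = true → ∀ a ∈ A.locallyControlled, ¬ A.Enabled (x.state (l + 1)) a

end Automaton

/-! ### Crash problems -/

/-- The events of a crash problem over the locations `Fin n`, with further inputs `I` and
outputs `O`. -/
inductive Event (n : ℕ) (I O : Type) : Type
  | crash (i : Fin n)
  | inp (a : I)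
  | out (o : O)

/-- The data of a crash problem distributed over `Fin n`. -/
structure CrashProblem (n : ℕ) where
  In : Type
  Out : Type
  locIn : In → Fin n
  locOut : Out → Fin n
  traces : Set (Stream'.Seq (Event n In Out))

section Events

variable {n : ℕ} {I O : Type}

/-- The locations that crash in `t`. -/
def faulty (t : Stream'.Seq (Event n I O)) : Set (Fin n) :=
  {i | ∃ k, t.get? k = some (Event.crash i)}

open Classical in
/-- The subsequence of the output events at `i`. -/
noncomputable def outsAt (loc : O → Fin n) (i : Fin n) (t : Stream'.Seq (Event n I O)) :
    Stream'.Seq O :=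
  proj (fun e => match e with
    | Event.out o => if loc o = i then some o else none
    | _ => none) t

open Classical in
/-- `t` without its extra crashes, that is, the `crash i` events preceded by a `crash i` event. -/
noncomputable def mincrash (t : Stream'.Seq (Event n I O)) : Stream'.Seq (Event n I O) :=
  select (fun k e => match e with
    | Event.crash i => if ∃ m < k, t.get? m = some (Event.crash i) then none
        else some (Event.crash i)
    | e => some e) t

/-- No output at `i` after a crash at `i`, and infinitely many outputs at each live location. -/
def Valid (loc : O → Fin n) (t : Stream'.Seq (Event n I O)) : Prop :=
  (∀ k m i o, k < m → t.get? k = some (Event.crash i) → t.get? m = some (Event.out o) →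
    loc o ≠ i) ∧
  ∀ i ∉ faulty t, ∀ m, ∃ k ≥ m, ∃ o, t.get? k = some (Event.out o) ∧ loc o = i

/-- `t'` is a sampling of `t`. -/
def IsSampling (loc : O → Fin n) (t' t : Stream'.Seq (Event n I O)) : Prop :=
  ∃ φ, IsEmbedding φ t' t ∧ ∀ i,
    (i ∉ faulty t → outsAt loc i t' = outsAt loc i t) ∧
    (i ∈ faulty t →
      (∃ k, t'.get? k = some (Event.crash i) ∧ ∀ m < φ k, t.get? m ≠ some (Event.crash i)) ∧
      IsPrefix (outsAt loc i t') (outsAt loc i t))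

/-- `t'` is a constrained reordering of `t`; `σ` maps positions in `t` to positions in `t'`. -/
def IsReordering (loc : O → Fin n) (t' t : Stream'.Seq (Event n I O)) : Prop :=
  Valid loc t' ∧ ∃ σ : ℕ → ℕ,
    Set.BijOn σ {k | (t.get? k).isSome = true} {k | (t'.get? k).isSome = true} ∧
    (∀ k e, t.get? k = some e → t'.get? (σ k) = some e) ∧
    (∀ k m o o', k < m → t.get? k = some (Event.out o) → t.get? m = some (Event.out o') →
      loc o = loc o' → σ k < σ m) ∧
    (∀ k m i o, k < m → t.get? k = some (Event.crash i) → t.get? m = some (Event.out o) →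
      σ k < σ m)

/-- `t'` is a crash extension of a finite prefix of `t`. -/
def IsCrashExtension (t' t : Stream'.Seq (Event n I O)) : Prop :=
  ∃ L, (∀ k < L, (t.get? k).isSome = true ∧ t'.get? k = t.get? k) ∧
    ∀ k ≥ L, ∀ e, t'.get? k = some e → ∃ i, e = Event.crash i

end Events

namespace CrashProblem

variable {n : ℕ}

abbrev Ev (P : CrashProblem n) : Type := Event n P.In P.Out

/-- Non-triviality: some automaton, with inputs and outputs those of `P` and arbitrary internal
actions, has all its fair traces in `P.traces`. -/
def IsProblem (P : CrashProblem n) : Prop :=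
  ∃ (Int : Type) (U : Automaton (P.Ev ⊕ Int)), U.WellFormed ∧
    U.input = {a | (∃ i, a = Sum.inl (Event.crash i)) ∨ ∃ x, a = Sum.inl (Event.inp x)} ∧
    U.output = {a | ∃ o, a = Sum.inl (Event.out o)} ∧
    ∀ x : U.Execution, x.Fair → proj Sum.getLeft? x.events ∈ P.traces

/-- Asynchronous failure detectors. -/
structure IsAFD (D : CrashProblem n) : Prop where
  isProblem : D.IsProblem
  crashExclusive : IsEmpty D.In
  valid : ∀ t ∈ D.traces, Valid D.locOut t
  sampling : ∀ t ∈ D.traces, ∀ t', IsSampling D.locOut t' t → t' ∈ D.traces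
  reordering : ∀ t ∈ D.traces, ∀ t', IsReordering D.locOut t' t → t' ∈ D.traces
  crashExtension_prefix : ∀ t ∈ D.traces, ∀ t', IsCrashExtension t' t → (∃ L, HasLength t' L) →
    ∃ t'' ∈ D.traces, IsPrefix t' t''
  crashExtension_mem : ∀ t ∈ D.traces, ∀ t', IsCrashExtension t' t → faulty t' = Set.univ →
    t' ∈ D.traces
  extraCrashes : ∀ t ∈ D.traces, ∀ t', mincrash t = mincrash t' → t' ∈ D.traces

/-- Strong-sampling asynchronous failure detectors. -/
structure IsStrongSamplingAFD (D : CrashProblem n) : Prop extends D.IsAFD where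
  strongSampling : ∀ t ∈ D.traces, ∀ t', (∃ φ, IsEmbedding φ t' t) → Valid D.locOut t' →
    t' ∈ D.traces

end CrashProblem

/-! ### Crash-tolerant binary consensus and the failure detector `Ω_f` -/

section Problems

variable {n : ℕ}

/-- Events of binary consensus: `inp (v, i)` is `propose(v)_i`, `out (v, i)` is `decide(v)_i`. -/
abbrev ConsEvent (n : ℕ) : Type := Event n (Bool × Fin n) (Bool × Fin n)

/-- Environment well-formedness. -/
def EnvWellFormed (t : Stream'.Seq (ConsEvent n)) : Prop :=
  (∀ i k m v w, t.get? k = some (Event.inp (v, i)) → t.get? m = some (Event.inp (w, i)) →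
    k = m) ∧
  (∀ i k m v, k < m → t.get? k = some (Event.crash i) → t.get? m ≠ some (Event.inp (v, i))) ∧
  ∀ i ∉ faulty t, ∃ k v, t.get? k = some (Event.inp (v, i))

def CrashValidity (t : Stream'.Seq (ConsEvent n)) : Prop :=
  ∀ i k m v, k < m → t.get? k = some (Event.crash i) → t.get? m ≠ some (Event.out (v, i))

def Agreement (t : Stream'.Seq (ConsEvent n)) : Prop :=
  ∀ i j k m v w, t.get? k = some (Event.out (v, i)) → t.get? m = some (Event.out (w, j)) → v = w

def Validity (t : Stream'.Seq (ConsEvent n)) : Prop :=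
  ∀ i k v, t.get? k = some (Event.out (v, i)) → ∃ j m, t.get? m = some (Event.inp (v, j))

def Termination (t : Stream'.Seq (ConsEvent n)) : Prop :=
  (∀ i k m v w, t.get? k = some (Event.out (v, i)) → t.get? m = some (Event.out (w, i)) →
    k = m) ∧
  ∀ i ∉ faulty t, ∃ k v, t.get? k = some (Event.out (v, i))

/-- `f`-crash-tolerant binary consensus. -/
abbrev consensus (n f : ℕ) : CrashProblem n where
  In := Bool × Fin n
  Out := Bool × Fin n
  locIn := Prod.snd
  locOut := Prod.snd
  traces := {t | EnvWellFormed t ∧ (faulty t).ncard ≤ f →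
    CrashValidity t ∧ Agreement t ∧ Validity t ∧ Termination t}

/-- The failure detector `Ω_f`; `out (j, i)` is the output at `i` of the location name `j`. -/
abbrev omegaF (n f : ℕ) : CrashProblem n where
  In := Empty
  Out := Fin n × Fin n
  locIn := Empty.elim
  locOut := Prod.snd
  traces := {t | Valid Prod.snd t ∧ ((faulty t).ncard ≤ f → (faulty t)ᶜ.Nonempty →
    ∃ l ∉ faulty t, ∃ m, ∀ k ≥ m, ∀ j i, t.get? k = some (Event.out (j, i)) →
      j = l ∧ i ∉ faulty t)}

end Problems

/-! ### Systems -/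

/-- Actions of a process automaton that uses `D` to solve `P` with messages from `M`:
`send m i j` and `recv m i j` are the sending and the receipt of a message from `i` to `j`, `fd o`
is an output of `D`, `pin` and `pout` are inputs and outputs of `P`, `tau` is internal. -/
inductive ProcAct {n : ℕ} (D P : CrashProblem n) (M X : Type) : Type
  | crash (i : Fin n)
  | fd (o : D.Out)
  | send (m : M) (i j : Fin n)
  | recv (m : M) (i j : Fin n)
  | pin (a : P.In)
  | pout (o : P.Out)
  | tau (i : Fin n) (x : X)

/-- Actions of an environment automaton for `P`. -/
inductive EnvAct {n : ℕ} (P : CrashProblem n) (Y : Type) : Type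
  | crash (i : Fin n)
  | pin (a : P.In)
  | pout (o : P.Out)
  | tau (i : Fin n) (y : Y)

/-- Actions of a system. -/
inductive SysAct {n : ℕ} (D P : CrashProblem n) (M X Y : Type) : Type
  | crash (i : Fin n)
  | fd (o : D.Out)
  | send (m : M) (i j : Fin n)
  | recv (m : M) (i j : Fin n)
  | pin (a : P.In)
  | pout (o : P.Out)
  | procTau (i : Fin n) (x : X)
  | envTau (i : Fin n) (y : Y)

/-- Ordered pairs of distinct locations. -/
abbrev Link (n : ℕ) : Type := {p : Fin n × Fin n // p.1 ≠ p.2}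

/-- The components of a system without the crash automaton. -/
inductive Comp (n : ℕ) : Type
  | proc (i : Fin n)
  | env (i : Fin n)
  | chan (c : Link n)

section Systems

variable {n : ℕ} {D P : CrashProblem n} {M X Y : Type}

def ProcAct.toSys : ProcAct D P M X → SysAct D P M X Y
  | .crash i => .crash i
  | .fd o => .fd o
  | .send m i j => .send m i j
  | .recv m i j => .recv m i j
  | .pin a => .pin a
  | .pout o => .pout o
  | .tau i x => .procTau i x

def EnvAct.toSys : EnvAct P Y → SysAct D P M X Y
  | .crash i => .crash i
  | .pin a => .pin a
  | .pout o => .pout o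
  | .tau i y => .envTau i y

/-- The events of the problem `D` among the actions of a system (`D` has no inputs but crashes). -/
def SysAct.asD : SysAct D P M X Y → Option D.Ev
  | .crash i => some (.crash i)
  | .fd o => some (.out o)
  | _ => none

/-- The events of the problem `P` among the actions of a system. -/
def SysAct.asP : SysAct D P M X Y → Option P.Ev
  | .crash i => some (.crash i)
  | .pin a => some (.inp a)
  | .pout o => some (.out o)
  | _ => none

/-- A distributed algorithm, with the signature required for solving `P` using `D`. -/
structure IsDistributedAlgorithm (A : Fin n → Automaton (ProcAct D P M X)) : Prop where
  wellFormed : ∀ i, (A i).WellFormed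
  deterministic : ∀ i, (A i).Deterministic
  input_eq : ∀ i, (A i).input = {a | a = .crash i ∨ (∃ o, D.locOut o = i ∧ a = .fd o) ∨
    (∃ m j, j ≠ i ∧ a = .recv m j i) ∨ ∃ x, P.locIn x = i ∧ a = .pin x}
  output_eq : ∀ i, (A i).output = {a | (∃ m j, j ≠ i ∧ a = .send m i j) ∨
    ∃ o, P.locOut o = i ∧ a = .pout o}
  internal_subset : ∀ i, (A i).internal ⊆ {a | ∃ x, a = .tau i x}
  crash_disables : ∀ i, (A i).DisabledBy (.crash i)

/-- The environments for `P`, as families of automata, one for each location. -/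
structure IsEnvironment (P : CrashProblem n) (E : Fin n → Automaton (EnvAct P Y)) : Prop where
  wellFormed : ∀ i, (E i).WellFormed
  one_start : ∀ i, ∃! s, s ∈ (E i).start
  taskDeterministic : ∀ i, (E i).TaskDeterministic
  input_eq : ∀ i, (E i).input = {a | a = .crash i ∨ ∃ o, P.locOut o = i ∧ a = .pout o}
  output_eq : ∀ i, (E i).output = {a | ∃ x, P.locIn x = i ∧ a = .pin x}
  internal_subset : ∀ i, (E i).internal ⊆ {a | ∃ y, a = .tau i y}
  crash_disables : ∀ i, (E i).DisabledBy (.crash i)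

/-- The reliable FIFO channel from `i` to `j`; its state is the queue, oldest message first. -/
def channel (i j : Fin n) : Automaton (SysAct D P M X Y) where
  input := {a | ∃ m, a = .send m i j}
  output := {a | ∃ m, a = .recv m i j}
  internal := ∅
  State := List M
  start := {[]}
  trans q a q' := ∃ m, (a = .send m i j ∧ q' = q ++ [m]) ∨ (a = .recv m i j ∧ q = m :: q')
  Task := Unit
  task _ := {a | ∃ m, a = .recv m i j}

/-- The crash automaton. Its state is the sequence of the crash events that are still to occur,
and every sequence is an initial state; so its fair traces are all the sequences of crash
events. -/
def crashAutomaton : Automaton (SysAct D P M X Y) where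
  input := ∅
  output := {a | ∃ i, a = .crash i}
  internal := ∅
  State := Stream'.Seq (Fin n)
  start := Set.univ
  trans s a s' := ∃ i, a = .crash i ∧ s = Stream'.Seq.cons i s'
  Task := Unit
  task _ := {a | ∃ i, a = .crash i}

def component (A : Fin n → Automaton (ProcAct D P M X)) (E : Fin n → Automaton (EnvAct P Y)) :
    Comp n → Automaton (SysAct D P M X Y)
  | .proc i => (A i).rename ProcAct.toSys
  | .env i => (E i).rename EnvAct.toSys
  | .chan c => channel c.1.1 c.1.2

/-- The composition of the algorithm, the channels and the environment. -/
def system (A : Fin n → Automaton (ProcAct D P M X)) (E : Fin n → Automaton (EnvAct P Y)) :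
    Automaton (SysAct D P M X Y) :=
  Automaton.compose (component A E)

/-- The composition of the algorithm, the channels, the environment and the crash automaton. -/
def fullSystem (A : Fin n → Automaton (ProcAct D P M X)) (E : Fin n → Automaton (EnvAct P Y)) :
    Automaton (SysAct D P M X Y) :=
  Automaton.compose fun c : Option (Comp n) => match c with
    | none => crashAutomaton
    | some c => component A E c

/-- The algorithm `A` solves `P` using `D` in the environment `E`. All events of `D` and of `P` are
external, so projecting the events of an execution is the same as projecting its trace. -/
def Solves (D P : CrashProblem n) (A : Fin n → Automaton (ProcAct D P M X))
    (E : Fin n → Automaton (EnvAct P Y)) : Prop :=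
  IsDistributedAlgorithm A ∧ ∀ x : (fullSystem A E).Execution, x.Fair →
    proj SysAct.asD x.events ∈ D.traces → proj SysAct.asP x.events ∈ P.traces

/-- `D` is sufficient to solve `P` in the environment `E`. -/
def Sufficient (D P : CrashProblem n) (E : Fin n → Automaton (EnvAct P Y)) : Prop :=
  ∃ (M X : Type) (A : Fin n → Automaton (ProcAct D P M X)), Solves D P A E

/-- The failure detector `D` is stronger than the failure detector `D'`: some algorithm solves
`D'` using `D` (in all environments for `D'`, none of which has any output). -/
def Stronger (D D' : CrashProblem n) : Prop :=
  ∃ (M X : Type) (A : Fin n → Automaton (ProcAct D D' M X)),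
    ∀ (Y : Type) (E : Fin n → Automaton (EnvAct D' Y)), IsEnvironment D' E → Solves D D' A E

/-- `D₀` is a weakest strong-sampling failure detector that is sufficient to solve `P` in `E`. -/
def IsWeakestStrongSampling (D₀ P : CrashProblem n) (E : Fin n → Automaton (EnvAct P Y)) : Prop :=
  D₀.IsStrongSamplingAFD ∧ Sufficient D₀ P E ∧
    ∀ D : CrashProblem n, D.IsStrongSamplingAFD → Sufficient D P E → Stronger D D₀

end Systems

/-- The environment `E_C` for consensus: each location proposes a value once, either `0` or `1`,
unless it crashes before. The state is the variable `stop`. -/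
def consensusEnv (n f : ℕ) (i : Fin n) : Automaton (EnvAct (consensus n f) Empty) where
  input := {a | a = .crash i ∨ ∃ b, a = .pout (b, i)}
  output := {a | ∃ b, a = .pin (b, i)}
  internal := ∅
  State := Bool
  start := {false}
  trans s a s' := (a = .crash i ∧ s' = true) ∨ (∃ b, a = .pout (b, i) ∧ s' = s) ∨
    ∃ b, a = .pin (b, i) ∧ s = false ∧ s' = true
  Task := Bool
  task b := {.pin (b, i)}

/-! ### Graphs of failure-detector outputs -/

/-- A vertex: a location, an index (from 1 on), and an output of the failure detector. -/
structure Vertex (n : ℕ) (O : Type) where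
  loc : Fin n
  idx : ℕ
  act : O

structure Graph (n : ℕ) (O : Type) where
  V : Set (Vertex n O)
  Z : Set (Vertex n O × Vertex n O)

namespace Graph

variable {n : ℕ} {O : Type}

def empty : Graph n O := ⟨∅, ∅⟩

def union (G H : Graph n O) : Graph n O := ⟨G.V ∪ H.V, G.Z ∪ H.Z⟩

/-- Add the vertex `v`, with edges from all vertices of `G` to `v`. -/
def insert (G : Graph n O) (v : Vertex n O) : Graph n O :=
  ⟨G.V ∪ {v}, G.Z ∪ {e | e.1 ∈ G.V ∧ e.2 = v}⟩

/-- `u` may follow the vertex tag `v`; the tag `none` is the null vertex. -/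
def Succ (G : Graph n O) (v : Option (Vertex n O)) (u : Vertex n O) : Prop :=
  u ∈ G.V ∧ ∀ x, v = some x → (x, u) ∈ G.Z

def HasSucc (G : Graph n O) (v : Option (Vertex n O)) (i : Fin n) : Prop :=
  ∃ u, u.loc = i ∧ G.Succ v u

end Graph

/-! ### The tree of executions -/

/-- The labels of the edges of the tree. -/
inductive Label (n : ℕ) : Type
  | proc (i : Fin n)
  | env (i : Fin n) (b : Bool)
  | chan (c : Link n)
  | fd (i : Fin n)

/-- The location at which the actions of a label occur. -/
def Label.loc {n : ℕ} : Label n → Fin n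
  | .proc i => i
  | .env i _ => i
  | .chan c => c.1.2
  | .fd i => i

/-- The number of a label in the order `Proc_1, …, Proc_n, Env_{1,0}, Env_{1,1}, …, Env_{n,1},
Chan_{1,2}, …, Chan_{n,n-1}, FD_1, …, FD_n`. -/
def Label.num {n : ℕ} : Label n → ℕ
  | .proc i => i.val + 1
  | .env i b => n + 2 * i.val + 1 + b.toNat
  | .chan c => 3 * n + (n - 1) * c.1.1.val +
      (if c.1.2.val < c.1.1.val then c.1.2.val + 1 else c.1.2.val)
  | .fd i => n ^ 2 + 2 * n + i.val + 1

/-- A node of the tree, given by the labels and the vertex tags of the edges that lead to it. -/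
abbrev Path (n : ℕ) (O : Type) : Type := List (Label n × Option (Vertex n O))

section Tree

variable {n f : ℕ} {D : CrashProblem n} {M X : Type}

/-- The edges out of a node with vertex tag `v`: there is an `l`-edge with vertex tag `w`. -/
def IsEdge (G : Graph n D.Out) (v : Option (Vertex n D.Out)) (l : Label n)
    (w : Option (Vertex n D.Out)) : Prop :=
  match l with
  | .fd i => (∃ u, w = some u ∧ u.loc = i ∧ G.Succ v u) ∨ (¬ G.HasSucc v i ∧ w = v)
  | _ => w = v

/-- The actions of a label. -/
def labelActs (A : Fin n → Automaton (ProcAct D (consensus n f) M X)) (l : Label n) :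
    Set (SysAct D (consensus n f) M X Empty) :=
  match l with
  | .proc i => ProcAct.toSys '' (A i).locallyControlled
  | .env i b => {.pin (b, i)}
  | .chan c => {a | ∃ m, a = .recv m c.1.1 c.1.2}
  | .fd i => {a | ∃ o, D.locOut o = i ∧ a = .fd o}

/-- `o` is the action in `labelActs A l` that is enabled in the state `s`, or `none` if there is no
such action. -/
def EnabledTag (A : Fin n → Automaton (ProcAct D (consensus n f) M X))
    (s : (system A (consensusEnv n f)).State) (l : Label n)
    (o : Option (SysAct D (consensus n f) M X Empty)) : Prop :=
  match o with
  | some a => a ∈ labelActs A l ∧ (system A (consensusEnv n f)).Enabled s a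
  | none => ∀ a ∈ labelActs A l, ¬ (system A (consensusEnv n f)).Enabled s a

/-- `o` is the action tag of the `l`-edge with vertex tag `w` out of a node with configuration tag
`s` and vertex tag `v`; `none` stands for `⊥`. -/
def ActionTag (A : Fin n → Automaton (ProcAct D (consensus n f) M X)) (G : Graph n D.Out)
    (s : (system A (consensusEnv n f)).State) (v : Option (Vertex n D.Out)) (l : Label n)
    (w : Option (Vertex n D.Out)) (o : Option (SysAct D (consensus n f) M X Empty)) : Prop :=
  match l with
  | .fd _ => (w = v ∧ o = none) ∨ (w ≠ v ∧ ∃ u, w = some u ∧ o = some (.fd u.act))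
  | .chan _ => EnabledTag A s l o
  | _ => (G.HasSucc v l.loc ∧ EnabledTag A s l o) ∨ (¬ G.HasSucc v l.loc ∧ o = none)

/-- `IsNode A G p tags s v`: the tree of executions for the graph `G`, for the system that consists
of the algorithm `A`, the channels and the environment `E_C`, has the node `p`; its configuration
tag is `s`, its vertex tag is `v`, and `tags` are the action tags along the path from the root to
`p`. The height of the tree is the number of vertices of `G`. -/
inductive IsNode (A : Fin n → Automaton (ProcAct D (consensus n f) M X)) (G : Graph n D.Out) :
    Path n D.Out → List (Option (SysAct D (consensus n f) M X Empty)) →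
    (system A (consensusEnv n f)).State → Option (Vertex n D.Out) → Prop
  | root (s : (system A (consensusEnv n f)).State) (hs : s ∈ (system A (consensusEnv n f)).start) :
      IsNode A G [] [] s none
  | bot (p : Path n D.Out) (tags : List (Option (SysAct D (consensus n f) M X Empty)))
      (s : (system A (consensusEnv n f)).State) (v w : Option (Vertex n D.Out)) (l : Label n)
      (hp : IsNode A G p tags s v) (hh : (p.length : ℕ∞) < G.V.encard) (he : IsEdge G v l w)
      (ha : ActionTag A G s v l w none) :
      IsNode A G (p ++ [(l, w)]) (tags ++ [none]) s w
  | act (p : Path n D.Out) (tags : List (Option (SysAct D (consensus n f) M X Empty)))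
      (s s' : (system A (consensusEnv n f)).State) (v w : Option (Vertex n D.Out)) (l : Label n)
      (a : SysAct D (consensus n f) M X Empty)
      (hp : IsNode A G p tags s v) (hh : (p.length : ℕ∞) < G.V.encard) (he : IsEdge G v l w)
      (ha : ActionTag A G s v l w (some a)) (hs : (system A (consensusEnv n f)).trans s a s') :
      IsNode A G (p ++ [(l, w)]) (tags ++ [some a]) s' w

variable (A : Fin n → Automaton (ProcAct D (consensus n f) M X)) (G : Graph n D.Out)

/-- `p` is a node of the tree. -/
def InTree (p : Path n D.Out) : Prop := ∃ tags s v, IsNode A G p tags s v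

/-- `p` is a node of the tree, and no action tag on the path from the root to `p` is `⊥`. -/
def IsNonBot (p : Path n D.Out) : Prop := ∃ tags s v, IsNode A G p tags s v ∧ none ∉ tags

/-- `b` is a decision value of the execution that leads to the node `p`. -/
def Decides (p : Path n D.Out) (b : Bool) : Prop :=
  ∃ tags s v, IsNode A G p tags s v ∧ ∃ i, some (SysAct.pout (b, i)) ∈ tags

/-- Some descendant of `p` (possibly `p` itself) has the decision value `b`. -/
def CanDecide (p : Path n D.Out) (b : Bool) : Prop := ∃ q, p <+: q ∧ Decides A G q b

def Bivalent (p : Path n D.Out) : Prop :=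
  InTree A G p ∧ CanDecide A G p false ∧ CanDecide A G p true

/-- `p` is `b`-valent. -/
def Valent (p : Path n D.Out) (b : Bool) : Prop :=
  InTree A G p ∧ CanDecide A G p b ∧ ¬ CanDecide A G p (!b)

/-! ### Decision gadgets -/

/-- Gadgets. `fork N l u u'` consists of the node `N` and its two `l`-edges with vertex tags `u`
and `u'`. `hook N l r u w u'` consists of the node `N`, its `l`-edge with vertex tag `u`, its
`r`-edge with vertex tag `w`, and the `l`-edge with vertex tag `u'` out of the lower endpoint of
the latter. -/
inductive Gadget (n : ℕ) (O : Type) : Type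
  | fork (N : Path n O) (l : Label n) (u u' : Option (Vertex n O))
  | hook (N : Path n O) (l r : Label n) (u w u' : Option (Vertex n O))

/-- The bivalent node of a decision gadget. -/
def Gadget.top {O : Type} : Gadget n O → Path n O
  | .fork N _ _ _ => N
  | .hook N _ _ _ _ _ => N

/-- The first of the two univalent nodes of a decision gadget. -/
def Gadget.left {O : Type} : Gadget n O → Path n O
  | .fork N l u _ => N ++ [(l, u)]
  | .hook N l _ u _ _ => N ++ [(l, u)]

/-- The second of the two univalent nodes of a decision gadget. -/
def Gadget.right {O : Type} : Gadget n O → Path n O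
  | .fork N l _ u' => N ++ [(l, u')]
  | .hook N l r _ w u' => N ++ [(r, w), (l, u')]

/-- The critical location: the location of the action tag of the `l`-edge of a fork, and of the
`r`-edge out of the bivalent node of a hook. -/
def Gadget.critLoc {O : Type} : Gadget n O → Fin n
  | .fork _ l _ _ => l.loc
  | .hook _ _ r _ _ _ => r.loc

/-- In a hook the labels `l` and `r` are distinct, the action tag of the `r`-edge is not `⊥`, and,
if `l` is the label of failure-detector outputs, both `l`-edges carry the same vertex. -/
def HookCondition : Gadget n D.Out → Prop
  | .fork _ _ _ _ => True
  | .hook N l r u w u' => l ≠ r ∧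
      (∃ tags a s v, IsNode A G (N ++ [(r, w)]) (tags ++ [some a]) s v) ∧
      ((∃ i, l = .fd i) → u = u')

/-- Decision gadgets whose bivalent node is a non-`⊥` node. -/
def IsNonBotDecisionGadget (Y : Gadget n D.Out) : Prop :=
  IsNonBot A G Y.top ∧ HookCondition A G Y ∧ Bivalent A G Y.top ∧
    ∃ b, Valent A G Y.left b ∧ Valent A G Y.right (!b)

/-! ### The order of the decision gadgets -/

/-- The number of a vertex tag; the null vertex has number `0`. -/
def vertexNum {O : Type} : Option (Vertex n O) → ℕ
  | none => 0
  | some u => u.idx * n + (u.loc.val + 1)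

/-- The depth of a node plus the index of its vertex tag. -/
def Path.level {O : Type} (p : Path n O) : ℕ :=
  p.length + match p.getLast? with
    | some (_, some u) => u.idx
    | _ => 0

/-- Edges are ordered by their vertex tags, and then by their labels. -/
def edgeLT {O : Type} (e e' : Label n × Option (Vertex n O)) : Prop :=
  vertexNum e.2 < vertexNum e'.2 ∨ (vertexNum e.2 = vertexNum e'.2 ∧ e.1.num < e'.1.num)

/-- Nodes are ordered by their levels, and then lexicographically. -/
def nodeLT {O : Type} (p q : Path n O) : Prop :=
  Path.level p < Path.level q ∨ (Path.level p = Path.level q ∧ List.Lex edgeLT p q)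

/-- The rank of a node among all nodes of the tree. -/
noncomputable def rank (p : Path n D.Out) : ℕ := {q | InTree A G q ∧ nodeLT q p}.ncard

/-- The Cantor pairing function. -/
def cantorPair (a b : ℕ) : ℕ := (a + b) * (a + b + 1) / 2 + b

noncomputable def Gadget.metric (Y : Gadget n D.Out) : ℕ :=
  cantorPair (rank A G Y.top) (cantorPair (rank A G Y.left) (rank A G Y.right))

/-- `Y` is the first non-`⊥` decision gadget of the tree for `G`. -/
def IsFirst (Y : Gadget n D.Out) : Prop :=
  IsNonBotDecisionGadget A G Y ∧
    ∀ Y', IsNonBotDecisionGadget A G Y' → Y' ≠ Y → Y.metric A G < Y'.metric A G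

open Classical in
/-- The critical location of the first non-`⊥` decision gadget of the tree for `G`, if there is
one, and `cur` otherwise. -/
noncomputable def firstLoc (cur : Fin n) : Fin n :=
  if h : ∃ Y, IsFirst A G Y then h.choose.critLoc else cur

end Tree

/-! ### The algorithm that solves `Ω_f` -/

/-- The local variables of the algorithm. -/
structure OmegaState (n : ℕ) (O : Type) where
  G : Graph n O
  k : ℕ
  sendq : List ((Graph n O ⊕ Fin n) × Fin n)
  fdout : Fin n
  faulty : Bool

section OmegaAlgorithm

variable {n f : ℕ} {D : CrashProblem n} {M X : Type}

/-- The effect, at a location `i` that has not crashed, of the output `o` of the failure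
detector. -/
noncomputable def OmegaState.afterFd (A : Fin n → Automaton (ProcAct D (consensus n f) M X))
    (i : Fin n) (o : D.Out) (s : OmegaState n D.Out) : OmegaState n D.Out :=
  let G' := s.G.insert ⟨i, s.k + 1, o⟩
  let out' := firstLoc A G' s.fdout
  { s with
    G := G'
    k := s.k + 1
    sendq := s.sendq ++ ((List.finRange n).filter (fun j => decide (j ≠ i))).map
      (fun j => (Sum.inl G', j)) ++ [(Sum.inr out', i)]
    fdout := out' }

/-- The algorithm that solves `Ω_f` using `D`, built from an algorithm `A` for consensus using
`D`. The messages are graphs, and there are no internal actions. -/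
noncomputable def omegaAlg (A : Fin n → Automaton (ProcAct D (consensus n f) M X)) (i : Fin n) :
    Automaton (ProcAct D (omegaF n f) (Graph n D.Out) Empty) where
  input := {a | a = .crash i ∨ (∃ o, D.locOut o = i ∧ a = .fd o) ∨
    ∃ m j, j ≠ i ∧ a = .recv m j i}
  output := {a | (∃ m j, j ≠ i ∧ a = .send m i j) ∨ ∃ j, a = .pout (j, i)}
  internal := ∅
  State := OmegaState n D.Out
  start := {⟨Graph.empty, 0, [], i, false⟩}
  trans s a s' :=
    (a = .crash i ∧ s' = { s with faulty := true }) ∨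
    (∃ o, a = .fd o ∧ D.locOut o = i ∧
      s' = if s.faulty = true then s else s.afterFd A i o) ∨
    (∃ m j, a = .recv m j i ∧ j ≠ i ∧
      s' = if s.faulty = true then s else { s with G := s.G.union m }) ∨
    (∃ m j q, a = .send m i j ∧ j ≠ i ∧ s.faulty = false ∧
      s.sendq = (Sum.inl m, j) :: q ∧ s' = { s with sendq := q }) ∨
    (∃ j q, a = .pout (j, i) ∧ s.faulty = false ∧
      s.sendq = (Sum.inr j, i) :: q ∧ s' = { s with sendq := q })
  Task := Unit
  task _ := {a | (∃ m j, j ≠ i ∧ a = .send m i j) ∨ ∃ j, a = .pout (j, i)}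

/-- The value of the variable `G` of the process at `i` in the `k`-th state of an execution of
the system with the algorithm `omegaAlg A`. -/
def localGraph {Y : Type} {A : Fin n → Automaton (ProcAct D (consensus n f) M X)}
    {E : Fin n → Automaton (EnvAct (omegaF n f) Y)} (x : (fullSystem (omegaAlg A) E).Execution)
    (i : Fin n) (k : ℕ) : Graph n D.Out :=
  (show OmegaState n D.Out from x.state k (some (Comp.proc i))).G

/-- The location `i` does not crash in the execution `x`. -/
def IsLive {Y : Type} {A : Fin n → Automaton (ProcAct D (consensus n f) M X)}
    {E : Fin n → Automaton (EnvAct (omegaF n f) Y)} (x : (fullSystem (omegaAlg A) E).Execution)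
    (i : Fin n) : Prop :=
  ∀ k, x.events.get? k ≠ some (SysAct.crash i)

/-- In the execution `x`, the graphs at all live locations converge to one graph `G`, whose tree
has a first non-`⊥` decision gadget `Y` with a live critical location. At every live location, `Y`
is from some point on the first non-`⊥` decision gadget of the tree for the local graph, and from
some point on all outputs are the critical location of `Y`, which is output infinitely often. -/
def StabilizesOnFirstGadget {Y : Type} {A : Fin n → Automaton (ProcAct D (consensus n f) M X)}
    {E : Fin n → Automaton (EnvAct (omegaF n f) Y)}
    (x : (fullSystem (omegaAlg A) E).Execution) : Prop :=
  ∃ (G : Graph n D.Out) (H : Gadget n D.Out),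
    (∀ i, IsLive x i →
      (⋃ k, (localGraph x i k).V) = G.V ∧ (⋃ k, (localGraph x i k).Z) = G.Z) ∧
    IsFirst A G H ∧ IsLive x H.critLoc ∧
    ∀ i, IsLive x i →
      (∃ k₀, ∀ k ≥ k₀, IsFirst A (localGraph x i k) H) ∧
      (∃ k₀, ∀ k ≥ k₀, ∀ j, x.events.get? k = some (SysAct.pout (j, i)) → j = H.critLoc) ∧
      ∀ m, ∃ k ≥ m, x.events.get? k = some (SysAct.pout (H.critLoc, i))

end OmegaAlgorithm

end Afd

/-! The proof follows the pattern of the classical result that `Ω` is the weakest failure detector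
for consensus. Let `t` be the sequence of events of `D` in a fair execution of `A^Ω` with at most
`f` crashes. Each output of `D` at a location becomes a vertex with edges from all vertices known
there, and the graphs are flooded. Hence all live locations converge to one graph `G∞` of outputs in
`t`, whose edges are transitive and point forward in `t`, and in which each vertex has edges to all
sufficiently late vertices at live locations (`FairOmegaRun.traceGraph`).

From tree paths to executions. An infinite path without `⊥` in the tree of `G∞` takes a chain of
vertices, that is, a subsequence of the outputs in `t`. Insert the crashes of `t` at the times at
which they occur relative to this chain. Every action on the path other than a receipt has a later
or equal output at its location in `t`, so it never comes after an inserted crash there; receipts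
are inputs and stay possible. If the path is fair to the channels and the live locations, a fair
execution of the full consensus system results, and its events of `D` form a valid subsequence of
`t`. Strong sampling puts them into `T_D`, so the decisions on the path satisfy agreement, validity
and termination (`FairPath.exists_execution`, `FairPath.decides`). Since `⊥`-edges change nothing,
they can be deleted from any path; thus every node leads to a decision, and the decisions on one
path agree.

Gadgets exist. Fair paths can avoid all proposals of a given value, so by validity the root is
bivalent. Suppose there is no non-`⊥` decision gadget. Then below each bivalent non-`⊥` node, every
label of a channel or a live location leads from some non-`⊥` node to a bivalent child: otherwise
all such children would be univalent with one and the same valence along every walk without `⊥`,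
since a change of valence is a fork or a hook. Dealing with all labels in turn produces a fair path
of bivalent nodes, which nevertheless decides (`ConsensusSetting.exists_gadget`).

The critical location is live. If it were faulty, the configurations at the two univalent nodes
would extend a common one up to states of faulty locations and messages from faulty locations at the
ends of channels. After an output at a live location that is later than all outputs at faulty ones,
faulty locations perform nothing but receipts, and these can be left out. So one continuation leads
both nodes to the same decision (`ConsensusSetting.exists_common_decision`,
`ConsensusSetting.critLoc_notMem_faulty`).

Stabilization. For a fixed path, being a node and its tags involve finitely many vertices and edges,
so they are eventually the same in the local trees as in the limit. Valence stabilizes too: a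
decision in the limit has a finite witness, and a decision in a local tree can be repeated in the
limit once `⊥`-edges are deleted. Nodes of bounded level lie in a finite set of paths that does not
depend on the local graph, so ranks stabilize. A gadget of metric at most `m` has nodes of rank at
most `m`, which in graphs with at least `m` vertices have level at most `m`. So finitely many
gadgets compete with the first one of the limit, and it is eventually first everywhere
(`ConsensusSetting.eventually_isFirst`). Queues pass on every entry, so from some point on exactly
its critical location is output.

That `Ω_f` is a strong-sampling AFD is checked directly: the closure properties preserve the faulty
set and the eventual leader, and an automaton that records crashes and outputs a fixed choice of an
uncrashed location generates its traces. The comparison statements then follow by applying the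
construction to any sufficient detector. -/

namespace Afd

/-! ### Sequences -/

section SequenceLemmas

open Classical

variable {α β : Type}

theorem retained_iff (f : ℕ → α → Option β) (t : Stream'.Seq α) (k : ℕ) :
    Retained f t k ↔ ∃ a b, t.get? k = some a ∧ f k a = some b := by
  unfold Retained
  cases h : t.get? k with
  | none => simp
  | some a => simp [Option.isSome_iff_exists]

/-- `Nat.count` and `Nat.nth` invert each other on retained positions. This turns every question
about a selected sequence into one about positions in `t`. -/
theorem select_get?_eq_some (f : ℕ → α → Option β) (t : Stream'.Seq α) (m : ℕ) (b : β) :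
    (select f t).get? m = some b ↔
      ∃ k a, t.get? k = some a ∧ f k a = some b ∧ Nat.count (Retained f t) k = m := by
  change selectAt f t m = some b ↔ _
  constructor
  · intro h
    have hs : ∀ h : (Set.ofPred (Retained f t)).Finite, m < h.toFinset.card :=
      (selectAt_isSome f t m).1 (by rw [h]; rfl)
    have hr : Retained f t (Nat.nth (Retained f t) m) := Nat.nth_mem m hs
    unfold selectAt at h
    rw [if_pos hs] at h
    obtain ⟨a, b', ha, hb⟩ := (retained_iff f t _).1 hr
    refine ⟨_, a, ha, ?_, Nat.count_nth hs⟩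
    rw [ha] at h
    exact h
  · rintro ⟨k, a, ha, hb, rfl⟩
    have hr : Retained f t k := (retained_iff f t k).2 ⟨a, b, ha, hb⟩
    unfold selectAt
    rw [if_pos fun h => Nat.count_lt_card h hr, Nat.nth_count hr, ha]
    exact hb

/-- The position in `select f t` of the entry at position `k` of `t`. -/
noncomputable def selPos (f : ℕ → α → Option β) (t : Stream'.Seq α) (k : ℕ) : ℕ :=
  Nat.count (Retained f t) k

theorem select_get?_selPos {f : ℕ → α → Option β} {t : Stream'.Seq α} {k : ℕ} {a : α} {b : β}
    (ha : t.get? k = some a) (hb : f k a = some b) : (select f t).get? (selPos f t k) = some b :=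
  (select_get?_eq_some _ _ _ _).2 ⟨k, a, ha, hb, rfl⟩

theorem selPos_mono (f : ℕ → α → Option β) (t : Stream'.Seq α) : Monotone (selPos f t) :=
  Nat.count_monotone _

theorem selPos_le (f : ℕ → α → Option β) (t : Stream'.Seq α) (k : ℕ) : selPos f t k ≤ k :=
  Nat.count_le _

theorem selPos_lt {f : ℕ → α → Option β} {t : Stream'.Seq α} {k m : ℕ} {a : α} {b : β}
    (ha : t.get? k = some a) (hb : f k a = some b) (h : k < m) : selPos f t k < selPos f t m :=
  Nat.count_strict_mono ((retained_iff _ _ _).2 ⟨a, b, ha, hb⟩) h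

theorem lt_of_selPos_lt {f : ℕ → α → Option β} {t : Stream'.Seq α} {k m : ℕ}
    (h : selPos f t k < selPos f t m) : k < m :=
  lt_of_not_ge fun hle => absurd (selPos_mono f t hle) (not_le.2 h)

theorem selPos_injOn {f : ℕ → α → Option β} {t : Stream'.Seq α} {k m : ℕ} {a a' : α} {b b' : β}
    (ha : t.get? k = some a) (hb : f k a = some b) (ha' : t.get? m = some a')
    (hb' : f m a' = some b') (h : selPos f t k = selPos f t m) : k = m := by
  rcases lt_trichotomy k m with h1 | h1 | h1
  · exact absurd h (selPos_lt ha hb h1).ne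
  · exact h1
  · exact absurd h (selPos_lt ha' hb' h1).ne'

/-- Each retained position raises the count by one, so infinitely many of them make it unbounded.
Used to turn "late in the selection" into "late in `t`". -/
theorem exists_le_selPos {f : ℕ → α → Option β} {t : Stream'.Seq α}
    (h : ∀ m, ∃ k ≥ m, ∃ a b, t.get? k = some a ∧ f k a = some b) (m : ℕ) :
    ∃ K, m ≤ selPos f t K := by
  induction m with
  | zero => exact ⟨0, Nat.zero_le _⟩
  | succ m ih =>
    obtain ⟨K, hK⟩ := ih
    obtain ⟨k, hk, a, b, ha, hb⟩ := h K
    exact ⟨k + 1, (Nat.succ_le_succ (hK.trans (selPos_mono f t hk))).trans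
      (selPos_lt ha hb (Nat.lt_succ_self k))⟩

/-- The infinite sequence with the given entries. -/
def ofFun (e : ℕ → α) : Stream'.Seq α := ⟨fun k => some (e k), fun h => by cases h⟩

theorem isSome_of_infinite {t : Stream'.Seq α} (h : ∀ m, ∃ k ≥ m, (t.get? k).isSome = true)
    (k : ℕ) : ∃ a, t.get? k = some a := by
  obtain ⟨k', hk', hs⟩ := h k
  obtain ⟨a, ha⟩ := Option.isSome_iff_exists.1 hs
  exact Stream'.Seq.ge_stable t hk' ha

theorem infinite_or_hasLength (t : Stream'.Seq α) :
    (∀ k, (t.get? k).isSome = true) ∨ ∃ L, HasLength t L := by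
  by_cases h : ∀ k, (t.get? k).isSome = true
  · exact Or.inl h
  · right
    push Not at h
    refine ⟨Nat.find h, fun k => ?_⟩
    constructor
    · intro hk
      by_contra hle
      obtain ⟨a, ha⟩ := Option.isSome_iff_exists.1 hk
      obtain ⟨b, hb⟩ := Stream'.Seq.ge_stable t (not_lt.1 hle) ha
      exact Nat.find_spec h (by rw [hb]; rfl)
    · intro hk
      exact not_not.1 (Nat.find_min h hk)

end SequenceLemmas

/-! ### Faulty locations and validity of selected sequences -/

section EventLemmas

variable {α : Type} {n : ℕ} {I O : Type}

theorem mem_faulty_select {g : ℕ → α → Option (Event n I O)} {t : Stream'.Seq α} {i : Fin n} :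
    i ∈ faulty (select g t) ↔ ∃ k a, t.get? k = some a ∧ g k a = some (Event.crash i) := by
  constructor
  · rintro ⟨m, hm⟩
    obtain ⟨k, a, ha, hb, -⟩ := (select_get?_eq_some _ _ _ _).1 hm
    exact ⟨k, a, ha, hb⟩
  · rintro ⟨k, a, ha, hb⟩
    exact ⟨_, select_get?_selPos ha hb⟩

/-- `selPos` is monotone, and strictly so at retained positions, so the order of events and
"infinitely often" can be read off before the selection. -/
theorem valid_select_iff {loc : O → Fin n} {g : ℕ → α → Option (Event n I O)} {t : Stream'.Seq α} :
    Valid loc (select g t) ↔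
      (∀ k m i o a b, k < m → t.get? k = some a → g k a = some (Event.crash i) →
        t.get? m = some b → g m b = some (Event.out o) → loc o ≠ i) ∧
      ∀ i, (∀ k a, t.get? k = some a → g k a ≠ some (Event.crash i)) →
        ∀ m, ∃ k ≥ m, ∃ a o, t.get? k = some a ∧ g k a = some (Event.out o) ∧ loc o = i := by
  constructor
  · rintro ⟨h1, h2⟩
    refine ⟨fun k m i o a b hkm ha hga hb hgb => h1 _ _ i o (selPos_lt ha hga hkm)
      (select_get?_selPos ha hga) (select_get?_selPos hb hgb), fun i hi m => ?_⟩
    have hi' : i ∉ faulty (select g t) := by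
      rw [mem_faulty_select]
      rintro ⟨k, a, ha, hg⟩
      exact hi k a ha hg
    obtain ⟨k', hk', o, ho, hl⟩ := h2 i hi' m
    obtain ⟨k, a, ha, hg, rfl⟩ := (select_get?_eq_some _ _ _ _).1 ho
    exact ⟨k, hk'.trans (selPos_le _ _ _), a, o, ha, hg, hl⟩
  · rintro ⟨h1, h2⟩
    refine ⟨fun k m i o hkm hk hm => ?_, fun i hi m => ?_⟩
    · obtain ⟨k', a, ha, hga, rfl⟩ := (select_get?_eq_some _ _ _ _).1 hk
      obtain ⟨m', b, hb, hgb, rfl⟩ := (select_get?_eq_some _ _ _ _).1 hm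
      exact h1 k' m' i o a b (lt_of_selPos_lt hkm) ha hga hb hgb
    · have h3 := h2 i fun k a ha hg => hi (mem_faulty_select.2 ⟨k, a, ha, hg⟩)
      obtain ⟨K, hK⟩ := exists_le_selPos (f := g) (t := t) (fun m => by
        obtain ⟨k, hk, a, o, ha, hg, -⟩ := h3 m
        exact ⟨k, hk, a, _, ha, hg⟩) m
      obtain ⟨k, hk, a, o, ha, hg, hl⟩ := h3 K
      exact ⟨_, hK.trans (selPos_mono _ _ hk), o, select_get?_selPos ha hg, hl⟩

end EventLemmas

/-! ### Queues -/

section Queues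

variable {β : Type}

/-- In a queue that is emptied at the head again and again, each entry arrives at the head and is
removed. -/
theorem exists_dequeue {q : ℕ → List β}
    (hstep : ∀ k, (∃ l, q (k + 1) = q k ++ l) ∨ ∃ x, q k = x :: q (k + 1))
    (hprog : ∀ k, q k ≠ [] → ∃ k' ≥ k, ∃ x, q k' = x :: q (k' + 1))
    (x : β) (l₁ : List β) : ∀ (k : ℕ) (l₂ : List β), q k = l₁ ++ x :: l₂ →
      ∃ k' ≥ k, q k' = x :: q (k' + 1) := by
  -- The head stays in place until it is removed; at that moment what stood behind it is still an
  -- initial segment of the queue.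
  have key : ∀ k y l, q k = y :: l → ∃ k' ≥ k, ∃ l', q k' = y :: q (k' + 1) ∧
      q (k' + 1) = l ++ l' := by
    intro k y l hk
    obtain ⟨k', hk', z, hz⟩ := hprog k (by rw [hk]; simp)
    obtain ⟨d, rfl⟩ := Nat.exists_eq_add_of_le hk'
    clear hk'
    induction d generalizing k l with
    | zero =>
      have : y = z ∧ l = q (k + 1) := by
        rw [Nat.add_zero, hk] at hz
        simpa using hz
      exact ⟨k, le_rfl, [], by rw [hk, this.2], by simp [this.2]⟩
    | succ d ih =>
      rcases hstep k with ⟨l', hl'⟩ | ⟨z', hz'⟩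
      · have h1 : q (k + 1) = y :: (l ++ l') := by rw [hl', hk]; rfl
        have e : k + (d + 1) = k + 1 + d := by ring
        rw [e] at hz
        obtain ⟨k', hk', l'', h2, h3⟩ := ih (k + 1) _ h1 hz
        exact ⟨k', by omega, l' ++ l'', h2, by rw [h3, List.append_assoc]⟩
      · rw [hk] at hz'
        have : y = z' ∧ l = q (k + 1) := by simpa using hz'
        exact ⟨k, le_rfl, [], by rw [hk, this.2], by simp [this.2]⟩
  induction l₁ with
  | nil =>
    intro k l₂ hk
    obtain ⟨k', h1, l', h2, -⟩ := key k x l₂ hk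
    exact ⟨k', h1, h2⟩
  | cons y l₁ ih =>
    intro k l₂ hk
    obtain ⟨k', h1, l', -, h3⟩ := key k y (l₁ ++ x :: l₂) hk
    obtain ⟨k'', h4, h5⟩ := ih (k' + 1) (l₂ ++ l') (by rw [h3]; simp)
    exact ⟨k'', by omega, h5⟩

/-- If from some point on only good entries are appended, then from some point on the queue has
only good entries. -/
theorem eventually_forall_mem_queue {q : ℕ → List β} (Gd : β → Prop) (K : ℕ)
    (hstep : ∀ k, (∃ l, q (k + 1) = q k ++ l ∧ (K ≤ k → ∀ x ∈ l, Gd x)) ∨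
      ∃ x, q k = x :: q (k + 1))
    (hprog : ∀ k, q k ≠ [] → ∃ k' ≥ k, ∃ x, q k' = x :: q (k' + 1)) :
    ∃ K', ∀ k ≥ K', ∀ x ∈ q k, Gd x := by
  have stay : ∀ k ≥ K, (∀ x ∈ q k, Gd x) → ∀ k' ≥ k, ∀ x ∈ q k', Gd x := by
    intro k hk h k' hk'
    induction k', hk' using Nat.le_induction with
    | base => exact h
    | succ k' hk' ih =>
      rcases hstep k' with ⟨l, hl, hg⟩ | ⟨y, hy⟩
      · intro x hx
        rw [hl, List.mem_append] at hx
        exact hx.elim (ih x) (hg (by omega) x)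
      · intro x hx
        exact ih x (by rw [hy]; exact List.mem_cons_of_mem _ hx)
  -- Induction on the number `N` of entries left over from time `K`: the queue is `old ++ new`,
  -- where everything in `new` is good. Each removal shortens `old`.
  have main : ∀ (N : ℕ) (k : ℕ) (old new : List β), old.length = N → k ≥ K →
      q k = old ++ new → (∀ x ∈ new, Gd x) → ∃ k' ≥ K, ∀ x ∈ q k', Gd x := by
    intro N
    induction N with
    | zero =>
      intro k old new ho hk hq hn
      rw [List.length_eq_zero_iff] at ho
      subst ho
      exact ⟨k, hk, by simpa [hq] using hn⟩
    | succ N ih =>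
      intro k old new ho hk hq hn
      obtain ⟨y, old, rfl⟩ := List.exists_cons_of_length_eq_add_one ho
      obtain ⟨k', hk', z, hz⟩ := hprog k (by rw [hq]; simp)
      obtain ⟨d, rfl⟩ := Nat.exists_eq_add_of_le hk'
      clear hk'
      have ho' : old.length = N := by simpa using ho
      induction d generalizing k new with
      | zero =>
        rw [Nat.add_zero, hq] at hz
        have : old ++ new = q (k + 1) := by
          have := (List.cons.inj hz).2
          exact this
        exact ih (k + 1) old new ho' (by omega) this.symm hn
      | succ d ihd =>
        rcases hstep k with ⟨l, hl, hg⟩ | ⟨z', hz'⟩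
        · have e : k + (d + 1) = k + 1 + d := by ring
          rw [e] at hz
          refine ihd (k + 1) (new ++ l) (by omega) ?_ (by rw [hl, hq]; simp) hz
          intro x hx
          rw [List.mem_append] at hx
          exact hx.elim (hn x) (hg hk x)
        · rw [hq] at hz'
          have : old ++ new = q (k + 1) := (List.cons.inj hz').2
          exact ih (k + 1) old new ho' (by omega) this.symm hn
  obtain ⟨K', h1, h2⟩ := main _ K (q K) [] rfl le_rfl (by simp) (by simp)
  exact ⟨K', stay K' h1 h2⟩

end Queues

/-! ### Automata -/

namespace Automaton

variable {α : Type}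

/-- The finite list `l` of actions leads from a start state to `s`. -/
inductive Run (A : Automaton α) : List α → A.State → Prop
  | nil (s : A.State) (hs : s ∈ A.start) : Run A [] s
  | snoc (l : List α) (s s' : A.State) (a : α) (h : Run A l s) (ht : A.trans s a s') :
      Run A (l ++ [a]) s'

theorem Run.exists_states {A : Automaton α} {l : List α} {s : A.State} (h : A.Run l s) :
    ∃ st : ℕ → A.State, st 0 ∈ A.start ∧ st l.length = s ∧
      ∀ k a, l[k]? = some a → A.trans (st k) a (st (k + 1)) := by
  induction h with
  | nil s hs => exact ⟨fun _ => s, hs, rfl, by simp⟩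
  | snoc l s s' a h ht ih =>
    obtain ⟨st, h0, hl, hst⟩ := ih
    refine ⟨fun k => if k ≤ l.length then st k else s', by simpa using h0, by simp, ?_⟩
    intro k b hb
    rcases lt_trichotomy k l.length with hk | hk | hk
    · rw [List.getElem?_append_left hk] at hb
      simp only [hk.le, if_true, Nat.succ_le_of_lt hk]
      exact hst k b hb
    · subst hk
      simp at hb
      subst hb
      simpa [hl] using ht
    · rw [List.getElem?_eq_none (by simp; omega)] at hb
      cases hb

/-- `DisabledBy` speaks of executions. A finite run is one: its last event has position `l.length -
1`, and the state after that event is `s`. -/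
theorem DisabledBy.not_enabled {A : Automaton α} {c : α} (hA : A.DisabledBy c) {l : List α}
    {s : A.State} (h : A.Run l s) (hc : c ∈ l) : ∀ a ∈ A.locallyControlled, ¬ A.Enabled s a := by
  obtain ⟨st, h0, hl, hst⟩ := h.exists_states
  obtain ⟨k, hk⟩ := List.mem_iff_getElem?.1 hc
  have hkl : k < l.length := by
    by_contra hle
    rw [List.getElem?_eq_none (not_lt.1 hle)] at hk
    cases hk
  have hpos : 0 < l.length := by omega
  let x : A.Execution := ⟨Stream'.Seq.ofList l, st, h0, by
    intro k a ha
    exact hst k a (by simpa using ha)⟩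
  have := hA x k (l.length - 1) (by simpa [x] using hk) (by omega)
    (by simp [x, hpos])
  have e : l.length - 1 + 1 = l.length := by omega
  rw [e] at this
  change ∀ a ∈ A.locallyControlled, ¬ A.Enabled (st l.length) a at this
  rwa [hl] at this

/-- The components move independently, so successor states can be chosen one component at a time. -/
theorem compose_enabled_iff {ι : Type} (A : ι → Automaton α) (s : (compose A).State) (a : α) :
    (compose A).Enabled s a ↔ (∃ i, a ∈ (A i).acts) ∧
      ∀ i, a ∈ (A i).acts → (A i).Enabled (s i) a := by
  classical
  constructor
  · rintro ⟨s', h1, h2⟩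
    refine ⟨h1, fun i hi => ?_⟩
    rcases h2 i with ⟨-, ht⟩ | ⟨hn, -⟩
    · exact ⟨s' i, ht⟩
    · exact absurd hi hn
  · rintro ⟨h1, h2⟩
    refine ⟨fun i => if h : a ∈ (A i).acts then (h2 i h).choose else s i, h1, fun i => ?_⟩
    by_cases h : a ∈ (A i).acts
    · left
      simp only [h, dif_pos, true_and]
      exact (h2 i h).choose_spec
    · right
      simp [h]

theorem Deterministic.eq_of_enabled {A : Automaton α} (hA : A.Deterministic) (hw : A.WellFormed)
    {s : A.State} {a b : α} (ha : a ∈ A.locallyControlled) (hb : b ∈ A.locallyControlled)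
    (h1 : A.Enabled s a) (h2 : A.Enabled s b) : a = b := by
  obtain ⟨c, hc, -⟩ := hw.task_unique a ha
  obtain ⟨c', hc', -⟩ := hw.task_unique b hb
  have e : c = c' := hA.one_task.unique trivial trivial
  subst e
  exact hA.taskDeterministic.task_enabled c s a hc b hc' h1 h2

end Automaton

/-! ### `Ω_f` is a strong-sampling asynchronous failure detector -/

section OmegaF

variable {n f : ℕ}

theorem outsAt_get?_eq_some {I O : Type} {loc : O → Fin n} {i : Fin n}
    {t : Stream'.Seq (Event n I O)} {m : ℕ} {o : O} (h : (outsAt loc i t).get? m = some o) :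
    ∃ k ≥ m, t.get? k = some (Event.out o) ∧ loc o = i := by
  unfold outsAt proj at h
  obtain ⟨k, a, ha, hb, rfl⟩ := (select_get?_eq_some _ _ _ _).1 h
  refine ⟨k, selPos_le _ _ _, ?_⟩
  rcases a with j | x | o'
  · cases hb
  · cases hb
  · dsimp only at hb
    split_ifs at hb with hl
    cases hb
    exact ⟨ha, hl⟩

theorem outsAt_infinite {I O : Type} {loc : O → Fin n} {i : Fin n}
    {t : Stream'.Seq (Event n I O)}
    (h : ∀ m, ∃ k ≥ m, ∃ o, t.get? k = some (Event.out o) ∧ loc o = i) (m : ℕ) :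
    ∃ o, (outsAt loc i t).get? m = some o := by
  unfold outsAt proj
  refine isSome_of_infinite (fun m => ?_) m
  obtain ⟨K, hK⟩ := exists_le_selPos (f := fun _ (e : Event n I O) => match e with
    | Event.out o => if loc o = i then some o else none
    | _ => none) (t := t) (fun m => by
      obtain ⟨k, hk, o, ho, hl⟩ := h m
      exact ⟨k, hk, _, o, ho, by simp [hl]⟩) m
  obtain ⟨k, hk, o, ho, hl⟩ := h K
  exact ⟨_, hK.trans (selPos_mono _ _ hk), Option.isSome_iff_exists.2
    ⟨o, select_get?_selPos ho (by simp [hl])⟩⟩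

/-- A sampling keeps a crash of each faulty location, so a location live in `t'` is live in `t` and
retains all of its infinitely many outputs. -/
theorem valid_of_isSampling {I O : Type} {loc : O → Fin n} {t t' : Stream'.Seq (Event n I O)}
    (ht : Valid loc t) (h : IsSampling loc t' t) : Valid loc t' := by
  obtain ⟨φ, ⟨hm, hφ⟩, hs⟩ := h
  refine ⟨fun k m i o hkm hk hmo => ht.1 _ _ i o (hm hkm) (hφ _ _ hk) (hφ _ _ hmo),
    fun i hi m => ?_⟩
  have hi' : i ∉ faulty t := fun hf => by
    obtain ⟨⟨k, hk, -⟩, -⟩ := (hs i).2 hf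
    exact hi ⟨k, hk⟩
  obtain ⟨o, ho⟩ := outsAt_infinite (ht.2 i hi') m
  rw [← (hs i).1 hi'] at ho
  obtain ⟨k, hk, h1, h2⟩ := outsAt_get?_eq_some ho
  exact ⟨k, hk, o, h1, h2⟩

/-- Validity forces `t'` to keep a crash of each location faulty in `t`: otherwise that location
would have infinitely many outputs in `t'`, some of them after its crash in `t`. So the faulty sets
coincide, and the eventual leader is inherited. -/
theorem omegaF_strongSampling {t t' : Stream'.Seq (omegaF n f).Ev} (ht : t ∈ (omegaF n f).traces)
    (hφ : ∃ φ, IsEmbedding φ t' t) (hv : Valid (omegaF n f).locOut t') :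
    t' ∈ (omegaF n f).traces := by
  obtain ⟨φ, hm, hφ⟩ := hφ
  have hfa : faulty t' = faulty t := by
    ext i
    constructor
    · rintro ⟨k, hk⟩
      exact ⟨_, hφ _ _ hk⟩
    · rintro ⟨K, hK⟩
      by_contra hi
      obtain ⟨k, hk, o, ho, hl⟩ := hv.2 i hi (K + 1)
      exact ht.1.1 K (φ k) i o (lt_of_lt_of_le hk (hm.le_apply)) hK (hφ _ _ ho) hl
  refine ⟨hv, fun h1 h2 => ?_⟩
  rw [hfa] at h1 h2 ⊢
  obtain ⟨l, hl, m, hm'⟩ := ht.2 h1 h2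
  exact ⟨l, hl, m, fun k hk j i h => hm' (φ k) (hk.trans hm.le_apply) j i (hφ _ _ h)⟩

/-- Without live locations only the absence of outputs after crashes matters, and all outputs lie
before `L`, where `t'` agrees with `t`. -/
theorem omegaF_crashExtension {t t' : Stream'.Seq (omegaF n f).Ev}
    (ht : t ∈ (omegaF n f).traces) (h : IsCrashExtension t' t) (hf : faulty t' = Set.univ) :
    t' ∈ (omegaF n f).traces := by
  obtain ⟨L, h1, h2⟩ := h
  have hL : ∀ m o, t'.get? m = some (Event.out o) → m < L := by
    intro m o hm
    by_contra hle
    obtain ⟨i, hi⟩ := h2 m (not_lt.1 hle) _ hm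
    cases hi
  refine ⟨⟨fun k m i o hkm hk hm => ?_, fun i hi => ?_⟩, fun _ hne => ?_⟩
  · have hm' := hL m o hm
    exact ht.1.1 k m i o hkm ((h1 k (hkm.trans hm')).2 ▸ hk) ((h1 m hm').2 ▸ hm)
  · rw [hf] at hi
    exact absurd (Set.mem_univ i) hi
  · rw [hf] at hne
    simp at hne

/-- One crash of each location is appended, so that `omegaF_crashExtension` applies. -/
theorem omegaF_crashExtension_prefix {t t' : Stream'.Seq (omegaF n f).Ev}
    (ht : t ∈ (omegaF n f).traces) (h : IsCrashExtension t' t) (hf : ∃ L, HasLength t' L) :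
    ∃ t'' ∈ (omegaF n f).traces, IsPrefix t' t'' := by
  obtain ⟨L', hL'⟩ := hf
  let e : ℕ → Option (omegaF n f).Ev := fun k => if k < L' then t'.get? k else
    if h : k - L' < n then some (Event.crash ⟨k - L', h⟩) else none
  let t'' : Stream'.Seq (omegaF n f).Ev := ⟨e, by
    intro k hk
    change e k = none at hk
    simp only [e] at hk ⊢
    split_ifs at hk with h1 h2
    · have := (hL' k).2 h1
      rw [hk] at this
      cases this
    · rw [if_neg (by omega), dif_neg (by omega)]⟩
  have he : ∀ k, t''.get? k = e k := fun k => rfl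
  obtain ⟨L, h1, h2⟩ := h
  refine ⟨t'', omegaF_crashExtension ht ⟨L, fun k hk => ⟨(h1 k hk).1, ?_⟩, fun k hk a ha => ?_⟩
    ?_, fun k a ha => ?_⟩
  · have : k < L' := (hL' k).1 (by rw [(h1 k hk).2]; exact (h1 k hk).1)
    rw [he, ← (h1 k hk).2]
    simp [e, this]
  · rw [he] at ha
    simp only [e] at ha
    split_ifs at ha with h3 h4
    · exact h2 k hk a ha
    · exact ⟨_, (Option.some.inj ha).symm⟩
  · refine Set.eq_univ_of_forall fun i => ⟨L' + i.val, ?_⟩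
    rw [he]
    simp [e]
  · have : k < L' := (hL' k).1 (by rw [ha]; rfl)
    rw [he]
    simp [e, this, ha]

theorem omegaF_reordering {t t' : Stream'.Seq (omegaF n f).Ev} (ht : t ∈ (omegaF n f).traces)
    (h : IsReordering (omegaF n f).locOut t' t) : t' ∈ (omegaF n f).traces := by
  obtain ⟨hv, σ, hb, hσ, -, -⟩ := h
  have hback : ∀ m e, t'.get? m = some e → ∃ k, σ k = m ∧ t.get? k = some e := by
    intro m e hm
    obtain ⟨k, hk, rfl⟩ := hb.surjOn (show m ∈ {k | (t'.get? k).isSome = true} by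
      simp [hm])
    obtain ⟨e', he'⟩ := Option.isSome_iff_exists.1 hk
    have := hσ k e' he'
    rw [hm] at this
    exact ⟨k, rfl, he'.trans this.symm⟩
  have hfa : faulty t' = faulty t := by
    ext i
    constructor
    · rintro ⟨m, hm⟩
      obtain ⟨k, -, hk⟩ := hback m _ hm
      exact ⟨k, hk⟩
    · rintro ⟨k, hk⟩
      exact ⟨_, hσ _ _ hk⟩
  refine ⟨hv, fun h1 h2 => ?_⟩
  rw [hfa] at h1 h2 ⊢
  obtain ⟨l, hl, m, hm⟩ := ht.2 h1 h2
  -- Past the images of all positions below `m`, only entries from position `m` on can appear.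
  refine ⟨l, hl, (Finset.range m).sup σ + 1, fun k hk j i hj => ?_⟩
  obtain ⟨k', rfl, hk'⟩ := hback k _ hj
  refine hm k' ?_ j i hk'
  by_contra hlt
  have := Finset.le_sup (f := σ) (Finset.mem_range.2 (not_le.1 hlt))
  omega

/-- Only the first crash at each location matters, both for validity and for the faulty set, and no
output is dropped. Applied once in each direction, this yields closure under extra crashes. -/
theorem omegaF_mincrash (t : Stream'.Seq (omegaF n f).Ev) :
    mincrash t ∈ (omegaF n f).traces ↔ t ∈ (omegaF n f).traces := by
  obtain ⟨g, hmin, hcr, hout⟩ : ∃ g : ℕ → (omegaF n f).Ev → Option (omegaF n f).Ev,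
      mincrash t = select g t ∧
      (∀ k e i, t.get? k = some e → (g k e = some (Event.crash i) ↔
        e = Event.crash i ∧ ∀ m < k, t.get? m ≠ some (Event.crash i))) ∧
      ∀ k e o, g k e = some (Event.out o) ↔ e = Event.out o := by
    refine ⟨_, rfl, fun k e i he => ?_, fun k e o => ?_⟩
    · rcases e with j | x | o
      · dsimp only
        split_ifs with h
        · simp only [false_iff, not_and]
          rintro ⟨⟩ h'
          obtain ⟨m, hm, hm'⟩ := h
          exact h' m hm hm'
        · push Not at h
          constructor
          · rintro ⟨⟩
            exact ⟨rfl, h⟩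
          · rintro ⟨⟨⟩, -⟩
            rfl
      · simp
      · simp
    · rcases e with j | x | o
      · dsimp only
        split_ifs <;> simp
      · simp
      · simp
  have hex : ∀ i, (∃ k, t.get? k = some (Event.crash i)) → ∃ k, t.get? k = some (Event.crash i) ∧
      ∀ m < k, t.get? m ≠ some (Event.crash i) := fun i h => by
    classical
    exact ⟨Nat.find h, Nat.find_spec h, fun m hm => Nat.find_min h hm⟩
  have hfa : faulty (mincrash t) = faulty t := by
    ext i
    rw [hmin, mem_faulty_select]
    constructor
    · rintro ⟨k, a, ha, hb⟩
      exact ⟨k, ((hcr k a i ha).1 hb).1 ▸ ha⟩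
    · intro h
      obtain ⟨k, h1, h2⟩ := hex i h
      exact ⟨k, _, h1, (hcr k _ i h1).2 ⟨rfl, h2⟩⟩
  have hval : Valid Prod.snd (mincrash t) ↔ Valid Prod.snd t := by
    rw [hmin, valid_select_iff]
    constructor
    · rintro ⟨h1, h2⟩
      refine ⟨fun k m i o hkm hk hm => ?_, fun i hi m => ?_⟩
      · obtain ⟨k', h3, h4⟩ := hex i ⟨k, hk⟩
        have : k' ≤ k := le_of_not_gt fun hlt => h4 k hlt hk
        exact h1 k' m i o _ _ (by omega) h3 ((hcr k' _ i h3).2 ⟨rfl, h4⟩) hm ((hout m _ o).2 rfl)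
      · obtain ⟨k, hk, a, o, h3, h4, h5⟩ := h2 i (fun k a ha hb =>
          hi ⟨k, ((hcr k a i ha).1 hb).1 ▸ ha⟩) m
        exact ⟨k, hk, o, (hout k a o).1 h4 ▸ h3, h5⟩
    · rintro ⟨h1, h2⟩
      refine ⟨fun k m i o a b hkm ha hga hb hgb => ?_, fun i hi m => ?_⟩
      · exact h1 k m i o hkm (((hcr k a i ha).1 hga).1 ▸ ha) ((hout m b o).1 hgb ▸ hb)
      · obtain ⟨k, hk, o, h3, h4⟩ := h2 i (fun h => by
          obtain ⟨k, h5, h6⟩ := hex i h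
          exact hi k _ h5 ((hcr k _ i h5).2 ⟨rfl, h6⟩)) m
        exact ⟨k, hk, _, o, h3, (hout k _ o).2 rfl, h4⟩
  change (Valid Prod.snd (mincrash t) ∧ _) ↔ (Valid Prod.snd t ∧ _)
  rw [hval, hfa]
  refine and_congr_right fun hv => imp_congr_right fun _ => ?_
  refine forall_congr' fun hne => exists_congr fun l => and_congr_right fun _ => ?_
  constructor
  · rintro ⟨m, hm⟩
    obtain ⟨i₀, hi₀⟩ := hne
    rw [hmin] at hm
    have hinf := exists_le_selPos (f := g) (t := t) (fun m => by
        obtain ⟨k, hk, o, h3, h4⟩ := hv.2 i₀ hi₀ m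
        exact ⟨k, hk, _, _, h3, (hout k _ o).2 rfl⟩) m
    obtain ⟨K, hK⟩ := hinf
    exact ⟨K, fun k hk j i hj => hm _ (hK.trans (selPos_mono _ _ hk)) j i
      (select_get?_selPos hj ((hout k _ (j, i)).2 rfl))⟩
  · rintro ⟨m, hm⟩
    refine ⟨m, fun k' hk' j i hj => ?_⟩
    rw [hmin] at hj
    obtain ⟨k, a, ha, hb, rfl⟩ := (select_get?_eq_some _ _ _ _).1 hj
    exact hm k (hk'.trans (selPos_le _ _ _)) j i ((hout k a (j, i)).1 hb ▸ ha)

open Classical in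
/-- A location that is not in `s`, if there is one. -/
noncomputable def liveLeader (s : Set (Fin n)) (i : Fin n) : Fin n :=
  if h : ∃ l, l ∉ s then h.choose else i

theorem liveLeader_eq {s : Set (Fin n)} {i : Fin n} (hi : i ∉ s) (j : Fin n) :
    liveLeader s i = liveLeader s j := by
  unfold liveLeader
  rw [dif_pos ⟨i, hi⟩, dif_pos ⟨i, hi⟩]

theorem liveLeader_notMem {s : Set (Fin n)} {i : Fin n} (hi : i ∉ s) : liveLeader s i ∉ s := by
  unfold liveLeader
  rw [dif_pos ⟨i, hi⟩]
  exact Exists.choose_spec (⟨i, hi⟩ : ∃ l, l ∉ s)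

/-- An automaton that records the crashes and outputs a live leader. -/
noncomputable def leaderAutomaton (n f : ℕ) : Automaton ((omegaF n f).Ev ⊕ Empty) where
  input := {a | (∃ i, a = Sum.inl (Event.crash i)) ∨ ∃ x, a = Sum.inl (Event.inp x)}
  output := {a | ∃ o, a = Sum.inl (Event.out o)}
  internal := ∅
  State := Set (Fin n)
  start := {∅}
  trans s a s' := (∃ i, a = Sum.inl (Event.crash i) ∧ s' = s ∪ {i}) ∨
    ∃ i j, a = Sum.inl (Event.out (j, i)) ∧ ((i ∉ s ∧ j = liveLeader s i)) ∧ s' = s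
  Task := Fin n
  task i := {a | ∃ j, a = Sum.inl (Event.out (j, i))}

theorem leaderAutomaton_wellFormed : (leaderAutomaton n f).WellFormed where
  input_output := by
    rw [Set.disjoint_left]
    rintro a (⟨i, rfl⟩ | ⟨⟨⟩, -⟩) ⟨o, h⟩
    cases h
  input_internal := by simp [leaderAutomaton]
  output_internal := by simp [leaderAutomaton]
  start_nonempty := ⟨(∅ : Set (Fin n)), rfl⟩
  trans_acts := by
    rintro s a s' (⟨i, rfl, -⟩ | ⟨i, j, rfl, -⟩)
    · exact Or.inl (Or.inl (Or.inl ⟨i, rfl⟩))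
    · exact Or.inl (Or.inr ⟨_, rfl⟩)
  input_enabled := by
    rintro s a (⟨i, rfl⟩ | ⟨⟨⟩, -⟩)
    exact ⟨_, Or.inl ⟨i, rfl, rfl⟩⟩
  task_local := by
    rintro c a ⟨j, rfl⟩
    exact Or.inl ⟨_, rfl⟩
  task_unique := by
    rintro a (⟨⟨j, i⟩, rfl⟩ | h)
    · refine ⟨i, ⟨j, rfl⟩, ?_⟩
      rintro i' ⟨j', h⟩
      cases h
      rfl
    · exact h.elim

/-- The task of a live location is always enabled, so fairness gives it infinitely many outputs. If
some location is live, the recorded set eventually equals the faulty set, and from then on the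
chosen leader is constant and live. -/
theorem leaderAutomaton_fair (x : (leaderAutomaton n f).Execution) (hx : x.Fair) :
    proj Sum.getLeft? x.events ∈ (omegaF n f).traces := by
  let st : ℕ → Set (Fin n) := x.state
  have h0 : st 0 = ∅ := x.state_zero
  have hstep : ∀ k a, x.events.get? k = some a →
      (∃ i, a = Sum.inl (Event.crash i) ∧ st (k + 1) = st k ∪ {i}) ∨
      ∃ i j, a = Sum.inl (Event.out (j, i)) ∧ (i ∉ st k ∧ j = liveLeader (st k) i) ∧
        st (k + 1) = st k := x.step
  -- The side condition says that `k` does not exceed the number of events; later values of `state`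
  -- have no meaning.
  have hmem : ∀ k, (x.events.get? k).isSome = true ∨ k = 0 ∨
      (x.events.get? (k - 1)).isSome = true → ∀ i, i ∈ st k ↔
      ∃ m < k, x.events.get? m = some (Sum.inl (Event.crash i)) := by
    intro k
    induction k with
    | zero => simp [h0]
    | succ k ih =>
      intro hk i
      have hs : (x.events.get? k).isSome = true := by
        rcases hk with hk | hk | hk
        · obtain ⟨a, ha⟩ := Option.isSome_iff_exists.1 hk
          obtain ⟨b, hb⟩ := Stream'.Seq.ge_stable x.events (Nat.le_succ k) ha
          rw [hb]; rfl
        · omega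
        · exact hk
      have ih' := ih (Or.inl hs) i
      obtain ⟨a, ha⟩ := Option.isSome_iff_exists.1 hs
      rcases hstep k a ha with ⟨i', rfl, h⟩ | ⟨i', j, rfl, -, h⟩
      · rw [h, Set.mem_union, ih', Set.mem_singleton_iff]
        constructor
        · rintro (⟨m, hm, h'⟩ | rfl)
          · exact ⟨m, by omega, h'⟩
          · exact ⟨k, by omega, ha⟩
        · rintro ⟨m, hm, h'⟩
          rcases Nat.lt_succ_iff_lt_or_eq.1 hm with hm | rfl
          · exact Or.inl ⟨m, hm, h'⟩
          · rw [ha] at h'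
            cases h'
            exact Or.inr rfl
      · rw [h, ih']
        constructor
        · rintro ⟨m, hm, h'⟩
          exact ⟨m, by omega, h'⟩
        · rintro ⟨m, hm, h'⟩
          rcases Nat.lt_succ_iff_lt_or_eq.1 hm with hm | rfl
          · exact ⟨m, hm, h'⟩
          · rw [ha] at h'
            cases h'
  have hgl : ∀ (a : (omegaF n f).Ev ⊕ Empty) e, Sum.getLeft? a = some e ↔ a = Sum.inl e := by
    rintro (a | a) e
    · simp
    · cases a
  have hout : ∀ k i j, x.events.get? k = some (Sum.inl (Event.out (j, i))) →
      i ∉ st k ∧ j = liveLeader (st k) i := by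
    intro k i j hk
    rcases hstep k _ hk with ⟨i', h, -⟩ | ⟨i', j', h, h', -⟩
    · cases h
    · cases h
      exact h'
  have henab : ∀ k i, i ∉ st k → (leaderAutomaton n f).TaskEnabled (x.state k) i :=
    fun k i hi => ⟨_, ⟨liveLeader (st k) i, rfl⟩, st k, Or.inr ⟨i, _, rfl, ⟨hi, rfl⟩, rfl⟩⟩
  have hlive : ∀ i, (∀ k, x.events.get? k ≠ some (Sum.inl (Event.crash i))) →
      (∀ k, (x.events.get? k).isSome = true) ∧
      ∀ m, ∃ k ≥ m, ∃ j, x.events.get? k = some (Sum.inl (Event.out (j, i))) := by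
    intro i hi
    rcases infinite_or_hasLength x.events with hinf | ⟨L, hL⟩
    · refine ⟨hinf, ?_⟩
      rcases (hx i).2 hinf with h | h
      · intro m
        obtain ⟨k, hk, a, ⟨j, rfl⟩, ha⟩ := h m
        exact ⟨k, hk, j, ha⟩
      · obtain ⟨k, -, hk⟩ := h 0
        refine absurd (henab k i fun hik => ?_) hk
        obtain ⟨m, -, hm⟩ := (hmem k (Or.inl (hinf k)) i).1 hik
        exact hi m hm
    · refine absurd (henab L i fun hik => ?_) ((hx i).1 L hL)
      have : L = 0 ∨ (x.events.get? (L - 1)).isSome = true := by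
        rcases Nat.eq_zero_or_pos L with h | h
        · exact Or.inl h
        · exact Or.inr ((hL _).2 (by omega))
      obtain ⟨m, -, hm⟩ := (hmem L (Or.inr this) i).1 hik
      exact hi m hm
  have hfa : ∀ i, i ∈ faulty (proj Sum.getLeft? x.events) ↔
      ∃ k, x.events.get? k = some (Sum.inl (Event.crash i)) := by
    intro i
    unfold proj
    rw [mem_faulty_select]
    simp only [hgl]
    simp
  refine ⟨?_, fun _ hne => ?_⟩
  · unfold proj
    rw [valid_select_iff]
    simp only [hgl]
    refine ⟨?_, fun i hi m => ?_⟩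
    · rintro k m i ⟨j, i'⟩ a b hkm ha rfl hb rfl rfl
      have hb' := hout m i' j hb
      exact hb'.1 ((hmem m (Or.inl (by rw [hb]; rfl)) i').2 ⟨k, hkm, ha⟩)
    · obtain ⟨k, hk, j, hj⟩ := (hlive i fun k h => hi k _ h rfl).2 m
      exact ⟨k, hk, _, (j, i), hj, rfl, rfl⟩
  · obtain ⟨i₀, hi₀⟩ := hne
    have hinf := (hlive i₀ fun k h => hi₀ ((hfa i₀).2 ⟨k, h⟩)).1
    have hst : ∃ K, ∀ k ≥ K, st k = faulty (proj Sum.getLeft? x.events) := by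
      have : ∀ i, ∃ K, ∀ k ≥ K, i ∈ st k ↔ i ∈ faulty (proj Sum.getLeft? x.events) := by
        intro i
        rw [hfa]
        by_cases h : ∃ k, x.events.get? k = some (Sum.inl (Event.crash i))
        · obtain ⟨k₀, hk₀⟩ := h
          refine ⟨k₀ + 1, fun k hk => ?_⟩
          rw [hmem k (Or.inl (hinf k))]
          exact ⟨fun _ => ⟨k₀, hk₀⟩, fun _ => ⟨k₀, by omega, hk₀⟩⟩
        · refine ⟨0, fun k _ => ?_⟩
          rw [hmem k (Or.inl (hinf k))]
          exact ⟨fun ⟨m, _, hm⟩ => ⟨m, hm⟩, fun h' => absurd h' h⟩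
      choose K hK using this
      refine ⟨Finset.univ.sup K, fun k hk => Set.ext fun i => hK i k ?_⟩
      exact (Finset.le_sup (Finset.mem_univ i)).trans hk
    obtain ⟨K, hK⟩ := hst
    refine ⟨liveLeader (faulty (proj Sum.getLeft? x.events)) i₀, liveLeader_notMem hi₀, K,
      fun k' hk' j i hj => ?_⟩
    unfold proj at hj
    obtain ⟨k, a, ha, hb, rfl⟩ := (select_get?_eq_some _ _ _ _).1 hj
    have hb' := (hgl _ _).1 hb
    subst hb'
    obtain ⟨h1, h2⟩ := hout k i j ha
    rw [hK k (hk'.trans (selPos_le _ _ _))] at h1 h2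
    exact ⟨h2.trans (liveLeader_eq h1 _), h1⟩

theorem omegaF_isStrongSamplingAFD : (omegaF n f).IsStrongSamplingAFD where
  isProblem := ⟨Empty, leaderAutomaton n f, leaderAutomaton_wellFormed, rfl, rfl,
    leaderAutomaton_fair⟩
  crashExclusive := inferInstanceAs (IsEmpty Empty)
  valid := fun t ht => ht.1
  sampling := fun t ht t' h => omegaF_strongSampling ht
    (by obtain ⟨φ, h1, -⟩ := h; exact ⟨φ, h1⟩) (valid_of_isSampling ht.1 h)
  reordering := fun t ht t' h => omegaF_reordering ht h
  crashExtension_prefix := fun t ht t' h hL => omegaF_crashExtension_prefix ht h hL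
  crashExtension_mem := fun t ht t' h hf => omegaF_crashExtension ht h hf
  extraCrashes := fun t ht t' h => (omegaF_mincrash t').1 (h ▸ (omegaF_mincrash t).2 ht)
  strongSampling := fun t ht t' h hv => omegaF_strongSampling ht h hv

end OmegaF

/-! ### Systems -/

section SystemLemmas

variable {n : ℕ} {D P : CrashProblem n} {M X Y : Type}

/-- The location of an action of a system. -/
def SysAct.loc : SysAct D P M X Y → Fin n
  | .crash i => i
  | .fd o => D.locOut o
  | .send _ i _ => i
  | .recv _ _ j => j
  | .pin a => P.locIn a
  | .pout o => P.locOut o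
  | .procTau i _ => i
  | .envTau i _ => i

theorem ProcAct.toSys_injective :
    Function.Injective (ProcAct.toSys : ProcAct D P M X → SysAct D P M X Y) := by
  intro a b h
  cases a <;> cases b <;> simp_all [ProcAct.toSys]

theorem EnvAct.toSys_injective :
    Function.Injective (EnvAct.toSys : EnvAct P Y → SysAct D P M X Y) := by
  intro a b h
  cases a <;> cases b <;> simp_all [EnvAct.toSys]

theorem Automaton.rename_acts {α β : Type} (g : α → β) (B : Automaton α) :
    (B.rename g).acts = g '' B.acts := by
  simp [Automaton.acts, Automaton.rename, Set.image_union]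

theorem Automaton.rename_trans {α β : Type} {g : α → β} (hg : Function.Injective g)
    (B : Automaton α) (s : B.State) (a : α) (s' : B.State) :
    (B.rename g).trans s (g a) s' ↔ B.trans s a s' :=
  ⟨fun ⟨_, h, ht⟩ => hg h ▸ ht, fun h => ⟨a, rfl, h⟩⟩

theorem Automaton.rename_enabled {α β : Type} {g : α → β} (hg : Function.Injective g)
    (B : Automaton α) (s : B.State) (a : α) :
    (B.rename g).Enabled s (g a) ↔ B.Enabled s a :=
  exists_congr fun s' => B.rename_trans hg s a s'

variable {A : Fin n → Automaton (ProcAct D P M X)} {E : Fin n → Automaton (EnvAct P Y)}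

/-- The content of a channel in a state of a system. -/
def chanq (s : (system A E).State) (c : Link n) : List M := s (.chan c)

theorem IsDistributedAlgorithm.mem_acts (hA : IsDistributedAlgorithm A) {i : Fin n}
    {a : ProcAct D P M X} (ha : a ∈ (A i).acts) :
    a = .crash i ∨ (∃ o, D.locOut o = i ∧ a = .fd o) ∨
      (∃ m j, j ≠ i ∧ a = .recv m j i) ∨ (∃ x, P.locIn x = i ∧ a = .pin x) ∨
      (∃ m j, j ≠ i ∧ a = .send m i j) ∨ (∃ o, P.locOut o = i ∧ a = .pout o) ∨
      ∃ x, a = .tau i x := by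
  rcases ha with (ha | ha) | ha
  · rw [hA.input_eq] at ha
    rcases ha with h | h | h | h
    · exact Or.inl h
    · exact Or.inr (Or.inl h)
    · exact Or.inr (Or.inr (Or.inl h))
    · exact Or.inr (Or.inr (Or.inr (Or.inl h)))
  · rw [hA.output_eq] at ha
    rcases ha with h | h
    · exact Or.inr (Or.inr (Or.inr (Or.inr (Or.inl h))))
    · exact Or.inr (Or.inr (Or.inr (Or.inr (Or.inr (Or.inl h)))))
  · exact Or.inr (Or.inr (Or.inr (Or.inr (Or.inr (Or.inr (hA.internal_subset i ha))))))

theorem IsDistributedAlgorithm.loc_eq (hA : IsDistributedAlgorithm A) {i : Fin n}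
    {a : SysAct D P M X Y} (ha : a ∈ (component A E (.proc i)).acts) : a.loc = i := by
  change a ∈ ((A i).rename _).acts at ha
  rw [Automaton.rename_acts] at ha
  obtain ⟨b, hb, rfl⟩ := ha
  rcases hA.mem_acts hb with h | ⟨o, h, rfl⟩ | ⟨m, j, -, h⟩ | ⟨x, h, rfl⟩ | ⟨m, j, -, h⟩ |
    ⟨o, h, rfl⟩ | ⟨x, h⟩
  all_goals subst h; rfl

/-- Each automaton of the family takes part only in actions at its own location. -/
def EnvLocal (E : Fin n → Automaton (EnvAct P Y)) : Prop :=
  ∀ i, ∀ a ∈ (E i).acts, a = .crash i ∨ (∃ o, P.locOut o = i ∧ a = .pout o) ∨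
    (∃ x, P.locIn x = i ∧ a = .pin x) ∨ ∃ y, a = .tau i y

theorem IsEnvironment.envLocal (hE : IsEnvironment P E) : EnvLocal E := by
  rintro i a ((ha | ha) | ha)
  · rw [hE.input_eq] at ha
    rcases ha with h | h
    · exact Or.inl h
    · exact Or.inr (Or.inl h)
  · rw [hE.output_eq] at ha
    obtain ⟨x, h1, h2⟩ := ha
    exact Or.inr (Or.inr (Or.inl ⟨x, h1, h2⟩))
  · exact Or.inr (Or.inr (Or.inr (hE.internal_subset i ha)))

theorem consensusEnv_envLocal (n f : ℕ) : EnvLocal (consensusEnv n f) := by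
  rintro i a ((ha | ha) | ha)
  · rcases ha with h | ⟨b, h⟩
    · exact Or.inl h
    · exact Or.inr (Or.inl ⟨(b, i), rfl, h⟩)
  · obtain ⟨b, h⟩ := ha
    exact Or.inr (Or.inr (Or.inl ⟨(b, i), rfl, h⟩))
  · exact ha.elim

theorem EnvLocal.loc_eq (hE : EnvLocal E) {i : Fin n} {a : SysAct D P M X Y}
    (ha : a ∈ (component A E (.env i)).acts) : a.loc = i := by
  change a ∈ ((E i).rename _).acts at ha
  rw [Automaton.rename_acts] at ha
  obtain ⟨b, hb, rfl⟩ := ha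
  rcases hE i b hb with h | ⟨o, h, rfl⟩ | ⟨x, h, rfl⟩ | ⟨y, h⟩
  all_goals subst h; rfl

theorem notMem_env_acts {i : Fin n} {a : SysAct D P M X Y}
    (ha : (∃ o, a = .fd o) ∨ (∃ m j k, a = .send m j k) ∨ ∃ m j k, a = .recv m j k) :
    a ∉ (component A E (.env i)).acts := by
  intro h
  change a ∈ ((E i).rename _).acts at h
  rw [Automaton.rename_acts] at h
  obtain ⟨b, -, rfl⟩ := h
  cases b <;> simp [EnvAct.toSys] at ha

theorem mem_chan_acts {c : Link n} {a : SysAct D P M X Y} :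
    a ∈ (component A E (.chan c)).acts ↔
      ∃ m, a = .send m c.1.1 c.1.2 ∨ a = .recv m c.1.1 c.1.2 := by
  change a ∈ (channel c.1.1 c.1.2).acts ↔ _
  simp [Automaton.acts, channel, exists_or]

theorem chan_trans_iff {c : Link n} {a : SysAct D P M X Y} {q q' : List M} :
    (component A E (.chan c)).trans q a q' ↔
      ∃ m, (a = .send m c.1.1 c.1.2 ∧ q' = q ++ [m]) ∨
        (a = .recv m c.1.1 c.1.2 ∧ q = m :: q') := Iff.rfl

theorem proc_input_enabled (hA : IsDistributedAlgorithm A) {i : Fin n} {b : ProcAct D P M X}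
    (hb : b ∈ (A i).input) (s : (component A E (.proc i)).State) :
    (component A E (.proc i)).Enabled s b.toSys :=
  ((A i).rename_enabled ProcAct.toSys_injective s b).2 ((hA.wellFormed i).input_enabled s b hb)

theorem mem_proc_acts {i : Fin n} {b : ProcAct D P M X} :
    (b.toSys : SysAct D P M X Y) ∈ (component A E (.proc i)).acts ↔ b ∈ (A i).acts := by
  change _ ∈ ((A i).rename _).acts ↔ _
  rw [Automaton.rename_acts]
  exact ProcAct.toSys_injective.mem_set_image

theorem mem_env_acts {i : Fin n} {b : EnvAct P Y} :
    (b.toSys : SysAct D P M X Y) ∈ (component A E (.env i)).acts ↔ b ∈ (E i).acts := by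
  change _ ∈ ((E i).rename _).acts ↔ _
  rw [Automaton.rename_acts]
  exact EnvAct.toSys_injective.mem_set_image

theorem fd_enabled (hA : IsDistributedAlgorithm A) (s : (system A E).State)
    (o : D.Out) : (system A E).Enabled s (.fd o) := by
  refine (Automaton.compose_enabled_iff _ _ _).2 ⟨⟨.proc (D.locOut o), ?_⟩, ?_⟩
  · refine (mem_proc_acts (b := .fd o)).2 (Or.inl (Or.inl ?_))
    rw [hA.input_eq]
    exact Or.inr (Or.inl ⟨o, rfl, rfl⟩)
  · rintro (i | i | c) h
    · refine proc_input_enabled hA (b := .fd o) ?_ _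
      rw [hA.input_eq]
      exact Or.inr (Or.inl ⟨o, hA.loc_eq h, rfl⟩)
    · exact absurd h (notMem_env_acts (Or.inl ⟨o, rfl⟩))
    · obtain ⟨m, h | h⟩ := mem_chan_acts.1 h <;> cases h

theorem recv_mem_input (hA : IsDistributedAlgorithm A) (m : M) {i j : Fin n} (h : i ≠ j) :
    ProcAct.recv m i j ∈ (A j).input := by
  rw [hA.input_eq]
  exact Or.inr (Or.inr (Or.inl ⟨m, i, h, rfl⟩))

/-- The receiving process cannot block, since receipts are among its inputs; only the channel
decides. -/
theorem recv_enabled_iff (hA : IsDistributedAlgorithm A)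
    (s : (system A E).State) (m : M) (c : Link n) :
    (system A E).Enabled s (.recv m c.1.1 c.1.2) ↔ ∃ q, chanq s c = m :: q := by
  refine (Automaton.compose_enabled_iff _ _ _).trans ⟨?_, ?_⟩
  · rintro ⟨-, h⟩
    obtain ⟨q, hq⟩ := h (.chan c) (mem_chan_acts.2 ⟨m, Or.inr rfl⟩)
    obtain ⟨m', ⟨h1, -⟩ | ⟨h1, h2⟩⟩ := chan_trans_iff.1 hq
    · cases h1
    · injection h1 with h3
      subst h3
      exact ⟨q, h2⟩
  · rintro ⟨q, hq⟩
    refine ⟨⟨.chan c, mem_chan_acts.2 ⟨m, Or.inr rfl⟩⟩, ?_⟩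
    rintro (i | i | c') h
    · have := hA.loc_eq h
      change c.1.2 = i at this
      subst this
      exact proc_input_enabled hA (b := .recv m c.1.1 c.1.2) (recv_mem_input hA m c.2) _
    · exact absurd h (notMem_env_acts (Or.inr (Or.inr ⟨m, _, _, rfl⟩)))
    · obtain ⟨m', h | h⟩ := mem_chan_acts.1 h
      · cases h
      · injection h with h1 h2 h3
        have : c' = c := Subtype.ext (Prod.ext h2.symm h3.symm)
        subst this
        exact ⟨q, m, Or.inr ⟨rfl, hq⟩⟩

/-- A locally controlled action of a process is enabled in the system if it is in the process. -/
theorem enabled_of_proc (hA : IsDistributedAlgorithm A) (hE : IsEnvironment P E)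
    {s : (system A E).State} {i : Fin n} {b : ProcAct D P M X}
    (hb : b ∈ (A i).locallyControlled) (h : (A i).Enabled (s (.proc i)) b) :
    (system A E).Enabled s b.toSys := by
  have hact : b ∈ (A i).acts := by
    rcases hb with hb | hb
    · exact Or.inl (Or.inr hb)
    · exact Or.inr hb
  refine (Automaton.compose_enabled_iff _ _ _).2 ⟨⟨.proc i, mem_proc_acts.2 hact⟩, ?_⟩
  have hloc : (b.toSys : SysAct D P M X Y).loc = i := hA.loc_eq (E := E) (mem_proc_acts.2 hact)
  have hcase : (∃ m j, b = .send m i j) ∨ (∃ o, b = .pout o) ∨ ∃ x, b = .tau i x := by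
    rcases hb with hb | hb
    · rw [hA.output_eq] at hb
      rcases hb with ⟨m, j, -, h⟩ | ⟨o, -, h⟩
      · exact Or.inl ⟨m, j, h⟩
      · exact Or.inr (Or.inl ⟨o, h⟩)
    · exact Or.inr (Or.inr (hA.internal_subset i hb))
  rintro (j | j | c) hj
  · have := hA.loc_eq hj
    rw [hloc] at this
    subst this
    exact ((A i).rename_enabled ProcAct.toSys_injective _ b).2 h
  · rcases hcase with ⟨m, k, rfl⟩ | ⟨o, rfl⟩ | ⟨x, rfl⟩
    · exact absurd hj (notMem_env_acts (Or.inr (Or.inl ⟨m, _, _, rfl⟩)))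
    · have h1 := hE.envLocal.loc_eq hj
      refine ((E j).rename_enabled EnvAct.toSys_injective _ (.pout o)).2
        ((hE.wellFormed j).input_enabled _ _ ?_)
      rw [hE.input_eq]
      exact Or.inr ⟨o, h1, rfl⟩
    · change _ ∈ ((E j).rename _).acts at hj
      rw [Automaton.rename_acts] at hj
      obtain ⟨b, -, h'⟩ := hj
      cases b <;> cases h'
  · obtain ⟨m, h1 | h1⟩ := mem_chan_acts.1 hj
    · exact ⟨(chanq s c) ++ [m], m, Or.inl ⟨h1, rfl⟩⟩
    · rcases hcase with ⟨m, k, rfl⟩ | ⟨o, rfl⟩ | ⟨x, rfl⟩ <;> cases h1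

/-! ### The full system -/

/-- The state of the algorithm, the channels and the environment. -/
def sysState (S : (fullSystem A E).State) : (system A E).State := fun c => S (some c)

/-- The state of the crash automaton. -/
def crashState (S : (fullSystem A E).State) : Stream'.Seq (Fin n) := S none

/-- A state of the full system from its two parts. -/
def mkState (s : (system A E).State) (r : Stream'.Seq (Fin n)) : (fullSystem A E).State :=
  fun c => match c with
    | none => r
    | some c => s c

theorem mem_crash_acts {a : SysAct D P M X Y} :
    a ∈ (crashAutomaton : Automaton (SysAct D P M X Y)).acts ↔ ∃ i, a = .crash i := by
  simp [Automaton.acts, crashAutomaton]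

/-- The crash automaton takes part in crashes only. Its schedule loses its head at a crash and stays
unchanged otherwise. -/
theorem fullSystem_trans_iff (hA : IsDistributedAlgorithm A) {S S' : (fullSystem A E).State}
    {a : SysAct D P M X Y} :
    (fullSystem A E).trans S a S' ↔ (system A E).trans (sysState S) a (sysState S') ∧
      (∀ i, a = .crash i → crashState S = Stream'.Seq.cons i (crashState S')) ∧
      ((∀ i, a ≠ .crash i) → crashState S' = crashState S) := by
  constructor
  · rintro ⟨h1, h2⟩
    have h3 : (a ∈ (crashAutomaton : Automaton (SysAct D P M X Y)).acts ∧
        ∃ i, a = .crash i ∧ crashState S = Stream'.Seq.cons i (crashState S')) ∨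
      (a ∉ (crashAutomaton : Automaton (SysAct D P M X Y)).acts ∧
        crashState S' = crashState S) := h2 none
    refine ⟨⟨?_, fun c => h2 (some c)⟩, ?_, ?_⟩
    · obtain ⟨_ | c, hc⟩ := h1
      · obtain ⟨i, rfl⟩ := mem_crash_acts.1 hc
        refine ⟨.proc i, (mem_proc_acts (b := .crash i)).2 (Or.inl (Or.inl ?_))⟩
        rw [hA.input_eq]
        exact Or.inl rfl
      · exact ⟨c, hc⟩
    · rintro i rfl
      rcases h3 with ⟨-, i', h, h'⟩ | ⟨h, -⟩
      · cases h
        exact h'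
      · exact absurd (mem_crash_acts.2 ⟨i, rfl⟩) h
    · intro hn
      rcases h3 with ⟨h, -⟩ | ⟨-, h⟩
      · obtain ⟨i, hi⟩ := mem_crash_acts.1 h
        exact absurd hi (hn i)
      · exact h
  · rintro ⟨⟨⟨c, hc⟩, h2⟩, h3, h4⟩
    refine ⟨⟨some c, hc⟩, ?_⟩
    rintro (_ | c)
    · by_cases h : ∃ i, a = .crash i
      · obtain ⟨i, hi⟩ := h
        exact Or.inl ⟨mem_crash_acts.2 ⟨i, hi⟩, i, hi, h3 i hi⟩
      · exact Or.inr ⟨fun h' => h (mem_crash_acts.1 h'), h4 fun i hi => h ⟨i, hi⟩⟩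
    · exact h2 c

theorem fullSystem_enabled_iff (hA : IsDistributedAlgorithm A) {S : (fullSystem A E).State}
    {a : SysAct D P M X Y} (ha : ∀ i, a ≠ .crash i) :
    (fullSystem A E).Enabled S a ↔ (system A E).Enabled (sysState S) a := by
  constructor
  · rintro ⟨S', h⟩
    exact ⟨_, ((fullSystem_trans_iff hA).1 h).1⟩
  · rintro ⟨s', h⟩
    exact ⟨mkState s' (crashState S), (fullSystem_trans_iff hA).2
      ⟨h, fun i hi => absurd hi (ha i), fun _ => rfl⟩⟩

end SystemLemmas

/-! ### Walks in the tree of executions -/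

section Walks

variable {n f : ℕ} {D : CrashProblem n} {M X : Type}

theorem consensusEnv_trans_unique {i : Fin n} {s s₁ s₂ : Bool}
    {a : EnvAct (consensus n f) Empty} (h₁ : (consensusEnv n f i).trans s a s₁)
    (h₂ : (consensusEnv n f i).trans s a s₂) : s₁ = s₂ := by
  rcases h₁ with ⟨rfl, rfl⟩ | ⟨b, rfl, rfl⟩ | ⟨b, rfl, h, rfl⟩ <;>
  rcases h₂ with ⟨h₂, rfl⟩ | ⟨b', h₂, rfl⟩ | ⟨b', h₂, h', rfl⟩ <;> first | rfl | cases h₂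

theorem component_trans_unique {A : Fin n → Automaton (ProcAct D (consensus n f) M X)}
    (hA : IsDistributedAlgorithm A) {c : Comp n}
    {s s₁ s₂ : (component A (consensusEnv n f) c).State}
    {a : SysAct D (consensus n f) M X Empty}
    (h₁ : (component A (consensusEnv n f) c).trans s a s₁)
    (h₂ : (component A (consensusEnv n f) c).trans s a s₂) : s₁ = s₂ := by
  rcases c with i | i | c
  · obtain ⟨b, rfl, h₁⟩ := h₁
    obtain ⟨b', hb, h₂⟩ := h₂
    have := ProcAct.toSys_injective hb
    subst this
    exact (hA.deterministic i).taskDeterministic.trans_unique _ _ _ _ h₁ h₂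
  · obtain ⟨b, rfl, h₁⟩ := h₁
    obtain ⟨b', hb, h₂⟩ := h₂
    have := EnvAct.toSys_injective hb
    subst this
    exact consensusEnv_trans_unique h₁ h₂
  · obtain ⟨m, ⟨rfl, h₁⟩ | ⟨rfl, h₁⟩⟩ := h₁
    · obtain ⟨m', ⟨h, h₂⟩ | ⟨h, h₂⟩⟩ := h₂
      · injection h with h
        subst h
        exact h₁.trans h₂.symm
      · cases h
    · obtain ⟨m', ⟨h, h₂⟩ | ⟨h, h₂⟩⟩ := h₂
      · cases h
      · exact (List.cons.inj (h₁.symm.trans h₂)).2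

theorem system_trans_unique {A : Fin n → Automaton (ProcAct D (consensus n f) M X)}
    (hA : IsDistributedAlgorithm A) {s s₁ s₂ : (system A (consensusEnv n f)).State}
    {a : SysAct D (consensus n f) M X Empty} (h₁ : (system A (consensusEnv n f)).trans s a s₁)
    (h₂ : (system A (consensusEnv n f)).trans s a s₂) : s₁ = s₂ := by
  funext c
  rcases h₁.2 c with ⟨ha, h₁⟩ | ⟨ha, h₁⟩ <;> rcases h₂.2 c with ⟨ha', h₂⟩ | ⟨ha', h₂⟩
  · exact component_trans_unique hA h₁ h₂
  · exact absurd ha ha'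
  · exact absurd ha' ha
  · exact h₁.trans h₂.symm

theorem system_start_unique {A : Fin n → Automaton (ProcAct D (consensus n f) M X)}
    (hA : IsDistributedAlgorithm A) {s s' : (system A (consensusEnv n f)).State}
    (h : s ∈ (system A (consensusEnv n f)).start)
    (h' : s' ∈ (system A (consensusEnv n f)).start) : s = s' := by
  funext c
  have h1 := h c
  have h2 := h' c
  rcases c with i | i | c
  · exact (hA.deterministic i).one_start.unique h1 h2
  · exact (Set.mem_singleton_iff.1 h1).trans (Set.mem_singleton_iff.1 h2).symm
  · exact (Set.mem_singleton_iff.1 h1).trans (Set.mem_singleton_iff.1 h2).symm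

theorem system_start_nonempty {A : Fin n → Automaton (ProcAct D (consensus n f) M X)}
    (hA : IsDistributedAlgorithm A) : ∃ s, s ∈ (system A (consensusEnv n f)).start := by
  have : ∀ c, ∃ s, s ∈ (component A (consensusEnv n f) c).start := by
    rintro (i | i | c)
    · exact (hA.wellFormed i).start_nonempty
    · exact ⟨false, rfl⟩
    · exact ⟨([] : List M), rfl⟩
  choose s hs using this
  exact ⟨s, hs⟩

variable (A : Fin n → Automaton (ProcAct D (consensus n f) M X)) (G : Graph n D.Out)

/-- Configurations: a configuration tag and a vertex tag. -/
abbrev Cfg : Type := (system A (consensusEnv n f)).State × Option (Vertex n D.Out)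

/-- One edge of the tree, with its action tag. -/
inductive Step : Cfg A → Label n × Option (Vertex n D.Out) →
    Option (SysAct D (consensus n f) M X Empty) → Cfg A → Prop
  | bot (s : (system A (consensusEnv n f)).State) (v w : Option (Vertex n D.Out)) (l : Label n)
      (he : IsEdge G v l w) (ha : ActionTag A G s v l w none) : Step (s, v) (l, w) none (s, w)
  | act (s s' : (system A (consensusEnv n f)).State) (v w : Option (Vertex n D.Out))
      (l : Label n) (a : SysAct D (consensus n f) M X Empty) (he : IsEdge G v l w)
      (ha : ActionTag A G s v l w (some a)) (hs : (system A (consensusEnv n f)).trans s a s') :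
      Step (s, v) (l, w) (some a) (s', w)

/-- A sequence of edges of the tree, with their action tags. -/
def Walk : Cfg A → Path n D.Out → List (Option (SysAct D (consensus n f) M X Empty)) →
    Cfg A → Prop
  | c, [], t, c' => t = [] ∧ c' = c
  | c, e :: p, t, c' => ∃ o c₁ t', Step A G c e o c₁ ∧ Walk c₁ p t' c' ∧ t = o :: t'

/-- Some walk from `c` has a decision event with value `b`. -/
def ReachDecides (c : Cfg A) (b : Bool) : Prop :=
  ∃ p t c', Walk A G c p t c' ∧ ∃ i, some (SysAct.pout (b, i)) ∈ t

variable {A G}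

theorem walk_append {c c' : Cfg A} {p q : Path n D.Out}
    {t : List (Option (SysAct D (consensus n f) M X Empty))} :
    Walk A G c (p ++ q) t c' ↔
      ∃ t₁ t₂ c₁, Walk A G c p t₁ c₁ ∧ Walk A G c₁ q t₂ c' ∧ t = t₁ ++ t₂ := by
  induction p generalizing c t with
  | nil =>
    constructor
    · intro h
      exact ⟨[], t, c, ⟨rfl, rfl⟩, h, rfl⟩
    · rintro ⟨t₁, t₂, c₁, ⟨rfl, rfl⟩, h, rfl⟩
      exact h
  | cons e p ih =>
    constructor
    · rintro ⟨o, c₁, t', h1, h2, rfl⟩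
      obtain ⟨t₁, t₂, c₂, h3, h4, rfl⟩ := ih.1 h2
      exact ⟨o :: t₁, t₂, c₂, ⟨o, c₁, t₁, h1, h3, rfl⟩, h4, rfl⟩
    · rintro ⟨t₁, t₂, c₂, ⟨o, c₁, t', h1, h2, rfl⟩, h3, rfl⟩
      exact ⟨o, c₁, t' ++ t₂, h1, ih.2 ⟨t', t₂, c₂, h2, h3, rfl⟩, rfl⟩

theorem walk_single {c c' : Cfg A} {e : Label n × Option (Vertex n D.Out)}
    {t : List (Option (SysAct D (consensus n f) M X Empty))} :
    Walk A G c [e] t c' ↔ ∃ o, t = [o] ∧ Step A G c e o c' := by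
  constructor
  · rintro ⟨o, c₁, t', h, ⟨rfl, rfl⟩, rfl⟩
    exact ⟨o, rfl, h⟩
  · rintro ⟨o, rfl, h⟩
    exact ⟨o, c', [], h, ⟨rfl, rfl⟩, rfl⟩

theorem walk_concat {c c' : Cfg A} {p : Path n D.Out} {e : Label n × Option (Vertex n D.Out)}
    {t : List (Option (SysAct D (consensus n f) M X Empty))} :
    Walk A G c (p ++ [e]) t c' ↔
      ∃ t₁ o c₁, Walk A G c p t₁ c₁ ∧ Step A G c₁ e o c' ∧ t = t₁ ++ [o] := by
  rw [walk_append]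
  constructor
  · rintro ⟨t₁, t₂, c₁, h1, h2, rfl⟩
    obtain ⟨o, rfl, h⟩ := walk_single.1 h2
    exact ⟨t₁, o, c₁, h1, h, rfl⟩
  · rintro ⟨t₁, o, c₁, h1, h2, rfl⟩
    exact ⟨t₁, [o], c₁, h1, walk_single.2 ⟨o, rfl, h2⟩, rfl⟩

/-- Separates the bound on the depth from the walk. Walks may start at any configuration and can be
cut and glued freely. -/
theorem isNode_iff {p : Path n D.Out}
    {t : List (Option (SysAct D (consensus n f) M X Empty))}
    {s : (system A (consensusEnv n f)).State} {v : Option (Vertex n D.Out)} :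
    IsNode A G p t s v ↔ (p.length : ℕ∞) ≤ G.V.encard ∧
      ∃ s₀ ∈ (system A (consensusEnv n f)).start, Walk A G (s₀, none) p t (s, v) := by
  constructor
  · intro h
    induction h with
    | root s hs => exact ⟨by simp, s, hs, rfl, rfl⟩
    | bot p tags s v w l hp hh he ha ih =>
      obtain ⟨-, s₀, h0, hw⟩ := ih
      refine ⟨?_, s₀, h0, walk_concat.2 ⟨_, _, _, hw, Step.bot s v w l he ha, rfl⟩⟩
      rw [List.length_append]
      exact_mod_cast Order.add_one_le_of_lt hh
    | act p tags s s' v w l a hp hh he ha hs ih =>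
      obtain ⟨-, s₀, h0, hw⟩ := ih
      refine ⟨?_, s₀, h0, walk_concat.2 ⟨_, _, _, hw, Step.act s s' v w l a he ha hs, rfl⟩⟩
      rw [List.length_append]
      exact_mod_cast Order.add_one_le_of_lt hh
  · rintro ⟨hl, s₀, h0, hw⟩
    induction p using List.reverseRecOn generalizing t s v with
    | nil =>
      obtain ⟨rfl, h⟩ := hw
      cases h
      exact IsNode.root _ h0
    | append_singleton p e ih =>
      obtain ⟨t₁, o, ⟨s₁, v₁⟩, h1, h2, rfl⟩ := walk_concat.1 hw
      have hlt : (p.length : ℕ∞) < G.V.encard := by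
        refine lt_of_lt_of_le ?_ hl
        rw [List.length_append]
        exact_mod_cast Nat.lt_succ_self _
      have := ih hlt.le h1
      cases h2 with
      | bot _ _ _ l he ha => exact IsNode.bot p t₁ _ _ _ l this hlt he ha
      | act _ _ _ _ l a he ha hs => exact IsNode.act p t₁ _ _ _ _ l a this hlt he ha hs

theorem Label.enabledTag_unique (hA : IsDistributedAlgorithm A)
    {s : (system A (consensusEnv n f)).State} {l : Label n} (hl : ∀ i, l ≠ .fd i)
    {o o' : Option (SysAct D (consensus n f) M X Empty)} (h : EnabledTag A s l o)
    (h' : EnabledTag A s l o') : o = o' := by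
  rcases o with _ | a <;> rcases o' with _ | b
  · rfl
  · exact absurd h'.2 (h b h'.1)
  · exact absurd h.2 (h' a h.1)
  · obtain ⟨h1, h2⟩ := h
    obtain ⟨h3, h4⟩ := h'
    rcases l with i | ⟨i, b⟩ | c | i
    · obtain ⟨a, ha, rfl⟩ := h1
      obtain ⟨b, hb, rfl⟩ := h3
      have key : ∀ a ∈ (A i).locallyControlled,
          (system A (consensusEnv n f)).Enabled s a.toSys → (A i).Enabled (s (.proc i)) a := by
        intro a ha h
        refine ((A i).rename_enabled ProcAct.toSys_injective _ a).1
          (((Automaton.compose_enabled_iff _ _ _).1 h).2 (.proc i) (mem_proc_acts.2 ?_))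
        rcases ha with ha | ha
        · exact Or.inl (Or.inr ha)
        · exact Or.inr ha
      rw [(hA.deterministic i).eq_of_enabled (hA.wellFormed i) ha hb (key a ha h2) (key b hb h4)]
    · rw [Set.mem_singleton_iff.1 h1, Set.mem_singleton_iff.1 h3]
    · obtain ⟨m, rfl⟩ := h1
      obtain ⟨m', rfl⟩ := h3
      obtain ⟨q, hq⟩ := (recv_enabled_iff hA s m c).1 h2
      obtain ⟨q', hq'⟩ := (recv_enabled_iff hA s m' c).1 h4
      rw [hq] at hq'
      rw [(List.cons.inj hq').1]
    · exact absurd rfl (hl i)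

theorem enabledTag_exists (A : Fin n → Automaton (ProcAct D (consensus n f) M X))
    (s : (system A (consensusEnv n f)).State) (l : Label n) : ∃ o, EnabledTag A s l o := by
  by_cases h : ∃ a ∈ labelActs A l, (system A (consensusEnv n f)).Enabled s a
  · obtain ⟨a, h1, h2⟩ := h
    exact ⟨some a, h1, h2⟩
  · exact ⟨none, fun a ha he => h ⟨a, ha, he⟩⟩

theorem actionTag_unique (hA : IsDistributedAlgorithm A)
    {s : (system A (consensusEnv n f)).State} {v w : Option (Vertex n D.Out)} {l : Label n}
    {o o' : Option (SysAct D (consensus n f) M X Empty)} (h : ActionTag A G s v l w o)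
    (h' : ActionTag A G s v l w o') : o = o' := by
  have key : ∀ l : Label n, (∀ i, l ≠ .fd i) →
      (G.HasSucc v l.loc ∧ EnabledTag A s l o) ∨ (¬ G.HasSucc v l.loc ∧ o = none) →
      (G.HasSucc v l.loc ∧ EnabledTag A s l o') ∨ (¬ G.HasSucc v l.loc ∧ o' = none) → o = o' := by
    rintro l hl (⟨h1, h2⟩ | ⟨h1, rfl⟩) (⟨h3, h4⟩ | ⟨h3, rfl⟩)
    · exact l.enabledTag_unique hA hl h2 h4
    · exact absurd h1 h3
    · exact absurd h3 h1
    · rfl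
  rcases l with i | ⟨i, b⟩ | c | i
  · exact key (.proc i) (by simp) h h'
  · exact key (.env i b) (by simp) h h'
  · exact Label.enabledTag_unique hA (l := .chan c) (by simp) h h'
  · rcases h with ⟨h1, rfl⟩ | ⟨h1, u, rfl, rfl⟩ <;> rcases h' with ⟨h3, rfl⟩ | ⟨h3, u', h4, rfl⟩
    · rfl
    · exact absurd h1 h3
    · exact absurd h3 h1
    · cases h4
      rfl

theorem actionTag_exists (A : Fin n → Automaton (ProcAct D (consensus n f) M X))
    (s : (system A (consensusEnv n f)).State) {v w : Option (Vertex n D.Out)} {l : Label n}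
    (he : IsEdge G v l w) : ∃ o, ActionTag A G s v l w o := by
  have key : ∀ l : Label n, ∃ o, (G.HasSucc v l.loc ∧ EnabledTag A s l o) ∨
      (¬ G.HasSucc v l.loc ∧ o = none) := by
    intro l
    by_cases h : G.HasSucc v l.loc
    · obtain ⟨o, ho⟩ := enabledTag_exists A s l
      exact ⟨o, Or.inl ⟨h, ho⟩⟩
    · exact ⟨none, Or.inr ⟨h, rfl⟩⟩
  rcases l with i | ⟨i, b⟩ | c | i
  · exact key (.proc i)
  · exact key (.env i b)
  · exact enabledTag_exists A s (.chan c)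
  · by_cases h : w = v
    · exact ⟨none, Or.inl ⟨h, rfl⟩⟩
    · rcases he with ⟨u, rfl, -⟩ | ⟨-, h'⟩
      · exact ⟨_, Or.inr ⟨h, u, rfl, rfl⟩⟩
      · exact absurd h' h

theorem ActionTag.enabled (hA : IsDistributedAlgorithm A)
    {s : (system A (consensusEnv n f)).State} {v w : Option (Vertex n D.Out)} {l : Label n}
    {a : SysAct D (consensus n f) M X Empty} (h : ActionTag A G s v l w (some a)) :
    (system A (consensusEnv n f)).Enabled s a := by
  rcases l with i | ⟨i, b⟩ | c | i
  · rcases h with ⟨-, h⟩ | ⟨-, h⟩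
    · exact h.2
    · cases h
  · rcases h with ⟨-, h⟩ | ⟨-, h⟩
    · exact h.2
    · cases h
  · exact h.2
  · rcases h with ⟨-, h⟩ | ⟨-, u, -, h⟩
    · cases h
    · cases h
      exact fd_enabled hA s u.act

theorem isEdge_exists (G : Graph n D.Out) (v : Option (Vertex n D.Out)) (l : Label n) :
    ∃ w, IsEdge G v l w := by
  rcases l with i | ⟨i, b⟩ | c | i
  · exact ⟨v, rfl⟩
  · exact ⟨v, rfl⟩
  · exact ⟨v, rfl⟩
  · by_cases h : G.HasSucc v i
    · obtain ⟨u, h1, h2⟩ := h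
      exact ⟨some u, Or.inl ⟨u, rfl, h1, h2⟩⟩
    · exact ⟨v, Or.inr ⟨h, rfl⟩⟩

theorem step_exists (hA : IsDistributedAlgorithm A) (c : Cfg A) {l : Label n}
    {w : Option (Vertex n D.Out)} (he : IsEdge G c.2 l w) : ∃ o c', Step A G c (l, w) o c' := by
  obtain ⟨s, v⟩ := c
  obtain ⟨_ | a, ho⟩ := actionTag_exists A s he
  · exact ⟨none, (s, w), Step.bot s v w l he ho⟩
  · obtain ⟨s', hs⟩ := ho.enabled hA
    exact ⟨some a, (s', w), Step.act s s' v w l a he ho hs⟩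

theorem Step.unique (hA : IsDistributedAlgorithm A) {c c₁ c₂ : Cfg A}
    {e : Label n × Option (Vertex n D.Out)} {o o' : Option (SysAct D (consensus n f) M X Empty)}
    (h₁ : Step A G c e o c₁) (h₂ : Step A G c e o' c₂) : o = o' ∧ c₁ = c₂ := by
  cases h₁ with
  | bot s v w l he ha =>
    cases h₂ with
    | bot _ _ _ _ he' ha' => exact ⟨rfl, rfl⟩
    | act _ s' _ _ _ a he' ha' hs => cases actionTag_unique hA ha ha'
  | act s s' v w l a he ha hs =>
    cases h₂ with
    | bot _ _ _ _ he' ha' => cases actionTag_unique hA ha ha'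
    | act _ s'' _ _ _ a' he' ha' hs' =>
      cases actionTag_unique hA ha ha'
      exact ⟨rfl, by rw [system_trans_unique hA hs hs']⟩

theorem Walk.unique (hA : IsDistributedAlgorithm A) {c c₁ c₂ : Cfg A} {p : Path n D.Out}
    {t t' : List (Option (SysAct D (consensus n f) M X Empty))}
    (h₁ : Walk A G c p t c₁) (h₂ : Walk A G c p t' c₂) : t = t' ∧ c₁ = c₂ := by
  induction p generalizing c t t' with
  | nil => exact ⟨h₁.1.trans h₂.1.symm, h₁.2.trans h₂.2.symm⟩
  | cons e p ih =>
    obtain ⟨o, d, t₁, hs, hw, rfl⟩ := h₁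
    obtain ⟨o', d', t₁', hs', hw', rfl⟩ := h₂
    obtain ⟨rfl, rfl⟩ := hs.unique hA hs'
    obtain ⟨rfl, rfl⟩ := ih hw hw'
    exact ⟨rfl, rfl⟩

/-- The start state is unique, and an edge determines its action tag and the next configuration. So
the tags are functions of the path, and those supplied by different existential statements may be
identified. -/
theorem IsNode.unique (hA : IsDistributedAlgorithm A) {p : Path n D.Out}
    {t t' : List (Option (SysAct D (consensus n f) M X Empty))}
    {s s' : (system A (consensusEnv n f)).State} {v v' : Option (Vertex n D.Out)}
    (h₁ : IsNode A G p t s v) (h₂ : IsNode A G p t' s' v') : t = t' ∧ s = s' ∧ v = v' := by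
  obtain ⟨-, s₀, h0, hw⟩ := isNode_iff.1 h₁
  obtain ⟨-, s₀', h0', hw'⟩ := isNode_iff.1 h₂
  rw [system_start_unique hA h0' h0] at hw'
  obtain ⟨h1, h2⟩ := hw.unique hA hw'
  exact ⟨h1, Prod.ext_iff.1 h2⟩

theorem Step.isEdge {c c' : Cfg A} {e : Label n × Option (Vertex n D.Out)}
    {o : Option (SysAct D (consensus n f) M X Empty)} (h : Step A G c e o c') :
    IsEdge G c.2 e.1 e.2 ∧ c'.2 = e.2 ∧ ActionTag A G c.1 c.2 e.1 e.2 o := by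
  cases h with
  | bot s v w l he ha => exact ⟨he, rfl, ha⟩
  | act s s' v w l a he ha hs => exact ⟨he, rfl, ha⟩

theorem Step.trans {c c' : Cfg A} {e : Label n × Option (Vertex n D.Out)}
    {a : SysAct D (consensus n f) M X Empty} (h : Step A G c e (some a) c') :
    (system A (consensusEnv n f)).trans c.1 a c'.1 := by
  cases h with
  | act s s' v w l a he ha hs => exact hs

/-- The edges with action tag `⊥` lead to the same configuration. -/
theorem Step.eq_of_none {c c' : Cfg A} {e : Label n × Option (Vertex n D.Out)}
    (h : Step A G c e none c') : c' = c := by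
  cases h with
  | bot s v w l he ha =>
    have : w = v := by
      rcases l with i | ⟨i, b⟩ | c | i
      · exact he
      · exact he
      · exact he
      · rcases ha with ⟨h, -⟩ | ⟨-, u, -, h⟩
        · exact h
        · cases h
    rw [this]

/-- Inclusion of graphs. -/
def Graph.LE {O : Type} (G H : Graph n O) : Prop := G.V ⊆ H.V ∧ G.Z ⊆ H.Z

theorem Graph.LE.succ {O : Type} {G H : Graph n O} (h : G.LE H) {v : Option (Vertex n O)}
    {u : Vertex n O} (hs : G.Succ v u) : H.Succ v u :=
  ⟨h.1 hs.1, fun x hx => h.2 (hs.2 x hx)⟩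

theorem Graph.LE.hasSucc {O : Type} {G H : Graph n O} (h : G.LE H) {v : Option (Vertex n O)}
    {i : Fin n} (hs : G.HasSucc v i) : H.HasSucc v i := by
  obtain ⟨u, h1, h2⟩ := hs
  exact ⟨u, h1, h.succ h2⟩

/-- A tag other than `⊥` rests on positive facts about the graph, namely that vertices, edges and
successors exist. For the tag `⊥` this fails: a larger graph may provide the missing successor. -/
theorem Step.mono {H : Graph n D.Out} (hGH : G.LE H) {c c' : Cfg A}
    {e : Label n × Option (Vertex n D.Out)} {a : SysAct D (consensus n f) M X Empty}
    (h : Step A G c e (some a) c') : Step A H c e (some a) c' := by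
  cases h with
  | act s s' v w l a he ha hs =>
    rcases l with i | ⟨i, b⟩ | c | i
    · rcases ha with ⟨h1, h2⟩ | ⟨-, h2⟩
      · exact Step.act s s' v w _ a he (Or.inl ⟨hGH.hasSucc h1, h2⟩) hs
      · cases h2
    · rcases ha with ⟨h1, h2⟩ | ⟨-, h2⟩
      · exact Step.act s s' v w _ a he (Or.inl ⟨hGH.hasSucc h1, h2⟩) hs
      · cases h2
    · exact Step.act s s' v w _ a he ha hs
    · refine Step.act s s' v w _ a ?_ ha hs
      rcases ha with ⟨-, h⟩ | ⟨h, -⟩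
      · cases h
      · rcases he with ⟨u, h1, h2, h3⟩ | ⟨-, h'⟩
        · exact Or.inl ⟨u, h1, h2, hGH.succ h3⟩
        · exact absurd h' h

theorem Graph.LE.refl {O : Type} (G : Graph n O) : G.LE G := ⟨subset_rfl, subset_rfl⟩

/-- The edges with action tag `⊥` of a walk can be removed, and the graph enlarged. -/
theorem Walk.removeBot {H : Graph n D.Out} (hGH : G.LE H) {c c' : Cfg A} {p : Path n D.Out}
    {t : List (Option (SysAct D (consensus n f) M X Empty))} (h : Walk A G c p t c') :
    ∃ q, Walk A H c q (t.filter (·.isSome)) c' := by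
  induction p generalizing c t with
  | nil =>
    obtain ⟨rfl, rfl⟩ := h
    exact ⟨[], rfl, rfl⟩
  | cons e p ih =>
    obtain ⟨_ | a, d, t₁, hs, hw, rfl⟩ := h
    · have := hs.eq_of_none
      subst this
      simpa using ih hw
    · obtain ⟨q, hq⟩ := ih hw
      exact ⟨e :: q, some a, d, _, hs.mono hGH, hq, by simp⟩

theorem ReachDecides.mono {H : Graph n D.Out} (hGH : G.LE H) {c : Cfg A} {b : Bool}
    (h : ReachDecides A G c b) : ReachDecides A H c b := by
  obtain ⟨p, t, c', hw, i, hi⟩ := h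
  obtain ⟨q, hq⟩ := hw.removeBot hGH
  exact ⟨q, _, c', hq, i, List.mem_filter.2 ⟨hi, rfl⟩⟩

theorem CanDecide.of_isNode (hA : IsDistributedAlgorithm A) {p : Path n D.Out}
    {t : List (Option (SysAct D (consensus n f) M X Empty))}
    {s : (system A (consensusEnv n f)).State} {v : Option (Vertex n D.Out)}
    (hp : IsNode A G p t s v) {b : Bool} (h : CanDecide A G p b) :
    (∃ i, some (SysAct.pout (b, i)) ∈ t) ∨ ReachDecides A G (s, v) b := by
  obtain ⟨_, ⟨q, rfl⟩, t', s', v', hq, i, hi⟩ := h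
  obtain ⟨-, s₀, h0, hw⟩ := isNode_iff.1 hp
  obtain ⟨-, s₀', h0', hw'⟩ := isNode_iff.1 hq
  rw [system_start_unique hA h0' h0] at hw'
  obtain ⟨t₁, t₂, c₁, h1, h2, rfl⟩ := walk_append.1 hw'
  obtain ⟨rfl, rfl⟩ := hw.unique hA h1
  rcases List.mem_append.1 hi with hi | hi
  · exact Or.inl ⟨i, hi⟩
  · exact Or.inr ⟨q, t₂, _, h2, i, hi⟩

/-- In an infinite graph the depth is unbounded, so what can be decided below a node depends only on
the two tags of the node and on the decisions already on its path. -/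
theorem canDecide_iff (hA : IsDistributedAlgorithm A) (hG : G.V.Infinite) {p : Path n D.Out}
    {t : List (Option (SysAct D (consensus n f) M X Empty))}
    {s : (system A (consensusEnv n f)).State} {v : Option (Vertex n D.Out)}
    (hp : IsNode A G p t s v) {b : Bool} :
    CanDecide A G p b ↔ (∃ i, some (SysAct.pout (b, i)) ∈ t) ∨ ReachDecides A G (s, v) b := by
  refine ⟨fun h => h.of_isNode hA hp, ?_⟩
  rintro (⟨i, hi⟩ | ⟨q, t', c', hw', i, hi⟩)
  · exact ⟨p, List.prefix_rfl, t, s, v, hp, i, hi⟩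
  · obtain ⟨-, s₀, h0, hw⟩ := isNode_iff.1 hp
    exact ⟨p ++ q, List.prefix_append _ _, t ++ t', c'.1, c'.2, isNode_iff.2
      ⟨by simp [hG.encard_eq], s₀, h0, walk_append.2 ⟨_, _, _, hw, hw', rfl⟩⟩, i,
      List.mem_append_right _ hi⟩

theorem IsNode.append (hG : G.V.Infinite) {p q : Path n D.Out}
    {t t' : List (Option (SysAct D (consensus n f) M X Empty))}
    {s : (system A (consensusEnv n f)).State} {v : Option (Vertex n D.Out)} {c' : Cfg A}
    (hp : IsNode A G p t s v) (hw : Walk A G (s, v) q t' c') :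
    IsNode A G (p ++ q) (t ++ t') c'.1 c'.2 := by
  obtain ⟨-, s₀, h0, hw₀⟩ := isNode_iff.1 hp
  exact isNode_iff.2 ⟨by simp [hG.encard_eq], s₀, h0, walk_append.2 ⟨_, _, _, hw₀, hw, rfl⟩⟩

theorem IsNode.split {p q : Path n D.Out}
    {t : List (Option (SysAct D (consensus n f) M X Empty))}
    {s : (system A (consensusEnv n f)).State} {v : Option (Vertex n D.Out)}
    (h : IsNode A G (p ++ q) t s v) :
    ∃ t₁ t₂ s₁ v₁, IsNode A G p t₁ s₁ v₁ ∧ Walk A G (s₁, v₁) q t₂ (s, v) ∧ t = t₁ ++ t₂ := by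
  obtain ⟨hl, s₀, h0, hw⟩ := isNode_iff.1 h
  obtain ⟨t₁, t₂, ⟨s₁, v₁⟩, h1, h2, rfl⟩ := walk_append.1 hw
  refine ⟨t₁, t₂, s₁, v₁, isNode_iff.2 ⟨le_trans ?_ hl, s₀, h0, h1⟩, h2, rfl⟩
  exact_mod_cast (List.prefix_append p q).length_le

end Walks

/-! ### Steps of the consensus system -/

section ConsensusSystem

variable {n f : ℕ} {D : CrashProblem n} {M X : Type}
  {A : Fin n → Automaton (ProcAct D (consensus n f) M X)}

/-- The variable `stop` of the environment automaton at `i`. -/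
def envStop (s : (system A (consensusEnv n f)).State) (i : Fin n) : Bool := s (.env i)

theorem env_step {s s' : (system A (consensusEnv n f)).State}
    {a : SysAct D (consensus n f) M X Empty} (h : (system A (consensusEnv n f)).trans s a s')
    (i : Fin n) :
    (a = .crash i ∧ envStop s' i = true) ∨
    (∃ b, a = .pin (b, i) ∧ envStop s i = false ∧ envStop s' i = true) ∨
    (a ≠ .crash i ∧ (∀ b, a ≠ .pin (b, i)) ∧ envStop s' i = envStop s i) := by
  rcases h.2 (.env i) with ⟨-, b, rfl, hb⟩ | ⟨hn, h⟩
  · rcases hb with ⟨rfl, h1⟩ | ⟨b, rfl, h1⟩ | ⟨b, rfl, h1, h2⟩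
    · exact Or.inl ⟨rfl, h1⟩
    · exact Or.inr (Or.inr ⟨by simp [EnvAct.toSys], by simp [EnvAct.toSys], h1⟩)
    · exact Or.inr (Or.inl ⟨b, rfl, h1, h2⟩)
  · refine Or.inr (Or.inr ⟨?_, ?_, h⟩)
    · rintro rfl
      exact hn ((mem_env_acts (b := .crash i)).2 (Or.inl (Or.inl (Or.inl rfl))))
    · rintro b rfl
      exact hn ((mem_env_acts (P := consensus n f) (b := .pin (b, i))).2 (Or.inl (Or.inr ⟨b, rfl⟩)))

theorem envStop_mono {s s' : (system A (consensusEnv n f)).State}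
    {a : SysAct D (consensus n f) M X Empty} (h : (system A (consensusEnv n f)).trans s a s')
    {i : Fin n} (hi : envStop s i = true) : envStop s' i = true := by
  rcases env_step h i with h | ⟨b, h⟩ | h
  · exact h.2
  · exact h.2.2
  · rw [h.2.2, hi]

theorem crash_enabled (hA : IsDistributedAlgorithm A) (s : (system A (consensusEnv n f)).State)
    (i : Fin n) : (system A (consensusEnv n f)).Enabled s (.crash i) := by
  have hin : ProcAct.crash i ∈ (A i).input := by
    rw [hA.input_eq]
    exact Or.inl rfl
  refine (Automaton.compose_enabled_iff _ _ _).2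
    ⟨⟨.proc i, (mem_proc_acts (b := .crash i)).2 (Or.inl (Or.inl hin))⟩, ?_⟩
  rintro (j | j | c) h
  · have := hA.loc_eq h
    change i = j at this
    subst this
    exact proc_input_enabled hA (b := .crash i) hin _
  · have := (consensusEnv_envLocal n f).loc_eq h
    change i = j at this
    subst this
    exact ⟨true, .crash i, rfl, Or.inl ⟨rfl, rfl⟩⟩
  · obtain ⟨m, h | h⟩ := mem_chan_acts.1 h <;> cases h

theorem pin_enabled (hA : IsDistributedAlgorithm A) {s : (system A (consensusEnv n f)).State}
    {i : Fin n} (hs : envStop s i = false) (b : Bool) :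
    (system A (consensusEnv n f)).Enabled s (.pin (b, i)) := by
  have hin : ProcAct.pin (b, i) ∈ (A i).input := by
    rw [hA.input_eq]
    exact Or.inr (Or.inr (Or.inr ⟨(b, i), rfl, rfl⟩))
  refine (Automaton.compose_enabled_iff _ _ _).2
    ⟨⟨.proc i, (mem_proc_acts (P := consensus n f) (b := .pin (b, i))).2 (Or.inl (Or.inl hin))⟩, ?_⟩
  rintro (j | j | c) h
  · have := hA.loc_eq h
    change i = j at this
    subst this
    exact proc_input_enabled hA (b := .pin (b, i)) hin _
  · have := (consensusEnv_envLocal n f).loc_eq h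
    change i = j at this
    subst this
    exact ⟨true, .pin (b, i), rfl, Or.inr (Or.inr ⟨b, rfl, hs, rfl⟩)⟩
  · obtain ⟨m, h | h⟩ := mem_chan_acts.1 h <;> cases h

theorem notMem_chan_acts {c : Link n} {a : SysAct D (consensus n f) M X Empty}
    (h1 : ∀ m, a ≠ .send m c.1.1 c.1.2) (h2 : ∀ m, a ≠ .recv m c.1.1 c.1.2) :
    a ∉ (component A (consensusEnv n f) (.chan c)).acts := fun h => by
  obtain ⟨m, h | h⟩ := mem_chan_acts.1 h
  · exact h1 m h
  · exact h2 m h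

/-- An action that is enabled in `s` is enabled in every state that agrees with `s` in the channels
and at the locations outside of `S`, if it is a receipt or its location is not in `S`. -/
theorem enabled_of_agree (hA : IsDistributedAlgorithm A)
    {s σ : (system A (consensusEnv n f)).State} {S : Set (Fin n)}
    {a : SysAct D (consensus n f) M X Empty}
    (hp : ∀ i ∉ S, σ (.proc i) = s (.proc i) ∧ σ (.env i) = s (.env i))
    (hc : ∀ c, σ (.chan c) = s (.chan c)) (ha : a.loc ∉ S ∨ ∃ m i j, a = .recv m i j)
    (h : (system A (consensusEnv n f)).Enabled s a) :
    (system A (consensusEnv n f)).Enabled σ a := by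
  obtain ⟨h1, h2⟩ := (Automaton.compose_enabled_iff _ _ _).1 h
  refine (Automaton.compose_enabled_iff _ _ _).2 ⟨h1, ?_⟩
  rintro (i | i | c) hi
  · rcases ha with ha | ⟨m, j, k, rfl⟩
    · rw [hA.loc_eq hi] at ha
      rw [(hp i ha).1]
      exact h2 _ hi
    · have hb : ProcAct.recv m j k ∈ (A i).acts := (mem_proc_acts (b := .recv m j k)).1 hi
      rcases hA.mem_acts hb with h | ⟨o, -, h⟩ | ⟨m', j', h', h⟩ | ⟨x, -, h⟩ | ⟨m', j', -, h⟩ |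
        ⟨o, -, h⟩ | ⟨x, h⟩ <;> cases h
      exact proc_input_enabled hA (recv_mem_input hA m h') _
  · rcases ha with ha | ⟨m, j, k, rfl⟩
    · rw [(consensusEnv_envLocal n f).loc_eq hi] at ha
      rw [(hp i ha).2]
      exact h2 _ hi
    · exact absurd hi (notMem_env_acts (Or.inr (Or.inr ⟨m, j, k, rfl⟩)))
  · rw [hc c]
    exact h2 _ hi

/-- By determinism of the components, equal component states remain equal when both systems take the
same action. -/
theorem agree_step (hA : IsDistributedAlgorithm A)
    {s σ s' σ' : (system A (consensusEnv n f)).State} {S : Set (Fin n)}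
    {a : SysAct D (consensus n f) M X Empty}
    (hp : ∀ i ∉ S, σ (.proc i) = s (.proc i) ∧ σ (.env i) = s (.env i))
    (hc : ∀ c, σ (.chan c) = s (.chan c))
    (h : (system A (consensusEnv n f)).trans s a s')
    (h' : (system A (consensusEnv n f)).trans σ a σ') :
    (∀ i ∉ S, σ' (.proc i) = s' (.proc i) ∧ σ' (.env i) = s' (.env i)) ∧
      ∀ c, σ' (.chan c) = s' (.chan c) := by
  have key : ∀ c, σ c = s c → σ' c = s' c := by
    intro c hc
    rcases h.2 c with ⟨ha, ht⟩ | ⟨ha, ht⟩ <;> rcases h'.2 c with ⟨ha', ht'⟩ | ⟨ha', ht'⟩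
    · rw [hc] at ht'
      exact component_trans_unique hA ht' ht
    · exact absurd ha ha'
    · exact absurd ha' ha
    · rw [ht, ht', hc]
  exact ⟨fun i hi => ⟨key _ (hp i hi).1, key _ (hp i hi).2⟩, fun c => key _ (hc c)⟩

/-- The histories of the processes in the runs of the system. -/
theorem proc_run_step {s s' : (system A (consensusEnv n f)).State}
    {a : SysAct D (consensus n f) M X Empty} (h : (system A (consensusEnv n f)).trans s a s')
    {i : Fin n} {l : List (ProcAct D (consensus n f) M X)} (hl : (A i).Run l (s (.proc i))) :
    ∃ l', (A i).Run (l ++ l') (s' (.proc i)) ∧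
      (a = .crash i → a ∈ (component A (consensusEnv n f) (.proc i)).acts → .crash i ∈ l') := by
  rcases h.2 (.proc i) with ⟨-, b, rfl, ht⟩ | ⟨hn, h⟩
  · refine ⟨[b], Automaton.Run.snoc _ _ _ _ hl ht, fun h _ => ?_⟩
    have : b = .crash i := ProcAct.toSys_injective h
    simp [this]
  · refine ⟨[], by rw [h]; simpa using hl, fun _ h => absurd h hn⟩

end ConsensusSystem

/-! ### Graphs of the failure-detector outputs in a trace -/

section TraceGraphs

variable {n f : ℕ} {D : CrashProblem n} {M X : Type}
  {A : Fin n → Automaton (ProcAct D (consensus n f) M X)}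

/-- `G` is a graph of outputs in `t`, with positions `pos`, that eventually has all edges to the
outputs at live locations. -/
structure TraceGraph (t : Stream'.Seq D.Ev) (G : Graph n D.Out) (pos : Vertex n D.Out → ℕ) :
    Prop where
  get : ∀ v ∈ G.V, t.get? (pos v) = some (.out v.act)
  loc : ∀ v ∈ G.V, D.locOut v.act = v.loc
  inj : Set.InjOn pos G.V
  edge : ∀ u v, (u, v) ∈ G.Z → u ∈ G.V ∧ v ∈ G.V ∧ pos u < pos v
  trans : ∀ u v w, (u, v) ∈ G.Z → (v, w) ∈ G.Z → (u, w) ∈ G.Z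
  idx : ∀ u ∈ G.V, ∀ v ∈ G.V, u.loc = v.loc → u.idx = v.idx → u = v
  late : ∀ i ∉ faulty t, ∀ u ∈ G.V, ∃ m, ∀ w ∈ G.V, w.loc = i → m ≤ pos w → (u, w) ∈ G.Z
  infinite : ∀ i ∉ faulty t, ∀ m, ∃ w ∈ G.V, w.loc = i ∧ m ≤ pos w

theorem TraceGraph.V_infinite {t : Stream'.Seq D.Ev} {G : Graph n D.Out}
    {pos : Vertex n D.Out → ℕ} (hG : TraceGraph t G pos) (hl : ∃ i, i ∉ faulty t) :
    G.V.Infinite := by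
  obtain ⟨i, hi⟩ := hl
  refine fun hfin => ?_
  obtain ⟨B, hB⟩ := (hfin.image pos).bddAbove
  obtain ⟨w, hw, -, hm⟩ := hG.infinite i hi (B + 1)
  have := hB ⟨w, hw, rfl⟩
  omega

/-- The position after the output in a vertex tag. -/
def tagPos (pos : Vertex n D.Out → ℕ) : Option (Vertex n D.Out) → ℕ
  | none => 0
  | some u => pos u + 1

theorem Graph.Succ.tagPos_lt {t : Stream'.Seq D.Ev} {G : Graph n D.Out}
    {pos : Vertex n D.Out → ℕ} (hG : TraceGraph t G pos) {v : Option (Vertex n D.Out)}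
    {u : Vertex n D.Out} (h : G.Succ v u) : tagPos pos v < pos u + 1 := by
  rcases v with _ | x
  · exact Nat.succ_pos _
  · exact Nat.succ_lt_succ (hG.edge _ _ (h.2 x rfl)).2.2

/-- The basis of all timing arguments: only outputs of `D` advance the vertex tag, and apart from
channel labels any other action requires that a further output at its location exists in the graph.
-/
theorem Step.cases_act {G : Graph n D.Out} {c c' : Cfg A} {e : Label n × Option (Vertex n D.Out)}
    {a : SysAct D (consensus n f) M X Empty} (h : Step A G c e (some a) c') :
    (∃ u, a = .fd u.act ∧ c'.2 = some u ∧ G.Succ c.2 u ∧ e = (.fd u.loc, some u)) ∨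
    (c'.2 = c.2 ∧ (∀ i, e.1 ≠ .fd i) ∧ EnabledTag A c.1 e.1 (some a) ∧
      (G.HasSucc c.2 e.1.loc ∨ ∃ d, e.1 = .chan d)) := by
  cases h with
  | act s s' v w l a he ha hs =>
    rcases l with i | ⟨i, b⟩ | d | i
    · rcases ha with ⟨h1, h2⟩ | ⟨-, h2⟩
      · exact Or.inr ⟨he, by simp, h2, Or.inl h1⟩
      · cases h2
    · rcases ha with ⟨h1, h2⟩ | ⟨-, h2⟩
      · exact Or.inr ⟨he, by simp, h2, Or.inl h1⟩
      · cases h2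
    · exact Or.inr ⟨he, by simp, ha, Or.inr ⟨d, rfl⟩⟩
    · rcases ha with ⟨-, h⟩ | ⟨h, u, rfl, h'⟩
      · cases h
      · cases h'
        rcases he with ⟨u', h1, h2, h3⟩ | ⟨-, h'⟩
        · cases h1
          subst h2
          exact Or.inl ⟨u, rfl, rfl, h3, rfl⟩
        · exact absurd h' h

theorem labelActs_cases (hA : IsDistributedAlgorithm A) {l : Label n} (hl : ∀ i, l ≠ .fd i)
    {a : SysAct D (consensus n f) M X Empty} (ha : a ∈ labelActs A l) :
    a.loc = l.loc ∧ (∀ i, a ≠ .crash i) ∧ (∀ o, a ≠ .fd o) ∧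
      ((∃ d : Link n, l = .chan d ∧ ∃ m, a = .recv m d.1.1 d.1.2) ∨
        ((∀ d, l ≠ .chan d) ∧ ∀ m i j, a ≠ .recv m i j)) := by
  rcases l with i | ⟨i, b⟩ | d | i
  · obtain ⟨b, hb, rfl⟩ := ha
    rcases hb with hb | hb
    · rw [hA.output_eq] at hb
      rcases hb with ⟨m, j, -, rfl⟩ | ⟨o, h, rfl⟩
      · exact ⟨rfl, by simp [ProcAct.toSys], by simp [ProcAct.toSys],
          Or.inr ⟨by simp, by simp [ProcAct.toSys]⟩⟩
      · exact ⟨h, by simp [ProcAct.toSys], by simp [ProcAct.toSys],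
          Or.inr ⟨by simp, by simp [ProcAct.toSys]⟩⟩
    · obtain ⟨x, rfl⟩ := hA.internal_subset i hb
      exact ⟨rfl, by simp [ProcAct.toSys], by simp [ProcAct.toSys],
          Or.inr ⟨by simp, by simp [ProcAct.toSys]⟩⟩
  · rw [Set.mem_singleton_iff.1 ha]
    exact ⟨rfl, by simp, by simp, Or.inr ⟨by simp, by simp⟩⟩
  · obtain ⟨m, rfl⟩ := ha
    exact ⟨rfl, by simp, by simp, Or.inl ⟨d, rfl, m, rfl⟩⟩
  · exact absurd rfl (hl i)

theorem Step.tagPos_le {t : Stream'.Seq D.Ev} {G : Graph n D.Out}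
    {pos : Vertex n D.Out → ℕ} (hG : TraceGraph t G pos) {c c' : Cfg A}
    {e : Label n × Option (Vertex n D.Out)} {a : SysAct D (consensus n f) M X Empty}
    (h : Step A G c e (some a) c') : tagPos pos c.2 ≤ tagPos pos c'.2 := by
  rcases h.cases_act with ⟨u, -, h1, h2, -⟩ | ⟨h1, -⟩
  · rw [h1]
    exact (h2.tagPos_lt hG).le
  · rw [h1]

/-- The actions in the tree other than receipts are followed by outputs at the same location. -/
theorem Step.exists_later {t : Stream'.Seq D.Ev} {G : Graph n D.Out}
    {pos : Vertex n D.Out → ℕ} (hA : IsDistributedAlgorithm A) (hG : TraceGraph t G pos)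
    {c c' : Cfg A} {e : Label n × Option (Vertex n D.Out)}
    {a : SysAct D (consensus n f) M X Empty} (h : Step A G c e (some a) c')
    (ha : ∀ m i j, a ≠ .recv m i j) :
    ∃ u ∈ G.V, u.loc = a.loc ∧ tagPos pos c'.2 ≤ pos u + 1 := by
  rcases h.cases_act with ⟨u, rfl, h1, h2, -⟩ | ⟨h1, h2, h3, h4⟩
  · exact ⟨u, h2.1, (hG.loc u h2.1).symm, by rw [h1]; exact le_rfl⟩
  · obtain ⟨h5, -, -, h6⟩ := labelActs_cases hA h2 h3.1
    rcases h6 with ⟨d, -, m, rfl⟩ | ⟨h6, -⟩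
    · exact absurd rfl (ha _ _ _)
    · rcases h4 with ⟨u, h7, h8⟩ | ⟨d, h7⟩
      · exact ⟨u, h8.1, h7.trans h5.symm, by rw [h1]; exact (h8.tagPos_lt hG).le⟩
      · exact absurd h7 (h6 d)

theorem Step.ne_crash (hA : IsDistributedAlgorithm A) {G : Graph n D.Out}
    {c c' : Cfg A} {e : Label n × Option (Vertex n D.Out)}
    {a : SysAct D (consensus n f) M X Empty} (h : Step A G c e (some a) c') (i : Fin n) :
    a ≠ .crash i := by
  rcases h.cases_act with ⟨u, rfl, -⟩ | ⟨-, h2, h3, -⟩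
  · simp
  · exact (labelActs_cases hA h2 h3.1).2.1 i

end TraceGraphs

/-! ### From fair paths in the tree to fair executions with crashes -/

section Interleaving

open Classical

variable {n : ℕ}

theorem exists_iterate {σ ε : Type} (R : σ → ε → σ → Prop) (h : ∀ s, ∃ e s', R s e s') (s₀ : σ) :
    ∃ (s : ℕ → σ) (e : ℕ → ε), s 0 = s₀ ∧ ∀ k, R (s k) (e k) (s (k + 1)) := by
  choose e s' hs using h
  exact ⟨fun k => Nat.rec s₀ (fun _ s => s' s) k, fun k => e (Nat.rec s₀ (fun _ s => s' s) k), rfl,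
    fun k => hs _⟩

/-- Insert the events `i ∈ F` with times `cp i` into a sequence of events: the `j`-th event of the
sequence is preceded by those `i` with `cp i < N (j + 1)`, in the order of the times. -/
theorem exists_interleaving {N : ℕ → ℕ} (hN : Monotone N) (hN0 : N 0 = 0)
    (hNu : ∀ m, ∃ j, m ≤ N j) (F : Set (Fin n)) {cp : Fin n → ℕ} (hcp : Set.InjOn cp F) :
    ∃ (J : ℕ → ℕ) (S : ℕ → Set (Fin n)) (κ : ℕ → Option (Fin n)), J 0 = 0 ∧ S 0 = ∅ ∧
      (∀ k i, κ k = some i → i ∈ F ∧ N (J k) ≤ cp i ∧ (∀ i' ∈ S k, cp i' < cp i) ∧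
        J (k + 1) = J k ∧ S (k + 1) = insert i (S k)) ∧
      (∀ k, κ k = none → J (k + 1) = J k + 1 ∧ S (k + 1) = S k) ∧
      (∀ k, ∀ i ∈ S k, i ∈ F ∧ cp i < N (J k + 1)) ∧
      (∃ B, ∀ k ≥ B, S k = F ∧ κ k = none) ∧
      ∀ j, ∃ k ≥ j, κ k = none ∧ J k = j := by
  -- A state consists of the number of events taken and the set of crashes inserted. If some
  -- remaining crash is due before the time `N (s.1 + 1)`, the earliest one is inserted; otherwise
  -- the next event is taken.
  let R : ℕ × Set (Fin n) → Option (Fin n) → ℕ × Set (Fin n) → Prop := fun s e s' =>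
    (∃ i, e = some i ∧ i ∈ F ∧ i ∉ s.2 ∧ cp i < N (s.1 + 1) ∧
      (∀ i' ∈ F, i' ∉ s.2 → cp i ≤ cp i') ∧ s'.1 = s.1 ∧ s'.2 = insert i s.2) ∨
    (e = none ∧ (∀ i ∈ F, i ∉ s.2 → N (s.1 + 1) ≤ cp i) ∧ s'.1 = s.1 + 1 ∧ s'.2 = s.2)
  have hR : ∀ s, ∃ e s', R s e s' := by
    rintro ⟨j, T⟩
    by_cases h : ∀ i ∈ F, i ∉ T → N (j + 1) ≤ cp i
    · exact ⟨none, (j + 1, T), Or.inr ⟨rfl, h, rfl, rfl⟩⟩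
    · push Not at h
      obtain ⟨i₀, h1, h2, h3⟩ := h
      obtain ⟨i, hi, hmin⟩ := Set.exists_min_image (F \ T) cp (Set.toFinite _) ⟨i₀, h1, h2⟩
      exact ⟨some i, (j, insert i T), Or.inl ⟨i, rfl, hi.1, hi.2,
        lt_of_le_of_lt (hmin i₀ ⟨h1, h2⟩) h3, fun i' h h' => hmin i' ⟨h, h'⟩, rfl, rfl⟩⟩
  obtain ⟨s, κ, hs0, hs⟩ := exists_iterate R hR (0, ∅)
  -- The last clause counts steps: each one takes an event or inserts one of at most `n` crashes, so
  -- `k` exceeds the number of events taken by at most `n`.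
  have inv : ∀ k, (∀ i ∈ F, i ∉ (s k).2 → N (s k).1 ≤ cp i) ∧
      (∀ i ∈ (s k).2, i ∈ F ∧ cp i < N ((s k).1 + 1)) ∧
      (∀ i ∈ (s k).2, ∀ i' ∈ F, i' ∉ (s k).2 → cp i < cp i') ∧ (s k).1 + (s k).2.ncard = k := by
    intro k
    induction k with
    | zero => simp [hs0, hN0]
    | succ k ih =>
      obtain ⟨ha, hb, hc, hd⟩ := ih
      rcases hs k with ⟨i, -, h1, h2, h3, h4, h5, h6⟩ | ⟨-, h1, h2, h3⟩
      · rw [h5, h6]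
        refine ⟨fun i' h h' => ha i' h fun h'' => h' (Or.inr h''), ?_, ?_, ?_⟩
        · rintro i' (rfl | h)
          · exact ⟨h1, h3⟩
          · exact hb i' h
        · rintro i' hi' i'' h h'
          have h'' : i'' ∉ (s k).2 := fun h'' => h' (Or.inr h'')
          rcases hi' with rfl | hi'
          · refine lt_of_le_of_ne (h4 i'' h h'') fun he => h' (Or.inl ?_)
            exact (hcp h1 h he).symm
          · exact hc i' hi' i'' h h''
        · rw [Set.ncard_insert_of_notMem h2]
          omega
      · rw [h2, h3]
        exact ⟨h1, fun i hi => ⟨(hb i hi).1, (hb i hi).2.trans_le (hN (by omega))⟩, hc, by omega⟩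
  have hgrow : ∀ k, k ≤ (s k).1 + n := by
    intro k
    have h1 := (inv k).2.2.2
    have h2 : (s k).2.ncard ≤ n := by
      have := Set.ncard_le_card (s k).2
      simpa using this
    omega
  have hnone : ∀ k, κ k = none → (s (k + 1)).1 = (s k).1 + 1 ∧ (s (k + 1)).2 = (s k).2 := by
    intro k hk
    rcases hs k with ⟨i, h, -⟩ | ⟨-, -, h2, h3⟩
    · rw [hk] at h
      cases h
    · exact ⟨h2, h3⟩
  refine ⟨fun k => (s k).1, fun k => (s k).2, κ, by simp [hs0], by simp [hs0], ?_, hnone,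
    fun k => (inv k).2.1, ?_, ?_⟩
  · intro k i hk
    rcases hs k with ⟨i', h, h1, h2, h3, h4, h5, h6⟩ | ⟨h, -⟩
    · rw [hk] at h
      cases h
      exact ⟨h1, (inv k).1 i h1 h2, fun i' hi' => (inv k).2.2.1 i' hi' i h1 h2, h5, h6⟩
    · rw [hk] at h
      cases h
  · obtain ⟨B, hB⟩ := (Set.toFinite (cp '' F)).bddAbove
    obtain ⟨j, hj⟩ := hNu (B + 1)
    -- After `j + n` steps at least `j` events have been taken, and `N j` lies beyond all crash
    -- times.
    have hS : ∀ k ≥ j + n, (s k).2 = F := by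
      intro k hk
      refine Set.Subset.antisymm (fun i hi => ((inv k).2.1 i hi).1) fun i hi => ?_
      by_contra hn
      have h1 := (inv k).1 i hi hn
      have h2 := hB ⟨i, hi, rfl⟩
      have h3 := hN (show j ≤ (s k).1 by have := hgrow k; omega)
      omega
    refine ⟨j + n, fun k hk => ⟨hS k hk, ?_⟩⟩
    rcases hs k with ⟨i, -, h1, h2, -⟩ | ⟨h, -⟩
    · rw [hS k hk] at h2
      exact absurd h1 h2
    · exact h
  · intro j
    -- The step just before the first state with more than `j` events is the one that takes event
    -- `j`.
    have hex : ∃ k, j < (s k).1 := ⟨j + n + 1, by have := hgrow (j + n + 1); omega⟩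
    have h1 := Nat.find_spec hex
    rcases h0 : Nat.find hex with _ | k
    · rw [h0, hs0] at h1
      simp at h1
    · have h2 : ¬ j < (s k).1 := Nat.find_min hex (by omega)
      rw [h0] at h1
      rcases hs k with ⟨i, -, -, -, -, -, h5, -⟩ | ⟨h3, -, h4, -⟩
      · omega
      · have h5 : (s k).1 = j := by omega
        refine ⟨k, ?_, h3, h5⟩
        have := (inv k).2.2.2
        omega

theorem proj_get?_eq_some {α β : Type} {f : α → Option β} {t : Stream'.Seq α} {m : ℕ} {b : β} :
    (proj f t).get? m = some b ↔
      ∃ k a, t.get? k = some a ∧ f a = some b ∧ selPos (fun _ => f) t k = m :=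
  select_get?_eq_some _ _ _ _

/-- The map `ψ` need only be increasing at the retained positions; `κ` enumerates these, and the
embedding is `ψ ∘ κ`. -/
theorem exists_embedding_proj {α β : Type} {g : α → Option β} {e : ℕ → α} {t : Stream'.Seq β}
    {ψ : ℕ → ℕ} (hinf : ∀ m, ∃ k ≥ m, ∃ b, g (e k) = some b)
    (hmono : ∀ k k' b b', k < k' → g (e k) = some b → g (e k') = some b' → ψ k < ψ k')
    (hget : ∀ k b, g (e k) = some b → t.get? (ψ k) = some b) :
    ∃ φ, IsEmbedding φ (proj g (ofFun e)) t := by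
  have hinf' : ∀ m, ∃ k ≥ m, ∃ a b, (ofFun e).get? k = some a ∧ g a = some b := by
    intro m
    obtain ⟨k, hk, b, hb⟩ := hinf m
    exact ⟨k, hk, e k, b, rfl, hb⟩
  have h1 : ∀ m, ∃ k, (∃ b, g (e k) = some b) ∧ selPos (fun _ => g) (ofFun e) k = m := by
    intro m
    obtain ⟨b, hb⟩ := isSome_of_infinite (t := proj g (ofFun e)) (fun m => by
      obtain ⟨K, hK⟩ := exists_le_selPos (f := fun _ => g) hinf' m
      obtain ⟨k, hk, a, b, ha, hb⟩ := hinf' K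
      exact ⟨_, hK.trans (selPos_mono _ _ hk),
        Option.isSome_iff_exists.2 ⟨b, select_get?_selPos ha hb⟩⟩) m
    obtain ⟨k, a, ha, hb, hk⟩ := proj_get?_eq_some.1 hb
    cases ha
    exact ⟨k, ⟨b, hb⟩, hk⟩
  choose κ hκ hκm using h1
  refine ⟨fun m => ψ (κ m), strictMono_nat_of_lt_succ fun m => ?_, fun m b hb => ?_⟩
  · obtain ⟨b, hb⟩ := hκ m
    obtain ⟨b', hb'⟩ := hκ (m + 1)
    refine hmono _ _ _ _ (lt_of_selPos_lt (f := fun _ => g) (t := ofFun e) ?_) hb hb'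
    rw [hκm, hκm]
    exact Nat.lt_succ_self m
  · obtain ⟨k, a, ha, hb, hk⟩ := proj_get?_eq_some.1 hb
    cases ha
    obtain ⟨b', hb'⟩ := hκ m
    have : κ m = k := selPos_injOn (f := fun _ => g) (t := ofFun e) rfl hb' rfl hb
      ((hκm m).trans hk.symm)
    change t.get? (ψ (κ m)) = some b
    rw [this]
    exact hget k b hb

/-- Some states of the crash automaton go with each sequence of events with finitely many
crashes. -/
theorem exists_crashStates {α : Type} (e : ℕ → α) (g : α → Option (Fin n)) {B : ℕ}
    (hB : ∀ k ≥ B, g (e k) = none) :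
    ∃ r : ℕ → Stream'.Seq (Fin n), (∀ k i, g (e k) = some i → r k = Stream'.Seq.cons i (r (k + 1))) ∧
      (∀ k, g (e k) = none → r (k + 1) = r k) ∧ ∀ k ≥ B, r k = Stream'.Seq.nil := by
  refine ⟨fun k => Stream'.Seq.ofList (((List.range' k (B - k)).map e).filterMap g), ?_, ?_, ?_⟩
  · intro k i hk
    have hlt : k < B := by
      by_contra hge
      rw [hB k (not_lt.1 hge)] at hk
      cases hk
    obtain ⟨d, hd⟩ : ∃ d, B - k = d + 1 := ⟨B - k - 1, by omega⟩
    have hd' : B - (k + 1) = d := by omega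
    simp only [hd, hd', List.range'_succ, List.map_cons, List.filterMap_cons, hk]
    exact Stream'.Seq.ofList_cons _ _
  · intro k hk
    by_cases hlt : k < B
    · obtain ⟨d, hd⟩ : ∃ d, B - k = d + 1 := ⟨B - k - 1, by omega⟩
      have hd' : B - (k + 1) = d := by omega
      simp only [hd, hd', List.range'_succ, List.map_cons, List.filterMap_cons, hk]
    · have h1 : B - k = 0 := by omega
      have h2 : B - (k + 1) = 0 := by omega
      simp only [h1, h2]
      rfl
  · intro k hk
    have h1 : B - k = 0 := by omega
    simp only [h1]
    rfl

end Interleaving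

/-! ### Executions of the consensus system that follow a fair path -/

section FairPaths

variable {n f : ℕ} {D : CrashProblem n} {M X : Type}

/-- An infinite path without `⊥` from the root of the tree for `G`, with configurations `c`, edges
`e` and actions `a`, that is fair to the channels and to the locations outside of `F`. -/
structure FairPath (A : Fin n → Automaton (ProcAct D (consensus n f) M X)) (G : Graph n D.Out)
    (F : Set (Fin n)) (c : ℕ → Cfg A) (e : ℕ → Label n × Option (Vertex n D.Out))
    (a : ℕ → SysAct D (consensus n f) M X Empty) : Prop where
  start : (c 0).1 ∈ (system A (consensusEnv n f)).start
  root : (c 0).2 = none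
  step : ∀ k, Step A G (c k) (e k) (some (a k)) (c (k + 1))
  fair : ∀ l : Label n, ((∃ d, l = .chan d) ∨ l.loc ∉ F) → ∀ m, ∃ k ≥ m, (e k).1 = l ∨
    ((∀ i, l ≠ .fd i) ∧ EnabledTag A (c k).1 l none)

variable {A : Fin n → Automaton (ProcAct D (consensus n f) M X)} {G : Graph n D.Out}

theorem FairPath.exists_fd {F : Set (Fin n)} {c : ℕ → Cfg A}
    {e : ℕ → Label n × Option (Vertex n D.Out)} {a : ℕ → SysAct D (consensus n f) M X Empty}
    (hp : FairPath A G F c e a) {i : Fin n} (hi : i ∉ F) (m : ℕ) :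
    ∃ k ≥ m, ∃ u, u.loc = i ∧ a k = .fd u.act ∧ (c (k + 1)).2 = some u ∧ G.Succ (c k).2 u := by
  obtain ⟨k, hk, h | h⟩ := hp.fair (.fd i) (Or.inr hi) m
  · rcases (hp.step k).cases_act with ⟨u, h1, h2, h3, h4⟩ | ⟨-, h2, -⟩
    · rw [h4] at h
      injection h with h
      exact ⟨k, hk, u, h, h1, h2, h3⟩
    · exact absurd h (h2 i)
  · exact absurd rfl (h.1 i)

/-- The crashes of `t` are interleaved with the path according to positions in `t`. After the crash
of a location has been inserted, the path contains only receipts there, because every other action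
is followed by an output at the same location in `t`. Channels and uncrashed locations therefore go
through the same states as in the tree. -/
theorem FairPath.exists_execution (hD : D.IsStrongSamplingAFD) (hA : IsDistributedAlgorithm A)
    {t : Stream'.Seq D.Ev} (ht : t ∈ D.traces) (hlive : ∃ i, i ∉ faulty t)
    {pos : Vertex n D.Out → ℕ} (hG : TraceGraph t G pos) {c : ℕ → Cfg A}
    {e : ℕ → Label n × Option (Vertex n D.Out)} {a : ℕ → SysAct D (consensus n f) M X Empty}
    (hp : FairPath A G (faulty t) c e a) :
    ∃ (x : (fullSystem A (consensusEnv n f)).Execution)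
      (ev : ℕ → SysAct D (consensus n f) M X Empty), x.events = ofFun ev ∧ x.Fair ∧
      proj SysAct.asD x.events ∈ D.traces ∧ (∀ i, (∃ k, ev k = .crash i) ↔ i ∈ faulty t) ∧
      (∀ k, (∃ i, ev k = .crash i) ∨ ∃ j, ev k = a j) ∧ ∀ j, ∃ k, ev k = a j := by
  classical
  have hval := hD.valid t ht
  obtain ⟨i₀, hi₀⟩ := hlive
  -- times of the crashes and of the outputs
  have : ∀ i, ∃ k, i ∈ faulty t → t.get? k = some (Event.crash i) := by
    intro i
    by_cases h : i ∈ faulty t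
    · obtain ⟨k, hk⟩ := h
      exact ⟨k, fun _ => hk⟩
    · exact ⟨0, fun h' => absurd h' h⟩
  choose cp hcp using this
  have hcpi : Set.InjOn cp (faulty t) := by
    intro i hi j hj h
    have := (hcp i hi).symm.trans (h ▸ hcp j hj)
    cases this
    rfl
  -- The time of the `j`-th configuration is the position in `t` just after the output taken last,
  -- and `0` before the first output.
  let N : ℕ → ℕ := fun j => tagPos pos (c j).2
  have hN : Monotone N := monotone_nat_of_le_succ fun j => (hp.step j).tagPos_le hG
  have hN0 : N 0 = 0 := by simp [N, hp.root, tagPos]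
  have hfdN : ∀ {j : ℕ} {u : Vertex n D.Out}, (c (j + 1)).2 = some u → N (j + 1) = pos u + 1 :=
    fun h => by simp only [N, h, tagPos]
  have hNu : ∀ m, ∃ j, m ≤ N j := by
    intro m
    induction m with
    | zero => exact ⟨0, Nat.zero_le _⟩
    | succ m ih =>
      obtain ⟨j, hj⟩ := ih
      obtain ⟨k, hk, u, -, -, h2, h3⟩ := hp.exists_fd hi₀ j
      have h4 := h3.tagPos_lt hG
      have h5 := hN hk
      refine ⟨k + 1, ?_⟩
      rw [hfdN h2]
      change N k < _ at h4
      omega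
  obtain ⟨J, S, κ, hJ0, hS0, hcr, hac, hSF, ⟨B, hB⟩, hJ⟩ :=
    exists_interleaving hN hN0 hNu (faulty t) hcpi
  let ev : ℕ → SysAct D (consensus n f) M X Empty := fun k => match κ k with
    | some i => .crash i
    | none => a (J k)
  have hevc : ∀ k i, κ k = some i → ev k = .crash i := fun k i h => by simp only [ev, h]
  have heva : ∀ k, κ k = none → ev k = a (J k) := fun k h => by simp only [ev, h]
  have hevk : ∀ k i, ev k = .crash i → κ k = some i := by
    intro k i h
    rcases hk : κ k with _ | i'
    · rw [heva k hk] at h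
      exact absurd h ((hp.step _).ne_crash hA i)
    · rw [hevc k i' hk] at h
      cases h
      rfl
  have hJs : ∀ k, J k ≤ J (k + 1) := by
    intro k
    rcases hk : κ k with _ | i
    · have := hac k hk
      omega
    · have := (hcr k i hk).2.2.2.1
      omega
  have hJm : Monotone J := monotone_nat_of_le_succ hJs
  have hSm : Monotone S := by
    refine monotone_nat_of_le_succ fun k => ?_
    rcases hk : κ k with _ | i
    · rw [(hac k hk).2]
    · rw [(hcr k i hk).2.2.2.2]
      exact Set.subset_insert _ _
  have hScr : ∀ k, ∀ i ∈ S k, ∃ k' < k, κ k' = some i := by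
    intro k
    induction k with
    | zero => simp [hS0]
    | succ k ih =>
      intro i hi
      rcases hk : κ k with _ | i'
      · rw [(hac k hk).2] at hi
        obtain ⟨k', h1, h2⟩ := ih i hi
        exact ⟨k', by omega, h2⟩
      · rw [(hcr k i' hk).2.2.2.2] at hi
        rcases hi with rfl | hi
        · exact ⟨k, by omega, hk⟩
        · obtain ⟨k', h1, h2⟩ := ih i hi
          exact ⟨k', by omega, h2⟩
  have hcrash : ∀ i, (∃ k, ev k = .crash i) ↔ i ∈ faulty t := by
    intro i
    constructor
    · rintro ⟨k, hk⟩
      exact (hcr k i (hevk k i hk)).1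
    · intro hi
      rw [← (hB B le_rfl).1] at hi
      obtain ⟨k, -, hk⟩ := hScr B i hi
      exact ⟨k, hevc k i hk⟩
  -- after its crash, a location has no outputs in the graph
  have hlater : ∀ k, ∀ i ∈ S k, ∀ u ∈ G.V, u.loc = i → N (J k + 1) ≤ pos u + 1 → False := by
    intro k i hi u hu hui hle
    obtain ⟨h1, h2⟩ := hSF k i hi
    have h3 := hcp i h1
    have h4 := hG.get u hu
    have hne : cp i ≠ pos u := fun h => by
      rw [h, h4] at h3
      cases h3
    exact hval.1 _ _ i u.act (by omega) h3 h4 ((hG.loc u hu).trans hui)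
  -- the states
  let σ : ℕ → (system A (consensusEnv n f)).State := fun k => Nat.rec (c 0).1
    (fun k s => if h : (system A (consensusEnv n f)).Enabled s (ev k) then h.choose else s) k
  have hσ : ∀ k, (system A (consensusEnv n f)).Enabled (σ k) (ev k) →
      (system A (consensusEnv n f)).trans (σ k) (ev k) (σ (k + 1)) := by
    intro k h
    have : σ (k + 1) = h.choose := dif_pos h
    rw [this]
    exact h.choose_spec
  -- A receipt depends on its channel only. Any other action on the path is at a location that has
  -- not crashed, by `hlater`, and there the states agree with the tree.
  have hen : ∀ k, (∀ i ∉ S k, σ k (.proc i) = (c (J k)).1 (.proc i) ∧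
      σ k (.env i) = (c (J k)).1 (.env i)) → (∀ d, σ k (.chan d) = (c (J k)).1 (.chan d)) →
      (system A (consensusEnv n f)).Enabled (σ k) (ev k) := by
    intro k h1 h2
    rcases hk : κ k with _ | i
    · rw [heva k hk]
      refine enabled_of_agree hA h1 h2 ?_ ⟨_, (hp.step (J k)).trans⟩
      by_cases hr : ∃ m i j, a (J k) = .recv m i j
      · exact Or.inr hr
      · push Not at hr
        obtain ⟨u, h3, h4, h5⟩ := (hp.step (J k)).exists_later hA hG hr
        exact Or.inl fun h => hlater k _ h u h3 h4 h5
    · rw [hevc k i hk]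
      exact crash_enabled hA _ _
  -- Only the states at crashed locations may deviate from the tree.
  have hrel : ∀ k, (∀ i ∉ S k, σ k (.proc i) = (c (J k)).1 (.proc i) ∧
      σ k (.env i) = (c (J k)).1 (.env i)) ∧ ∀ d, σ k (.chan d) = (c (J k)).1 (.chan d) := by
    intro k
    induction k with
    | zero =>
      rw [hJ0]
      exact ⟨fun i _ => ⟨rfl, rfl⟩, fun d => rfl⟩
    | succ k ih =>
      have htr := hσ k (hen k ih.1 ih.2)
      rcases hk : κ k with _ | i
      · rw [heva k hk] at htr
        rw [(hac k hk).1, (hac k hk).2]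
        exact agree_step hA ih.1 ih.2 (hp.step (J k)).trans htr
      · rw [hevc k i hk] at htr
        obtain ⟨-, -, -, h1, h2⟩ := hcr k i hk
        rw [h1, h2]
        have same : ∀ d, (SysAct.crash i : SysAct D (consensus n f) M X Empty) ∉
            (component A (consensusEnv n f) d).acts → σ (k + 1) d = σ k d := by
          intro d hd
          rcases htr.2 d with ⟨h, -⟩ | ⟨-, h⟩
          · exact absurd h hd
          · exact h
        refine ⟨fun i' hi' => ?_, fun d => ?_⟩
        · have hne : i ≠ i' := fun h => hi' (Or.inl h.symm)
          have hn : i' ∉ S k := fun h => hi' (Or.inr h)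
          exact ⟨(same (.proc i') fun h => hne (hA.loc_eq h)).trans (ih.1 i' hn).1,
            (same (.env i') fun h => hne ((consensusEnv_envLocal n f).loc_eq h)).trans
              (ih.1 i' hn).2⟩
        · exact (same (.chan d) (notMem_chan_acts (by simp) (by simp))).trans (ih.2 d)
  have htrans : ∀ k, (system A (consensusEnv n f)).trans (σ k) (ev k) (σ (k + 1)) :=
    fun k => hσ k (hen k (hrel k).1 (hrel k).2)
  -- Finite runs of the processes, to which `crash_disables` can be applied after a crash.
  have hrun : ∀ i k, ∃ l, (A i).Run l (σ k (.proc i)) ∧ (i ∈ S k → .crash i ∈ l) := by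
    intro i k
    induction k with
    | zero => exact ⟨[], Automaton.Run.nil _ (hp.start (.proc i)), by simp [hS0]⟩
    | succ k ih =>
      obtain ⟨l, h1, h2⟩ := ih
      obtain ⟨l', h3, h4⟩ := proc_run_step (htrans k) h1
      refine ⟨l ++ l', h3, fun hi => ?_⟩
      rcases hk : κ k with _ | i'
      · rw [(hac k hk).2] at hi
        exact List.mem_append_left _ (h2 hi)
      · rw [(hcr k i' hk).2.2.2.2] at hi
        rcases hi with rfl | hi
        · refine List.mem_append_right _ (h4 (hevc k i hk) ?_)
          rw [hevc k i hk]
          refine (mem_proc_acts (b := .crash i)).2 (Or.inl (Or.inl ?_))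
          rw [hA.input_eq]
          exact Or.inl rfl
        · exact List.mem_append_left _ (h2 hi)
  have hmono_env : ∀ k, ∀ i ∈ S k, envStop (σ k) i = true := by
    intro k i hi
    obtain ⟨k', hk', h⟩ := hScr k i hi
    have h1 : envStop (σ (k' + 1)) i = true := by
      rcases env_step (htrans k') i with ⟨-, h'⟩ | ⟨b, -, -, h'⟩ | ⟨h', -⟩
      · exact h'
      · exact h'
      · exact absurd (hevc k' i h) h'
    have : ∀ m ≥ k' + 1, envStop (σ m) i = true := by
      intro m hm
      induction m, hm using Nat.le_induction with
      | base => exact h1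
      | succ m hm ih => exact envStop_mono (htrans m) ih
    exact this k hk'
  -- the execution
  let gcr : SysAct D (consensus n f) M X Empty → Option (Fin n) := fun
    | .crash i => some i
    | _ => none
  have hgcr : ∀ b, gcr b = none ↔ ∀ i, b ≠ .crash i := by
    intro b
    cases b <;> simp [gcr]
  obtain ⟨r, hr1, hr2, hr3⟩ := exists_crashStates ev gcr (B := B) (fun k hk => by
    rw [hgcr, heva k (hB k hk).2]
    exact (hp.step _).ne_crash hA)
  let x : (fullSystem A (consensusEnv n f)).Execution :=
    { events := ofFun ev
      state := fun k => mkState (σ k) (r k)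
      state_zero := by
        rintro (_ | d)
        · exact Set.mem_univ _
        · exact hp.start d
      step := by
        rintro k b hb
        cases hb
        refine (fullSystem_trans_iff hA).2 ⟨htrans k, fun i hi => ?_, fun h => ?_⟩
        · exact hr1 k i (by rw [hi])
        · exact hr2 k ((hgcr _).2 h) }
  have hmem : ∀ k, (∃ i, ev k = .crash i) ∨ ∃ j, ev k = a j := by
    intro k
    rcases hk : κ k with _ | i
    · exact Or.inr ⟨_, heva k hk⟩
    · exact Or.inl ⟨i, hevc k i hk⟩
  have hhit : ∀ j, ∃ k ≥ j, κ k = none ∧ J k = j ∧ ev k = a j := by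
    intro j
    obtain ⟨k, h1, h2, h3⟩ := hJ j
    exact ⟨k, h1, h2, h3, by rw [heva k h2, h3]⟩
  have hasD : ∀ k b, SysAct.asD (ev k) = some b →
      (∃ i, κ k = some i ∧ b = Event.crash i) ∨
      ∃ u ∈ G.V, κ k = none ∧ a (J k) = .fd u.act ∧ (c (J k + 1)).2 = some u ∧
        G.Succ (c (J k)).2 u ∧ b = Event.out u.act := by
    intro k b hb
    rcases hk : κ k with _ | i
    · rw [heva k hk] at hb
      right
      rcases (hp.step (J k)).cases_act with ⟨u, h1, h2, h3, -⟩ | ⟨-, h2, h3, -⟩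
      · rw [h1] at hb
        cases hb
        exact ⟨u, h3.1, rfl, h1, h2, h3, rfl⟩
      · obtain ⟨-, h4, h5, -⟩ := labelActs_cases hA h2 h3.1
        exfalso
        revert hb h4 h5
        cases a (J k) <;> simp [SysAct.asD]
    · rw [hevc k i hk] at hb
      cases hb
      exact Or.inl ⟨i, rfl, rfl⟩
  -- Positions in `t`. When the event is the output in a vertex `u`, the time after it is `pos u +
  -- 1`, which explains the subtraction; at events that do not belong to `D` the value is
  -- irrelevant.
  let ψ : ℕ → ℕ := fun k => match κ k with
    | some i => cp i
    | none => N (J k + 1) - 1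
  have hψc : ∀ {k i}, κ k = some i → ψ k = cp i := fun h => by simp only [ψ, h]
  have hψa : ∀ {k u}, κ k = none → (c (J k + 1)).2 = some u → ψ k = pos u := fun h h' => by
    simp only [ψ, h, hfdN h', Nat.add_sub_cancel]
  have hψget : ∀ k b, SysAct.asD (ev k) = some b → t.get? (ψ k) = some b := by
    intro k b hb
    rcases hasD k b hb with ⟨i, h1, rfl⟩ | ⟨u, h1, h2, -, h4, -, rfl⟩
    · rw [hψc h1]
      exact hcp i (hcr k i h1).1
    · rw [hψa h2 h4]
      exact hG.get u h1
  have hψmono : ∀ k k' b b', k < k' → SysAct.asD (ev k) = some b →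
      SysAct.asD (ev k') = some b' → ψ k < ψ k' := by
    intro k k' b b' hkk hb hb'
    have hg := hψget k b hb
    have hg' := hψget k' b' hb'
    have hj := hJm (Nat.succ_le_of_lt hkk)
    rcases hasD k b hb with ⟨i, h1, rfl⟩ | ⟨u, h1, h2, -, h4, -, rfl⟩
    · have hi : i ∈ S k' := hSm (Nat.succ_le_of_lt hkk) (by
        rw [(hcr k i h1).2.2.2.2]
        exact Or.inl rfl)
      rcases hasD k' b' hb' with ⟨i', h1', rfl⟩ | ⟨u', h1', h2', -, h4', -, rfl⟩
      · rw [hψc h1, hψc h1']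
        exact (hcr k' i' h1').2.2.1 i hi
      · have h5 := (hSF k' i hi).2
        rw [hfdN h4'] at h5
        rw [hψc h1] at hg ⊢
        rw [hψa h2' h4'] at hg' ⊢
        have : cp i ≠ pos u' := fun h => by
          rw [h, hg'] at hg
          cases hg
        omega
    · rw [Nat.succ_eq_add_one, (hac k h2).1] at hj
      have h5 := hN hj
      rw [hfdN h4] at h5
      rw [hψa h2 h4]
      rcases hasD k' b' hb' with ⟨i', h1', rfl⟩ | ⟨u', h1', h2', -, h4', h6', rfl⟩
      · rw [hψc h1']
        have := (hcr k' i' h1').2.1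
        omega
      · rw [hψa h2' h4']
        have : N (J k') < pos u' + 1 := h6'.tagPos_lt hG
        omega
  have hfd : ∀ i ∉ faulty t, ∀ m, ∃ k ≥ m, ∃ o, ev k = .fd o ∧ D.locOut o = i := by
    intro i hi m
    obtain ⟨j, h1, u, h2, h3, -, h4⟩ := hp.exists_fd hi m
    obtain ⟨k, h5, -, -, h6⟩ := hhit j
    exact ⟨k, h1.trans h5, u.act, h6.trans h3, (hG.loc u h4.1).trans h2⟩
  refine ⟨x, ev, rfl, ?_, ?_, hcrash, hmem, fun j => ?_⟩
  · have hinf : ∀ L, ¬ HasLength x.events L := fun L hL =>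
      lt_irrefl L ((hL L).1 rfl)
    have hJB : ∀ m, ∃ k ≥ m, k ≥ B := fun m => ⟨max m B, le_max_left _ _, le_max_right _ _⟩
    -- fairness to a label at a location that does not crash, or of a channel
    have key : ∀ l : Label n, ((∃ d, l = .chan d) ∨ l.loc ∉ faulty t) → (∀ i, l ≠ .fd i) →
        (∀ m, ∃ k ≥ m, ∃ b ∈ labelActs A l, x.events.get? k = some b) ∨
        ∀ m, ∃ k ≥ m, ∀ b ∈ labelActs A l,
          ¬ (fullSystem A (consensusEnv n f)).Enabled (x.state k) b := by
      intro l hl hl'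
      by_cases h : ∀ m, ∃ k ≥ m, (e k).1 = l
      · left
        intro m
        obtain ⟨j, h1, h2⟩ := h m
        obtain ⟨k, h3, -, -, h4⟩ := hhit j
        refine ⟨k, h1.trans h3, a j, ?_, by rw [← h4]; rfl⟩
        rcases (hp.step j).cases_act with ⟨u, -, -, -, h5⟩ | ⟨-, -, h5, -⟩
        · rw [h5] at h2
          exact absurd h2.symm (hl' _)
        · rw [← h2]
          exact h5.1
      · right
        push Not at h
        obtain ⟨m₀, hm₀⟩ := h
        intro m
        obtain ⟨j, h1, h2 | ⟨-, h2⟩⟩ := hp.fair l hl (max m m₀)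
        · exact absurd h2 (hm₀ j ((le_max_right _ _).trans h1))
        · obtain ⟨k, h3, h4, h5, -⟩ := hhit j
          refine ⟨k, (le_max_left _ _).trans (h1.trans h3), fun b hb hen' => ?_⟩
          obtain ⟨h6, h7, -, h8⟩ := labelActs_cases hA hl' hb
          have h9 := (fullSystem_enabled_iff hA h7).1 hen'
          rcases h8 with ⟨d, rfl, m', rfl⟩ | ⟨h8, -⟩
          · refine h2 _ hb ((recv_enabled_iff hA _ _ _).2 ?_)
            obtain ⟨q, hq⟩ := (recv_enabled_iff hA _ _ _).1 h9
            have h10 := (hrel k).2 d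
            rw [h5] at h10
            exact ⟨q, h10.symm.trans hq⟩
          · refine h2 b hb ?_
            have hn : b.loc ∉ S k := by
              rcases hl with ⟨d, rfl⟩ | hl
              · exact absurd rfl (h8 d)
              · rw [h6]
                exact fun h => hl (hSF k _ h).1
            have h10 := hrel k
            rw [h5] at h10
            exact enabled_of_agree hA (S := S k) (fun i hi => ⟨(h10.1 i hi).1.symm,
              (h10.1 i hi).2.symm⟩) (fun d => (h10.2 d).symm) (Or.inl hn) h9
    -- From `B` on the crash schedule is empty, and the tasks of faulty locations are disabled. The
    -- tasks of channels and live locations inherit fairness from the path by `key`.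
    rintro ⟨_ | (i | i | d), T⟩
    · refine ⟨fun L hL => absurd hL (hinf L), fun _ => Or.inr fun m => ?_⟩
      obtain ⟨k, h1, h2⟩ := hJB m
      refine ⟨k, h1, ?_⟩
      rintro ⟨b, ⟨i, rfl⟩, S', hS'⟩
      have h3 := ((fullSystem_trans_iff hA).1 hS').2.1 i rfl
      change r k = _ at h3
      rw [hr3 k h2] at h3
      exact absurd h3.symm (Stream'.Seq.cons_ne_nil)
    · refine ⟨fun L hL => absurd hL (hinf L), fun _ => ?_⟩
      have htask : ∀ b, b ∈ (fullSystem A (consensusEnv n f)).task ⟨some (.proc i), T⟩ ↔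
          b ∈ labelActs A (.proc i) := by
        intro b
        constructor
        · rintro ⟨b', h, rfl⟩
          exact ⟨b', (hA.wellFormed i).task_local T h, rfl⟩
        · rintro ⟨b', h, rfl⟩
          obtain ⟨T', h1, -⟩ := (hA.wellFormed i).task_unique b' h
          have : T' = T := (hA.deterministic i).one_task.unique trivial trivial
          exact ⟨b', this ▸ h1, rfl⟩
      by_cases hi : i ∈ faulty t
      · right
        intro m
        obtain ⟨k, h1, h2⟩ := hJB m
        refine ⟨k, h1, ?_⟩
        rintro ⟨b, hb, hen'⟩
        obtain ⟨b', hb', rfl⟩ := (htask b).1 hb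
        obtain ⟨h6, h7, -, -⟩ := labelActs_cases hA (l := .proc i) (by simp) ((htask _).1 hb)
        have h8 := (fullSystem_enabled_iff hA h7).1 hen'
        obtain ⟨l, hl1, hl2⟩ := hrun i k
        refine (hA.crash_disables i).not_enabled hl1 (hl2 ((hB k h2).1.symm ▸ hi)) b' hb' ?_
        refine ((A i).rename_enabled ProcAct.toSys_injective _ _).1
          (((Automaton.compose_enabled_iff _ _ _).1 h8).2 (.proc i) (mem_proc_acts.2 ?_))
        rcases hb' with hb' | hb'
        · exact Or.inl (Or.inr hb')
        · exact Or.inr hb'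
      · rcases key (.proc i) (Or.inr hi) (by simp) with h | h
        · left
          intro m
          obtain ⟨k, h1, b, h2, h3⟩ := h m
          exact ⟨k, h1, b, (htask b).2 h2, h3⟩
        · right
          intro m
          obtain ⟨k, h1, h2⟩ := h m
          exact ⟨k, h1, fun ⟨b, hb, hen'⟩ => h2 b ((htask b).1 hb) hen'⟩
    · refine ⟨fun L hL => absurd hL (hinf L), fun _ => ?_⟩
      have htask : ∀ b, b ∈ (fullSystem A (consensusEnv n f)).task ⟨some (.env i), T⟩ ↔
          b ∈ labelActs A (.env i T) := by
        intro b
        constructor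
        · rintro ⟨b', h, rfl⟩
          rw [Set.mem_singleton_iff.1 h]
          exact rfl
        · intro h
          rw [Set.mem_singleton_iff.1 h]
          exact ⟨.pin (T, i), rfl, rfl⟩
      by_cases hi : i ∈ faulty t
      · right
        intro m
        obtain ⟨k, h1, h2⟩ := hJB m
        refine ⟨k, h1, ?_⟩
        rintro ⟨b, hb, hen'⟩
        have hb' : b = .pin (T, i) := (htask b).1 hb
        subst hb'
        obtain ⟨s', hs'⟩ := (fullSystem_enabled_iff hA (by simp)).1 hen'
        have h3 := hmono_env k i ((hB k h2).1.symm ▸ hi)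
        rcases env_step hs' i with ⟨h, -⟩ | ⟨b, -, h, -⟩ | ⟨-, h, -⟩
        · cases h
        · change envStop (σ k) i = false at h
          rw [h3] at h
          cases h
        · exact h T rfl
      · rcases key (.env i T) (Or.inr hi) (by simp) with h | h
        · left
          intro m
          obtain ⟨k, h1, b, h2, h3⟩ := h m
          exact ⟨k, h1, b, (htask b).2 h2, h3⟩
        · right
          intro m
          obtain ⟨k, h1, h2⟩ := h m
          exact ⟨k, h1, fun ⟨b, hb, hen'⟩ => h2 b ((htask b).1 hb) hen'⟩
    · refine ⟨fun L hL => absurd hL (hinf L), fun _ => ?_⟩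
      rcases key (.chan d) (Or.inl ⟨d, rfl⟩) (by simp) with h | h
      · exact Or.inl h
      · right
        intro m
        obtain ⟨k, h1, h2⟩ := h m
        exact ⟨k, h1, fun ⟨b, hb, hen'⟩ => h2 b hb hen'⟩
  -- Here strong sampling is indispensable: the path may skip outputs at live locations, so the
  -- events of `D` need not form a sampling of `t`, only a valid subsequence.
  · refine hD.strongSampling t ht _ (exists_embedding_proj (ψ := ψ) (fun m => ?_) hψmono hψget) ?_
    · obtain ⟨k, hk, o, ho, -⟩ := hfd i₀ hi₀ m
      exact ⟨k, hk, Event.out o, by rw [ho]; rfl⟩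
    · unfold proj
      refine valid_select_iff.2 ⟨fun k m i o b b' hkm hb hgb hb' hgb' => ?_, fun i hi m => ?_⟩
      · cases hb
        cases hb'
        exact hval.1 _ _ i o (hψmono k m _ _ hkm hgb hgb') (hψget k _ hgb) (hψget m _ hgb')
      · have hi' : i ∉ faulty t := fun h => by
          obtain ⟨k, hk⟩ := (hcrash i).2 h
          exact hi k _ rfl (by rw [hk]; rfl)
        obtain ⟨k, hk, o, ho, hl⟩ := hfd i hi' m
        exact ⟨k, hk, _, o, rfl, by rw [ho]; rfl, hl⟩
  · obtain ⟨k, -, -, -, h⟩ := hhit j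
    exact ⟨k, h⟩

/-- Agreement, validity and termination are transported from the execution back to the path. The
hypothesis `F = faulty t` with at most `f` elements, and well-formedness of the proposals, make the
consensus specification applicable. -/
theorem FairPath.decides (hf : f < n) (hD : D.IsStrongSamplingAFD)
    (hA : Solves D (consensus n f) A (consensusEnv n f))
    {t : Stream'.Seq D.Ev} (ht : t ∈ D.traces) (hF : (faulty t).ncard ≤ f)
    {pos : Vertex n D.Out → ℕ} (hG : TraceGraph t G pos) {c : ℕ → Cfg A}
    {e : ℕ → Label n × Option (Vertex n D.Out)} {a : ℕ → SysAct D (consensus n f) M X Empty}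
    (hp : FairPath A G (faulty t) c e a) :
    (∃ k b i, a k = .pout (b, i)) ∧
    (∀ k k' b b' i i', a k = .pout (b, i) → a k' = .pout (b', i') → b = b') ∧
    ∀ k b i, a k = .pout (b, i) → ∃ k' j, a k' = .pin (b, j) := by
  have hlive : ∃ i, i ∉ faulty t := by
    by_contra h
    push Not at h
    rw [Set.eq_univ_of_forall h, Set.ncard_univ, Nat.card_eq_fintype_card, Fintype.card_fin] at hF
    omega
  obtain ⟨x, ev, hx, hfair, hDt, hcr, hmem, hhit⟩ := hp.exists_execution hD hA.1 ht hlive hG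
  have hP := hA.2 x hfair hDt
  rw [hx] at hP
  have hget : ∀ {m b}, (proj SysAct.asP (ofFun ev)).get? m = some b →
      ∃ k, SysAct.asP (ev k) = some b ∧ selPos (fun _ => SysAct.asP) (ofFun ev) k = m := by
    intro m b h
    obtain ⟨k, a, ha, hb, hk⟩ := proj_get?_eq_some.1 h
    cases ha
    exact ⟨k, hb, hk⟩
  have hput : ∀ {k b}, SysAct.asP (ev k) = some b →
      (proj SysAct.asP (ofFun ev)).get? (selPos (fun _ => SysAct.asP) (ofFun ev) k) = some b :=
    fun h => select_get?_selPos rfl h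
  have hpin : ∀ {a : SysAct D (consensus n f) M X Empty} {b}, SysAct.asP a = some (.inp b) ↔
      a = .pin b := by
    intro a b
    cases a <;> simp [SysAct.asP]
  have hpout : ∀ {a : SysAct D (consensus n f) M X Empty} {b}, SysAct.asP a = some (.out b) ↔
      a = .pout b := by
    intro a b
    cases a <;> simp [SysAct.asP]
  have hpcr : ∀ {a : SysAct D (consensus n f) M X Empty} {i}, SysAct.asP a = some (.crash i) ↔
      a = .crash i := by
    intro a b
    cases a <;> simp [SysAct.asP]
  have hfa : faulty (proj SysAct.asP (ofFun ev)) = faulty t := by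
    ext i
    rw [← hcr i]
    unfold proj
    rw [mem_faulty_select]
    constructor
    · rintro ⟨k, a, ha, hb⟩
      cases ha
      exact ⟨k, hpcr.1 hb⟩
    · rintro ⟨k, hk⟩
      exact ⟨k, _, rfl, hpcr.2 hk⟩
  have htr : ∀ k, (system A (consensusEnv n f)).trans (sysState (x.state k)) (ev k)
      (sysState (x.state (k + 1))) := fun k =>
    ((fullSystem_trans_iff hA.1).1 (x.step k (ev k) (by rw [hx]; rfl))).1
  have hmono_env : ∀ {k k' i}, k ≤ k' → envStop (sysState (x.state k)) i = true →
      envStop (sysState (x.state k')) i = true := by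
    intro k k' i hk h
    induction k', hk using Nat.le_induction with
    | base => exact h
    | succ m hm ih => exact envStop_mono (htr m) ih
  have hsp : ∀ {k b i}, ev k = .pin (b, i) → envStop (sysState (x.state k)) i = false ∧
      envStop (sysState (x.state (k + 1))) i = true := by
    intro k b i h
    rcases env_step (htr k) i with ⟨h', -⟩ | ⟨b, -, h'⟩ | ⟨-, h', -⟩
    · rw [h] at h'
      cases h'
    · exact h'
    · exact absurd h (h' b)
  have hnot : ∀ {k k' b i}, k < k' → envStop (sysState (x.state (k + 1))) i = true →
      ev k' ≠ .pin (b, i) := by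
    intro k k' b i hk h h'
    have h1 := hmono_env (Nat.succ_le_of_lt hk) h
    rw [(hsp h').1] at h1
    cases h1
  have hwf : EnvWellFormed (proj SysAct.asP (ofFun ev)) := by
    refine ⟨fun i k m v w hk hm => ?_, fun i k m v hkm hk hm => ?_, fun i hi => ?_⟩
    · obtain ⟨k, h1, rfl⟩ := hget hk
      obtain ⟨m, h2, rfl⟩ := hget hm
      rcases lt_trichotomy k m with h | rfl | h
      · exact absurd (hpin.1 h2) (hnot h (hsp (hpin.1 h1)).2)
      · rfl
      · exact absurd (hpin.1 h1) (hnot h (hsp (hpin.1 h2)).2)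
    · obtain ⟨k, h1, rfl⟩ := hget hk
      obtain ⟨m, h2, rfl⟩ := hget hm
      refine absurd (hpin.1 h2) (hnot (lt_of_selPos_lt hkm) ?_)
      rcases env_step (htr k) i with ⟨-, h'⟩ | ⟨b, -, -, h'⟩ | ⟨h', -⟩
      · exact h'
      · exact h'
      · exact absurd (hpcr.1 h1) h'
    · rw [hfa] at hi
      by_contra hno
      have hno' : ∀ k b, a k ≠ .pin (b, i) := by
        intro j b h
        obtain ⟨k, hk⟩ := hhit j
        exact hno ⟨_, b, hput (hpin.2 (hk.trans h))⟩
      -- If `i` never proposed, both proposals would remain enabled along the whole path, and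
      -- fairness to one of them would enforce it.
      have hst : ∀ k, envStop (c k).1 i = false := by
        intro k
        induction k with
        | zero => exact hp.start (.env i)
        | succ k ih =>
          rcases env_step (hp.step k).trans i with ⟨h', -⟩ | ⟨b, h', -⟩ | ⟨-, -, h'⟩
          · exact absurd h' ((hp.step k).ne_crash hA.1 i)
          · exact absurd h' (hno' k b)
          · rw [h', ih]
      obtain ⟨k, -, h | ⟨-, h⟩⟩ := hp.fair (.env i false) (Or.inr hi) 0
      · rcases (hp.step k).cases_act with ⟨u, -, -, -, h5⟩ | ⟨-, -, h5, -⟩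
        · rw [h5] at h
          cases h
        · rw [h] at h5
          exact hno' k false h5.1
      · exact h (.pin (false, i)) rfl (pin_enabled hA.1 (hst k) false)
  obtain ⟨-, hag, hvd, -, htm⟩ := hP ⟨hwf, by rw [hfa]; exact hF⟩
  have hout : ∀ k b i, a k = .pout (b, i) → ∃ m, ev m = .pout (b, i) := by
    intro k b i h
    obtain ⟨m, hm⟩ := hhit k
    exact ⟨m, hm.trans h⟩
  have hback : ∀ m (b : SysAct D (consensus n f) M X Empty), (∀ i, b ≠ .crash i) → ev m = b →
      ∃ k, a k = b := by
    intro m b hb h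
    rcases hmem m with ⟨i, h'⟩ | ⟨k, h'⟩
    · exact absurd (h.symm.trans h') (hb i)
    · exact ⟨k, h'.symm.trans h⟩
  refine ⟨?_, fun k k' b b' i i' h h' => ?_, fun k b i h => ?_⟩
  · obtain ⟨i, hi⟩ := hlive
    obtain ⟨k, v, hk⟩ := htm i (hfa ▸ hi)
    obtain ⟨m, hm, -⟩ := hget hk
    obtain ⟨k, hk⟩ := hback m _ (by simp) (hpout.1 hm)
    exact ⟨k, v, i, hk⟩
  · obtain ⟨m, hm⟩ := hout k b i h
    obtain ⟨m', hm'⟩ := hout k' b' i' h'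
    exact hag _ _ _ _ _ _ (hput (hpout.2 hm)) (hput (hpout.2 hm'))
  · obtain ⟨m, hm⟩ := hout k b i h
    obtain ⟨j, m', hm'⟩ := hvd _ _ _ (hput (hpout.2 hm))
    obtain ⟨m'', h1, -⟩ := hget hm'
    obtain ⟨k', hk'⟩ := hback m'' _ (by simp) (hpin.1 h1)
    exact ⟨k', j, hk'⟩

end FairPaths

/-! ### Construction of fair paths -/

section PathConstruction

variable {n f : ℕ} {D : CrashProblem n} {M X : Type}
  {A : Fin n → Automaton (ProcAct D (consensus n f) M X)} {G : Graph n D.Out}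

theorem exists_label_enumeration [Nonempty (Label n)] :
    ∃ g : ℕ → Label n, ∀ l m, ∃ k ≥ m, g k = l := by
  let φ : Label n → (Fin n ⊕ (Fin n × Bool)) ⊕ (Link n ⊕ Fin n) := fun
    | .proc i => Sum.inl (Sum.inl i)
    | .env i b => Sum.inl (Sum.inr (i, b))
    | .chan c => Sum.inr (Sum.inl c)
    | .fd i => Sum.inr (Sum.inr i)
  have hφ : Function.Injective φ := by
    intro a b h
    cases a <;> cases b <;> simp_all [φ]
  have : Finite (Label n) := Finite.of_injective φ hφ
  obtain ⟨g, hg⟩ := exists_surjective_nat (Label n)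
  -- The second component of the pair is a dummy counter that makes every label recur.
  refine ⟨fun k => g (Nat.unpair k).1, fun l m => ?_⟩
  obtain ⟨j, rfl⟩ := hg l
  exact ⟨Nat.pair j m, Nat.right_le_pair j m, by simp⟩

/-- The label `l` is dealt with between the nodes `p` and `p'`. -/
def Handled (A : Fin n → Automaton (ProcAct D (consensus n f) M X)) (G : Graph n D.Out)
    (l : Label n) (p p' : Path n D.Out) : Prop :=
  (∃ q w, p <+: q ∧ q ++ [(l, w)] <+: p') ∨
    ((∀ i, l ≠ .fd i) ∧ ∃ q t s v, p <+: q ∧ q <+: p' ∧ IsNode A G q t s v ∧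
      EnabledTag A s l none)

theorem IsNonBot.of_prefix {p q : Path n D.Out} (h : p <+: q) (hq : IsNonBot A G q) :
    IsNonBot A G p := by
  obtain ⟨r, rfl⟩ := h
  obtain ⟨t, s, v, hn, ht⟩ := hq
  obtain ⟨t₁, t₂, s₁, v₁, h1, -, rfl⟩ := hn.split
  exact ⟨t₁, s₁, v₁, h1, fun h => ht (List.mem_append_left _ h)⟩

/-- Round robin: stage `m` deals with the `m`-th label of an enumeration in which each label recurs,
and every stage lengthens the path. `Q` holds at the ends of stages only, but absence of `⊥` passes
to all prefixes, so the limit is a fair path. -/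
theorem exists_fairPath (hA : IsDistributedAlgorithm A) {F : Set (Fin n)}
    {Q : Path n D.Out → Prop} (hQ : ∀ p, Q p → IsNonBot A G p)
    (hext : ∀ p, Q p → ∀ l : Label n, ((∃ d, l = .chan d) ∨ l.loc ∉ F) →
      ∃ p', Q p' ∧ p <+: p' ∧ p.length < p'.length ∧ Handled A G l p p')
    (hF : ∃ i, i ∉ F) {p₀ : Path n D.Out} (hp₀ : Q p₀) :
    ∃ c e a, FairPath A G F c e a ∧ (∀ m, ∃ k ≥ m, Q ((List.range k).map e)) ∧
      p₀ = (List.range p₀.length).map e ∧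
      ∀ k, IsNode A G ((List.range k).map e) ((List.range k).map fun j => some (a j))
        (c k).1 (c k).2 := by
  obtain ⟨i₀, hi₀⟩ := hF
  have : Nonempty (Label n) := ⟨.proc i₀⟩
  obtain ⟨g, hg⟩ := exists_label_enumeration (n := n)
  obtain ⟨st, -, hst0, hst⟩ := exists_iterate (σ := ℕ × {p // Q p}) (ε := Unit)
    (fun s _ s' => s'.1 = s.1 + 1 ∧ s.2.1 <+: s'.2.1 ∧ s.2.1.length < s'.2.1.length ∧
      (((∃ d, g s.1 = .chan d) ∨ (g s.1).loc ∉ F) → Handled A G (g s.1) s.2.1 s'.2.1))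
    (by
      rintro ⟨m, p, hp⟩
      by_cases h : (∃ d, g m = .chan d) ∨ (g m).loc ∉ F
      · obtain ⟨p', h1, h2, h3, h4⟩ := hext p hp (g m) h
        exact ⟨(), (m + 1, ⟨p', h1⟩), rfl, h2, h3, fun _ => h4⟩
      · obtain ⟨p', h1, h2, h3, -⟩ := hext p hp (.proc i₀) (Or.inr hi₀)
        exact ⟨(), (m + 1, ⟨p', h1⟩), rfl, h2, h3, fun h' => absurd h' h⟩) (0, ⟨p₀, hp₀⟩)
  let P : ℕ → Path n D.Out := fun m => (st m).2.1
  have hP0 : P 0 = p₀ := by simp only [P, hst0]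
  have hst1 : ∀ m, (st m).1 = m := by
    intro m
    induction m with
    | zero => rw [hst0]
    | succ m ih => rw [(hst m).1, ih]
  have hPQ : ∀ m, Q (P m) := fun m => (st m).2.2
  have hpre : ∀ {m m'}, m ≤ m' → P m <+: P m' := by
    intro m m' h
    induction m', h using Nat.le_induction with
    | base => exact List.prefix_rfl
    | succ m' h ih => exact ih.trans (hst m').2.1
  have hlen : ∀ m, m ≤ (P m).length := by
    intro m
    induction m with
    | zero => exact Nat.zero_le _
    | succ m ih => exact Nat.succ_le_of_lt (lt_of_le_of_lt ih (hst m).2.2.1)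
  have hex : ∀ k, ∃ e, (P (k + 1))[k]? = some e := fun k =>
    ⟨_, List.getElem?_eq_getElem (lt_of_lt_of_le (Nat.lt_succ_self k) (hlen (k + 1)))⟩
  choose e he using hex
  have heP : ∀ m k, k < (P m).length → (P m)[k]? = some (e k) := by
    intro m k hk
    rcases le_total m (k + 1) with h | h
    · obtain ⟨r, hr⟩ := hpre h
      have := he k
      rw [← hr, List.getElem?_append_left hk] at this
      exact this
    · obtain ⟨r, hr⟩ := hpre h
      rw [← hr, List.getElem?_append_left (lt_of_lt_of_le (Nat.lt_succ_self k) (hlen (k + 1)))]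
      exact he k
  have hpref : ∀ m q, q <+: P m → q = (List.range q.length).map e := by
    intro m q hq
    refine List.ext_getElem? fun k => ?_
    rcases lt_or_ge k q.length with hk | hk
    · obtain ⟨r, hr⟩ := hq
      have h1 := heP m k (by rw [← hr, List.length_append]; omega)
      rw [← hr, List.getElem?_append_left hk] at h1
      rw [h1]
      simp [hk]
    · rw [List.getElem?_eq_none hk, List.getElem?_eq_none (by simpa using hk)]
  have htake : ∀ k, (List.range k).map e <+: P k := by
    intro k
    have h := hpref k ((P k).take k) (List.take_prefix _ _)
    rw [List.length_take, min_eq_left (hlen k)] at h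
    rw [← h]
    exact List.take_prefix _ _
  have hnode : ∀ k, ∃ (t : List (Option (SysAct D (consensus n f) M X Empty))) (c : Cfg A),
      IsNode A G ((List.range k).map e) t c.1 c.2 ∧ none ∉ t := by
    intro k
    obtain ⟨t, s, v, h, h'⟩ := (hQ _ (hPQ k)).of_prefix (htake k)
    exact ⟨t, (s, v), h, h'⟩
  choose t c hc ht using hnode
  have hsucc : ∀ k, ∃ a, t (k + 1) = t k ++ [some a] ∧
      Step A G (c k) (e k) (some a) (c (k + 1)) := by
    intro k
    have h1 := hc (k + 1)
    rw [List.range_succ, List.map_append] at h1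
    obtain ⟨t₁, t₂, s₁, v₁, h2, h3, h4⟩ := h1.split
    obtain ⟨rfl, rfl, rfl⟩ := (hc k).unique hA h2
    obtain ⟨_ | a, rfl, h5⟩ := walk_single.1 h3
    · exact absurd (by rw [h4]; simp) (ht (k + 1))
    · exact ⟨a, h4, h5⟩
  choose a hta hstep using hsucc
  have htm : ∀ k, t k = (List.range k).map fun j => some (a j) := by
    intro k
    induction k with
    | zero =>
      obtain ⟨-, s₀, -, h⟩ := isNode_iff.1 (hc 0)
      exact h.1
    | succ k ih => rw [hta, ih, List.range_succ, List.map_append]; rfl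
  have hroot : (c 0).1 ∈ (system A (consensusEnv n f)).start ∧ (c 0).2 = none := by
    obtain ⟨-, s₀, h0, h⟩ := isNode_iff.1 (hc 0)
    have : c 0 = (s₀, none) := h.2
    rw [this]
    exact ⟨h0, rfl⟩
  refine ⟨c, e, a, ⟨hroot.1, hroot.2, hstep, fun l hl m => ?_⟩, fun m => ?_, ?_, fun k => ?_⟩
  · obtain ⟨m', hm', rfl⟩ := hg l m
    have h1 := (hst m').2.2.2
    rw [hst1 m'] at h1
    rcases h1 hl with ⟨q, w, h2, h3⟩ | ⟨h2, q, t', s, v, h3, h4, h5, h6⟩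
    · refine ⟨q.length, hm'.trans ((hlen m').trans h2.length_le), Or.inl ?_⟩
      have h4 := hpref (m' + 1) _ h3
      have h5 := congrArg (fun l => l[q.length]?) h4
      simp at h5
      rw [← h5]
    · refine ⟨q.length, hm'.trans ((hlen m').trans h3.length_le), Or.inr ⟨h2, ?_⟩⟩
      rw [hpref (m' + 1) q h4] at h5
      obtain ⟨-, rfl, -⟩ := (hc q.length).unique hA h5
      exact h6
  · exact ⟨(P m).length, hlen m, by rw [← hpref m _ List.prefix_rfl]; exact hPQ m⟩
  · exact hpref 0 p₀ (by rw [hP0])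
  · rw [← htm]
    exact hc k

end PathConstruction

/-! ### Decision gadgets exist -/

section Gadgets

variable {n f : ℕ} {D : CrashProblem n} {M X : Type}
  {A : Fin n → Automaton (ProcAct D (consensus n f) M X)} {G : Graph n D.Out}
  {t : Stream'.Seq D.Ev} {pos : Vertex n D.Out → ℕ}

/-- `A` solves consensus using `D`, and `G` is a graph of the outputs in a trace of `D` with at most
`f` faulty locations. -/
structure ConsensusSetting (A : Fin n → Automaton (ProcAct D (consensus n f) M X))
    (G : Graph n D.Out) (t : Stream'.Seq D.Ev) (pos : Vertex n D.Out → ℕ) : Prop where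
  lt : f < n
  afd : D.IsStrongSamplingAFD
  solves : Solves D (consensus n f) A (consensusEnv n f)
  mem : t ∈ D.traces
  faulty_le : (faulty t).ncard ≤ f
  graph : TraceGraph t G pos

theorem exists_notMem_of_ncard_le {F : Set (Fin n)} (hF : F.ncard ≤ f) (hf : f < n) :
    ∃ i, i ∉ F := by
  by_contra h
  push Not at h
  rw [Set.eq_univ_of_forall h, Set.ncard_univ, Nat.card_eq_fintype_card, Fintype.card_fin] at hF
  omega

theorem ConsensusSetting.alg (h : ConsensusSetting A G t pos) : IsDistributedAlgorithm A :=
  h.solves.1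

theorem ConsensusSetting.exists_live (h : ConsensusSetting A G t pos) : ∃ i, i ∉ faulty t :=
  exists_notMem_of_ncard_le h.faulty_le h.lt

theorem ConsensusSetting.V_infinite (h : ConsensusSetting A G t pos) : G.V.Infinite :=
  h.graph.V_infinite h.exists_live

/-- The vertex of a tag is in the graph. -/
def TagMem (G : Graph n D.Out) (v : Option (Vertex n D.Out)) : Prop := ∀ x, v = some x → x ∈ G.V

theorem IsEdge.tagMem {v w : Option (Vertex n D.Out)} {l : Label n} (hv : TagMem G v)
    (he : IsEdge G v l w) : TagMem G w := by
  rcases l with i | ⟨i, b⟩ | d | i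
  · cases he
    exact hv
  · cases he
    exact hv
  · cases he
    exact hv
  · rcases he with ⟨u, rfl, -, h⟩ | ⟨-, rfl⟩
    · rintro x ⟨⟩
      exact h.1
    · exact hv

theorem Walk.tagMem {c c' : Cfg A} {p : Path n D.Out}
    {tags : List (Option (SysAct D (consensus n f) M X Empty))} (h : Walk A G c p tags c')
    (hc : TagMem G c.2) : TagMem G c'.2 := by
  induction p generalizing c tags with
  | nil =>
    obtain ⟨-, rfl⟩ := h
    exact hc
  | cons e p ih =>
    obtain ⟨o, d, t', hs, hw, -⟩ := h
    refine ih hw ?_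
    rw [hs.isEdge.2.1]
    exact hs.isEdge.1.tagMem hc

theorem IsNode.tagMem {p : Path n D.Out}
    {tags : List (Option (SysAct D (consensus n f) M X Empty))}
    {s : (system A (consensusEnv n f)).State} {v : Option (Vertex n D.Out)}
    (h : IsNode A G p tags s v) : TagMem G v := by
  obtain ⟨-, s₀, -, hw⟩ := isNode_iff.1 h
  exact hw.tagMem (by rintro x ⟨⟩)

/-- Every vertex tag has late successors at the live locations. -/
theorem ConsensusSetting.exists_succ (h : ConsensusSetting A G t pos) {i : Fin n}
    (hi : i ∉ faulty t) {v v' : Option (Vertex n D.Out)} (hv : TagMem G v) (hv' : TagMem G v')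
    (m : ℕ) : ∃ u, u.loc = i ∧ G.Succ v u ∧ G.Succ v' u ∧ m ≤ pos u := by
  have key : ∀ v, TagMem G v → ∃ m, ∀ w ∈ G.V, w.loc = i → m ≤ pos w → G.Succ v w := by
    rintro (_ | x) hv
    · exact ⟨0, fun w hw _ _ => ⟨hw, by rintro x ⟨⟩⟩⟩
    · obtain ⟨m, hm⟩ := h.graph.late i hi x (hv x rfl)
      exact ⟨m, fun w hw h1 h2 => ⟨hw, by rintro y ⟨⟩; exact hm w hw h1 h2⟩⟩
  obtain ⟨m₁, h₁⟩ := key v hv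
  obtain ⟨m₂, h₂⟩ := key v' hv'
  obtain ⟨w, hw, hl, hm⟩ := h.graph.infinite i hi (max m (max m₁ m₂))
  exact ⟨w, hl, h₁ w hw hl (by omega), h₂ w hw hl (by omega), by omega⟩

theorem ConsensusSetting.hasSucc (h : ConsensusSetting A G t pos) {i : Fin n}
    (hi : i ∉ faulty t) {v : Option (Vertex n D.Out)} (hv : TagMem G v) : G.HasSucc v i := by
  obtain ⟨u, h1, h2, -, -⟩ := h.exists_succ hi hv hv 0
  exact ⟨u, h1, h2⟩

/-- Edges point forward in `pos`, so there are no loops. Taking a successor thus always changes the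
vertex tag, and the action tag is not `⊥`. -/
theorem ConsensusSetting.succ_ne (h : ConsensusSetting A G t pos) {v : Option (Vertex n D.Out)}
    {u : Vertex n D.Out} (hs : G.Succ v u) : some u ≠ v := by
  rintro rfl
  exact lt_irrefl _ (h.graph.edge _ _ (hs.2 u rfl)).2.2

theorem ConsensusSetting.fd_step (h : ConsensusSetting A G t pos) (c : Cfg A)
    {u : Vertex n D.Out} (hs : G.Succ c.2 u) :
    ∃ s', Step A G c (.fd u.loc, some u) (some (.fd u.act)) (s', some u) := by
  obtain ⟨s, v⟩ := c
  obtain ⟨s', hs'⟩ := fd_enabled h.alg s u.act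
  exact ⟨s', Step.act s s' v (some u) (.fd u.loc) _ (Or.inl ⟨u, rfl, rfl, hs⟩)
    (Or.inr ⟨h.succ_ne hs, u, rfl, rfl⟩) hs'⟩

/-- At a label of a live location or of a channel, only disabled tasks have the action tag `⊥`. -/
theorem ConsensusSetting.actionTag_none (h : ConsensusSetting A G t pos)
    {s : (system A (consensusEnv n f)).State} {v w : Option (Vertex n D.Out)} {l : Label n}
    (hl : (∃ d, l = .chan d) ∨ l.loc ∉ faulty t) (hv : TagMem G v) (he : IsEdge G v l w)
    (ha : ActionTag A G s v l w none) : (∀ i, l ≠ .fd i) ∧ EnabledTag A s l none := by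
  rcases l with i | ⟨i, b⟩ | d | i
  · have hi : i ∉ faulty t := hl.resolve_left (by simp)
    refine ⟨by simp, ?_⟩
    rcases ha with ⟨-, ha⟩ | ⟨ha, -⟩
    · exact ha
    · exact absurd (h.hasSucc hi hv) ha
  · have hi : i ∉ faulty t := hl.resolve_left (by simp)
    refine ⟨by simp, ?_⟩
    rcases ha with ⟨-, ha⟩ | ⟨ha, -⟩
    · exact ha
    · exact absurd (h.hasSucc hi hv) ha
  · exact ⟨by simp, ha⟩
  · have hi : i ∉ faulty t := hl.resolve_left (by simp)
    rcases ha with ⟨rfl, -⟩ | ⟨-, u, -, ha⟩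
    · rcases he with ⟨u, rfl, -, h2⟩ | ⟨h1, -⟩
      · exact absurd rfl (h.succ_ne h2)
      · exact absurd (h.hasSucc hi hv) h1
    · cases ha

theorem IsNonBot.inTree {p : Path n D.Out} (h : IsNonBot A G p) : InTree A G p := by
  obtain ⟨t, s, v, h, -⟩ := h
  exact ⟨t, s, v, h⟩

theorem IsNode.concat (h : ConsensusSetting A G t pos) {p : Path n D.Out}
    {tags : List (Option (SysAct D (consensus n f) M X Empty))} {c c' : Cfg A}
    (hp : IsNode A G p tags c.1 c.2) {e : Label n × Option (Vertex n D.Out)}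
    {o : Option (SysAct D (consensus n f) M X Empty)} (hs : Step A G c e o c') :
    IsNode A G (p ++ [e]) (tags ++ [o]) c'.1 c'.2 :=
  hp.append h.V_infinite (walk_single.2 ⟨o, rfl, hs⟩)

/-- Extend a path by a late output at a live location. -/
theorem ConsensusSetting.exists_fd_child (h : ConsensusSetting A G t pos) {i : Fin n}
    (hi : i ∉ faulty t) {p : Path n D.Out}
    {tags : List (Option (SysAct D (consensus n f) M X Empty))} {c : Cfg A}
    (hp : IsNode A G p tags c.1 c.2) : ∃ (u : Vertex n D.Out) (c' : Cfg A), u.loc = i ∧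
      Step A G c (.fd i, some u) (some (.fd u.act)) c' ∧
      IsNode A G (p ++ [(.fd i, some u)]) (tags ++ [some (.fd u.act)]) c'.1 c'.2 := by
  obtain ⟨u, rfl, h2, -, -⟩ := h.exists_succ hi hp.tagMem hp.tagMem 0
  obtain ⟨s', hs'⟩ := h.fd_step c h2
  exact ⟨u, _, rfl, hs', hp.concat h hs'⟩

/-- Paths without `⊥` that avoid the proposals `av` can be extended to fair paths of this kind. -/
theorem ConsensusSetting.extend_avoiding (h : ConsensusSetting A G t pos)
    {av : Option Bool} {p : Path n D.Out}
    (hp : ∃ tags s v, IsNode A G p tags s v ∧ none ∉ tags ∧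
      ∀ b ∈ av, ∀ i, some (SysAct.pin (b, i)) ∉ tags)
    {l : Label n} (hl : (∃ d, l = .chan d) ∨ l.loc ∉ faulty t) :
    ∃ p', (∃ tags s v, IsNode A G p' tags s v ∧ none ∉ tags ∧
      ∀ b ∈ av, ∀ i, some (SysAct.pin (b, i)) ∉ tags) ∧ p <+: p' ∧ p.length < p'.length ∧
      Handled A G l p p' := by
  obtain ⟨i₀, hi₀⟩ := h.exists_live
  obtain ⟨tags, s, v, hn, ht, hav⟩ := hp
  -- it suffices to deal with `l` by a path that may have length 0
  have fin : ∀ (q : Path n D.Out) tags' (c : Cfg A), IsNode A G q tags' c.1 c.2 → none ∉ tags' →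
      (∀ b ∈ av, ∀ i, some (SysAct.pin (b, i)) ∉ tags') → p <+: q → (∀ i, l ≠ .fd i) →
      EnabledTag A c.1 l none →
      ∃ p', (∃ tags s v, IsNode A G p' tags s v ∧ none ∉ tags ∧
      ∀ b ∈ av, ∀ i, some (SysAct.pin (b, i)) ∉ tags) ∧ p <+: p' ∧ p.length < p'.length ∧
      Handled A G l p p' := by
    intro q tags' c hq h1 h2 h3 h4 h5
    obtain ⟨u, c', rfl, h6, h7⟩ := h.exists_fd_child hi₀ hq
    refine ⟨_, ⟨_, _, _, h7, ?_, ?_⟩, h3.trans (List.prefix_append _ _), ?_, Or.inr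
      ⟨h4, q, _, _, _, h3, List.prefix_append _ _, hq, h5⟩⟩
    · simp [h1]
    · intro b hb i
      simp [h2 b hb i]
    · have := h3.length_le
      simp
      omega
  -- For a forbidden proposal the opposite one is made instead, if none was made before. This
  -- disables the task, which satisfies the demand of fairness.
  by_cases hlb : ∃ i b, b ∈ av ∧ l = .env i b
  · obtain ⟨i, b, hb, rfl⟩ := hlb
    have hdis : ∀ s : (system A (consensusEnv n f)).State, envStop s i = true →
        EnabledTag A s (.env i b) none := by
      rintro s hs a ha ⟨s', hs'⟩
      rw [Set.mem_singleton_iff.1 ha] at hs'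
      rcases env_step hs' i with ⟨h, -⟩ | ⟨b, -, h, -⟩ | ⟨-, h, -⟩
      · cases h
      · rw [hs] at h
        cases h
      · exact h b rfl
    cases hst : envStop s i with
    | true => exact fin p tags (s, v) hn ht hav List.prefix_rfl (by simp) (hdis s hst)
    | false =>
      have hi : i ∉ faulty t := hl.resolve_left (by simp)
      obtain ⟨s', hs'⟩ := pin_enabled h.alg hst (!b)
      have hstep : Step A G (s, v) (.env i (!b), v) (some (.pin (!b, i))) (s', v) :=
        Step.act s s' v v _ _ rfl (Or.inl ⟨h.hasSucc hi hn.tagMem, rfl, s', hs'⟩) hs'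
      refine fin _ _ (s', v) (hn.concat h hstep) (by simp [ht]) ?_ (List.prefix_append _ _)
        (by simp) (hdis s' ?_)
      · intro b' hb' i'
        have : b' = b := Option.some.inj (hb'.symm.trans hb)
        subst this
        simp [hav b' hb i']
      · rcases env_step hs' i with ⟨h, -⟩ | ⟨b, -, -, h⟩ | ⟨-, h, -⟩
        · cases h
        · exact h
        · exact absurd rfl (h _)
  · obtain ⟨w, he⟩ : ∃ w, IsEdge G v l w := isEdge_exists G v l
    obtain ⟨_ | a, c', hstep⟩ := step_exists h.alg ((s, v) : Cfg A) he
    · obtain ⟨h1, h2⟩ := h.actionTag_none hl hn.tagMem he hstep.isEdge.2.2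
      exact fin p tags (s, v) hn ht hav List.prefix_rfl h1 h2
    · refine ⟨_, ⟨_, _, _, hn.concat h hstep, by simp [ht], fun b hb i => ?_⟩,
        List.prefix_append _ _, by simp, Or.inl ⟨p, w, List.prefix_rfl, List.prefix_rfl⟩⟩
      rw [List.mem_append, not_or]
      refine ⟨hav b hb i, ?_⟩
      rw [List.mem_singleton]
      rintro ⟨⟩
      rcases hstep.cases_act with ⟨u, h1, -⟩ | ⟨-, h1, h2, -⟩
      · cases h1
      · rcases l with j | ⟨j, b'⟩ | d | j
        · obtain ⟨a, ha, ha'⟩ := h2.1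
          rcases ha with ha | ha
          · rw [h.alg.output_eq] at ha
            rcases ha with ⟨m, j', -, rfl⟩ | ⟨o, -, rfl⟩ <;> cases ha'
          · obtain ⟨x, rfl⟩ := h.alg.internal_subset j ha
            cases ha'
        · have := Set.mem_singleton_iff.1 h2.1
          cases this
          exact hlb ⟨i, b, hb, rfl⟩
        · obtain ⟨m, h3⟩ := h2.1
          cases h3
        · exact h1 j rfl

/-- Every path without `⊥` leads to a decision, also under restrictions on the proposals. -/
theorem ConsensusSetting.exists_decision (h : ConsensusSetting A G t pos)
    {av : Option Bool} {p : Path n D.Out}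
    (hp : ∃ tags s v, IsNode A G p tags s v ∧ none ∉ tags ∧
      ∀ b ∈ av, ∀ i, some (SysAct.pin (b, i)) ∉ tags) :
    ∃ b, b ∉ av ∧ CanDecide A G p b ∧ ∀ tags s v, IsNode A G p tags s v → ∀ b' i,
      some (SysAct.pout (b', i)) ∈ tags → b' = b := by
  obtain ⟨c, e, a, hpath, hQ, hpe, hnode⟩ := exists_fairPath h.alg (F := faulty t)
    (Q := fun p => ∃ tags s v, IsNode A G p tags s v ∧ none ∉ tags ∧
      ∀ b ∈ av, ∀ i, some (SysAct.pin (b, i)) ∉ tags)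
    (fun p ⟨tags, s, v, h1, h2, _⟩ => ⟨tags, s, v, h1, h2⟩)
    (fun p hp l hl => h.extend_avoiding hp hl) h.exists_live hp
  obtain ⟨⟨k, b, i, hk⟩, hag, hvd⟩ := hpath.decides h.lt h.afd h.solves h.mem h.faulty_le h.graph
  -- By validity the decided value is proposed on the path, so it is not the avoided one. By
  -- agreement every decision on the way to `p` has the value `b`.
  refine ⟨b, fun hb => ?_, ?_, fun tags s v hn b' i' hi' => ?_⟩
  · obtain ⟨k', j, hj⟩ := hvd k b i hk
    obtain ⟨K, hK, tags, s, v, hn, -, hav⟩ := hQ (k' + 1)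
    obtain ⟨rfl, -, -⟩ := hn.unique h.alg (hnode K)
    refine hav b hb j (List.mem_map.2 ⟨k', List.mem_range.2 (by omega), by rw [hj]⟩)
  · have hmax : p <+: (List.range (max p.length (k + 1))).map e := by
      obtain ⟨d, hd⟩ := Nat.exists_eq_add_of_le (le_max_left p.length (k + 1))
      rw [hd, List.range_add, List.map_append, ← hpe]
      exact List.prefix_append _ _
    refine ⟨_, hmax, _, _, _, hnode _, i, List.mem_map.2 ⟨k, List.mem_range.2 ?_, by rw [hk]⟩⟩
    exact lt_of_lt_of_le (Nat.lt_succ_self k) (le_max_right _ _)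
  · rw [hpe] at hn
    obtain ⟨rfl, -, -⟩ := hn.unique h.alg (hnode _)
    obtain ⟨k', -, hk'⟩ := List.mem_map.1 hi'
    exact hag k' k b' b i' i (Option.some.inj hk') hk

/-- In each node all decisions agree. -/
theorem ConsensusSetting.decides_unique (h : ConsensusSetting A G t pos) {p : Path n D.Out}
    {b b' : Bool} (hb : Decides A G p b) (hb' : Decides A G p b') : b = b' := by
  obtain ⟨tags, s, v, hn, i, hi⟩ := hb
  obtain ⟨tags', s', v', hn', i', hi'⟩ := hb'
  obtain ⟨rfl, -, -⟩ := hn.unique h.alg hn'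
  obtain ⟨-, s₀, h0, hw⟩ := isNode_iff.1 hn
  -- Executions are available for paths without `⊥` only; deleting the `⊥`-edges keeps the decisions
  -- and the final configuration.
  obtain ⟨q, hq⟩ := hw.removeBot (Graph.LE.refl G)
  have hnq : IsNode A G q (tags.filter (·.isSome)) s v :=
    isNode_iff.2 ⟨by simp [h.V_infinite.encard_eq], s₀, h0, hq⟩
  obtain ⟨b'', -, -, h3⟩ := h.exists_decision (av := none)
    ⟨_, _, _, hnq, by simp [List.mem_filter], by rintro b ⟨⟩⟩
  rw [h3 _ _ _ hnq b i (List.mem_filter.2 ⟨hi, rfl⟩),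
    h3 _ _ _ hnq b' i' (List.mem_filter.2 ⟨hi', rfl⟩)]

/-- Every node leads to a decision. -/
theorem ConsensusSetting.exists_canDecide (h : ConsensusSetting A G t pos) {p : Path n D.Out}
    (hp : InTree A G p) : ∃ b, CanDecide A G p b := by
  obtain ⟨tags, s, v, hn⟩ := hp
  obtain ⟨-, s₀, h0, hw⟩ := isNode_iff.1 hn
  obtain ⟨q, hq⟩ := hw.removeBot (Graph.LE.refl G)
  have hnq : IsNode A G q (tags.filter (·.isSome)) s v :=
    isNode_iff.2 ⟨by simp [h.V_infinite.encard_eq], s₀, h0, hq⟩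
  obtain ⟨b, -, h2, -⟩ := h.exists_decision (av := none)
    ⟨_, _, _, hnq, by simp [List.mem_filter], by rintro b ⟨⟩⟩
  refine ⟨b, (canDecide_iff h.alg h.V_infinite hn).2 ?_⟩
  rcases h2.of_isNode h.alg hnq with ⟨i, hi⟩ | h2
  · exact Or.inl ⟨i, (List.mem_filter.1 hi).1⟩
  · exact Or.inr h2

theorem CanDecide.of_prefix {p q : Path n D.Out} (h : p <+: q) {b : Bool}
    (hq : CanDecide A G q b) : CanDecide A G p b := by
  obtain ⟨r, hr, hd⟩ := hq
  exact ⟨r, h.trans hr, hd⟩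

theorem Decides.of_prefix {p q : Path n D.Out} (h : p <+: q) (hq : InTree A G q)
    (hA : IsDistributedAlgorithm A) {b : Bool} (hp : Decides A G p b) : Decides A G q b := by
  obtain ⟨r, rfl⟩ := h
  obtain ⟨tags, s, v, hn⟩ := hq
  obtain ⟨t₁, t₂, s₁, v₁, h1, -, rfl⟩ := hn.split
  obtain ⟨tags', s', v', hn', i, hi⟩ := hp
  obtain ⟨rfl, -, -⟩ := hn'.unique hA h1
  exact ⟨_, s, v, hn, i, List.mem_append_left _ hi⟩

theorem Decides.inTree {p : Path n D.Out} {b : Bool} (h : Decides A G p b) : InTree A G p := by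
  obtain ⟨tags, s, v, hn, -⟩ := h
  exact ⟨tags, s, v, hn⟩

/-- Nodes with a decision are not bivalent. -/
theorem ConsensusSetting.canDecide_of_decides (h : ConsensusSetting A G t pos)
    {p : Path n D.Out} {b b' : Bool} (hd : Decides A G p b) (hc : CanDecide A G p b') :
    b = b' := by
  obtain ⟨q, hq, hd'⟩ := hc
  exact h.decides_unique (hd.of_prefix hq hd'.inTree h.alg) hd'

theorem bivalent_iff {p : Path n D.Out} (b : Bool) :
    Bivalent A G p ↔ InTree A G p ∧ CanDecide A G p b ∧ CanDecide A G p (!b) := by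
  cases b
  · exact Iff.rfl
  · exact and_congr_right fun _ => and_comm

theorem ConsensusSetting.exists_valent (h : ConsensusSetting A G t pos) {p : Path n D.Out}
    (hp : InTree A G p) (hb : ¬ Bivalent A G p) : ∃ b, Valent A G p b := by
  obtain ⟨b, hc⟩ := h.exists_canDecide hp
  exact ⟨b, hp, hc, fun hc' => hb ((bivalent_iff b).2 ⟨hp, hc, hc'⟩)⟩

/-- To reach the decision `b`, take a fair path from the root without proposals of `!b` and use
validity. -/
theorem ConsensusSetting.bivalent_root (h : ConsensusSetting A G t pos) : Bivalent A G [] := by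
  obtain ⟨s₀, h0⟩ := system_start_nonempty h.alg
  have hn : IsNode A G [] [] s₀ none := IsNode.root s₀ h0
  have key : ∀ b, CanDecide A G [] b := by
    intro b
    obtain ⟨b', h1, h2, -⟩ := h.exists_decision (av := some (!b)) (p := [])
      ⟨[], s₀, none, hn, by simp, by simp⟩
    have : b' = b := by
      have : b' ≠ !b := fun h => h1 (by rw [h]; rfl)
      cases b <;> cases b' <;> simp_all
    exact this ▸ h2
  exact ⟨⟨_, _, _, hn⟩, key false, key true⟩

end Gadgets

/-! ### The bivalence argument -/

section GadgetExistence

variable {n f : ℕ} {D : CrashProblem n} {M X : Type}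
  {A : Fin n → Automaton (ProcAct D (consensus n f) M X)} {G : Graph n D.Out}
  {t : Stream'.Seq D.Ev} {pos : Vertex n D.Out → ℕ}

theorem Bool.eq_not_of_ne {b b' : Bool} (h : b' ≠ b) : b' = !b := by
  cases b <;> cases b' <;> simp_all

theorem Bool.eq_not_self (b : Bool) (h : b = !b) : False := by
  cases b <;> cases h

/-- If there is no gadget, then below a bivalent node without `⊥` there is one with a bivalent
child along an edge with a given label. -/
theorem ConsensusSetting.exists_bivalent_child (h : ConsensusSetting A G t pos)
    (hno : ∀ Y, ¬ IsNonBotDecisionGadget A G Y) {p : Path n D.Out} (hp : IsNonBot A G p)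
    (hb : Bivalent A G p) {l : Label n} (hl : (∃ d, l = .chan d) ∨ l.loc ∉ faulty t) :
    ∃ q tags s v, p <+: q ∧ IsNode A G q tags s v ∧ none ∉ tags ∧
      ∃ w, IsEdge G v l w ∧ Bivalent A G (q ++ [(l, w)]) := by
  by_contra hcon
  obtain ⟨tags, s, v, hn, ht⟩ := hp
  -- By `hcon` no `l`-child of a non-`⊥` node below `p` is bivalent, and every node can decide
  -- something.
  have huniv : ∀ {q tags} {c : Cfg A}, p <+: q → IsNode A G q tags c.1 c.2 → none ∉ tags →
      ∀ {w}, IsEdge G c.2 l w → ∃ b, Valent A G (q ++ [(l, w)]) b := by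
    intro q tags c hpq hq htq w hw
    obtain ⟨o, c', hs⟩ := step_exists h.alg c hw
    exact h.exists_valent ⟨_, _, _, hq.concat h hs⟩ fun hbi =>
      hcon ⟨q, tags, c.1, c.2, hpq, hq, htq, w, hw, hbi⟩
  obtain ⟨w₀, hw₀⟩ := isEdge_exists G v l
  obtain ⟨b, hvb⟩ := huniv (c := (s, v)) List.prefix_rfl hn ht hw₀
  have hpb : CanDecide A G p (!b) := ((bivalent_iff b).1 hb).2.2
  -- the same valence along each edge labelled `l` of a node
  have hfork : ∀ {q tags} {c : Cfg A}, p <+: q → IsNode A G q tags c.1 c.2 → none ∉ tags →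
      ∀ {w w'}, Valent A G (q ++ [(l, w)]) b → IsEdge G c.2 l w' →
      Valent A G (q ++ [(l, w')]) b := by
    intro q tags c hpq hq htq w w' hw hw'
    obtain ⟨b', hb'⟩ := huniv hpq hq htq hw'
    by_cases hbb : b' = b
    · exact hbb ▸ hb'
    · have hbb' : b' = !b := Bool.eq_not_of_ne hbb
      subst hbb'
      refine absurd ⟨⟨tags, c.1, c.2, hq, htq⟩, trivial, ?_, b, hw, hb'⟩ (hno (.fork q l w w'))
      exact (bivalent_iff b).2 ⟨⟨_, _, _, hq⟩, hw.2.1.of_prefix (List.prefix_append _ _),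
        hb'.2.1.of_prefix (List.prefix_append _ _)⟩
  -- The valence `b` of the `l`-children persists along every walk without `⊥`. Across an edge
  -- labelled `l`, the new node is itself one of the `b`-valent `l`-children; across any other edge,
  -- a change of valence would complete a hook.
  have hmain : ∀ (r : Path n D.Out) (q : Path n D.Out) tags (c : Cfg A) tr c', p <+: q →
      IsNode A G q tags c.1 c.2 → none ∉ tags → Walk A G c r tr c' → none ∉ tr →
      (∃ w, Valent A G (q ++ [(l, w)]) b) →
      ∃ w, IsEdge G c'.2 l w ∧ Valent A G (q ++ r ++ [(l, w)]) b := by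
    intro r
    induction r with
    | nil =>
      rintro q tags c tr c' hpq hq htq ⟨-, rfl⟩ - ⟨w, hw⟩
      obtain ⟨w', hw'⟩ := isEdge_exists G c'.2 l
      exact ⟨w', hw', by simpa using hfork hpq hq htq hw hw'⟩
    | cons e r ih =>
      rintro q tags c tr c' hpq hq htq ⟨_ | a, c₁, tr', hs, hw, rfl⟩ htr ⟨w, hvw⟩
      · simp at htr
      · have hq' := hq.concat h hs
        have htq' : none ∉ tags ++ [some a] := by simp [htq]
        have hpq' : p <+: q ++ [e] := hpq.trans (List.prefix_append _ _)
        rw [← List.singleton_append, ← List.append_assoc]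
        refine ih _ _ c₁ tr' c' hpq' hq' htq' hw (fun hn => htr (List.mem_cons_of_mem _ hn)) ?_
        obtain ⟨r, wr⟩ := e
        by_cases hrl : r = l
        · subst hrl
          have hv := hfork hpq hq htq hvw hs.isEdge.1
          obtain ⟨w', hw'⟩ := isEdge_exists G c₁.2 r
          obtain ⟨b', hb'⟩ := huniv hpq' hq' htq' hw'
          have : b' = b := by
            by_contra hne
            have hbb' : b' = !b := Bool.eq_not_of_ne hne
            exact hv.2.2 (hbb' ▸ hb'.2.1.of_prefix (List.prefix_append _ _))
          exact ⟨w', this ▸ hb'⟩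
        · -- edges with the label `l` out of both nodes
          obtain ⟨w₁, w₂, hw₁, hw₂, hw₁₂⟩ : ∃ w₁ w₂, IsEdge G c.2 l w₁ ∧ IsEdge G c₁.2 l w₂ ∧
              ((∃ i, l = .fd i) → w₁ = w₂) := by
            -- A hook with label `FD_i` must carry the same vertex twice; a common late successor of
            -- the two vertex tags serves.
            by_cases hfd : ∃ i, l = .fd i
            · obtain ⟨i, rfl⟩ := hfd
              have hi : i ∉ faulty t := hl.resolve_left (by simp)
              obtain ⟨u, h1, h2, h3, -⟩ := h.exists_succ hi hq.tagMem hq'.tagMem 0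
              exact ⟨some u, some u, Or.inl ⟨u, rfl, h1, h2⟩, Or.inl ⟨u, rfl, h1, h3⟩,
                fun _ => rfl⟩
            · obtain ⟨w₁, hw₁⟩ := isEdge_exists G c.2 l
              obtain ⟨w₂, hw₂⟩ := isEdge_exists G c₁.2 l
              exact ⟨w₁, w₂, hw₁, hw₂, fun h' => absurd h' hfd⟩
          have hv₁ := hfork hpq hq htq hvw hw₁
          obtain ⟨b', hb'⟩ := huniv hpq' hq' htq' hw₂
          by_cases hbb : b' = b
          · exact ⟨w₂, hbb ▸ hb'⟩
          · have hbb' : b' = !b := Bool.eq_not_of_ne hbb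
            subst hbb'
            have e1 : q ++ [(r, wr)] ++ [(l, w₂)] = q ++ [(r, wr), (l, w₂)] := by simp
            rw [e1] at hb'
            refine absurd ⟨⟨tags, c.1, c.2, hq, htq⟩, ⟨fun h' => hrl h'.symm,
              ⟨tags, a, c₁.1, c₁.2, hq'⟩, hw₁₂⟩, ?_, b, hv₁, hb'⟩ (hno (.hook q l r w₁ wr w₂))
            exact (bivalent_iff b).2 ⟨⟨_, _, _, hq⟩, hv₁.2.1.of_prefix (List.prefix_append _ _),
              hb'.2.1.of_prefix (List.prefix_append _ _)⟩
  -- Since `p` is bivalent, some walk leads to a decision for `!b`, although the `l`-child at its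
  -- end is `b`-valent.
  rcases hpb.of_isNode h.alg hn with ⟨i, hi⟩ | ⟨r, tr, c', hr, i, hi⟩
  · have hd : Decides A G p (!b) := ⟨_, _, _, hn, i, hi⟩
    have := h.canDecide_of_decides hd (hvb.2.1.of_prefix (List.prefix_append _ _))
    exact Bool.eq_not_self b this.symm
  · obtain ⟨r', hr'⟩ := hr.removeBot (Graph.LE.refl G)
    obtain ⟨w, hw, hv⟩ := hmain r' p tags (s, v) _ c' List.prefix_rfl hn ht hr'
      (by simp [List.mem_filter]) ⟨w₀, hvb⟩
    have hd : Decides A G (p ++ r') (!b) := ⟨_, _, _, hn.append h.V_infinite hr', i,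
      List.mem_append_right _ (List.mem_filter.2 ⟨hi, rfl⟩)⟩
    have := h.canDecide_of_decides hd (hv.2.1.of_prefix (List.prefix_append _ _))
    exact Bool.eq_not_self b this.symm

/-- Without gadgets, all labels of channels and live locations can be dealt with in turn while
staying at bivalent nodes. The resulting fair path contains a decision, and nodes beyond a decision
are not bivalent. -/
theorem ConsensusSetting.exists_gadget (h : ConsensusSetting A G t pos) :
    ∃ Y, IsNonBotDecisionGadget A G Y := by
  by_contra hno
  push Not at hno
  obtain ⟨i₀, hi₀⟩ := h.exists_live
  have hone : ∀ p, (IsNonBot A G p ∧ Bivalent A G p) → ∀ l : Label n,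
      ((∃ d, l = .chan d) ∨ l.loc ∉ faulty t) →
      ∃ p', (IsNonBot A G p' ∧ Bivalent A G p') ∧ p <+: p' ∧ Handled A G l p p' ∧
        ((∃ i, l = .fd i) → p.length < p'.length) := by
    rintro p ⟨hp, hb⟩ l hl
    obtain ⟨q, tags, s, v, hpq, hq, htq, w, hw, hbi⟩ := h.exists_bivalent_child hno hp hb hl
    obtain ⟨_ | a, c', hs⟩ := step_exists h.alg ((s, v) : Cfg A) hw
    · obtain ⟨h1, h2⟩ := h.actionTag_none hl hq.tagMem hw hs.isEdge.2.2
      refine ⟨q, ⟨⟨_, _, _, hq, htq⟩, ⟨_, _, _, hq⟩, hbi.2.1.of_prefix (List.prefix_append _ _),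
        hbi.2.2.of_prefix (List.prefix_append _ _)⟩, hpq,
        Or.inr ⟨h1, q, _, _, _, hpq, List.prefix_rfl, hq, h2⟩, ?_⟩
      rintro ⟨i, hi⟩
      exact absurd hi (h1 i)
    · refine ⟨_, ⟨⟨_, _, _, hq.concat h hs, by simp [htq]⟩, hbi⟩,
        hpq.trans (List.prefix_append _ _), Or.inl ⟨q, w, hpq, List.prefix_rfl⟩, fun _ => ?_⟩
      have := hpq.length_le
      simp
      omega
  obtain ⟨s₀, h0⟩ := system_start_nonempty h.alg
  obtain ⟨c, e, a, hpath, hQ, -, hnode⟩ := exists_fairPath h.alg (F := faulty t)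
    (Q := fun p => IsNonBot A G p ∧ Bivalent A G p) (fun p hp => hp.1)
    -- A disabled label may be dealt with without lengthening the path; the additional `FD`-edge at
    -- `i₀` ensures growth.
    (fun p hp l hl => by
      obtain ⟨p₁, h1, h2, h3, -⟩ := hone p hp l hl
      obtain ⟨p₂, h4, h5, -, h6⟩ := hone p₁ h1 (.fd i₀) (Or.inr hi₀)
      refine ⟨p₂, h4, h2.trans h5, lt_of_le_of_lt h2.length_le (h6 ⟨_, rfl⟩), ?_⟩
      rcases h3 with ⟨q, w, h7, h8⟩ | ⟨h7, q, t', s, v, h8, h9, h10⟩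
      · exact Or.inl ⟨q, w, h7, h8.trans h5⟩
      · exact Or.inr ⟨h7, q, t', s, v, h8, h9.trans h5, h10⟩)
    h.exists_live (p₀ := []) ⟨⟨[], s₀, none, IsNode.root s₀ h0, by simp⟩, h.bivalent_root⟩
  obtain ⟨⟨k, b, i, hk⟩, -, -⟩ :=
    hpath.decides h.lt h.afd h.solves h.mem h.faulty_le h.graph
  obtain ⟨K, hK, -, hb⟩ := hQ (k + 1)
  have hd : Decides A G ((List.range K).map e) b := ⟨_, _, _, hnode K, i,
    List.mem_map.2 ⟨k, List.mem_range.2 (by omega), by rw [hk]⟩⟩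
  have := h.canDecide_of_decides hd ((bivalent_iff b).1 hb).2.2
  exact Bool.eq_not_self b this

end GadgetExistence

/-! ### Runs that differ at faulty locations only -/

section Simulation

variable {n f : ℕ} {D : CrashProblem n} {M X : Type}
  {A : Fin n → Automaton (ProcAct D (consensus n f) M X)} {F : Set (Fin n)}

/-- The states of a component may differ at the locations in `F`, and channels from `F` to other
locations may have further messages in the second state. -/
def compLe (A : Fin n → Automaton (ProcAct D (consensus n f) M X)) (F : Set (Fin n)) :
    ∀ c : Comp n, (component A (consensusEnv n f) c).State →
      (component A (consensusEnv n f) c).State → Prop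
  | .proc i, x, y => i ∉ F → x = y
  | .env i, x, y => i ∉ F → x = y
  | .chan c, x, y => c.1.2 ∉ F → (c.1.1 ∉ F → x = y) ∧ List.IsPrefix (α := M) x y

/-- The configuration `s` is a part of `s'` up to the locations in `F`. -/
def SimLe (F : Set (Fin n)) (s s' : (system A (consensusEnv n f)).State) : Prop :=
  ∀ c, compLe A F c (s c) (s' c)

theorem SimLe.refl (s : (system A (consensusEnv n f)).State) : SimLe F s s := by
  rintro (i | i | c)
  · exact fun _ => rfl
  · exact fun _ => rfl
  · exact fun _ => ⟨fun _ => rfl, List.prefix_rfl⟩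

theorem SimLe.trans {s₁ s₂ s₃ : (system A (consensusEnv n f)).State} (h : SimLe F s₁ s₂)
    (h' : SimLe F s₂ s₃) : SimLe F s₁ s₃ := by
  rintro (i | i | c)
  · exact fun hi => (h (.proc i) hi).trans (h' (.proc i) hi)
  · exact fun hi => (h (.env i) hi).trans (h' (.env i) hi)
  · exact fun hc => ⟨fun hc' => ((h (.chan c) hc).1 hc').trans ((h' (.chan c) hc).1 hc'),
      (h (.chan c) hc).2.trans (h' (.chan c) hc).2⟩

/-- The location of an action of a process or environment is the location of the latter. -/
theorem eq_of_trans {s s' : (system A (consensusEnv n f)).State}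
    {a : SysAct D (consensus n f) M X Empty} (h : (system A (consensusEnv n f)).trans s a s')
    (c : Comp n) (ha : a ∉ (component A (consensusEnv n f) c).acts) : s' c = s c := by
  rcases h.2 c with ⟨h, -⟩ | ⟨-, h⟩
  · exact absurd h ha
  · exact h

/-- An action at a location in `F` affects the components there, the channels into `F`, and the
tails of channels from `F` to other locations, which is precisely what `SimLe` tolerates. -/
theorem simLe_of_trans (hA : IsDistributedAlgorithm A)
    {s s' : (system A (consensusEnv n f)).State} {a : SysAct D (consensus n f) M X Empty}
    (h : (system A (consensusEnv n f)).trans s a s') (ha : a.loc ∈ F) : SimLe F s s' := by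
  rintro (i | i | c)
  · exact fun hi => (eq_of_trans h (.proc i) fun h' => hi (hA.loc_eq h' ▸ ha)).symm
  · exact fun hi =>
      (eq_of_trans h (.env i) fun h' => hi ((consensusEnv_envLocal n f).loc_eq h' ▸ ha)).symm
  · intro hc
    rcases h.2 (.chan c) with ⟨-, m, ⟨rfl, ht⟩ | ⟨rfl, -⟩⟩ | ⟨-, ht⟩
    · exact ⟨fun hc' => absurd ha hc', by rw [ht]; exact List.prefix_append _ _⟩
    · exact absurd ha hc
    · rw [ht]
      exact ⟨fun _ => rfl, List.prefix_rfl⟩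

/-- Receipts at faulty locations can be left out. -/
theorem SimLe.of_recv (hA : IsDistributedAlgorithm A)
    {s s' s₁ : (system A (consensusEnv n f)).State} {m : M} {i j : Fin n}
    (h : (system A (consensusEnv n f)).trans s (.recv m i j) s₁) (hj : j ∈ F)
    (hs : SimLe F s s') : SimLe F s₁ s' := by
  rintro (k | k | c)
  · intro hk
    rw [eq_of_trans h (.proc k) fun h' => hk (hA.loc_eq h' ▸ hj)]
    exact hs (.proc k) hk
  · intro hk
    rw [eq_of_trans h (.env k) (notMem_env_acts (Or.inr (Or.inr ⟨m, i, j, rfl⟩)))]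
    exact hs (.env k) hk
  · intro hc
    rw [eq_of_trans h (.chan c) (notMem_chan_acts (by simp) ?_)]
    · exact hs (.chan c) hc
    · rintro m' ⟨⟩
      exact hc hj

/-- Actions at other locations than those in `F` can be repeated. -/
theorem SimLe.exists_trans (hA : IsDistributedAlgorithm A)
    {s s' s₁ : (system A (consensusEnv n f)).State} {a : SysAct D (consensus n f) M X Empty}
    (h : (system A (consensusEnv n f)).trans s a s₁) (ha : a.loc ∉ F) (hs : SimLe F s s') :
    ∃ s₁', (system A (consensusEnv n f)).trans s' a s₁' ∧ SimLe F s₁ s₁' := by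
  have key : ∀ c, ∃ y, ((a ∈ (component A (consensusEnv n f) c).acts ∧
      (component A (consensusEnv n f) c).trans (s' c) a y) ∨
      (a ∉ (component A (consensusEnv n f) c).acts ∧ y = s' c)) ∧ compLe A F c (s₁ c) y := by
    intro c
    rcases h.2 c with ⟨h1, h2⟩ | ⟨h1, h2⟩
    · rcases c with i | i | c
      · rw [hA.loc_eq h1] at ha
        refine ⟨s₁ (.proc i), Or.inl ⟨h1, ?_⟩, fun _ => rfl⟩
        rw [← hs (.proc i) ha]
        exact h2
      · rw [(consensusEnv_envLocal n f).loc_eq h1] at ha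
        refine ⟨s₁ (.env i), Or.inl ⟨h1, ?_⟩, fun _ => rfl⟩
        rw [← hs (.env i) ha]
        exact h2
      · obtain ⟨m, ⟨rfl, ht⟩ | ⟨rfl, ht⟩⟩ := h2
        · refine ⟨(chanq s' c ++ [m] : List M), Or.inl ⟨h1, m, Or.inl ⟨rfl, rfl⟩⟩, fun hc => ?_⟩
          have h3 : s (.chan c) = s' (.chan c) := (hs (.chan c) hc).1 ha
          rw [h3] at ht
          rw [ht]
          exact ⟨fun _ => rfl, List.prefix_rfl⟩
        -- The shorter queue is an initial segment of the longer one, so the received message is at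
        -- the head of both.
        · obtain ⟨h3, r, h4⟩ := hs (.chan c) ha
          rw [ht] at h4
          refine ⟨(chanq s₁ c ++ r : List M), Or.inl ⟨h1, m, Or.inr ⟨rfl, h4.symm⟩⟩, fun _ =>
            ⟨fun hc => ?_, List.prefix_append _ _⟩⟩
          have h5 := h3 hc
          rw [ht, ← h4] at h5
          exact (List.cons.inj h5).2
    · refine ⟨s' c, Or.inr ⟨h1, rfl⟩, ?_⟩
      rw [h2]
      exact hs c
  choose s₁' h1 h2 using key
  exact ⟨s₁', ⟨h.1, h1⟩, h2⟩

theorem SimLe.exists_step (hA : IsDistributedAlgorithm A) {G : Graph n D.Out}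
    {s s' s₁ : (system A (consensusEnv n f)).State} {v w : Option (Vertex n D.Out)}
    {e : Label n × Option (Vertex n D.Out)} {a : SysAct D (consensus n f) M X Empty}
    (h : Step A G (s, v) e (some a) (s₁, w)) (ha : a.loc ∉ F) (hs : SimLe F s s') :
    ∃ s₁', Step A G (s', v) e (some a) (s₁', w) ∧ SimLe F s₁ s₁' := by
  obtain ⟨s₁', ht, hs'⟩ := hs.exists_trans hA h.trans ha
  refine ⟨s₁', ?_, hs'⟩
  cases h with
  | act _ _ _ _ l _ he htag _ =>
    refine Step.act s' s₁' v w l a he ?_ ht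
    have key : ∀ l : Label n, EnabledTag A s l (some a) → EnabledTag A s' l (some a) :=
      fun l hl => ⟨hl.1, _, ht⟩
    rcases l with i | ⟨i, b⟩ | d | i
    · exact htag.imp (And.imp_right (key _)) id
    · exact htag.imp (And.imp_right (key _)) id
    · exact key _ htag
    · exact htag

end Simulation

/-! ### Critical locations are live -/

section CriticalLocation

variable {n f : ℕ} {D : CrashProblem n} {M X : Type}
  {A : Fin n → Automaton (ProcAct D (consensus n f) M X)} {G : Graph n D.Out}
  {t : Stream'.Seq D.Ev} {pos : Vertex n D.Out → ℕ}

theorem Graph.Succ.trans (hG : TraceGraph t G pos) {v : Option (Vertex n D.Out)}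
    {u w : Vertex n D.Out} (h : G.Succ v u) (h' : G.Succ (some u) w) : G.Succ v w :=
  ⟨h'.1, fun x hx => hG.trans _ _ _ (h.2 x hx) (h'.2 u rfl)⟩

/-- Outputs at faulty locations occur before some position. -/
theorem ConsensusSetting.exists_bound (h : ConsensusSetting A G t pos) :
    ∃ B, ∀ w ∈ G.V, w.loc ∈ faulty t → pos w < B := by
  have : ∀ i : Fin n, ∃ B, ∀ w ∈ G.V, w.loc ∈ faulty t → w.loc = i → pos w < B := by
    intro i
    by_cases hi : i ∈ faulty t
    · obtain ⟨k, hk⟩ := hi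
      refine ⟨k, fun w hw _ hwi => ?_⟩
      have h1 := h.graph.get w hw
      rcases lt_trichotomy (pos w) k with h2 | h2 | h2
      · exact h2
      · rw [h2, hk] at h1
        cases h1
      · exact absurd ((h.graph.loc w hw).trans hwi) ((h.afd.valid t h.mem).1 k _ i _ h2 hk h1)
    · exact ⟨0, fun w _ h1 h2 => absurd (h2 ▸ h1) hi⟩
  choose B hB using this
  exact ⟨Finset.univ.sup B, fun w hw hf =>
    (hB w.loc w hw hf rfl).trans_le (Finset.le_sup (Finset.mem_univ w.loc))⟩

/-- Late walks without `⊥` can be repeated from configurations with more messages from faulty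
locations. -/
theorem ConsensusSetting.exists_late_walk (h : ConsensusSetting A G t pos)
    {s s' : (system A (consensusEnv n f)).State} {v : Option (Vertex n D.Out)} {c' : Cfg A}
    {p : Path n D.Out} {tags : List (Option (SysAct D (consensus n f) M X Empty))}
    (hw : Walk A G (s, v) p tags c') (ht : none ∉ tags)
    (hv : ∀ w ∈ G.V, w.loc ∈ faulty t → pos w + 1 < tagPos pos v)
    (hs : SimLe (faulty t) s s') : ∃ q tags' c'', Walk A G (s', v) q tags' c'' ∧
      ∀ b i, some (SysAct.pout (b, i)) ∈ tags → some (SysAct.pout (b, i)) ∈ tags' := by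
  induction p generalizing s s' v tags with
  | nil =>
    obtain ⟨rfl, -⟩ := hw
    exact ⟨[], [], _, ⟨rfl, rfl⟩, by simp⟩
  | cons e p ih =>
    obtain ⟨_ | a, ⟨s₁, v₁⟩, t₁, hstep, hw, rfl⟩ := hw
    · simp at ht
    have ht₁ : none ∉ t₁ := fun h' => ht (List.mem_cons_of_mem _ h')
    have hle : tagPos pos v ≤ tagPos pos v₁ := hstep.tagPos_le h.graph
    have hv₁ : ∀ w ∈ G.V, w.loc ∈ faulty t → pos w + 1 < tagPos pos v₁ :=
      fun w hw hf => (hv w hw hf).trans_le hle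
    -- At this late time only receipts can occur at faulty locations, since any other action has a
    -- later or equal output there. The repeated walk omits these receipts and copies all other
    -- actions.
    by_cases ha : a.loc ∈ faulty t
    · by_cases hr : ∃ m i j, a = .recv m i j
      · obtain ⟨m, i, j, rfl⟩ := hr
        have hvv : v₁ = v := by
          rcases hstep.cases_act with ⟨u, h', -⟩ | ⟨h', -⟩
          · cases h'
          · exact h'
        subst hvv
        obtain ⟨q, t', c'', h1, h2⟩ := ih hw ht₁ hv₁ (hs.of_recv h.alg hstep.trans ha)
        exact ⟨q, t', c'', h1, fun b i hb => h2 b i (by simpa using hb)⟩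
      · push Not at hr
        obtain ⟨u, hu, hl, hlt⟩ := hstep.exists_later h.alg h.graph hr
        exact absurd hlt (not_le.2 (hv₁ u hu (hl ▸ ha)))
    · obtain ⟨s₁', h1, h2⟩ := hs.exists_step h.alg hstep ha
      obtain ⟨q, t', c'', h3, h4⟩ := ih hw ht₁ hv₁ h2
      refine ⟨e :: q, some a :: t', c'', ⟨_, _, _, h1, h3, rfl⟩, fun b i hb => ?_⟩
      rcases List.mem_cons.1 hb with hb | hb
      · exact hb ▸ List.mem_cons_self
      · exact List.mem_cons_of_mem _ (h4 b i hb)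

/-- Two nodes that both extend the configuration of a third one up to faulty locations can decide
the same value. -/
theorem ConsensusSetting.exists_common_decision (h : ConsensusSetting A G t pos)
    {p p₁ p₂ : Path n D.Out}
    {tags tags₁ tags₂ : List (Option (SysAct D (consensus n f) M X Empty))}
    {s s₁ s₂ : (system A (consensusEnv n f)).State} {v v₁ v₂ : Option (Vertex n D.Out)}
    (hp : IsNode A G p tags s v) (hp₁ : IsNode A G p₁ tags₁ s₁ v₁)
    (hp₂ : IsNode A G p₂ tags₂ s₂ v₂) (hs₁ : SimLe (faulty t) s s₁)
    (hs₂ : SimLe (faulty t) s s₂)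
    (hd : ∀ b, Decides A G p b → CanDecide A G p₁ b ∧ CanDecide A G p₂ b) :
    ∃ b, CanDecide A G p₁ b ∧ CanDecide A G p₂ b := by
  obtain ⟨i₀, hi₀⟩ := h.exists_live
  obtain ⟨B, hB⟩ := h.exists_bound
  obtain ⟨u₁, -, h1, h2, -⟩ := h.exists_succ hi₀ hp.tagMem hp₁.tagMem 0
  -- The vertex `u` lies beyond all outputs at faulty locations and is a successor of all three
  -- vertex tags, of `v` and `v₁` by way of `u₁`.
  obtain ⟨u, hl, h3, h4, hBu⟩ := h.exists_succ hi₀ (v := some u₁) (v' := v₂)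
    (by rintro x ⟨⟩; exact h1.1) hp₂.tagMem (B + 1)
  have hloc : (SysAct.fd u.act : SysAct D (consensus n f) M X Empty).loc ∉ faulty t := by
    change D.locOut u.act ∉ _
    rw [h.graph.loc u h3.1, hl]
    exact hi₀
  obtain ⟨s', hstep⟩ := h.fd_step (s, v) (h1.trans h.graph h3)
  have hlate : ∀ w ∈ G.V, w.loc ∈ faulty t → pos w + 1 < tagPos pos (some u) := fun w hw hf => by
    have := hB w hw hf
    change pos w + 1 < pos u + 1
    omega
  obtain ⟨b, hb⟩ := h.exists_canDecide (p := p ++ [(.fd u.loc, some u)])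
    ⟨_, _, _, hp.concat h hstep⟩
  -- The decision `b` is found below `p` after taking `u`; the same continuation is repeated below
  -- the other node, which takes `u` as well.
  have key : ∀ {p₁ tags₁} {c : Cfg A}, IsNode A G p₁ tags₁ c.1 c.2 → SimLe (faulty t) s c.1 →
      G.Succ c.2 u → (∀ b, Decides A G p b → CanDecide A G p₁ b) → CanDecide A G p₁ b := by
    intro p₁ tags₁ c hn hsim hsucc hd
    rcases hb.of_isNode h.alg (hp.concat h hstep) with ⟨i, hi⟩ | ⟨q, t', c', hw, i, hi⟩
    · refine hd b ⟨_, _, _, hp, i, ?_⟩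
      rcases List.mem_append.1 hi with hi | hi
      · exact hi
      · simp at hi
    · obtain ⟨s₁', hstep'⟩ := h.fd_step c hsucc
      obtain ⟨s₁'', ht, hsim'⟩ := hsim.exists_trans h.alg hstep.trans hloc
      rw [system_trans_unique h.alg ht hstep'.trans] at hsim'
      obtain ⟨q', hw'⟩ := hw.removeBot (Graph.LE.refl G)
      obtain ⟨q'', t'', c'', h5, h6⟩ := h.exists_late_walk hw' (by simp [List.mem_filter]) hlate
        hsim'
      exact CanDecide.of_prefix (List.prefix_append _ _)
        ((canDecide_iff h.alg h.V_infinite (hn.concat h hstep')).2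
          (Or.inr ⟨q'', t'', c'', h5, i, h6 b i (List.mem_filter.2 ⟨hi, rfl⟩)⟩))
  exact ⟨b, key (c := (s₁, v₁)) hp₁ hs₁ (h2.trans h.graph h3) fun b hb => (hd b hb).1,
    key (c := (s₂, v₂)) hp₂ hs₂ h4 fun b hb => (hd b hb).2⟩

theorem Step.loc_eq (h : ConsensusSetting A G t pos) {c c' : Cfg A}
    {e : Label n × Option (Vertex n D.Out)} {a : SysAct D (consensus n f) M X Empty}
    (hs : Step A G c e (some a) c') : a.loc = e.1.loc := by
  rcases hs.cases_act with ⟨u, rfl, -, hu, rfl⟩ | ⟨-, h2, h3, -⟩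
  · exact h.graph.loc u hu.1
  · exact (labelActs_cases h.alg h2 h3.1).1

theorem Step.simLe (h : ConsensusSetting A G t pos) {c c' : Cfg A}
    {e : Label n × Option (Vertex n D.Out)} {o : Option (SysAct D (consensus n f) M X Empty)}
    (hs : Step A G c e o c') (he : e.1.loc ∈ faulty t) : SimLe (faulty t) c.1 c'.1 := by
  rcases o with _ | a
  · rw [hs.eq_of_none]
    exact SimLe.refl _
  · exact simLe_of_trans h.alg hs.trans (hs.loc_eq h ▸ he)

theorem InTree.exists_step (hA : IsDistributedAlgorithm A) {p : Path n D.Out}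
    {e : Label n × Option (Vertex n D.Out)}
    {tags : List (Option (SysAct D (consensus n f) M X Empty))} {c : Cfg A}
    (hp : IsNode A G p tags c.1 c.2) (he : InTree A G (p ++ [e])) :
    ∃ o c', Step A G c e o c' ∧ IsNode A G (p ++ [e]) (tags ++ [o]) c'.1 c'.2 := by
  obtain ⟨t', s', v', hn⟩ := he
  obtain ⟨t₁, t₂, s₁, v₁, h1, h2, rfl⟩ := hn.split
  obtain ⟨rfl, rfl, rfl⟩ := h1.unique hA hp
  obtain ⟨o, rfl, hs⟩ := walk_single.1 h2
  exact ⟨o, _, hs, hn⟩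

theorem ConsensusSetting.not_decides_of_bivalent (h : ConsensusSetting A G t pos)
    {p : Path n D.Out} (hb : Bivalent A G p) (b : Bool) : ¬ Decides A G p b := fun hd =>
  Bool.eq_not_self b (h.canDecide_of_decides hd ((bivalent_iff b).1 hb).2.2)

/-- Used to show that the two univalent nodes of a gadget cannot share a possible decision. -/
theorem Valent.eq {p : Path n D.Out} {b b' : Bool} (h : Valent A G p b)
    (hb : CanDecide A G p b') : b' = b := by
  by_contra hne
  exact h.2.2 (Bool.eq_not_of_ne hne ▸ hb)

/-- The critical locations of decision gadgets are live. -/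
theorem ConsensusSetting.critLoc_notMem_faulty (h : ConsensusSetting A G t pos)
    {Y : Gadget n D.Out} (hY : IsNonBotDecisionGadget A G Y) : Y.critLoc ∉ faulty t := by
  intro hF
  obtain ⟨⟨tags, s, v, hn, -⟩, hhook, hbi, b, hl, hr⟩ := hY
  have fin : ∀ b', CanDecide A G Y.left b' ∧ CanDecide A G Y.right b' → False := fun b' h' =>
    Bool.eq_not_self b ((hl.eq h'.1).symm.trans (hr.eq h'.2))
  have hnd := h.not_decides_of_bivalent hbi
  rcases Y with ⟨N, l, u, u'⟩ | ⟨N, l, r, u, w, u'⟩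
  -- Both children of a fork extend the configuration of `N` up to faulty locations.
  · obtain ⟨o₁, c₁, hs₁, hn₁⟩ := InTree.exists_step h.alg (c := (s, v)) hn hl.1
    obtain ⟨o₂, c₂, hs₂, hn₂⟩ := InTree.exists_step h.alg (c := (s, v)) hn hr.1
    obtain ⟨b', hb'⟩ := h.exists_common_decision hn hn₁ hn₂ (hs₁.simLe h hF) (hs₂.simLe h hF)
      fun b hd => absurd hd (hnd b)
    exact fin b' hb'
  · obtain ⟨hlr, ⟨tr, a, sr, vr, hnr⟩, huu⟩ := hhook
    obtain ⟨o₁, c₁, hs₁, hn₁⟩ := InTree.exists_step h.alg (c := (s, v)) hn hl.1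
    obtain ⟨o₂, c₂, hs₂, hn₂⟩ := InTree.exists_step h.alg (c := (s, v)) hn ⟨_, _, _, hnr⟩
    have ho₂ : o₂ = some a := by
      have h1 := (hn₂.unique h.alg hnr).1
      simpa using (List.append_inj' h1 rfl).2
    subst ho₂
    have hr1 : InTree A G ((N ++ [(r, w)]) ++ [(l, u')]) := by
      have := hr.1
      simpa [Gadget.right] using this
    obtain ⟨o₃, c₃, hs₃, hn₃⟩ := InTree.exists_step h.alg hn₂ hr1
    have hright : (Gadget.hook N l r u w u').right = (N ++ [(r, w)]) ++ [(l, u')] := by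
      simp [Gadget.right]
    have hw : w = c₂.2 := hs₂.isEdge.2.1.symm
    have hu' : u' = c₃.2 := hs₃.isEdge.2.1.symm
    have hrF : SimLe (faulty t) s c₂.1 := hs₂.simLe h hF
    -- If the `l`-edge out of `N` has the tag `⊥`, its lower end has the tags of `N` and can decide
    -- both values.
    rcases o₁ with _ | a₁
    · have hc := hs₁.eq_of_none
      subst hc
      refine hl.2.2 ((canDecide_iff h.alg h.V_infinite hn₁).2 ?_)
      rcases ((bivalent_iff b).1 hbi).2.2.of_isNode h.alg hn with ⟨i, hi⟩ | h1
      · exact Or.inl ⟨i, List.mem_append_left _ hi⟩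
      · exact Or.inr h1
    -- If `l` is at a faulty location too, both univalent nodes extend the configuration of `N`.
    by_cases hlF : l.loc ∈ faulty t
    · obtain ⟨b', h1, h2⟩ := h.exists_common_decision hn hn₁ hn₃ (hs₁.simLe h hlF)
        (hrF.trans (hs₃.simLe h hlF)) fun b hd => absurd hd (hnd b)
      exact fin b' ⟨h1, hright ▸ h2⟩
    -- Otherwise the `r`-step cannot prevent the action of the `l`-edge, so both `l`-edges carry the
    -- same action and the second univalent node extends the configuration of the first. As `N` is
    -- bivalent, a decision on the path to the first can only stem from the `l`-edge, and then it
    -- occurs on both paths.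
    · have hloc : a₁.loc ∉ faulty t := by rw [hs₁.loc_eq h]; exact hlF
      obtain ⟨s₃, ht₃, hsim⟩ := hrF.exists_trans h.alg hs₁.trans hloc
      have hstep : Step A G c₂ (l, u') (some a₁) (s₃, u') := by
        refine Step.act c₂.1 s₃ c₂.2 u' l a₁ hs₃.isEdge.1 ?_ ht₃
        have htag := hs₁.isEdge.2.2
        have hsucc := h.hasSucc hlF hn₂.tagMem
        have hle := hs₃.isEdge.1
        rcases hs₁.cases_act with ⟨x, rfl, h2, h3, h4⟩ | ⟨-, h2, h3, -⟩
        · obtain ⟨rfl, rfl⟩ := Prod.ext_iff.1 h4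
          obtain rfl := huu ⟨_, rfl⟩
          rcases hle with ⟨y, hy, -, h6⟩ | ⟨h6, -⟩
          · cases hy
            exact Or.inr ⟨h.succ_ne h6, x, rfl, rfl⟩
          · exact absurd hsucc h6
        · have he : EnabledTag A c₂.1 l (some a₁) := ⟨h3.1, _, ht₃⟩
          rcases l with i | ⟨i, b⟩ | d | i
          · exact Or.inl ⟨hsucc, he⟩
          · exact Or.inl ⟨hsucc, he⟩
          · exact he
          · exact absurd rfl (h2 i)
      obtain ⟨rfl, rfl⟩ := hs₃.unique h.alg hstep
      obtain ⟨b', h1, h2⟩ := h.exists_common_decision hn₁ hn₁ hn₃ (SimLe.refl _) hsim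
        (fun b' hd => ⟨⟨_, List.prefix_rfl, hd⟩, _, List.prefix_rfl, by
          obtain ⟨t', s', v', hn', i, hi⟩ := hd
          obtain ⟨rfl, -, -⟩ := hn'.unique h.alg hn₁
          refine ⟨_, _, _, hn₃, i, ?_⟩
          rcases List.mem_append.1 hi with hi | hi
          · exact absurd ⟨_, _, _, hn, i, hi⟩ (hnd b')
          · exact List.mem_append_right _ hi⟩)
      exact fin b' ⟨h1, hright ▸ h2⟩

end CriticalLocation

open Filter

/-! ### Trees of converging graphs -/

section Limits

variable {n f : ℕ} {D : CrashProblem n} {M X : Type}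
  {A : Fin n → Automaton (ProcAct D (consensus n f) M X)}

/-- The graphs `Gs k` converge to the larger graph `G`. -/
structure GraphLimit {O : Type} (Gs : ℕ → Graph n O) (G : Graph n O) : Prop where
  le : ∀ k, (Gs k).LE G
  V : ∀ u ∈ G.V, ∀ᶠ k in atTop, u ∈ (Gs k).V
  Z : ∀ e ∈ G.Z, ∀ᶠ k in atTop, e ∈ (Gs k).Z

/-- For properties inherited by the limit, only their truth in the limit needs a stabilization
argument. -/
theorem eventually_iff_of_imp {P : ℕ → Prop} {Q : Prop} (h : ∀ k, P k → Q)
    (h' : Q → ∀ᶠ k in atTop, P k) : ∀ᶠ k in atTop, (P k ↔ Q) := by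
  by_cases hQ : Q
  · filter_upwards [h' hQ] with k hk
    exact iff_of_true hk hQ
  · exact Eventually.of_forall fun k => iff_of_false (fun hk => hQ (h k hk)) hQ

variable {Gs : ℕ → Graph n D.Out} {G : Graph n D.Out}

theorem GraphLimit.succ (h : GraphLimit Gs G) (v : Option (Vertex n D.Out)) (u : Vertex n D.Out) :
    ∀ᶠ k in atTop, ((Gs k).Succ v u ↔ G.Succ v u) := by
  refine eventually_iff_of_imp (fun k => (h.le k).succ) fun hs => ?_
  rcases v with _ | x
  · filter_upwards [h.V u hs.1] with k hk
    exact ⟨hk, by rintro x ⟨⟩⟩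
  · filter_upwards [h.V u hs.1, h.Z _ (hs.2 x rfl)] with k hk hk'
    exact ⟨hk, by rintro x ⟨⟩; exact hk'⟩

theorem GraphLimit.hasSucc (h : GraphLimit Gs G) (v : Option (Vertex n D.Out)) (i : Fin n) :
    ∀ᶠ k in atTop, ((Gs k).HasSucc v i ↔ G.HasSucc v i) := by
  refine eventually_iff_of_imp (fun k => (h.le k).hasSucc) fun ⟨u, hu, hs⟩ => ?_
  filter_upwards [h.succ v u] with k hk
  exact ⟨u, hu, hk.2 hs⟩

theorem GraphLimit.isEdge (h : GraphLimit Gs G) (v : Option (Vertex n D.Out)) (l : Label n)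
    (w : Option (Vertex n D.Out)) : ∀ᶠ k in atTop, (IsEdge (Gs k) v l w ↔ IsEdge G v l w) := by
  rcases l with i | ⟨i, b⟩ | d | i
  · exact Eventually.of_forall fun k => Iff.rfl
  · exact Eventually.of_forall fun k => Iff.rfl
  · exact Eventually.of_forall fun k => Iff.rfl
  · rcases w with _ | x
    · filter_upwards [h.hasSucc v i] with k hk
      simp [IsEdge, hk]
    · filter_upwards [h.hasSucc v i, h.succ v x] with k hk hk'
      simp [IsEdge, hk, hk']

theorem Step.congr {H : Graph n D.Out} {c c' : Cfg A} {e : Label n × Option (Vertex n D.Out)}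
    {o : Option (SysAct D (consensus n f) M X Empty)} (h : Step A G c e o c')
    (he : IsEdge G c.2 e.1 e.2 → IsEdge H c.2 e.1 e.2)
    (hs : H.HasSucc c.2 e.1.loc ↔ G.HasSucc c.2 e.1.loc) : Step A H c e o c' := by
  have key : ∀ (s : (system A (consensusEnv n f)).State) (v w : Option (Vertex n D.Out))
      (l : Label n) (o : Option (SysAct D (consensus n f) M X Empty)),
      (H.HasSucc v l.loc ↔ G.HasSucc v l.loc) → ActionTag A G s v l w o →
      ActionTag A H s v l w o := by
    intro s v w l o hs ha
    rcases l with i | ⟨i, b⟩ | d | i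
    · exact ha.imp (And.imp_left hs.2) (And.imp_left (mt hs.1))
    · exact ha.imp (And.imp_left hs.2) (And.imp_left (mt hs.1))
    · exact ha
    · exact ha
  cases h with
  | bot s v w l he' ha => exact Step.bot s v w l (he he') (key _ _ _ _ _ hs ha)
  | act s s' v w l a he' ha ht => exact Step.act s s' v w l a (he he') (key _ _ _ _ _ hs ha) ht

theorem GraphLimit.step (h : GraphLimit Gs G) (c : Cfg A)
    (e : Label n × Option (Vertex n D.Out)) :
    ∀ᶠ k in atTop, ∀ o c', Step A (Gs k) c e o c' ↔ Step A G c e o c' := by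
  filter_upwards [h.isEdge c.2 e.1 e.2, h.hasSucc c.2 e.1.loc] with k h1 h2 o c'
  exact ⟨fun hs => hs.congr h1.1 h2.symm, fun hs => hs.congr h1.2 h2⟩

/-- By determinism a path admits at most one walk from `c` in the limit, so finitely many steps have
to stabilize. -/
theorem GraphLimit.walk (hA : IsDistributedAlgorithm A) (h : GraphLimit Gs G) (c : Cfg A)
    (p : Path n D.Out) :
    ∀ᶠ k in atTop, ∀ t c', Walk A (Gs k) c p t c' ↔ Walk A G c p t c' := by
  induction p generalizing c with
  | nil => exact Eventually.of_forall fun k t c' => Iff.rfl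
  | cons e p ih =>
    by_cases hs : ∃ o c₁, Step A G c e o c₁
    · obtain ⟨o, c₁, hs⟩ := hs
      filter_upwards [h.step c e, ih c₁] with k h1 h2 t c'
      constructor
      · rintro ⟨o', c₂, t', h3, h4, rfl⟩
        obtain ⟨rfl, rfl⟩ := hs.unique hA ((h1 _ _).1 h3)
        exact ⟨o, c₁, t', hs, (h2 _ _).1 h4, rfl⟩
      · rintro ⟨o', c₂, t', h3, h4, rfl⟩
        obtain ⟨rfl, rfl⟩ := hs.unique hA h3
        exact ⟨o, c₁, t', (h1 _ _).2 hs, (h2 _ _).2 h4, rfl⟩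
    · filter_upwards [h.step c e] with k h1 t c'
      constructor
      · rintro ⟨o', c₂, t', h3, h4, rfl⟩
        exact absurd ⟨_, _, (h1 _ _).1 h3⟩ hs
      · rintro ⟨o', c₂, t', h3, h4, rfl⟩
        exact absurd ⟨_, _, h3⟩ hs

theorem GraphLimit.encard (h : GraphLimit Gs G) (hG : G.V.Infinite) (m : ℕ) :
    ∀ᶠ k in atTop, (m : ℕ∞) ≤ (Gs k).V.encard := by
  obtain ⟨T, hT, hc⟩ := hG.exists_subset_card_eq m
  filter_upwards [(eventually_all_finset T).2 fun u hu => h.V u (hT hu)] with k hk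
  rw [← hc, ← Set.encard_coe_eq_coe_finsetCard]
  exact Set.encard_le_encard fun u hu => hk u hu

theorem GraphLimit.isNode (hA : IsDistributedAlgorithm A) (h : GraphLimit Gs G)
    (hG : G.V.Infinite) (p : Path n D.Out) :
    ∀ᶠ k in atTop, ∀ t s v, IsNode A (Gs k) p t s v ↔ IsNode A G p t s v := by
  obtain ⟨s₀, h0⟩ := system_start_nonempty hA
  filter_upwards [h.walk hA (s₀, none) p, h.encard hG p.length] with k h1 h2 t s v
  rw [isNode_iff, isNode_iff]
  refine and_congr (iff_of_true h2 (by simp [hG.encard_eq])) (exists_congr fun s' => ?_)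
  exact and_congr_right fun hs' => system_start_unique hA h0 hs' ▸ h1 _ _

theorem GraphLimit.inTree (hA : IsDistributedAlgorithm A) (h : GraphLimit Gs G)
    (hG : G.V.Infinite) (p : Path n D.Out) :
    ∀ᶠ k in atTop, (InTree A (Gs k) p ↔ InTree A G p) := by
  filter_upwards [h.isNode hA hG p] with k hk
  simp only [InTree, hk]

/-- A decision in the limit is witnessed by one node, which eventually occurs in the approximating
trees. Conversely, a decision in such a tree can be repeated in the limit by `ReachDecides.mono`,
where deleting `⊥`-edges is essential and the greater height does no harm. -/
theorem GraphLimit.canDecide (hA : IsDistributedAlgorithm A) (h : GraphLimit Gs G)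
    (hG : G.V.Infinite) (p : Path n D.Out) (b : Bool) :
    ∀ᶠ k in atTop, (InTree A (Gs k) p ∧ CanDecide A (Gs k) p b ↔
      InTree A G p ∧ CanDecide A G p b) := by
  by_cases hd : CanDecide A G p b
  · obtain ⟨q, hq, hd'⟩ := id hd
    filter_upwards [h.inTree hA hG p, h.isNode hA hG q] with k h1 h2
    refine and_congr h1 (iff_of_true ⟨q, hq, ?_⟩ hd)
    obtain ⟨t, s, v, hn, hi⟩ := hd'
    exact ⟨t, s, v, (h2 _ _ _).2 hn, hi⟩
  · filter_upwards [h.isNode hA hG p] with k h1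
    refine iff_of_false ?_ fun h' => hd h'.2
    rintro ⟨⟨t, s, v, hn⟩, hc⟩
    refine hd ((canDecide_iff hA hG ((h1 _ _ _).1 hn)).2 ?_)
    exact (hc.of_isNode hA hn).imp id (ReachDecides.mono (h.le k))

theorem bivalent_iff_and {H : Graph n D.Out} {p : Path n D.Out} :
    Bivalent A H p ↔ (InTree A H p ∧ CanDecide A H p false) ∧ (InTree A H p ∧ CanDecide A H p true) := by
  unfold Bivalent
  tauto

theorem valent_iff_and {H : Graph n D.Out} {p : Path n D.Out} {b : Bool} :
    Valent A H p b ↔ (InTree A H p ∧ CanDecide A H p b) ∧ ¬ (InTree A H p ∧ CanDecide A H p !b) := by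
  unfold Valent
  tauto

theorem GraphLimit.bivalent (hA : IsDistributedAlgorithm A) (h : GraphLimit Gs G)
    (hG : G.V.Infinite) (p : Path n D.Out) :
    ∀ᶠ k in atTop, (Bivalent A (Gs k) p ↔ Bivalent A G p) := by
  filter_upwards [h.canDecide hA hG p false, h.canDecide hA hG p true] with k h1 h2
  rw [bivalent_iff_and, bivalent_iff_and, h1, h2]

theorem GraphLimit.valent (hA : IsDistributedAlgorithm A) (h : GraphLimit Gs G)
    (hG : G.V.Infinite) (p : Path n D.Out) (b : Bool) :
    ∀ᶠ k in atTop, (Valent A (Gs k) p b ↔ Valent A G p b) := by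
  filter_upwards [h.canDecide hA hG p b, h.canDecide hA hG p (!b)] with k h1 h2
  rw [valent_iff_and, valent_iff_and, h1, h2]

theorem GraphLimit.isNonBotDecisionGadget (hA : IsDistributedAlgorithm A) (h : GraphLimit Gs G)
    (hG : G.V.Infinite) (Y : Gadget n D.Out) :
    ∀ᶠ k in atTop, (IsNonBotDecisionGadget A (Gs k) Y ↔ IsNonBotDecisionGadget A G Y) := by
  have hhook : ∀ᶠ k in atTop, (HookCondition A (Gs k) Y ↔ HookCondition A G Y) := by
    rcases Y with ⟨N, l, u, u'⟩ | ⟨N, l, r, u, w, u'⟩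
    · exact Eventually.of_forall fun k => Iff.rfl
    · filter_upwards [h.isNode hA hG (N ++ [(r, w)])] with k hk
      simp only [HookCondition, hk]
  have hb : ∀ b, ∀ᶠ k in atTop, ((Valent A (Gs k) Y.left b ∧ Valent A (Gs k) Y.right (!b)) ↔
      (Valent A G Y.left b ∧ Valent A G Y.right (!b))) := by
    intro b
    filter_upwards [h.valent hA hG Y.left b, h.valent hA hG Y.right (!b)] with k h1 h2
    rw [h1, h2]
  filter_upwards [h.isNode hA hG Y.top, hhook, h.bivalent hA hG Y.top, hb false, hb true]
    with k h1 h2 h3 h4 h5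
  have h6 : IsNonBot A (Gs k) Y.top ↔ IsNonBot A G Y.top := by simp only [IsNonBot, h1]
  unfold IsNonBotDecisionGadget
  rw [h6, h2, h3]
  refine and_congr_right fun _ => and_congr_right fun _ => and_congr_right fun _ => ?_
  rw [Bool.exists_bool, Bool.exists_bool, h4, h5]

end Limits

/-! ### The order of nodes and gadgets -/

section Order

variable {n : ℕ} {O : Type}

theorem vertexNum_injOn {V : Set (Vertex n O)}
    (hV : ∀ u ∈ V, ∀ v ∈ V, u.loc = v.loc → u.idx = v.idx → u = v)
    {v w : Option (Vertex n O)} (hv : ∀ x, v = some x → x ∈ V) (hw : ∀ x, w = some x → x ∈ V)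
    (h : vertexNum v = vertexNum w) : v = w := by
  rcases v with _ | x <;> rcases w with _ | y
  · rfl
  · simp only [vertexNum] at h
    omega
  · simp only [vertexNum] at h
    omega
  · simp only [vertexNum] at h
    have hx := x.loc.isLt
    have hy := y.loc.isLt
    have h1 : x.loc.val + n * x.idx = y.loc.val + n * y.idx := by
      rw [mul_comm n, mul_comm n]
      omega
    have h2 : x.loc.val = y.loc.val := by
      have := congrArg (· % n) h1
      simpa [Nat.add_mul_mod_self_left, Nat.mod_eq_of_lt hx, Nat.mod_eq_of_lt hy] using this
    have h3 : x.idx = y.idx := by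
      rw [h2] at h1
      exact Nat.eq_of_mul_eq_mul_left (by omega) (Nat.add_left_cancel h1)
    rw [hV x (hv x rfl) y (hw y rfl) (Fin.ext h2) h3]

theorem Link.index_lt (c : Link n) :
    (if c.1.2.val < c.1.1.val then c.1.2.val + 1 else c.1.2.val) ≤ n - 1 ∧
      1 ≤ (if c.1.2.val < c.1.1.val then c.1.2.val + 1 else c.1.2.val) := by
  have h1 := c.1.1.isLt
  have h2 := c.1.2.isLt
  have h3 : c.1.1.val ≠ c.1.2.val := fun h => c.2 (Fin.ext h)
  split_ifs <;> omega

/-- The four kinds of labels occupy disjoint intervals, and within the channels division by `n - 1`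
with remainder recovers both ends. -/
theorem Label.num_injective : Function.Injective (Label.num : Label n → ℕ) := by
  have hchan : ∀ c : Link n, 3 * n < (Label.chan c).num ∧ (Label.chan c).num ≤ n ^ 2 + 2 * n := by
    intro c
    have h1 := c.1.1.isLt
    obtain ⟨h2, h3⟩ := c.index_lt
    simp only [Label.num]
    refine ⟨by omega, ?_⟩
    have h4 : (n - 1) * c.1.1.val + (n - 1) ≤ (n - 1) * n := by
      rw [← Nat.mul_succ]
      exact Nat.mul_le_mul_left _ h1
    have h5 : (n - 1) * n + n = n ^ 2 := by
      rw [sq, ← Nat.succ_mul, Nat.succ_eq_add_one, Nat.sub_add_cancel (by omega)]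
    omega
  rintro (i | ⟨i, b⟩ | c | i) (j | ⟨j, b'⟩ | d | j) h
  case chan.chan =>
    obtain ⟨h1, h2⟩ := c.index_lt
    obtain ⟨h3, h4⟩ := d.index_lt
    simp only [Label.num] at h
    set x := (if c.1.2.val < c.1.1.val then c.1.2.val + 1 else c.1.2.val) with hx
    set y := (if d.1.2.val < d.1.1.val then d.1.2.val + 1 else d.1.2.val) with hy
    have h5 : (x - 1) + (n - 1) * c.1.1.val = (y - 1) + (n - 1) * d.1.1.val := by omega
    have h6 : x - 1 = y - 1 := by
      have := congrArg (· % (n - 1)) h5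
      simpa [Nat.add_mul_mod_self_left, Nat.mod_eq_of_lt (show x - 1 < n - 1 by omega),
        Nat.mod_eq_of_lt (show y - 1 < n - 1 by omega)] using this
    have h7 : c.1.1.val = d.1.1.val := by
      rw [h6] at h5
      exact Nat.eq_of_mul_eq_mul_left (by omega) (Nat.add_left_cancel h5)
    have h8 : c.1.1.val ≠ c.1.2.val := fun h => c.2 (Fin.ext h)
    have h9 : d.1.1.val ≠ d.1.2.val := fun h => d.2 (Fin.ext h)
    have h10 : c.1.2.val = d.1.2.val := by
      split_ifs at hx hy <;> omega
    rw [show c = d from Subtype.ext (Prod.ext (Fin.ext h7) (Fin.ext h10))]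
  case env.env =>
    simp only [Label.num] at h
    have h1 := b.toNat_le
    have h2 := b'.toNat_le
    have h3 : i = j := Fin.ext (by omega)
    have h4 : b.toNat = b'.toNat := by omega
    cases b <;> cases b' <;> simp_all
  all_goals
    try have hc := hchan c
    try have hd := hchan d
    try have hi := i.isLt
    try have hj := j.isLt
    try have hb := b.toNat_le
    try have hb' := b'.toNat_le
    have hn : n * 1 ≤ n ^ 2 := by rw [sq]; exact Nat.mul_le_mul_left _ (by omega)
    simp only [Label.num] at h
    try simp only [Label.num] at hc
    try simp only [Label.num] at hd
    first
    | omega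
    | (have : i = j := Fin.ext (by omega)
       rw [this])

/-- The position of an edge in the order of edges. -/
def edgeKey (e : Label n × Option (Vertex n O)) : ℕ ×ₗ ℕ := toLex (vertexNum e.2, e.1.num)

theorem edgeLT_iff {e e' : Label n × Option (Vertex n O)} : edgeLT e e' ↔ edgeKey e < edgeKey e' := by
  rw [edgeKey, edgeKey, Prod.Lex.toLex_lt_toLex]
  rfl

/-- `edgeLT` compares keys only, while lexicographic order asks for equality of the common initial
edges. The two fit together where keys determine edges. -/
theorem lex_edgeLT_iff {S : Set (Label n × Option (Vertex n O))} (hS : Set.InjOn edgeKey S)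
    {p q : Path n O} (hp : ∀ e ∈ p, e ∈ S) (hq : ∀ e ∈ q, e ∈ S) :
    List.Lex edgeLT p q ↔ p.map edgeKey < q.map edgeKey := by
  induction p generalizing q with
  | nil =>
    cases q with
    | nil => simp
    | cons e q => exact iff_of_true List.Lex.nil (by simp)
  | cons e p ih =>
    cases q with
    | nil => simp
    | cons e' q =>
      have ih' := ih (q := q) (fun x hx => hp x (List.mem_cons_of_mem _ hx))
        (fun x hx => hq x (List.mem_cons_of_mem _ hx))
      rw [List.map_cons, List.map_cons, List.cons_lt_cons_iff, ← ih', ← edgeLT_iff]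
      constructor
      · rintro (_ | h | h)
        · exact Or.inl h
        · exact Or.inr ⟨rfl, h⟩
      · rintro (h | ⟨h, h'⟩)
        · exact List.Lex.rel h
        · rw [hS (hp e List.mem_cons_self) (hq e' List.mem_cons_self) h]
          exact List.Lex.cons h'

/-- The position of a node in the order of nodes. -/
def nodeKey (p : Path n O) : ℕ ×ₗ List (ℕ ×ₗ ℕ) := toLex (Path.level p, p.map edgeKey)

theorem nodeLT_iff {S : Set (Label n × Option (Vertex n O))} (hS : Set.InjOn edgeKey S)
    {p q : Path n O} (hp : ∀ e ∈ p, e ∈ S) (hq : ∀ e ∈ q, e ∈ S) :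
    nodeLT p q ↔ nodeKey p < nodeKey q := by
  rw [nodeKey, nodeKey, Prod.Lex.toLex_lt_toLex, ← lex_edgeLT_iff hS hp hq]
  rfl

theorem nodeKey_inj {S : Set (Label n × Option (Vertex n O))} (hS : Set.InjOn edgeKey S)
    {p q : Path n O} (hp : ∀ e ∈ p, e ∈ S) (hq : ∀ e ∈ q, e ∈ S) (h : nodeKey p = nodeKey q) :
    p = q := by
  have h1 : p.map edgeKey = q.map edgeKey := (Prod.ext_iff.1 (toLex.injective h)).2
  clear h
  induction p generalizing q with
  | nil => simpa using h1.symm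
  | cons e p ih =>
    cases q with
    | nil => simp at h1
    | cons e' q =>
      rw [List.map_cons, List.map_cons, List.cons.injEq] at h1
      rw [hS (hp e List.mem_cons_self) (hq e' List.mem_cons_self) h1.1,
        ih (fun x hx => hp x (List.mem_cons_of_mem _ hx))
          (fun x hx => hq x (List.mem_cons_of_mem _ hx)) h1.2]

/-- The values with sum `s` start at `s(s+1)/2` and fill a block of length `s + 1`, because `b ≤ s`.
-/
theorem cantorPair_lt_of_lt {a b a' b' : ℕ} (h : a + b < a' + b') :
    cantorPair a b < cantorPair a' b' := by
  have h1 : (a + b) * (a + b + 1) / 2 + (a + b + 1) ≤ (a' + b') * (a' + b' + 1) / 2 := by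
    have h2 : (a + b + 1) * (a + b + 1 + 1) ≤ (a' + b') * (a' + b' + 1) :=
      Nat.mul_le_mul (by omega) (by omega)
    have h3 : (a + b + 1) * (a + b + 1 + 1) = (a + b) * (a + b + 1) + (a + b + 1) * 2 := by ring
    rw [h3] at h2
    calc _ = ((a + b) * (a + b + 1) + (a + b + 1) * 2) / 2 := by
          rw [Nat.add_mul_div_right _ _ (by norm_num)]
      _ ≤ _ := Nat.div_le_div_right h2
  unfold cantorPair
  omega

theorem cantorPair_inj {a b a' b' : ℕ} (h : cantorPair a b = cantorPair a' b') :
    a = a' ∧ b = b' := by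
  have h1 : a + b = a' + b' := by
    rcases lt_trichotomy (a + b) (a' + b') with h1 | h1 | h1
    · exact absurd h (cantorPair_lt_of_lt h1).ne
    · exact h1
    · exact absurd h (cantorPair_lt_of_lt h1).ne'
  unfold cantorPair at h
  rw [h1] at h
  omega

theorem le_cantorPair (a b : ℕ) : a ≤ cantorPair a b ∧ b ≤ cantorPair a b := by
  refine ⟨?_, Nat.le_add_left _ _⟩
  have h1 : a + b ≤ (a + b) * (a + b + 1) / 2 + b := by
    rcases Nat.eq_zero_or_pos (a + b) with h | h
    · omega
    · have : (a + b) * 2 ≤ (a + b) * (a + b + 1) := Nat.mul_le_mul_left _ (by omega)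
      have := (Nat.le_div_iff_mul_le (by norm_num : 0 < 2)).2 this
      omega
  exact (Nat.le_add_right a b).trans h1

/-- Gadgets are determined by their nodes. -/
theorem Gadget.ext_nodes {Y Y' : Gadget n O} (h1 : Y.top = Y'.top) (h2 : Y.left = Y'.left)
    (h3 : Y.right = Y'.right) : Y = Y' := by
  rcases Y with ⟨N, l, u, u'⟩ | ⟨N, l, r, u, w, u'⟩ <;>
  rcases Y' with ⟨N', m, x, x'⟩ | ⟨N', m, r', x, y, x'⟩ <;>
  simp only [Gadget.top] at h1 <;> subst h1 <;> simp_all [Gadget.left, Gadget.right]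

theorem finite_bounded_lists {α : Type} {S : Set α} (hS : S.Finite) (L : ℕ) :
    {l : List α | l.length ≤ L ∧ ∀ x ∈ l, x ∈ S}.Finite := by
  have : Finite S := hS
  refine ((List.finite_length_le S L).image (List.map Subtype.val)).subset ?_
  rintro l ⟨h1, h2⟩
  refine ⟨l.attach.map fun x => ⟨x.1, h2 x.1 x.2⟩, by simpa using h1, ?_⟩
  simp

end Order

/-! ### Stabilization of the first gadget -/

section Stabilization

variable {n f : ℕ} {D : CrashProblem n} {M X : Type}
  {A : Fin n → Automaton (ProcAct D (consensus n f) M X)} {G H : Graph n D.Out}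
  {t : Stream'.Seq D.Ev} {pos : Vertex n D.Out → ℕ}

theorem IsEdge.cases {v w : Option (Vertex n D.Out)} {l : Label n} (he : IsEdge G v l w) :
    w = v ∨ ∃ u, w = some u ∧ G.Succ v u := by
  rcases l with i | ⟨i, b⟩ | d | i
  · exact Or.inl he
  · exact Or.inl he
  · exact Or.inl he
  · rcases he with ⟨u, h1, -, h2⟩ | ⟨-, h⟩
    · exact Or.inr ⟨u, h1, h2⟩
    · exact Or.inl h

/-- The index of a vertex tag. -/
def tagIdx : Option (Vertex n D.Out) → ℕ
  | none => 0
  | some u => u.idx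

theorem level_concat (p : Path n D.Out) (l : Label n) (w : Option (Vertex n D.Out)) :
    Path.level (p ++ [(l, w)]) = p.length + 1 + tagIdx w := by
  unfold Path.level
  rw [List.getLast?_concat, List.length_append]
  rcases w with _ | u <;> rfl

theorem IsNode.level {p : Path n D.Out}
    {tags : List (Option (SysAct D (consensus n f) M X Empty))}
    {s : (system A (consensusEnv n f)).State} {v : Option (Vertex n D.Out)}
    (h : IsNode A H p tags s v) : Path.level p = p.length + tagIdx v := by
  cases h with
  | root => rfl
  | bot p tags s v w l => rw [level_concat, List.length_append]; rfl
  | act p tags s s' v w l a => rw [level_concat, List.length_append]; rfl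

/-- The vertex tags on the path to a node precede the vertex tag of the node. -/
theorem IsNode.tag_le (hG : TraceGraph t G pos) (hle : H.LE G) {p : Path n D.Out}
    {tags : List (Option (SysAct D (consensus n f) M X Empty))}
    {s : (system A (consensusEnv n f)).State} {v : Option (Vertex n D.Out)}
    (h : IsNode A H p tags s v) : TagMem G v ∧ ∀ e ∈ p, e.2 = none ∨ e.2 = v ∨
      ∃ x y, e.2 = some x ∧ v = some y ∧ (x, y) ∈ G.Z := by
  have key : ∀ (p : Path n D.Out) (v w : Option (Vertex n D.Out)) (l : Label n), IsEdge H v l w →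
      (TagMem G v ∧ ∀ e ∈ p, e.2 = none ∨ e.2 = v ∨
        ∃ x y, e.2 = some x ∧ v = some y ∧ (x, y) ∈ G.Z) →
      (TagMem G w ∧ ∀ e ∈ p ++ [(l, w)], e.2 = none ∨ e.2 = w ∨
        ∃ x y, e.2 = some x ∧ w = some y ∧ (x, y) ∈ G.Z) := by
    rintro p v w l he ⟨hv, hp⟩
    rcases he.cases with rfl | ⟨u, rfl, hs⟩
    · refine ⟨hv, fun e he => ?_⟩
      rcases List.mem_append.1 he with he | he
      · exact hp e he
      · rw [List.mem_singleton.1 he]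
        exact Or.inr (Or.inl rfl)
    · have hs := hle.succ hs
      refine ⟨by rintro x ⟨⟩; exact hs.1, fun e he => ?_⟩
      rcases List.mem_append.1 he with he | he
      · rcases hp e he with h | h | ⟨x, y, h1, h2, h3⟩
        · exact Or.inl h
        · rcases hv : v with _ | x
          · exact Or.inl (h.trans hv)
          · exact Or.inr (Or.inr ⟨x, u, h.trans hv, rfl, hs.2 x hv⟩)
        · exact Or.inr (Or.inr ⟨x, u, h1, rfl, hG.trans _ _ _ h3 (hs.2 y h2)⟩)
      · rw [List.mem_singleton.1 he]
        exact Or.inr (Or.inl rfl)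
  induction h with
  | root => exact ⟨by rintro x ⟨⟩, by simp⟩
  | bot p tags s v w l hp hh he ha ih => exact key _ _ _ _ he ih
  | act p tags s s' v w l a hp hh he ha hs ih => exact key _ _ _ _ he ih

/-- The vertices of index at most `L` and their predecessors. -/
def lowVertices (G : Graph n D.Out) (L : ℕ) : Set (Vertex n D.Out) :=
  {x | x ∈ G.V ∧ (x.idx ≤ L ∨ ∃ y ∈ G.V, y.idx ≤ L ∧ (x, y) ∈ G.Z)}

/-- A vertex is determined by location and index, and its predecessors have smaller positions in
`t`, so there are finitely many of them. -/
theorem TraceGraph.finite_lowVertices (hG : TraceGraph t G pos) (L : ℕ) :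
    (lowVertices G L).Finite := by
  have h1 : {x | x ∈ G.V ∧ x.idx ≤ L}.Finite := by
    refine Set.Finite.of_finite_image (f := fun x => (x.loc, x.idx))
      ((Set.finite_univ.prod (Set.finite_le_nat L)).subset ?_) ?_
    · rintro _ ⟨x, hx, rfl⟩
      exact ⟨Set.mem_univ _, hx.2⟩
    · intro x hx y hy h
      exact hG.idx x hx.1 y hy.1 (Prod.ext_iff.1 h).1 (Prod.ext_iff.1 h).2
  have h2 : ∀ y, {x | (x, y) ∈ G.Z}.Finite := by
    intro y
    refine Set.Finite.of_finite_image (f := pos) ((Set.finite_lt_nat (pos y)).subset ?_) ?_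
    · rintro _ ⟨x, hx, rfl⟩
      exact (hG.edge x y hx).2.2
    · intro x hx x' hx'
      exact hG.inj (hG.edge x y hx).1 (hG.edge x' y hx').1
  refine (h1.union (h1.biUnion fun y _ => h2 y)).subset ?_
  rintro x ⟨hx, h | ⟨y, hy, hyL, hxy⟩⟩
  · exact Or.inl ⟨hx, h⟩
  · exact Or.inr (Set.mem_biUnion (show y ∈ {x | x ∈ G.V ∧ x.idx ≤ L} from ⟨hy, hyL⟩) hxy)

/-- A set of paths that contains all nodes of level at most `L`. -/
def lowPaths (G : Graph n D.Out) (L : ℕ) : Set (Path n D.Out) :=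
  {p | p.length ≤ L ∧ ∀ e ∈ p, e ∈ (Set.univ ×ˢ {o | ∀ x ∈ o, x ∈ lowVertices G L} :
    Set (Label n × Option (Vertex n D.Out)))}

theorem TraceGraph.finite_lowPaths (hG : TraceGraph t G pos) (L : ℕ) : (lowPaths G L).Finite := by
  refine finite_bounded_lists (Set.Finite.prod ?_ ?_) L
  · have : Finite (Label n) := Finite.of_injective
      (fun l : Label n => (match l with
        | .proc i => Sum.inl i
        | .env i b => Sum.inr (Sum.inl (i, b))
        | .chan c => Sum.inr (Sum.inr (Sum.inl c))
        | .fd i => Sum.inr (Sum.inr (Sum.inr i)) :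
          Fin n ⊕ (Fin n × Bool) ⊕ Link n ⊕ Fin n)) (by
      rintro (i | ⟨i, b⟩ | c | i) (j | ⟨j, b'⟩ | d | j) h <;> simp_all)
    exact Set.finite_univ
  · refine (((hG.finite_lowVertices L).image some).insert none).subset ?_
    rintro (_ | x) hx
    · exact Set.mem_insert _ _
    · exact Or.inr ⟨x, hx x rfl, rfl⟩

/-- The level bounds the index of the last vertex tag only. The earlier tags may have larger indices
at other locations, but by transitivity they are predecessors of the last one. The bounding set
depends on `G` and not on `H`. -/
theorem InTree.mem_lowPaths (hG : TraceGraph t G pos) (hle : H.LE G) {p : Path n D.Out}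
    (h : InTree A H p) {L : ℕ} (hL : Path.level p ≤ L) : p ∈ lowPaths G L := by
  obtain ⟨tags, s, v, hn⟩ := h
  rw [hn.level] at hL
  obtain ⟨hv, hp⟩ := hn.tag_le hG hle
  refine ⟨by omega, fun e he => ⟨Set.mem_univ _, ?_⟩⟩
  intro x hx
  rcases hp e he with h | h | ⟨x', y, h1, h2, h3⟩
  · rw [h] at hx
    cases hx
  · rw [h] at hx
    obtain rfl := Option.mem_def.1 hx
    exact ⟨hv x rfl, Or.inl ((Nat.le_add_left _ _).trans hL)⟩
  · rw [h1] at hx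
    obtain rfl := Option.mem_some_iff.1 hx
    subst h2
    exact ⟨(hG.edge _ _ h3).1, Or.inr ⟨y, hv y rfl, (Nat.le_add_left _ _).trans hL, h3⟩⟩

theorem nodeLT.level_le {O : Type} {p q : Path n O} (h : nodeLT p q) :
    Path.level p ≤ Path.level q := by
  rcases h with h | ⟨h, -⟩ <;> omega

theorem TraceGraph.finite_before (hG : TraceGraph t G pos) (hle : H.LE G) (p : Path n D.Out) :
    {q | InTree A H q ∧ nodeLT q p}.Finite :=
  (hG.finite_lowPaths (Path.level p)).subset fun _ hq =>
    hq.1.mem_lowPaths hG hle hq.2.level_le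

theorem TraceGraph.edgeKey_injOn (hG : TraceGraph t G pos) :
    Set.InjOn edgeKey {e : Label n × Option (Vertex n D.Out) | TagMem G e.2} := by
  intro e he e' he' h
  obtain ⟨h1, h2⟩ := Prod.ext_iff.1 (toLex.injective h)
  exact Prod.ext (Label.num_injective h2) (vertexNum_injOn hG.idx he he' h1)

theorem InTree.tagMem (hG : TraceGraph t G pos) {p : Path n D.Out} (h : InTree A G p) :
    ∀ e ∈ p, e ∈ {e : Label n × Option (Vertex n D.Out) | TagMem G e.2} := by
  intro e he x hx
  obtain ⟨-, h2⟩ := h.mem_lowPaths hG (Graph.LE.refl G) le_rfl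
  exact ((h2 e he).2 x hx).1

/-- Node keys are linearly ordered and injective on the tree, and the sets of earlier nodes are
finite, so a larger key has strictly more nodes before it. -/
theorem TraceGraph.rank_inj (hG : TraceGraph t G pos) {p q : Path n D.Out} (hp : InTree A G p)
    (hq : InTree A G q) (h : rank A G p = rank A G q) : p = q := by
  have hlt : ∀ {p q : Path n D.Out}, InTree A G p → InTree A G q → nodeKey p < nodeKey q →
      rank A G p < rank A G q := by
    intro p q hp hq hpq
    refine Set.ncard_lt_ncard ⟨?_, fun hsub => ?_⟩ (hG.finite_before (Graph.LE.refl G) q)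
    · rintro r ⟨hr, hrp⟩
      refine ⟨hr, ?_⟩
      rw [nodeLT_iff hG.edgeKey_injOn (hr.tagMem hG) (hp.tagMem hG)] at hrp
      exact (nodeLT_iff hG.edgeKey_injOn (hr.tagMem hG) (hq.tagMem hG)).2 (hrp.trans hpq)
    · have := hsub (show p ∈ {r | InTree A G r ∧ nodeLT r q} from
        ⟨hp, (nodeLT_iff hG.edgeKey_injOn (hp.tagMem hG) (hq.tagMem hG)).2 hpq⟩)
      exact lt_irrefl _ ((nodeLT_iff hG.edgeKey_injOn (hp.tagMem hG) (hp.tagMem hG)).1 this.2)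
  refine nodeKey_inj hG.edgeKey_injOn (hp.tagMem hG) (hq.tagMem hG) ?_
  rcases lt_trichotomy (nodeKey p) (nodeKey q) with h1 | h1 | h1
  · exact absurd h (hlt hp hq h1).ne
  · exact h1
  · exact absurd h (hlt hq hp h1).ne'

theorem IsNonBotDecisionGadget.inTree {Y : Gadget n D.Out} (hY : IsNonBotDecisionGadget A H Y) :
    InTree A H Y.top ∧ InTree A H Y.left ∧ InTree A H Y.right := by
  obtain ⟨h1, -, -, b, h2, h3⟩ := hY
  exact ⟨h1.inTree, h2.1, h3.1⟩

theorem TraceGraph.metric_inj (hG : TraceGraph t G pos) {Y Y' : Gadget n D.Out}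
    (hY : IsNonBotDecisionGadget A G Y) (hY' : IsNonBotDecisionGadget A G Y')
    (h : Y.metric A G = Y'.metric A G) : Y = Y' := by
  obtain ⟨h1, h2⟩ := cantorPair_inj h
  obtain ⟨h3, h4⟩ := cantorPair_inj h2
  exact Gadget.ext_nodes (hG.rank_inj hY.inTree.1 hY'.inTree.1 h1)
    (hG.rank_inj hY.inTree.2.1 hY'.inTree.2.1 h3) (hG.rank_inj hY.inTree.2.2 hY'.inTree.2.2 h4)

/-- The tree has a first non-`⊥` decision gadget. -/
theorem ConsensusSetting.exists_isFirst (h : ConsensusSetting A G t pos) :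
    ∃ Y, IsFirst A G Y := by
  obtain ⟨Y, hY, hmin⟩ := (InvImage.wf (Gadget.metric A G) wellFounded_lt).has_min
    {Y | IsNonBotDecisionGadget A G Y} h.exists_gadget
  refine ⟨Y, hY, fun Y' hY' hne => ?_⟩
  refine lt_of_le_of_ne (not_lt.1 (hmin Y' hY')) fun heq => hne ?_
  exact h.graph.metric_inj hY' hY heq.symm

theorem IsFirst.unique {Y Y' : Gadget n D.Out} (h : IsFirst A H Y) (h' : IsFirst A H Y') :
    Y = Y' := by
  by_contra hne
  exact lt_asymm (h.2 Y' h'.1 (Ne.symm hne)) (h'.2 Y h.1 hne)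

theorem IsFirst.firstLoc_eq {Y : Gadget n D.Out} (h : IsFirst A H Y) (cur : Fin n) :
    firstLoc A H cur = Y.critLoc := by
  have hex : ∃ Y, IsFirst A H Y := ⟨Y, h⟩
  rw [firstLoc, dif_pos hex, hex.choose_spec.unique h]

variable {Gs : ℕ → Graph n D.Out}

/-- Membership in the tree has to stabilize only for the finitely many paths of level at most that
of `p`. -/
theorem GraphLimit.rank (hA : IsDistributedAlgorithm A) (h : GraphLimit Gs G)
    (hG : TraceGraph t G pos) (hinf : G.V.Infinite) (p : Path n D.Out) :
    ∀ᶠ k in atTop, rank A (Gs k) p = rank A G p := by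
  filter_upwards [(eventually_all_finite (hG.finite_lowPaths (Path.level p))).2
    fun q _ => h.inTree hA hinf q] with k hk
  unfold Afd.rank
  congr 1
  ext q
  constructor
  · rintro ⟨h1, h2⟩
    exact ⟨(hk q (h1.mem_lowPaths hG (h.le k) h2.level_le)).1 h1, h2⟩
  · rintro ⟨h1, h2⟩
    exact ⟨(hk q (h1.mem_lowPaths hG (Graph.LE.refl G) h2.level_le)).2 h1, h2⟩

theorem GraphLimit.metric (hA : IsDistributedAlgorithm A) (h : GraphLimit Gs G)
    (hG : TraceGraph t G pos) (hinf : G.V.Infinite) (Y : Gadget n D.Out) :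
    ∀ᶠ k in atTop, Y.metric A (Gs k) = Y.metric A G := by
  filter_upwards [h.rank hA hG hinf Y.top, h.rank hA hG hinf Y.left,
    h.rank hA hG hinf Y.right] with k h1 h2 h3
  rw [Gadget.metric, Gadget.metric, h1, h2, h3]

/-- The path that uses only `Proc_i` keeps the vertex tag `⊥`, so it supplies a node of each level
up to the number of vertices. -/
theorem isNode_replicate (hA : IsDistributedAlgorithm A) (i : Fin n) (j : ℕ)
    (hj : (j : ℕ∞) ≤ H.V.encard) :
    InTree A H (List.replicate j (Label.proc i, (none : Option (Vertex n D.Out)))) := by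
  obtain ⟨s₀, h0⟩ := system_start_nonempty hA
  have key : ∀ j s, ∃ tags s', Walk A H (s, none)
      (List.replicate j (Label.proc i, (none : Option (Vertex n D.Out)))) tags (s', none) := by
    intro j
    induction j with
    | zero => exact fun s => ⟨[], s, rfl, rfl⟩
    | succ j ih =>
      intro s
      obtain ⟨o, ⟨s₁, v₁⟩, hs⟩ := step_exists hA ((s, none) : Cfg A)
        (show IsEdge H none (.proc i) none from rfl)
      obtain rfl : v₁ = none := hs.isEdge.2.1
      obtain ⟨tags, s', hw⟩ := ih s₁
      exact ⟨_, s', o, _, tags, hs, hw, rfl⟩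
  obtain ⟨tags, s', hw⟩ := key j s₀
  exact ⟨tags, s', none, isNode_iff.2 ⟨by simpa using hj, s₀, h0, hw⟩⟩

theorem level_replicate (i : Fin n) (j : ℕ) :
    Path.level (List.replicate j (Label.proc i, (none : Option (Vertex n D.Out)))) = j := by
  cases j with
  | zero => rfl
  | succ j => rw [List.replicate_succ', level_concat]; simp [tagIdx]

/-- In large graphs, the level of a node is at most its rank. -/
theorem level_le_of_rank_le (hA : IsDistributedAlgorithm A) (hG : TraceGraph t G pos)
    (hle : H.LE G) (i : Fin n) {m : ℕ} (hm : (m : ℕ∞) ≤ H.V.encard) {p : Path n D.Out}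
    (hp : rank A H p ≤ m) : Path.level p ≤ m := by
  by_contra hlt
  push Not at hlt
  -- If the level of `p` exceeded `m`, the nodes of levels `0, …, m` on the `Proc_i` path would be
  -- `m + 1` nodes before `p`.
  have h1 : (Finset.range (m + 1)).card ≤ rank A H p := by
    rw [← Set.ncard_coe_finset]
    refine Set.ncard_le_ncard_of_injOn
      (fun j => List.replicate j (Label.proc i, (none : Option (Vertex n D.Out)))) ?_ ?_
      (hG.finite_before hle p)
    · intro j hj
      have hj : j < m + 1 := by simpa using hj
      refine ⟨isNode_replicate hA i j (le_trans (by exact_mod_cast Nat.lt_succ_iff.1 hj) hm), Or.inl ?_⟩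
      rw [level_replicate]
      omega
    · intro j _ j' _ h
      simpa using congrArg List.length h
  rw [Finset.card_range] at h1
  omega

/-- The first gadget of the limit is eventually the first gadget. -/
theorem ConsensusSetting.eventually_isFirst (h : ConsensusSetting A G t pos)
    (hlim : GraphLimit Gs G) {Y : Gadget n D.Out} (hY : IsFirst A G Y) :
    ∀ᶠ k in atTop, IsFirst A (Gs k) Y := by
  obtain ⟨i₀, -⟩ := h.exists_live
  set m := Y.metric A G with hm
  -- The possible competitors form a finite set that does not depend on `k`, so finitely many
  -- eventual statements suffice.
  have hfin : {Y' : Gadget n D.Out | Y'.top ∈ lowPaths G m ∧ Y'.left ∈ lowPaths G m ∧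
      Y'.right ∈ lowPaths G m}.Finite := by
    have hfin := h.graph.finite_lowPaths m
    refine Set.Finite.of_finite_image (f := fun Y' => (Y'.top, Y'.left, Y'.right))
      ((hfin.prod (hfin.prod hfin)).subset ?_) ?_
    · rintro _ ⟨Y', h', rfl⟩
      exact h'
    · intro Y₁ _ Y₂ _ heq
      obtain ⟨h1, h2⟩ := Prod.ext_iff.1 heq
      exact Gadget.ext_nodes h1 (Prod.ext_iff.1 h2).1 (Prod.ext_iff.1 h2).2
  filter_upwards [hlim.isNonBotDecisionGadget h.alg h.V_infinite Y,
    hlim.metric h.alg h.graph h.V_infinite Y, hlim.encard h.V_infinite m,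
    (eventually_all_finite hfin).2 fun Y' _ =>
      hlim.isNonBotDecisionGadget h.alg h.V_infinite Y',
    (eventually_all_finite hfin).2 fun Y' _ => hlim.metric h.alg h.graph h.V_infinite Y']
    with k h1 h2 h3 h4 h5
  refine ⟨h1.2 hY.1, fun Y' hY' hne => ?_⟩
  rw [h2]
  by_contra hlt
  push Not at hlt
  -- Both arguments of the pairing function are bounded by its value, so all three ranks are at most
  -- `m`.
  have hr1 := (le_cantorPair _ _).1.trans hlt
  have hr2 := (le_cantorPair _ _).2.trans hlt
  have hr3 := (le_cantorPair _ _).1.trans hr2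
  have hr4 := (le_cantorPair _ _).2.trans hr2
  have key : ∀ {p}, InTree A (Gs k) p → Afd.rank A (Gs k) p ≤ m → p ∈ lowPaths G m :=
    fun hp hr => hp.mem_lowPaths h.graph (hlim.le k)
      (level_le_of_rank_le h.alg h.graph (hlim.le k) i₀ h3 hr)
  have hmem : Y' ∈ {Y' : Gadget n D.Out | Y'.top ∈ lowPaths G m ∧ Y'.left ∈ lowPaths G m ∧
      Y'.right ∈ lowPaths G m} :=
    ⟨key hY'.inTree.1 hr1, key hY'.inTree.2.1 hr3, key hY'.inTree.2.2 hr4⟩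
  have h6 := hY.2 Y' ((h4 Y' hmem).1 hY') hne
  rw [h5 Y' hmem] at hlt
  omega

end Stabilization

/-! ### The algorithm for `Ω_f` -/

section OmegaAlgorithmLemmas

variable {n f : ℕ} {D : CrashProblem n} {M X : Type}
  {A : Fin n → Automaton (ProcAct D (consensus n f) M X)}

theorem omegaAlg_crash_trans {i : Fin n} {s s' : OmegaState n D.Out}
    (h : (omegaAlg A i).trans s (.crash i) s') : s'.faulty = true := by
  rcases h with ⟨-, rfl⟩ | ⟨o, h, -⟩ | ⟨m, j, h, -⟩ | ⟨m, j, q, h, -⟩ | ⟨j, q, h, -⟩ <;>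
    first | rfl | cases h

theorem omegaAlg_faulty_trans {i : Fin n} {s s' : OmegaState n D.Out}
    {a : ProcAct D (omegaF n f) (Graph n D.Out) Empty} (h : (omegaAlg A i).trans s a s')
    (hs : s.faulty = true) : s'.faulty = true := by
  rcases h with ⟨-, rfl⟩ | ⟨o, -, -, rfl⟩ | ⟨m, j, -, -, rfl⟩ | ⟨m, j, q, -, -, h, -⟩ |
    ⟨j, q, -, h, -⟩
  · rfl
  · rwa [if_pos hs]
  · rwa [if_pos hs]
  · rw [hs] at h
    cases h
  · rw [hs] at h
    cases h

theorem omegaAlg_local_trans {i : Fin n} {s s' : OmegaState n D.Out}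
    {a : ProcAct D (omegaF n f) (Graph n D.Out) Empty} (h : (omegaAlg A i).trans s a s')
    (ha : a ∈ (omegaAlg A i).locallyControlled) : s.faulty = false ∧
      ((∃ m j q, a = .send m i j ∧ s.sendq = (Sum.inl m, j) :: q) ∨
        ∃ j q, a = .pout (j, i) ∧ s.sendq = (Sum.inr j, i) :: q) := by
  have ha : (∃ m j, j ≠ i ∧ a = .send m i j) ∨ ∃ j, a = .pout (j, i) := by
    rcases ha with ha | ha
    · exact ha
    · exact ha.elim
  rcases h with ⟨rfl, -⟩ | ⟨o, rfl, -⟩ | ⟨m, j, rfl, -⟩ | ⟨m, j, q, rfl, -, h1, h2, -⟩ |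
    ⟨j, q, rfl, h1, h2, -⟩
  · rcases ha with ⟨m, j, -, h⟩ | ⟨j, h⟩ <;> cases h
  · rcases ha with ⟨m, j, -, h⟩ | ⟨j, h⟩ <;> cases h
  · rcases ha with ⟨m, j, -, h⟩ | ⟨j, h⟩ <;> cases h
  · exact ⟨h1, Or.inl ⟨m, j, q, rfl, h2⟩⟩
  · exact ⟨h1, Or.inr ⟨j, q, rfl, h2⟩⟩

theorem omegaAlg_wellFormed (A : Fin n → Automaton (ProcAct D (consensus n f) M X)) (i : Fin n) :
    (omegaAlg A i).WellFormed where
  input_output := by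
    rw [Set.disjoint_left]
    rintro a (rfl | ⟨o, -, rfl⟩ | ⟨m, j, -, rfl⟩) (⟨m, j, -, h⟩ | ⟨j, h⟩) <;> cases h
  input_internal := Set.disjoint_empty _
  output_internal := Set.disjoint_empty _
  start_nonempty := ⟨_, rfl⟩
  trans_acts := by
    rintro s a s' (⟨rfl, -⟩ | ⟨o, rfl, h, -⟩ | ⟨m, j, rfl, h, -⟩ | ⟨m, j, q, rfl, h, -⟩ |
      ⟨j, q, rfl, -⟩)
    · exact Or.inl (Or.inl (Or.inl rfl))
    · exact Or.inl (Or.inl (Or.inr (Or.inl ⟨o, h, rfl⟩)))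
    · exact Or.inl (Or.inl (Or.inr (Or.inr ⟨m, j, h, rfl⟩)))
    · exact Or.inl (Or.inr (Or.inl ⟨m, j, h, rfl⟩))
    · exact Or.inl (Or.inr (Or.inr ⟨j, rfl⟩))
  input_enabled := by
    rintro s a (rfl | ⟨o, h, rfl⟩ | ⟨m, j, h, rfl⟩)
    · exact ⟨_, Or.inl ⟨rfl, rfl⟩⟩
    · exact ⟨_, Or.inr (Or.inl ⟨o, rfl, h, rfl⟩)⟩
    · exact ⟨_, Or.inr (Or.inr (Or.inl ⟨m, j, rfl, h, rfl⟩))⟩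
  task_local := fun _ _ ha => Or.inl ha
  task_unique := by
    rintro a (ha | ha)
    · exact ⟨(), ha, fun _ _ => rfl⟩
    · exact ha.elim

theorem omegaAlg_deterministic (A : Fin n → Automaton (ProcAct D (consensus n f) M X))
    (i : Fin n) : (omegaAlg A i).Deterministic where
  taskDeterministic := by
    constructor
    · rintro c s a ha b hb ⟨s₁, h1⟩ ⟨s₂, h2⟩
      rcases (omegaAlg_local_trans h1 (Or.inl ha)).2 with ⟨m, j, q, rfl, h3⟩ | ⟨j, q, rfl, h3⟩ <;>
      rcases (omegaAlg_local_trans h2 (Or.inl hb)).2 with ⟨m', j', q', rfl, h4⟩ |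
        ⟨j', q', rfl, h4⟩ <;>
      rw [h3] at h4 <;> cases h4 <;> rfl
    · rintro s a s₁ s₂ h1 h2
      rcases h1 with ⟨rfl, rfl⟩ | ⟨o, rfl, -, rfl⟩ | ⟨m, j, rfl, -, rfl⟩ |
        ⟨m, j, q, rfl, -, -, hq, rfl⟩ | ⟨j, q, rfl, -, hq, rfl⟩ <;>
      rcases h2 with ⟨h, rfl⟩ | ⟨o', h, -, rfl⟩ | ⟨m', j', h, -, rfl⟩ |
        ⟨m', j', q', h, -, -, hq', rfl⟩ | ⟨j', q', h, -, hq', rfl⟩ <;>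
      cases h
      · rfl
      · rfl
      · rfl
      · rw [hq] at hq'
        rw [(List.cons.inj hq').2]
      · rw [hq] at hq'
        rw [(List.cons.inj hq').2]
  one_task := ⟨(), trivial, fun _ _ => rfl⟩
  one_start := ⟨_, rfl, fun _ h => h⟩

theorem omegaAlg_isDistributedAlgorithm
    (A : Fin n → Automaton (ProcAct D (consensus n f) M X)) :
    IsDistributedAlgorithm (P := omegaF n f) (omegaAlg A) where
  wellFormed := omegaAlg_wellFormed A
  deterministic := omegaAlg_deterministic A
  input_eq := by
    intro i
    ext a
    constructor
    · rintro (h | h | h)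
      · exact Or.inl h
      · exact Or.inr (Or.inl h)
      · exact Or.inr (Or.inr (Or.inl h))
    · rintro (h | h | h | ⟨x, -⟩)
      · exact Or.inl h
      · exact Or.inr (Or.inl h)
      · exact Or.inr (Or.inr h)
      · exact x.elim
  output_eq := by
    intro i
    ext a
    constructor
    · rintro (h | ⟨j, rfl⟩)
      · exact Or.inl h
      · exact Or.inr ⟨(j, i), rfl, rfl⟩
    · rintro (h | ⟨⟨j, i'⟩, rfl, rfl⟩)
      · exact Or.inl h
      · exact Or.inr ⟨j, rfl⟩
  internal_subset := fun i => Set.empty_subset _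
  crash_disables := by
    intro i x k l hk hkl hl a ha hen
    have key : ∀ l ≥ k, (x.events.get? l).isSome = true →
        (show OmegaState n D.Out from x.state (l + 1)).faulty = true := by
      intro l hl
      induction l, hl using Nat.le_induction with
      | base => exact fun _ => omegaAlg_crash_trans (x.step k _ hk)
      | succ l hl ih =>
        intro hs
        obtain ⟨b, hb⟩ := Option.isSome_iff_exists.1 hs
        obtain ⟨b', hb'⟩ := Stream'.Seq.ge_stable _ (Nat.le_succ l) hb
        exact omegaAlg_faulty_trans (x.step _ _ hb) (ih (by rw [hb']; rfl))
    obtain ⟨s', hs'⟩ := hen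
    have := (omegaAlg_local_trans hs' ha).1
    rw [key l hkl hl] at this
    cases this

end OmegaAlgorithmLemmas

/-! ### Runs of the processes and channels -/

section OmegaRuns

variable {n f : ℕ} {D : CrashProblem n} {M X Y : Type}
  {A : Fin n → Automaton (ProcAct D (consensus n f) M X)}

/-- The steps of the process at `i`, in the runs of the system. -/
def OmegaStep (A : Fin n → Automaton (ProcAct D (consensus n f) M X)) (i : Fin n)
    (a : SysAct D (omegaF n f) (Graph n D.Out) Empty Y) (s s' : OmegaState n D.Out) : Prop :=
  (a = .crash i ∧ s' = { s with faulty := true }) ∨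
  (∃ o, a = .fd o ∧ D.locOut o = i ∧ s.faulty = false ∧ s' = s.afterFd A i o) ∨
  (∃ m j, a = .recv m j i ∧ j ≠ i ∧ s.faulty = false ∧ s' = { s with G := s.G.union m }) ∨
  (∃ m j q, a = .send m i j ∧ j ≠ i ∧ s.faulty = false ∧ s.sendq = (Sum.inl m, j) :: q ∧
    s' = { s with sendq := q }) ∨
  (∃ j q, a = .pout (j, i) ∧ s.faulty = false ∧ s.sendq = (Sum.inr j, i) :: q ∧
    s' = { s with sendq := q }) ∨
  (s' = s ∧ a ≠ .crash i ∧ (s.faulty = false → (∀ o, a = .fd o → D.locOut o ≠ i) ∧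
      ∀ m j, j ≠ i → a ≠ .recv m j i) ∧
    (∀ m j, j ≠ i → a ≠ .send m i j) ∧ ∀ j, a ≠ .pout (j, i))

/-- The steps of the channels. -/
def ChanStep (c : Link n) (a : SysAct D (omegaF n f) (Graph n D.Out) Empty Y)
    (q q' : List (Graph n D.Out)) : Prop :=
  (∃ m, a = .send m c.1.1 c.1.2 ∧ q' = q ++ [m]) ∨ (∃ m, a = .recv m c.1.1 c.1.2 ∧ q = m :: q') ∨
  (q' = q ∧ (∀ m, a ≠ .send m c.1.1 c.1.2) ∧ ∀ m, a ≠ .recv m c.1.1 c.1.2)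

variable {E : Fin n → Automaton (EnvAct (omegaF n f) Y)}
  (x : (fullSystem (omegaAlg A) E).Execution)

/-- The state of the process at `i`. -/
def procState (i : Fin n) (k : ℕ) : OmegaState n D.Out := x.state k (some (Comp.proc i))

/-- The state of a channel. -/
def chanState (c : Link n) (k : ℕ) : List (Graph n D.Out) := x.state k (some (Comp.chan c))

theorem procState_zero (i : Fin n) : procState x i 0 = ⟨Graph.empty, 0, [], i, false⟩ :=
  x.state_zero (some (.proc i))

theorem chanState_zero (c : Link n) : chanState x c 0 = [] := x.state_zero (some (.chan c))

theorem omegaStep {k : ℕ} {a : SysAct D (omegaF n f) (Graph n D.Out) Empty Y}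
    (hk : x.events.get? k = some a) (i : Fin n) :
    OmegaStep A i a (procState x i k) (procState x i (k + 1)) := by
  have hA := omegaAlg_isDistributedAlgorithm A
  rcases (x.step k a hk).2 (some (.proc i)) with ⟨-, b, rfl, h⟩ | ⟨hn, h⟩
  · change (omegaAlg A i).trans (procState x i k) b (procState x i (k + 1)) at h
    have stay : ∀ (b : ProcAct D (omegaF n f) (Graph n D.Out) Empty),
        (∃ o, b = .fd o) ∨ (∃ m j j', b = .recv m j j') → (procState x i k).faulty = true →
        procState x i (k + 1) = procState x i k →
        OmegaStep A i (b.toSys : SysAct D (omegaF n f) (Graph n D.Out) Empty Y)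
          (procState x i k) (procState x i (k + 1)) := by
      intro b hb hf hs
      refine Or.inr (Or.inr (Or.inr (Or.inr (Or.inr ⟨hs, ?_, ?_, ?_, ?_⟩))))
      · rcases hb with ⟨o, rfl⟩ | ⟨m, j, j', rfl⟩ <;> rintro ⟨⟩
      · intro h
        rw [hf] at h
        cases h
      · rcases hb with ⟨o, rfl⟩ | ⟨m, j, j', rfl⟩ <;> rintro m j - ⟨⟩
      · rcases hb with ⟨o, rfl⟩ | ⟨m, j, j', rfl⟩ <;> rintro j ⟨⟩
    rcases h with ⟨rfl, h⟩ | ⟨o, rfl, h1, h⟩ | ⟨m, j, rfl, h1, h⟩ | ⟨m, j, q, rfl, h⟩ |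
      ⟨j, q, rfl, h⟩
    · exact Or.inl ⟨rfl, h⟩
    · by_cases hf : (procState x i k).faulty = true
      · rw [if_pos hf] at h
        exact stay _ (Or.inl ⟨o, rfl⟩) hf h
      · rw [if_neg hf] at h
        exact Or.inr (Or.inl ⟨o, rfl, h1, by simpa using hf, h⟩)
    · by_cases hf : (procState x i k).faulty = true
      · rw [if_pos hf] at h
        exact stay _ (Or.inr ⟨m, j, i, rfl⟩) hf h
      · rw [if_neg hf] at h
        exact Or.inr (Or.inr (Or.inl ⟨m, j, rfl, h1, by simpa using hf, h⟩))
    · exact Or.inr (Or.inr (Or.inr (Or.inl ⟨m, j, q, rfl, h⟩)))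
    · exact Or.inr (Or.inr (Or.inr (Or.inr (Or.inl ⟨j, q, rfl, h⟩))))
  · change a ∉ (component (omegaAlg A) E (.proc i)).acts at hn
    have hn' : ∀ b : ProcAct D (omegaF n f) (Graph n D.Out) Empty, b ∈ (omegaAlg A i).acts →
        a ≠ b.toSys := fun b hb h => hn (h ▸ mem_proc_acts.2 hb)
    refine Or.inr (Or.inr (Or.inr (Or.inr (Or.inr ⟨h, ?_, fun _ => ⟨?_, ?_⟩, ?_, ?_⟩))))
    · exact hn' (.crash i) (Or.inl (Or.inl (Or.inl rfl)))
    · exact fun o ho hl => hn' (.fd o) (Or.inl (Or.inl (Or.inr (Or.inl ⟨o, hl, rfl⟩)))) ho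
    · exact fun m j hj => hn' (.recv m j i) (Or.inl (Or.inl (Or.inr (Or.inr ⟨m, j, hj, rfl⟩))))
    · exact fun m j hj => hn' (.send m i j) (Or.inl (Or.inr (Or.inl ⟨m, j, hj, rfl⟩)))
    · exact fun j => hn' (.pout (j, i)) (Or.inl (Or.inr (Or.inr ⟨j, rfl⟩)))

theorem chanStep {k : ℕ} {a : SysAct D (omegaF n f) (Graph n D.Out) Empty Y}
    (hk : x.events.get? k = some a) (c : Link n) :
    ChanStep c a (chanState x c k) (chanState x c (k + 1)) := by
  rcases (x.step k a hk).2 (some (.chan c)) with ⟨-, m, ⟨h1, h2⟩ | ⟨h1, h2⟩⟩ | ⟨hn, h⟩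
  · exact Or.inl ⟨m, h1, h2⟩
  · exact Or.inr (Or.inl ⟨m, h1, h2⟩)
  · change a ∉ (component (omegaAlg A) E (.chan c)).acts at hn
    exact Or.inr (Or.inr ⟨h, fun m h => hn (mem_chan_acts.2 ⟨m, Or.inl h⟩),
      fun m h => hn (mem_chan_acts.2 ⟨m, Or.inr h⟩)⟩)

variable {x}

/-- A task that remains enabled in an infinite fair execution has events. -/
theorem exists_task_event {α : Type} {U : Automaton α} {x : U.Execution} (hx : x.Fair)
    (hinf : ∀ k, (x.events.get? k).isSome = true) (c : U.Task) (m : ℕ)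
    (h : (∀ k ≥ m, ∀ a ∈ U.task c, x.events.get? k ≠ some a) →
      ∀ k ≥ m, U.TaskEnabled (x.state k) c) :
    ∃ k ≥ m, ∃ a ∈ U.task c, x.events.get? k = some a := by
  by_contra hno
  push Not at hno
  have hen := h hno
  rcases (hx c).2 hinf with h1 | h1
  · obtain ⟨k, hk, a, ha, hka⟩ := h1 m
    exact hno k hk a ha hka
  · obtain ⟨k, hk, hn⟩ := h1 m
    exact hn (hen k hk)

end OmegaRuns

/-! ### Graphs in the runs of the algorithm for `Ω_f` -/

section OmegaStepLemmas

variable {n f : ℕ} {D : CrashProblem n} {M X Y : Type}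
  {A : Fin n → Automaton (ProcAct D (consensus n f) M X)} {i : Fin n}
  {a : SysAct D (omegaF n f) (Graph n D.Out) Empty Y} {s s' : OmegaState n D.Out}

theorem Graph.LE.trans {O : Type} {G H K : Graph n O} (h : G.LE H) (h' : H.LE K) : G.LE K :=
  ⟨h.1.trans h'.1, h.2.trans h'.2⟩

theorem OmegaStep.G_le (h : OmegaStep A i a s s') : s.G.LE s'.G := by
  rcases h with ⟨-, rfl⟩ | ⟨o, -, -, -, rfl⟩ | ⟨m, j, -, -, -, rfl⟩ | ⟨m, j, q, -, -, -, -, rfl⟩ |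
    ⟨j, q, -, -, -, rfl⟩ | ⟨rfl, -⟩
  · exact Graph.LE.refl _
  · exact ⟨Set.subset_union_left, Set.subset_union_left⟩
  · exact ⟨Set.subset_union_left, Set.subset_union_left⟩
  · exact Graph.LE.refl _
  · exact Graph.LE.refl _
  · exact Graph.LE.refl _

theorem OmegaStep.k_le (h : OmegaStep A i a s s') : s.k ≤ s'.k := by
  rcases h with ⟨-, rfl⟩ | ⟨o, -, -, -, rfl⟩ | ⟨m, j, -, -, -, rfl⟩ | ⟨m, j, q, -, -, -, -, rfl⟩ |
    ⟨j, q, -, -, -, rfl⟩ | ⟨rfl, -⟩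
  · exact le_rfl
  · exact Nat.le_succ _
  · exact le_rfl
  · exact le_rfl
  · exact le_rfl
  · exact le_rfl

theorem OmegaStep.faulty_iff (h : OmegaStep A i a s s') :
    s'.faulty = true ↔ s.faulty = true ∨ a = .crash i := by
  rcases h with ⟨rfl, rfl⟩ | ⟨o, rfl, -, -, rfl⟩ | ⟨m, j, rfl, -, -, rfl⟩ |
    ⟨m, j, q, rfl, -, -, -, rfl⟩ | ⟨j, q, rfl, -, -, rfl⟩ | ⟨rfl, h, -⟩ <;>
    simp_all [OmegaState.afterFd]

theorem OmegaStep.fd {o : D.Out} (h : OmegaStep A i (.fd o : SysAct D (omegaF n f) _ Empty Y) s s')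
    (ho : D.locOut o = i) (hs : s.faulty = false) : s' = s.afterFd A i o := by
  rcases h with ⟨h, -⟩ | ⟨o', h, -, -, h'⟩ | ⟨m, j, h, -⟩ | ⟨m, j, q, h, -⟩ | ⟨j, q, h, -⟩ |
    ⟨-, -, h, -⟩
  · cases h
  · cases h
    exact h'
  · cases h
  · cases h
  · cases h
  · exact absurd ho ((h hs).1 o rfl)

theorem OmegaStep.recv {m : Graph n D.Out} {j : Fin n}
    (h : OmegaStep A i (.recv m j i : SysAct D (omegaF n f) _ Empty Y) s s')
    (hj : j ≠ i) (hs : s.faulty = false) : s' = { s with G := s.G.union m } := by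
  rcases h with ⟨h, -⟩ | ⟨o', h, -⟩ | ⟨m, j, h, -, -, h'⟩ | ⟨m, j, q, h, -⟩ | ⟨j, q, h, -⟩ |
    ⟨-, -, h, -⟩
  · cases h
  · cases h
  · cases h
    exact h'
  · cases h
  · cases h
  · exact absurd rfl ((h hs).2 m j hj)

theorem OmegaStep.send {m : Graph n D.Out} {j : Fin n}
    (h : OmegaStep A i (.send m i j : SysAct D (omegaF n f) _ Empty Y) s s')
    (hj : j ≠ i) : s.sendq = (Sum.inl m, j) :: s'.sendq := by
  rcases h with ⟨h, -⟩ | ⟨o', h, -⟩ | ⟨m, j, h, -⟩ | ⟨m, j, q, h, -, -, h', rfl⟩ | ⟨j, q, h, -⟩ |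
    ⟨-, -, -, h, -⟩
  · cases h
  · cases h
  · cases h
  · cases h
    exact h'
  · cases h
  · exact absurd rfl (h m j hj)

theorem OmegaStep.pout {j : Fin n}
    (h : OmegaStep A i (.pout (j, i) : SysAct D (omegaF n f) (Graph n D.Out) Empty Y) s s') :
    s.faulty = false ∧ s.sendq = (Sum.inr j, i) :: s'.sendq := by
  rcases h with ⟨h, -⟩ | ⟨o', h, -⟩ | ⟨m, j, h, -⟩ | ⟨m, j, q, h, -⟩ | ⟨j, q, h, h1, h', rfl⟩ |
    ⟨-, -, -, -, h⟩
  · cases h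
  · cases h
  · cases h
  · cases h
  · cases h
    exact ⟨h1, h'⟩
  · exact absurd rfl (h j)

/-- The entries that an output of the failure detector appends to the queue. -/
theorem afterFd_sendq (o : D.Out) : (s.afterFd A i o).sendq = s.sendq ++
    (((List.finRange n).filter (fun j => decide (j ≠ i))).map
      (fun j => (Sum.inl (s.afterFd A i o).G, j)) ++ [(Sum.inr (s.afterFd A i o).fdout, i)]) := by
  simp [OmegaState.afterFd]

theorem OmegaStep.sendq (h : OmegaStep A i a s s') :
    (s'.sendq = s.sendq) ∨ (∃ o, s' = s.afterFd A i o) ∨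
    (∃ m j, a = .send m i j ∧ j ≠ i ∧ s.sendq = (Sum.inl m, j) :: s'.sendq) ∨
    ∃ j, a = .pout (j, i) ∧ s.sendq = (Sum.inr j, i) :: s'.sendq := by
  rcases h with ⟨-, rfl⟩ | ⟨o, -, -, -, rfl⟩ | ⟨m, j, -, -, -, rfl⟩ | ⟨m, j, q, h, hj, -, h', rfl⟩ |
    ⟨j, q, h, -, h', rfl⟩ | ⟨rfl, -⟩
  · exact Or.inl rfl
  · exact Or.inr (Or.inl ⟨o, rfl⟩)
  · exact Or.inl rfl
  · exact Or.inr (Or.inr (Or.inl ⟨m, j, h, hj, h'⟩))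
  · exact Or.inr (Or.inr (Or.inr ⟨j, h, h'⟩))
  · exact Or.inl rfl

/-- Entries leave the queue in actions of the process. -/
theorem OmegaStep.of_dequeue (h : OmegaStep A i a s s') {x : (Graph n D.Out ⊕ Fin n) × Fin n}
    (hx : s.sendq = x :: s'.sendq) : (∃ m j, a = .send m i j ∧ j ≠ i ∧ x = (Sum.inl m, j)) ∨
      ∃ j, a = .pout (j, i) ∧ x = (Sum.inr j, i) := by
  rcases h.sendq with h | ⟨o, rfl⟩ | ⟨m, j, h, hj, h'⟩ | ⟨j, h, h'⟩
  · have := congrArg List.length hx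
    simp [h] at this
  · have := congrArg List.length hx
    rw [afterFd_sendq] at this
    simp only [List.length_cons, List.length_append] at this
    omega
  · rw [hx] at h'
    exact Or.inl ⟨m, j, h, hj, (List.cons.inj h').1⟩
  · rw [hx] at h'
    exact Or.inr ⟨j, h, (List.cons.inj h').1⟩

end OmegaStepLemmas

/-! ### Issued vertices and the invariant of the graphs -/

section OmegaRun

variable {n f : ℕ} {D : CrashProblem n} {M X Y : Type}

/-- Infinite runs of the processes of the algorithm for `Ω_f` and of the channels. -/
structure OmegaRun (A : Fin n → Automaton (ProcAct D (consensus n f) M X))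
    (e : ℕ → SysAct D (omegaF n f) (Graph n D.Out) Empty Y)
    (st : Fin n → ℕ → OmegaState n D.Out) (ch : Link n → ℕ → List (Graph n D.Out)) : Prop where
  proc_zero : ∀ i, st i 0 = ⟨Graph.empty, 0, [], i, false⟩
  proc_step : ∀ k i, OmegaStep A i (e k) (st i k) (st i (k + 1))
  chan_zero : ∀ c, ch c 0 = []
  chan_step : ∀ k c, ChanStep c (e k) (ch c k) (ch c (k + 1))

/-- The vertex `v` is added to the graph at its location by the event `k`. -/
def Issued (e : ℕ → SysAct D (omegaF n f) (Graph n D.Out) Empty Y)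
    (st : Fin n → ℕ → OmegaState n D.Out) (v : Vertex n D.Out) (k : ℕ) : Prop :=
  e k = .fd v.act ∧ D.locOut v.act = v.loc ∧ (st v.loc k).faulty = false ∧
    v.idx = (st v.loc k).k + 1

/-- The graphs that occur before the event `K`. -/
structure GoodGraph (e : ℕ → SysAct D (omegaF n f) (Graph n D.Out) Empty Y)
    (st : Fin n → ℕ → OmegaState n D.Out) (K : ℕ) (H : Graph n D.Out) : Prop where
  issued : ∀ v ∈ H.V, ∃ k < K, Issued e st v k
  closed : ∀ v ∈ H.V, ∀ k, Issued e st v k → (st v.loc k).G.V ⊆ H.V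
  edge : ∀ u v, (u, v) ∈ H.Z ↔ v ∈ H.V ∧ ∃ k, Issued e st v k ∧ u ∈ (st v.loc k).G.V

variable {A : Fin n → Automaton (ProcAct D (consensus n f) M X)}
  {e : ℕ → SysAct D (omegaF n f) (Graph n D.Out) Empty Y}
  {st : Fin n → ℕ → OmegaState n D.Out} {ch : Link n → ℕ → List (Graph n D.Out)}

theorem OmegaRun.G_mono (h : OmegaRun A e st ch) (i : Fin n) {k m : ℕ} (hkm : k ≤ m) :
    (st i k).G.LE (st i m).G := by
  induction m, hkm using Nat.le_induction with
  | base => exact Graph.LE.refl _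
  | succ m _ ih => exact ih.trans (h.proc_step m i).G_le

theorem OmegaRun.k_mono (h : OmegaRun A e st ch) (i : Fin n) : Monotone fun k => (st i k).k :=
  monotone_nat_of_le_succ fun k => (h.proc_step k i).k_le

theorem OmegaRun.faulty_iff (h : OmegaRun A e st ch) (i : Fin n) (k : ℕ) :
    (st i k).faulty = true ↔ ∃ m < k, e m = .crash i := by
  induction k with
  | zero => simp [h.proc_zero i]
  | succ k ih =>
    rw [(h.proc_step k i).faulty_iff, ih]
    constructor
    · rintro (⟨m, hm, h'⟩ | h')
      · exact ⟨m, by omega, h'⟩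
      · exact ⟨k, by omega, h'⟩
    · rintro ⟨m, hm, h'⟩
      rcases Nat.lt_succ_iff_lt_or_eq.1 hm with hm | rfl
      · exact Or.inl ⟨m, hm, h'⟩
      · exact Or.inr h'

theorem OmegaRun.not_faulty (h : OmegaRun A e st ch) {i : Fin n} (hi : ∀ k, e k ≠ .crash i)
    (k : ℕ) : (st i k).faulty = false := by
  rw [← Bool.not_eq_true, h.faulty_iff]
  rintro ⟨m, -, h'⟩
  exact hi m h'

theorem Issued.step (h : OmegaRun A e st ch) {v : Vertex n D.Out} {k : ℕ}
    (hv : Issued e st v k) : st v.loc (k + 1) = (st v.loc k).afterFd A v.loc v.act := by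
  have := h.proc_step k v.loc
  rw [hv.1] at this
  exact this.fd hv.2.1 hv.2.2.1

theorem Issued.mem (h : OmegaRun A e st ch) {v : Vertex n D.Out} {k : ℕ}
    (hv : Issued e st v k) : v ∈ (st v.loc (k + 1)).G.V := by
  rw [hv.step h]
  refine Or.inr ?_
  rw [← hv.2.2.2]
  rfl

/-- The counter at a location grows with each vertex issued there, so location and index determine
the event. -/
theorem Issued.unique (h : OmegaRun A e st ch) {v v' : Vertex n D.Out} {k k' : ℕ}
    (hv : Issued e st v k) (hv' : Issued e st v' k') (hl : v.loc = v'.loc)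
    (hi : v.idx = v'.idx) : k = k' := by
  have key : ∀ {v v' : Vertex n D.Out} {k k' : ℕ}, Issued e st v k → Issued e st v' k' →
      v.loc = v'.loc → k < k' → v.idx ≠ v'.idx := by
    intro v v' k k' hv hv' hl hlt
    have h1 := h.k_mono v.loc (show k + 1 ≤ k' from hlt)
    have h2 : (st v.loc (k + 1)).k = (st v.loc k).k + 1 := by rw [hv.step h]; rfl
    have h3 := hv.2.2.2
    have h4 := hv'.2.2.2
    rw [← hl] at h4
    simp only at h1
    omega
  rcases lt_trichotomy k k' with h1 | h1 | h1
  · exact absurd hi (key hv hv' hl h1)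
  · exact h1
  · exact absurd hi.symm (key hv' hv hl.symm h1)

theorem Issued.eq {v v' : Vertex n D.Out} {k : ℕ} (hv : Issued e st v k)
    (hv' : Issued e st v' k) : v = v' := by
  have h1 : v.act = v'.act := by
    have := hv.1.symm.trans hv'.1
    injection this
  have h2 : v.loc = v'.loc := by rw [← hv.2.1, ← hv'.2.1, h1]
  have h3 : v.idx = v'.idx := by rw [hv.2.2.2, hv'.2.2.2, h2]
  cases v
  cases v'
  simp_all

theorem GoodGraph.mono {K K' : ℕ} (hK : K ≤ K') {H : Graph n D.Out} (h : GoodGraph e st K H) :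
    GoodGraph e st K' H :=
  ⟨fun v hv => by
    obtain ⟨k, hk, h'⟩ := h.issued v hv
    exact ⟨k, by omega, h'⟩, h.closed, h.edge⟩

/-- In a good graph the edges into a vertex are those it received when it was issued, and its
predecessors are present. These conditions refer to one vertex at a time, so they survive unions. -/
theorem GoodGraph.union {K : ℕ} {H H' : Graph n D.Out} (h : GoodGraph e st K H)
    (h' : GoodGraph e st K H') : GoodGraph e st K (H.union H') where
  issued := by
    rintro v (hv | hv)
    · exact h.issued v hv
    · exact h'.issued v hv
  closed := by
    rintro v (hv | hv) k hk
    · exact (h.closed v hv k hk).trans Set.subset_union_left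
    · exact (h'.closed v hv k hk).trans Set.subset_union_right
  edge := by
    intro u v
    change (u, v) ∈ H.Z ∪ H'.Z ↔ v ∈ H.V ∪ H'.V ∧ _
    rw [Set.mem_union, h.edge, h'.edge, Set.mem_union, or_and_right]

theorem GoodGraph.empty (e : ℕ → SysAct D (omegaF n f) (Graph n D.Out) Empty Y)
    (st : Fin n → ℕ → OmegaState n D.Out) (K : ℕ) : GoodGraph e st K Graph.empty where
  issued := fun _ hv => hv.elim
  closed := fun _ hv => hv.elim
  edge := fun _ _ => ⟨fun hv => hv.elim, fun hv => hv.1.elim⟩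

theorem GoodGraph.insert (h : OmegaRun A e st ch) {K : ℕ} {v : Vertex n D.Out}
    (hv : Issued e st v K) (hG : GoodGraph e st K (st v.loc K).G) :
    GoodGraph e st (K + 1) ((st v.loc K).G.insert v) where
  issued := by
    rintro w (hw | rfl)
    · obtain ⟨k, hk, h'⟩ := hG.issued w hw
      exact ⟨k, by omega, h'⟩
    · exact ⟨K, by omega, hv⟩
  closed := by
    rintro w (hw | rfl) k hk
    · exact (hG.closed w hw k hk).trans Set.subset_union_left
    · rw [hk.unique h hv rfl rfl]
      exact Set.subset_union_left
  edge := by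
    intro u w
    constructor
    · rintro (hw | ⟨hu, hw⟩)
      · obtain ⟨h1, h2⟩ := (hG.edge u w).1 hw
        exact ⟨Or.inl h1, h2⟩
      · change w = v at hw
        subst hw
        exact ⟨Or.inr rfl, K, hv, hu⟩
    · rintro ⟨hw | rfl, k, hk, hu⟩
      · exact Or.inl ((hG.edge u w).2 ⟨hw, k, hk, hu⟩)
      · rw [hk.unique h hv rfl rfl] at hu
        exact Or.inr ⟨hu, rfl⟩

/-- All graphs in the run are good. -/
theorem OmegaRun.goodGraph (h : OmegaRun A e st ch) (K : ℕ) :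
    (∀ i, GoodGraph e st K (st i K).G) ∧
    (∀ i m j, (Sum.inl m, j) ∈ (st i K).sendq → GoodGraph e st K m ∧ j ≠ i) ∧
    (∀ i j j', (Sum.inr j, j') ∈ (st i K).sendq → j' = i) ∧
    ∀ c, ∀ m ∈ ch c K, GoodGraph e st K m := by
  induction K with
  | zero =>
    refine ⟨fun i => ?_, fun i m j => ?_, fun i j j' => ?_, fun c m hm => ?_⟩
    · rw [h.proc_zero]
      exact GoodGraph.empty _ _ _
    · rw [h.proc_zero]
      rintro ⟨⟩
    · rw [h.proc_zero]
      rintro ⟨⟩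
    · rw [h.chan_zero] at hm
      cases hm
  | succ K ih =>
    obtain ⟨ih1, ih2, ih3, ih4⟩ := ih
    -- The graph in a receipt was at the head of its channel, so it is good by induction.
    have hG : ∀ i, GoodGraph e st (K + 1) (st i (K + 1)).G := by
      intro i
      have ih1' := (ih1 i).mono (Nat.le_succ K)
      rcases h.proc_step K i with ⟨-, hs⟩ | ⟨o, h1, h2, h3, hs⟩ | ⟨m, j, h1, h2, -, hs⟩ |
        ⟨m, j, q, -, -, -, -, hs⟩ | ⟨j, q, -, -, -, hs⟩ | ⟨hs, -⟩
      · rw [hs]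
        exact ih1'
      · rw [hs]
        exact GoodGraph.insert h (v := ⟨i, (st i K).k + 1, o⟩) ⟨h1, h2, h3, rfl⟩ (ih1 i)
      · rw [hs]
        refine ih1'.union ((ih4 ⟨(j, i), h2⟩ m ?_).mono (Nat.le_succ K))
        rcases h.chan_step K ⟨(j, i), h2⟩ with ⟨m', h', -⟩ | ⟨m', h', hq⟩ | ⟨-, -, h'⟩
        · rw [h1] at h'
          cases h'
        · rw [h1] at h'
          injection h' with h'
          rw [hq, h']
          exact List.mem_cons_self
        · exact absurd h1 (h' m)
      · rw [hs]
        exact ih1'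
      · rw [hs]
        exact ih1'
      · rw [hs]
        exact ih1'
    have hq : ∀ i y, y ∈ (st i (K + 1)).sendq → y ∈ (st i K).sendq ∨
        (∃ j, j ≠ i ∧ y = (Sum.inl (st i (K + 1)).G, j)) ∨ ∃ j, y = (Sum.inr j, i) := by
      intro i y hy
      rcases (h.proc_step K i).sendq with hs | ⟨o, hs⟩ | ⟨m, j, -, -, hs⟩ | ⟨j, -, hs⟩
      · rw [hs] at hy
        exact Or.inl hy
      · rw [hs, afterFd_sendq, ← hs] at hy
        rcases List.mem_append.1 hy with hy | hy
        · exact Or.inl hy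
        · rcases List.mem_append.1 hy with hy | hy
          · obtain ⟨j, hj, rfl⟩ := List.mem_map.1 hy
            exact Or.inr (Or.inl ⟨j, by simpa using (List.mem_filter.1 hj).2, rfl⟩)
          · exact Or.inr (Or.inr ⟨_, List.mem_singleton.1 hy⟩)
      · rw [hs]
        exact Or.inl (List.mem_cons_of_mem _ hy)
      · rw [hs]
        exact Or.inl (List.mem_cons_of_mem _ hy)
    refine ⟨hG, fun i m j hm => ?_, fun i j j' hm => ?_, fun c m hm => ?_⟩
    · rcases hq i _ hm with hm | ⟨j', hj, h'⟩ | ⟨j', h'⟩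
      · exact ⟨(ih2 i m j hm).1.mono (Nat.le_succ K), (ih2 i m j hm).2⟩
      · obtain ⟨h1, rfl⟩ := Prod.ext_iff.1 h'
        cases h1
        exact ⟨hG i, hj⟩
      · cases h'
    · rcases hq i _ hm with hm | ⟨j', hj, h'⟩ | ⟨j', h'⟩
      · exact ih3 i j j' hm
      · cases h'
      · exact (Prod.ext_iff.1 h').2
    · rcases h.chan_step K c with ⟨m', h1, h2⟩ | ⟨m', h1, h2⟩ | ⟨h2, -⟩
      · rw [h2] at hm
        rcases List.mem_append.1 hm with hm | hm
        · exact (ih4 c m hm).mono (Nat.le_succ K)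
        · obtain rfl := List.mem_singleton.1 hm
          have hs := h.proc_step K c.1.1
          rw [h1] at hs
          have := hs.send c.2.symm
          exact (ih2 c.1.1 m c.1.2 (by rw [this]; exact List.mem_cons_self)).1.mono (Nat.le_succ K)
      · exact (ih4 c m (by rw [h2]; exact List.mem_cons_of_mem _ hm)).mono (Nat.le_succ K)
      · rw [h2] at hm
        exact (ih4 c m hm).mono (Nat.le_succ K)

end OmegaRun

/-! ### Convergence of the graphs -/

section FairOmegaRuns

variable {n f : ℕ} {D : CrashProblem n} {M X Y : Type}
  {A : Fin n → Automaton (ProcAct D (consensus n f) M X)}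
  {e : ℕ → SysAct D (omegaF n f) (Graph n D.Out) Empty Y}
  {st : Fin n → ℕ → OmegaState n D.Out} {ch : Link n → ℕ → List (Graph n D.Out)}

/-- Fair runs in which the live locations have infinitely many outputs of the failure detector. -/
structure FairOmegaRun (A : Fin n → Automaton (ProcAct D (consensus n f) M X))
    (e : ℕ → SysAct D (omegaF n f) (Graph n D.Out) Empty Y)
    (st : Fin n → ℕ → OmegaState n D.Out) (ch : Link n → ℕ → List (Graph n D.Out)) : Prop
    extends OmegaRun A e st ch where
  proc_progress : ∀ i, (∀ k, e k ≠ .crash i) → ∀ k, (st i k).sendq ≠ [] →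
    ∃ k' ≥ k, (∃ m j, j ≠ i ∧ e k' = .send m i j) ∨ ∃ j, e k' = .pout (j, i)
  chan_progress : ∀ (c : Link n) k, ch c k ≠ [] → ∃ k' ≥ k, ∃ m, e k' = .recv m c.1.1 c.1.2
  fd_infinite : ∀ i, (∀ k, e k ≠ .crash i) → ∀ m, ∃ k ≥ m, ∃ o, e k = .fd o ∧ D.locOut o = i

theorem OmegaRun.sendq_step (h : OmegaRun A e st ch) (i : Fin n) (k : ℕ) :
    (∃ l, (st i (k + 1)).sendq = (st i k).sendq ++ l ∧ (l = [] ∨ ∃ o,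
      st i (k + 1) = (st i k).afterFd A i o ∧ l =
        ((List.finRange n).filter (fun j => decide (j ≠ i))).map
          (fun j => (Sum.inl (st i (k + 1)).G, j)) ++ [(Sum.inr (st i (k + 1)).fdout, i)])) ∨
    ∃ x, (st i k).sendq = x :: (st i (k + 1)).sendq := by
  rcases (h.proc_step k i).sendq with hs | ⟨o, hs⟩ | ⟨m, j, -, -, hs⟩ | ⟨j, -, hs⟩
  · exact Or.inl ⟨[], by rw [hs, List.append_nil], Or.inl rfl⟩
  · exact Or.inl ⟨_, by rw [hs, afterFd_sendq], Or.inr ⟨o, hs, by rw [hs]⟩⟩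
  · exact Or.inr ⟨_, hs⟩
  · exact Or.inr ⟨_, hs⟩

theorem FairOmegaRun.sendq_progress (h : FairOmegaRun A e st ch) {i : Fin n}
    (hi : ∀ k, e k ≠ .crash i) (k : ℕ) (hk : (st i k).sendq ≠ []) :
    ∃ k' ≥ k, ∃ x, (st i k').sendq = x :: (st i (k' + 1)).sendq := by
  obtain ⟨k', hk', ⟨m, j, hj, he⟩ | ⟨j, he⟩⟩ := h.proc_progress i hi k hk
  · have := h.proc_step k' i
    rw [he] at this
    exact ⟨k', hk', _, this.send hj⟩
  · have := h.proc_step k' i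
    rw [he] at this
    exact ⟨k', hk', _, this.pout.2⟩

theorem FairOmegaRun.exists_dequeue (h : FairOmegaRun A e st ch) {i : Fin n}
    (hi : ∀ k, e k ≠ .crash i) {k : ℕ} {x : (Graph n D.Out ⊕ Fin n) × Fin n}
    (hx : x ∈ (st i k).sendq) : ∃ k' ≥ k, (st i k').sendq = x :: (st i (k' + 1)).sendq := by
  obtain ⟨l₁, l₂, hl⟩ := List.append_of_mem hx
  refine Afd.exists_dequeue (q := fun k => (st i k).sendq) (fun k => ?_)
    (h.sendq_progress hi) x l₁ k l₂ hl
  exact (h.sendq_step i k).imp (fun ⟨l, hl, _⟩ => ⟨l, hl⟩) id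

theorem ChanStep.of_dequeue {c : Link n} {a : SysAct D (omegaF n f) (Graph n D.Out) Empty Y}
    {q q' : List (Graph n D.Out)} (h : ChanStep c a q q') {m : Graph n D.Out}
    (hq : q = m :: q') : a = .recv m c.1.1 c.1.2 := by
  rcases h with ⟨m', -, h⟩ | ⟨m', h, h'⟩ | ⟨h, -⟩
  · have := congrArg List.length h
    rw [hq] at this
    simp at this
    omega
  · rw [hq] at h'
    rw [h, (List.cons.inj h').1]
  · have := congrArg List.length h
    rw [hq] at this
    simp at this

theorem FairOmegaRun.exists_receipt (h : FairOmegaRun A e st ch) (c : Link n) {k : ℕ}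
    {m : Graph n D.Out} (hm : m ∈ ch c k) : ∃ k' ≥ k, e k' = .recv m c.1.1 c.1.2 := by
  obtain ⟨l₁, l₂, hl⟩ := List.append_of_mem hm
  obtain ⟨k', hk', hq⟩ := Afd.exists_dequeue (q := ch c) (fun k => by
    rcases h.chan_step k c with ⟨m, -, h⟩ | ⟨m, -, h⟩ | ⟨h, -⟩
    · exact Or.inl ⟨_, h⟩
    · exact Or.inr ⟨_, h⟩
    · exact Or.inl ⟨[], by rw [h, List.append_nil]⟩) (fun k hk => by
    obtain ⟨k', hk', m, he⟩ := h.chan_progress c k hk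
    refine ⟨k', hk', m, ?_⟩
    rcases h.chan_step k' c with ⟨m', h', -⟩ | ⟨m', h', hq⟩ | ⟨-, -, h'⟩
    · rw [he] at h'
      cases h'
    · rw [he] at h'
      injection h' with h'
      rw [h']
      exact hq
    · exact absurd he (h' m)) m l₁ k l₂ hl
  exact ⟨k', hk', (h.chan_step k' c).of_dequeue hq⟩

/-- An output of the failure detector at a live location. -/
theorem FairOmegaRun.exists_fd (h : FairOmegaRun A e st ch) {i : Fin n}
    (hi : ∀ k, e k ≠ .crash i) (m : ℕ) : ∃ k ≥ m, ∃ o, D.locOut o = i ∧ e k = .fd o ∧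
      st i (k + 1) = (st i k).afterFd A i o ∧ Issued e st ⟨i, (st i k).k + 1, o⟩ k := by
  obtain ⟨k, hk, o, h1, h2⟩ := h.fd_infinite i hi m
  have hs := h.proc_step k i
  rw [h1] at hs
  exact ⟨k, hk, o, h2, h1, hs.fd h2 (h.not_faulty hi k), h1, h2, h.not_faulty hi k, rfl⟩

/-- Vertices of the graph at a live location reach the other live locations. -/
theorem FairOmegaRun.exists_mem (h : FairOmegaRun A e st ch) {i j : Fin n}
    (hi : ∀ k, e k ≠ .crash i) (hj : ∀ k, e k ≠ .crash j) {k : ℕ} {v : Vertex n D.Out}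
    (hv : v ∈ (st i k).G.V) : ∃ k', v ∈ (st j k').G.V := by
  by_cases hij : j = i
  · exact ⟨k, hij ▸ hv⟩
  -- The next output of `D` at `i` queues the whole graph for `j`; it then passes from the queue to
  -- the channel and on to `j`.
  obtain ⟨κ, hκ, o, -, -, hs, -⟩ := h.exists_fd hi k
  have hv' : v ∈ (st i (κ + 1)).G.V := (h.G_mono i (Nat.le_succ_of_le hκ)).1 hv
  have hmem : (Sum.inl (st i (κ + 1)).G, j) ∈ (st i (κ + 1)).sendq := by
    rw [hs, afterFd_sendq]
    refine List.mem_append_right _ (List.mem_append_left _ (List.mem_map.2 ⟨j, ?_, rfl⟩))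
    exact List.mem_filter.2 ⟨List.mem_finRange j, by simpa using hij⟩
  obtain ⟨k₁, -, hq⟩ := h.exists_dequeue hi hmem
  rcases (h.proc_step k₁ i).of_dequeue hq with ⟨m, j', he, -, h1⟩ | ⟨j', -, h1⟩
  · obtain ⟨h1, rfl⟩ := Prod.ext_iff.1 h1
    cases h1
    have hc : (st i (κ + 1)).G ∈ ch ⟨(i, j), Ne.symm hij⟩ (k₁ + 1) := by
      rcases h.chan_step k₁ ⟨(i, j), Ne.symm hij⟩ with ⟨m', h', hq⟩ | ⟨m', h', -⟩ | ⟨-, h', -⟩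
      · rw [he] at h'
        injection h' with h'
        rw [hq, h']
        simp
      · rw [he] at h'
        cases h'
      · exact absurd he (h' _)
    obtain ⟨k₂, -, he₂⟩ := h.exists_receipt _ hc
    have hs₂ := h.proc_step k₂ j
    rw [he₂] at hs₂
    refine ⟨k₂ + 1, ?_⟩
    rw [hs₂.recv (Ne.symm hij) (h.not_faulty hj k₂)]
    exact Or.inr hv'
  · cases h1

/-- The union of the graphs at the live locations. -/
def limitGraph (e : ℕ → SysAct D (omegaF n f) (Graph n D.Out) Empty Y)
    (st : Fin n → ℕ → OmegaState n D.Out) : Graph n D.Out where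
  V := {v | ∃ i, (∀ k, e k ≠ .crash i) ∧ ∃ k, v ∈ (st i k).G.V}
  Z := {p | (∃ i, (∀ k, e k ≠ .crash i) ∧ ∃ k, p.2 ∈ (st i k).G.V) ∧
    ∃ k, Issued e st p.2 k ∧ p.1 ∈ (st p.2.loc k).G.V}

/-- Vertices reach every live location by flooding. Edges need no separate argument, since a good
graph that contains a vertex contains all edges into it. -/
theorem FairOmegaRun.graphLimit (h : FairOmegaRun A e st ch) {i : Fin n}
    (hi : ∀ k, e k ≠ .crash i) : GraphLimit (fun k => (st i k).G) (limitGraph e st) := by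
  have hV : ∀ u ∈ (limitGraph e st).V, ∀ᶠ k in atTop, u ∈ (st i k).G.V := by
    rintro u ⟨j, hj, k, hk⟩
    obtain ⟨k', hk'⟩ := h.exists_mem hj hi hk
    exact eventually_atTop.2 ⟨k', fun m hm => (h.G_mono i hm).1 hk'⟩
  refine ⟨fun k => ⟨fun v hv => ⟨i, hi, k, hv⟩, ?_⟩, hV, ?_⟩
  · rintro ⟨u, v⟩ huv
    obtain ⟨h1, h2⟩ := (((h.goodGraph k).1 i).edge u v).1 huv
    exact ⟨⟨i, hi, k, h1⟩, h2⟩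
  · rintro ⟨u, v⟩ ⟨h1, h2⟩
    filter_upwards [hV v h1] with k hk
    exact (((h.goodGraph k).1 i).edge u v).2 ⟨hk, h2⟩

theorem GraphLimit.iUnion_eq {O : Type} {Gs : ℕ → Graph n O} {G : Graph n O}
    (h : GraphLimit Gs G) : (⋃ k, (Gs k).V) = G.V ∧ (⋃ k, (Gs k).Z) = G.Z := by
  constructor
  · refine Set.Subset.antisymm (Set.iUnion_subset fun k => (h.le k).1) fun u hu => ?_
    obtain ⟨k, hk⟩ := (h.V u hu).exists
    exact Set.mem_iUnion.2 ⟨k, hk⟩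
  · refine Set.Subset.antisymm (Set.iUnion_subset fun k => (h.le k).2) fun u hu => ?_
    obtain ⟨k, hk⟩ := (h.Z u hu).exists
    exact Set.mem_iUnion.2 ⟨k, hk⟩

/-- The event that adds a vertex to the graph at its location. -/
noncomputable def issueTime (e : ℕ → SysAct D (omegaF n f) (Graph n D.Out) Empty Y)
    (st : Fin n → ℕ → OmegaState n D.Out) (v : Vertex n D.Out) : ℕ := sInf {k | Issued e st v k}

theorem Issued.issueTime_eq (h : OmegaRun A e st ch) {v : Vertex n D.Out} {k : ℕ}
    (hv : Issued e st v k) : issueTime e st v = k :=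
  Issued.unique h (Nat.sInf_mem (s := {k | Issued e st v k}) ⟨k, hv⟩) hv rfl rfl

theorem OmegaRun.issued_of_mem (h : OmegaRun A e st ch) {v : Vertex n D.Out}
    (hv : v ∈ (limitGraph e st).V) : Issued e st v (issueTime e st v) := by
  obtain ⟨i, -, k, hk⟩ := hv
  obtain ⟨k', -, h'⟩ := ((h.goodGraph k).1 i).issued v hk
  rw [h'.issueTime_eq h]
  exact h'

theorem OmegaRun.mem_limitGraph_Z (h : OmegaRun A e st ch) {u v : Vertex n D.Out} :
    (u, v) ∈ (limitGraph e st).Z ↔ v ∈ (limitGraph e st).V ∧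
      u ∈ (st v.loc (issueTime e st v)).G.V := by
  refine and_congr_right fun hv => ⟨?_, fun hu => ⟨_, h.issued_of_mem hv, hu⟩⟩
  rintro ⟨k, hk, hu⟩
  rw [hk.issueTime_eq h]
  exact hu

/-- The position of a vertex is that of the issuing event among the events of `D`. For `late`: a
vertex `u` arrives at the live location `i` at some event, and each vertex issued at `i` afterwards
gets an edge from `u`. -/
theorem FairOmegaRun.traceGraph (h : FairOmegaRun A e st ch)
    {ev : Stream'.Seq (SysAct D (omegaF n f) (Graph n D.Out) Empty Y)}
    (hev : ∀ k, ev.get? k = some (e k)) (hlive : ∃ i, ∀ k, e k ≠ .crash i) :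
    TraceGraph (proj SysAct.asD ev) (limitGraph e st)
      (fun v => selPos (fun _ => SysAct.asD) ev (issueTime e st v)) := by
  have hget : ∀ v ∈ (limitGraph e st).V, ev.get? (issueTime e st v) = some (.fd v.act) :=
    fun v hv => (hev _).trans (congrArg some (h.issued_of_mem hv).1)
  have hlt : ∀ {v : Vertex n D.Out} {m : ℕ}, v ∈ (limitGraph e st).V → issueTime e st v < m →
      selPos (fun _ => SysAct.asD) ev (issueTime e st v) < selPos (fun _ => SysAct.asD) ev m :=
    fun hv hm => selPos_lt (hget _ hv) rfl hm
  have hclosed : ∀ {u v : Vertex n D.Out}, v ∈ (limitGraph e st).V →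
      u ∈ (st v.loc (issueTime e st v)).G.V → u ∈ (limitGraph e st).V := by
    intro u v hv hu
    obtain ⟨i, hi, k, hk⟩ := id hv
    exact ⟨i, hi, k, ((h.goodGraph k).1 i).closed v hk _ (h.issued_of_mem hv) hu⟩
  have hfaulty : ∀ {i}, i ∉ faulty (proj SysAct.asD ev) → ∀ k, e k ≠ .crash i := by
    intro i hi k hk
    exact hi (mem_faulty_select.2 ⟨k, _, hev k, by rw [hk]; rfl⟩)
  refine ⟨fun v hv => select_get?_selPos (hget v hv) rfl,
    fun v hv => (h.issued_of_mem hv).2.1, fun u hu v hv huv => ?_, fun u v huv => ?_,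
    fun u v w huv hvw => ?_, fun u hu v hv hl hi => ?_, fun i hi u hu => ?_, fun i hi m => ?_⟩
  · have h1 := selPos_injOn (f := fun _ => SysAct.asD) (hget u hu) rfl (hget v hv) rfl huv
    have h2 := h.issued_of_mem hu
    rw [h1] at h2
    exact h2.eq (h.issued_of_mem hv)
  · obtain ⟨hv, hu⟩ := h.mem_limitGraph_Z.1 huv
    have huV := hclosed hv hu
    refine ⟨huV, hv, hlt huV ?_⟩
    obtain ⟨k, hk, h'⟩ := ((h.goodGraph _).1 v.loc).issued u hu
    rwa [h'.issueTime_eq h.toOmegaRun]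
  · obtain ⟨hv, hu⟩ := h.mem_limitGraph_Z.1 huv
    obtain ⟨hw, hv'⟩ := h.mem_limitGraph_Z.1 hvw
    exact h.mem_limitGraph_Z.2 ⟨hw,
      ((h.goodGraph _).1 w.loc).closed v hv' _ (h.issued_of_mem hv) hu⟩
  · have h1 := Issued.unique h.toOmegaRun (h.issued_of_mem hu) (h.issued_of_mem hv) hl hi
    have h2 := h.issued_of_mem hu
    rw [h1] at h2
    exact h2.eq (h.issued_of_mem hv)
  · obtain ⟨j, hj, k, hk⟩ := hu
    obtain ⟨k', hk'⟩ := h.exists_mem hj (hfaulty hi) hk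
    refine ⟨selPos (fun _ => SysAct.asD) ev k', fun w hw hl hm => ?_⟩
    refine h.mem_limitGraph_Z.2 ⟨hw, ?_⟩
    have : k' ≤ issueTime e st w := by
      by_contra hlt'
      exact absurd (hlt hw (not_le.1 hlt')) (not_lt.2 hm)
    rw [hl]
    exact (h.G_mono i this).1 hk'
  · obtain ⟨i₀, hi₀⟩ := hlive
    obtain ⟨K, hK⟩ := exists_le_selPos (f := fun _ => SysAct.asD) (t := ev) (fun m => by
      obtain ⟨k, hk, o, -, h1, -⟩ := h.exists_fd hi₀ m
      exact ⟨k, hk, _, _, hev k, by rw [h1]; rfl⟩) m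
    obtain ⟨k, hk, o, -, -, -, h'⟩ := h.exists_fd (hfaulty hi) K
    refine ⟨_, ⟨i, hfaulty hi, k + 1, h'.mem h.toOmegaRun⟩, rfl, ?_⟩
    rw [h'.issueTime_eq h.toOmegaRun]
    exact hK.trans (selPos_mono _ _ hk)

/-- Live locations have infinitely many outputs. -/
theorem FairOmegaRun.exists_output (h : FairOmegaRun A e st ch) {i : Fin n}
    (hi : ∀ k, e k ≠ .crash i) (m : ℕ) : ∃ k ≥ m, ∃ j, e k = .pout (j, i) := by
  obtain ⟨κ, hκ, o, -, -, hs, -⟩ := h.exists_fd hi m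
  have hmem : (Sum.inr (st i (κ + 1)).fdout, i) ∈ (st i (κ + 1)).sendq := by
    rw [hs, afterFd_sendq]
    simp
  obtain ⟨k, hk, hq⟩ := h.exists_dequeue hi hmem
  rcases (h.proc_step k i).of_dequeue hq with ⟨m, j', -, -, h1⟩ | ⟨j', he, -⟩
  · cases h1
  · exact ⟨k, by omega, j', he⟩

/-- If a gadget is eventually the first gadget, then its critical location is eventually the only
output. -/
theorem FairOmegaRun.eventually_output (h : FairOmegaRun A e st ch) {i : Fin n}
    (hi : ∀ k, e k ≠ .crash i) {H : Gadget n D.Out} {K : ℕ}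
    (hK : ∀ k ≥ K, IsFirst A (st i k).G H) :
    ∃ K', ∀ k ≥ K', ∀ j, e k = .pout (j, i) → j = H.critLoc := by
  obtain ⟨K', hK'⟩ := eventually_forall_mem_queue (q := fun k => (st i k).sendq)
    (fun y => ∀ j, y.1 = Sum.inr j → j = H.critLoc) K (fun k => by
      rcases h.sendq_step i k with ⟨l, hl, hl'⟩ | hx
      · refine Or.inl ⟨l, hl, fun hk y hy j hj => ?_⟩
        rcases hl' with rfl | ⟨o, hs, rfl⟩
        · cases hy
        · rcases List.mem_append.1 hy with hy | hy
          · obtain ⟨j', -, rfl⟩ := List.mem_map.1 hy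
            cases hj
          · obtain rfl := List.mem_singleton.1 hy
            cases hj
            have h1 := (hK (k + 1) (by omega)).firstLoc_eq (st i k).fdout
            have h2 : (st i (k + 1)).fdout = firstLoc A (st i (k + 1)).G (st i k).fdout := by
              rw [hs]
              rfl
            rw [h2, h1]
      · exact Or.inr hx) (h.sendq_progress hi)
  refine ⟨K', fun k hk j he => ?_⟩
  have hs := h.proc_step k i
  rw [he] at hs
  refine hK' k hk (Sum.inr j, i) ?_ j rfl
  rw [hs.pout.2]
  exact List.mem_cons_self

end FairOmegaRuns

/-! ### Correctness of the algorithm for `Ω_f` -/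

section Correctness

variable {n f : ℕ} {D : CrashProblem n} {M X Y : Type}
  {A : Fin n → Automaton (ProcAct D (consensus n f) M X)}
  {E : Fin n → Automaton (EnvAct (omegaF n f) Y)}

theorem SysAct.asD_eq_crash {P : CrashProblem n} {a : SysAct D P M X Y} {i : Fin n} :
    a.asD = some (.crash i) ↔ a = .crash i := by
  cases a <;> simp [SysAct.asD]

theorem SysAct.asD_eq_out {P : CrashProblem n} {a : SysAct D P M X Y} {o : D.Out} :
    a.asD = some (.out o) ↔ a = .fd o := by
  cases a <;> simp [SysAct.asD]

theorem SysAct.asP_eq_crash {P : CrashProblem n} {a : SysAct D P M X Y} {i : Fin n} :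
    a.asP = some (.crash i) ↔ a = .crash i := by
  cases a <;> simp [SysAct.asP]

theorem SysAct.asP_eq_out {P : CrashProblem n} {a : SysAct D P M X Y} {o : P.Out} :
    a.asP = some (.out o) ↔ a = .pout o := by
  cases a <;> simp [SysAct.asP]

theorem mem_faulty_asD {P : CrashProblem n} {t : Stream'.Seq (SysAct D P M X Y)} {i : Fin n} :
    i ∈ faulty (proj SysAct.asD t) ↔ ∃ k, t.get? k = some (.crash i) := by
  unfold proj
  simp only [mem_faulty_select, SysAct.asD_eq_crash]
  constructor
  · rintro ⟨k, a, h, rfl⟩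
    exact ⟨k, h⟩
  · rintro ⟨k, h⟩
    exact ⟨k, _, h, rfl⟩

theorem mem_faulty_asP {P : CrashProblem n} {t : Stream'.Seq (SysAct D P M X Y)} {i : Fin n} :
    i ∈ faulty (proj SysAct.asP t) ↔ ∃ k, t.get? k = some (.crash i) := by
  unfold proj
  simp only [mem_faulty_select, SysAct.asP_eq_crash]
  constructor
  · rintro ⟨k, a, h, rfl⟩
    exact ⟨k, h⟩
  · rintro ⟨k, h⟩
    exact ⟨k, _, h, rfl⟩

theorem isLive_iff {x : (fullSystem (omegaAlg A) E).Execution} {i : Fin n} :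
    IsLive x i ↔ i ∉ faulty (proj SysAct.asD x.events) := by
  rw [mem_faulty_asD, not_exists]
  rfl

/-- No outputs after crashes. -/
theorem omegaAlg_crash_validity (x : (fullSystem (omegaAlg A) E).Execution) {i : Fin n} {k m : ℕ}
    (hkm : k < m) (hk : x.events.get? k = some (.crash i)) (j : Fin n) :
    x.events.get? m ≠ some (.pout (j, i)) := by
  intro hm
  have key : ∀ l, k + 1 ≤ l → l ≤ m → (procState x i l).faulty = true := by
    intro l hl
    induction l, hl using Nat.le_induction with
    | base => exact fun _ => (omegaStep x hk i).faulty_iff.2 (Or.inr rfl)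
    | succ l hl ih =>
      intro hlm
      obtain ⟨b, hb⟩ := Stream'.Seq.ge_stable _ (by omega : l ≤ m) hm
      exact (omegaStep x hb i).faulty_iff.2 (Or.inl (ih (by omega)))
  have := (omegaStep x hm i).pout.1
  rw [key m hkm le_rfl] at this
  cases this

/-- A live location has infinitely many outputs of `D`, so the execution is infinite. A nonempty
queue stays nonempty and has its head enabled until it is served, so fairness provides progress;
from here on fairness enters only through the run. -/
theorem exists_fairOmegaRun (hE : IsEnvironment (omegaF n f) E)
    {x : (fullSystem (omegaAlg A) E).Execution} (hx : x.Fair)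
    (hv : Valid D.locOut (proj SysAct.asD x.events))
    (hlive : ∃ i, i ∉ faulty (proj SysAct.asD x.events)) :
    ∃ e, (∀ k, x.events.get? k = some (e k)) ∧ FairOmegaRun A e (procState x) (chanState x) := by
  have hA := omegaAlg_isDistributedAlgorithm A
  have hout : ∀ i, (∀ k, x.events.get? k ≠ some (.crash i)) → ∀ m, ∃ k ≥ m, ∃ o,
      x.events.get? k = some (.fd o) ∧ D.locOut o = i := by
    intro i hi m
    unfold proj at hv
    obtain ⟨k, hk, a, o, h1, h2, h3⟩ := (valid_select_iff.1 hv).2 i (fun k a ha hc =>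
      hi k (by rw [ha, SysAct.asD_eq_crash.1 hc])) m
    exact ⟨k, hk, o, by rw [h1, SysAct.asD_eq_out.1 h2], h3⟩
  have hsome : ∀ k, ∃ a, x.events.get? k = some a := by
    obtain ⟨i, hi⟩ := hlive
    refine isSome_of_infinite fun m => ?_
    obtain ⟨k, hk, o, h, -⟩ := hout i (fun k h => hi (mem_faulty_asD.2 ⟨k, h⟩)) m
    exact ⟨k, hk, by rw [h]; rfl⟩
  choose e he using hsome
  have hrun : OmegaRun A e (procState x) (chanState x) :=
    ⟨procState_zero x, fun k i => omegaStep x (he k) i, chanState_zero x,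
      fun k c => chanStep x (he k) c⟩
  have hinf : ∀ k, (x.events.get? k).isSome = true := fun k => by rw [he k]; rfl
  refine ⟨e, he, hrun, ?_, ?_, ?_⟩
  · intro i hi k hk
    obtain ⟨k', hk', a, ⟨b, hb, rfl⟩, hka⟩ := exists_task_event hx hinf ⟨some (.proc i), ()⟩ k (by
      intro hno
      have hne : ∀ l ≥ k, (procState x i l).sendq ≠ [] := by
        intro l hl
        induction l, hl using Nat.le_induction with
        | base => exact hk
        | succ l hl ih =>
          rcases (hrun.proc_step l i).sendq with hs | ⟨o, hs⟩ | ⟨m, j, ha, hj, -⟩ | ⟨j, ha, -⟩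
          · rw [hs]
            exact ih
          · rw [hs, afterFd_sendq]
            simp
          · exact absurd ((he l).trans (congrArg some ha))
              (hno l hl _ ⟨.send m i j, Or.inl ⟨m, j, hj, rfl⟩, rfl⟩)
          · exact absurd ((he l).trans (congrArg some ha))
              (hno l hl _ ⟨.pout (j, i), Or.inr ⟨j, rfl⟩, rfl⟩)
      intro l hl
      have hfl := hrun.not_faulty hi l
      obtain ⟨y, q, hq⟩ := List.exists_cons_of_ne_nil (hne l hl)
      have key : ∃ b, b ∈ (omegaAlg A i).task () ∧
          (omegaAlg A i).Enabled (procState x i l) b := by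
        -- The invariants on the addresses of queue entries exclude heads that could be neither sent
        -- nor output.
        rcases y with ⟨m | j, j'⟩
        · have hj := ((hrun.goodGraph l).2.1 i m j' (by rw [hq]; exact List.mem_cons_self)).2
          exact ⟨.send m i j', Or.inl ⟨m, j', hj, rfl⟩, _,
            Or.inr (Or.inr (Or.inr (Or.inl ⟨m, j', q, rfl, hj, hfl, hq, rfl⟩)))⟩
        · obtain rfl := (hrun.goodGraph l).2.2.1 i j j' (by rw [hq]; exact List.mem_cons_self)
          exact ⟨.pout (j, j'), Or.inr ⟨j, rfl⟩, _,
            Or.inr (Or.inr (Or.inr (Or.inr ⟨j, q, rfl, hfl, hq, rfl⟩)))⟩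
      obtain ⟨b, hb, hen⟩ := key
      refine ⟨b.toSys, ⟨b, hb, rfl⟩, (fullSystem_enabled_iff hA ?_).2
        (enabled_of_proc hA hE (i := i) (Or.inl hb) hen)⟩
      rcases hb with ⟨m, j, -, rfl⟩ | ⟨j, rfl⟩ <;> rintro i' ⟨⟩)
    refine ⟨k', hk', ?_⟩
    have hke := Option.some.inj ((he k').symm.trans hka)
    rcases hb with ⟨m, j, hj, rfl⟩ | ⟨j, rfl⟩
    · exact Or.inl ⟨m, j, hj, hke⟩
    · exact Or.inr ⟨j, hke⟩
  · intro c k hk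
    obtain ⟨k', hk', a, ⟨m, rfl⟩, hka⟩ := exists_task_event hx hinf ⟨some (.chan c), ()⟩ k (by
      intro hno
      have hne : ∀ l ≥ k, chanState x c l ≠ [] := by
        intro l hl
        induction l, hl using Nat.le_induction with
        | base => exact hk
        | succ l hl ih =>
          rcases hrun.chan_step l c with ⟨m, -, hs⟩ | ⟨m, ha, -⟩ | ⟨hs, -⟩
          · rw [hs]
            simp
          · exact absurd ((he l).trans (congrArg some ha)) (hno l hl _ ⟨m, rfl⟩)
          · rw [hs]
            exact ih
      intro l hl
      obtain ⟨m, q, hq⟩ := List.exists_cons_of_ne_nil (hne l hl)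
      exact ⟨.recv m c.1.1 c.1.2, ⟨m, rfl⟩, (fullSystem_enabled_iff hA (by simp)).2
        ((recv_enabled_iff hA _ m c).2 ⟨q, hq⟩)⟩)
    exact ⟨k', hk', m, Option.some.inj ((he k').symm.trans hka)⟩
  · intro i hi m
    obtain ⟨k, hk, o, h1, h2⟩ := hout i (fun k h => hi k (Option.some.inj ((he k).symm.trans h))) m
    exact ⟨k, hk, o, Option.some.inj ((he k).symm.trans h1), h2⟩

/-- Convergence of the graphs and of the outputs. -/
theorem stabilizesOnFirstGadget (hf : f < n) (hD : D.IsStrongSamplingAFD)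
    (hA : Solves D (consensus n f) A (consensusEnv n f)) (hE : IsEnvironment (omegaF n f) E)
    {x : (fullSystem (omegaAlg A) E).Execution} (hx : x.Fair)
    (hxD : proj SysAct.asD x.events ∈ D.traces)
    (hle : (faulty (proj SysAct.asD x.events)).ncard ≤ f) : StabilizesOnFirstGadget x := by
  have hlive := exists_notMem_of_ncard_le hle hf
  obtain ⟨e, he, hrun⟩ := exists_fairOmegaRun hE hx (hD.valid _ hxD) hlive
  have hlive_iff : ∀ i, IsLive x i ↔ ∀ k, e k ≠ .crash i := fun i =>
    forall_congr' fun k => by rw [he k, ne_eq, Option.some.injEq]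
  have hS : ConsensusSetting A (limitGraph e (procState x)) (proj SysAct.asD x.events) _ :=
    ⟨hf, hD, hA, hxD, hle, hrun.traceGraph he
      (hlive.imp fun i hi => (hlive_iff i).1 (isLive_iff.2 hi))⟩
  obtain ⟨H, hH⟩ := hS.exists_isFirst
  refine ⟨limitGraph e (procState x), H, fun i hi => ?_, hH,
    isLive_iff.2 (hS.critLoc_notMem_faulty hH.1), fun i hi => ?_⟩
  · exact (hrun.graphLimit ((hlive_iff i).1 hi)).iUnion_eq
  · have hi' := (hlive_iff i).1 hi
    obtain ⟨K, hK⟩ := eventually_atTop.1 (hS.eventually_isFirst (hrun.graphLimit hi') hH)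
    obtain ⟨K', hK'⟩ := hrun.eventually_output hi' hK
    refine ⟨⟨K, hK⟩, ⟨K', fun k hk j hj => hK' k hk j (Option.some.inj ((he k).symm.trans hj))⟩,
      fun m => ?_⟩
    obtain ⟨k, hk, j, hj⟩ := hrun.exists_output hi' (max m K')
    refine ⟨k, le_trans (le_max_left _ _) hk, ?_⟩
    rw [he k, hj, hK' k (le_trans (le_max_right _ _) hk) j hj]

/-- The algorithm solves `Ω_f`. -/
theorem omegaAlg_solves (hf : f < n) (hD : D.IsStrongSamplingAFD)
    (hA : Solves D (consensus n f) A (consensusEnv n f)) (hE : IsEnvironment (omegaF n f) E) :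
    Solves D (omegaF n f) (omegaAlg A) E := by
  refine ⟨omegaAlg_isDistributedAlgorithm A, fun x hx hxD => ⟨?_, fun hle _ => ?_⟩⟩
  · unfold proj
    refine valid_select_iff.2 ⟨?_, fun i hi m => ?_⟩
    · rintro k m i ⟨j, i'⟩ a b hkm ha hga hb hgb rfl
      rw [SysAct.asP_eq_crash.1 hga] at ha
      rw [SysAct.asP_eq_out.1 hgb] at hb
      exact omegaAlg_crash_validity x hkm ha j hb
    · have hi' : ∀ k, x.events.get? k ≠ some (.crash i) := fun k hk => hi k _ hk rfl
      obtain ⟨e, he, hrun⟩ := exists_fairOmegaRun hE hx (hD.valid _ hxD)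
        ⟨i, isLive_iff.1 hi'⟩
      obtain ⟨k, hk, j, hj⟩ := hrun.exists_output
        (fun k h => hi' k ((he k).trans (congrArg some h))) m
      exact ⟨k, hk, _, (j, i), he k, by rw [hj]; rfl, rfl⟩
  · have hfaulty : faulty (proj SysAct.asP x.events) = faulty (proj SysAct.asD x.events) := by
      ext i
      rw [mem_faulty_asP, mem_faulty_asD]
    rw [hfaulty] at hle ⊢
    obtain ⟨G, H, -, -, hl, hout⟩ := stabilizesOnFirstGadget hf hD hA hE hx hxD hle
    -- Live locations stabilize on the critical location, faulty ones fall silent after their crash;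
    -- the maximum over the locations serves for all of them.
    have key : ∀ i, ∃ K, ∀ k ≥ K, ∀ j, x.events.get? k = some (.pout (j, i)) →
        j = H.critLoc ∧ i ∉ faulty (proj SysAct.asD x.events) := by
      intro i
      by_cases hi : IsLive x i
      · obtain ⟨K, hK⟩ := (hout i hi).2.1
        exact ⟨K, fun k hk j hj => ⟨hK k hk j hj, isLive_iff.1 hi⟩⟩
      · simp only [IsLive, not_forall, not_not] at hi
        obtain ⟨k₀, hk₀⟩ := hi
        exact ⟨k₀ + 1, fun k hk j hj => absurd hj (omegaAlg_crash_validity x hk hk₀ j)⟩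
    choose K hK using key
    refine ⟨H.critLoc, isLive_iff.1 hl,
      selPos (fun _ => SysAct.asP) x.events (Finset.univ.sup K), fun k hk j i hj => ?_⟩
    obtain ⟨m, a, ha, hb, rfl⟩ := (select_get?_eq_some _ _ _ _).1 hj
    rw [SysAct.asP_eq_out.1 hb] at ha
    refine hK i m ?_ j ha
    have h1 : Finset.univ.sup K ≤ m := by
      by_contra hlt
      exact absurd hk (not_le.2 (selPos_lt ha rfl (not_le.1 hlt)))
    exact (Finset.le_sup (Finset.mem_univ i)).trans h1

end Correctness

end Afd

theorem mainTheorem1 (n f : ℕ) (hf : f < n)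
    (D : Afd.CrashProblem n) (hD : D.IsStrongSamplingAFD)
    (M X : Type) (A : Fin n → Afd.Automaton (Afd.ProcAct D (Afd.consensus n f) M X))
    (hA : Afd.Solves D (Afd.consensus n f) A (Afd.consensusEnv n f)) :
    (∀ (Y : Type) (E : Fin n → Afd.Automaton (Afd.EnvAct (Afd.omegaF n f) Y)),
      Afd.IsEnvironment (Afd.omegaF n f) E →
        Afd.Solves D (Afd.omegaF n f) (Afd.omegaAlg A) E ∧
        ∀ x : (Afd.fullSystem (Afd.omegaAlg A) E).Execution, x.Fair →
          Afd.proj Afd.SysAct.asD x.events ∈ D.traces →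
          (Afd.faulty (Afd.proj Afd.SysAct.asD x.events)).ncard ≤ f →
          Afd.StabilizesOnFirstGadget x) ∧
    (Afd.omegaF n f).IsStrongSamplingAFD ∧
    (∀ D' : Afd.CrashProblem n, D'.IsStrongSamplingAFD →
      Afd.Sufficient D' (Afd.consensus n f) (Afd.consensusEnv n f) →
      Afd.Stronger D' (Afd.omegaF n f)) ∧
    (Afd.Sufficient (Afd.omegaF n f) (Afd.consensus n f) (Afd.consensusEnv n f) →
      Afd.IsWeakestStrongSampling (Afd.omegaF n f) (Afd.consensus n f)
        (Afd.consensusEnv n f)) := by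
  -- Quantified over all detectors, because the comparison needs it for every sufficient `D'`.
  have main : ∀ D : Afd.CrashProblem n, D.IsStrongSamplingAFD → ∀ (M X : Type)
      (A : Fin n → Afd.Automaton (Afd.ProcAct D (Afd.consensus n f) M X)),
      Afd.Solves D (Afd.consensus n f) A (Afd.consensusEnv n f) →
      ∀ (Y : Type) (E : Fin n → Afd.Automaton (Afd.EnvAct (Afd.omegaF n f) Y)),
      Afd.IsEnvironment (Afd.omegaF n f) E →
        Afd.Solves D (Afd.omegaF n f) (Afd.omegaAlg A) E :=
    fun D hD M X A hA Y E hE => Afd.omegaAlg_solves hf hD hA hE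
  have stronger : ∀ D' : Afd.CrashProblem n, D'.IsStrongSamplingAFD →
      Afd.Sufficient D' (Afd.consensus n f) (Afd.consensusEnv n f) →
      Afd.Stronger D' (Afd.omegaF n f) := by
    rintro D' hD' ⟨M', X', A', hA'⟩
    exact ⟨Afd.Graph n D'.Out, Empty, Afd.omegaAlg A', main D' hD' M' X' A' hA'⟩
  exact ⟨fun Y E hE => ⟨main D hD M X A hA Y E hE, fun x hx hxD hle =>
      Afd.stabilizesOnFirstGadget hf hD hA hE hx hxD hle⟩,
    Afd.omegaF_isStrongSamplingAFD, stronger,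
    fun h => ⟨Afd.omegaF_isStrongSamplingAFD, h, stronger⟩⟩
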